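/- **Setting.** Let $\phi_t$ be a non-singular continuous flow on a closed $3$-manifold $M$ and let $\gamma\subset M$ be a periodic orbit. Fix $0<\lambda<1$, integers $n,p\ge 1$ and an integer $m\neq 0$. Suppose that $M\setminus\gamma$ is equipped with an *almost-Anosov structure*: a smooth atlas, a smooth non-singular vector field $X_\Gamma$ generating a complete flow $\phi^\Gamma_t$ which is an (orientation-preserving) reparametrization of $\phi_t|_{M\setminus\gamma}$, a $D\phi^\Gamma_t$-invariant splitting $T(M\setminus\gamma)=E^s\oplus\mathrm{span}(X_\Gamma)\oplus E^u$ into continuous line bundles, and a Riemannian metric with $|D\phi^\Gamma_t v|=\lambda^t|v|$ for $v\in E^s$, $t\ge0$, and $|D\phi^\Gamma_t v|=\lambda^{-t}|v|$ for $v\in E^u$, $t\le 0$. Suppose also that near $\gamma$ there is a system of *normal coordinates*: an open neighbourhood $W$ of $\gamma$ such that $W\setminus\gamma$ is the union of four relatively closed punctured quadrants $W_i\setminus\gamma$, and smooth injective charts $\Pi_i:W_i\setminus\gamma\to(\mathbb D_i\setminus\{0\})\times\mathbb R/\mathbb Z$, $i=1,\dots,4$ ($\mathbb D_i$ the closed quadrants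 of $\mathbb R^2$ in circular order), whose images contain a punctured neighbourhood of $\{0\}\times\mathbb R/\mathbb Z$, with $q\to\gamma$ if and only if the planar coordinates of $q$ tend to $0$, such that $D\Pi_i$ sends $X_\Gamma$ to $X_{(\lambda,n,p)}(x,y,z)=(\log(\lambda)x,-\log(\lambda)y,\tfrac1{np})$, $E^s$ to $\mathbb R\times0\times0$ and $E^u$ to $0\times\mathbb R\times0$, and such that the charts match smoothly across the common faces with $\Pi_2\circ\Pi_1^{-1}=\Pi_3\circ\Pi_2^{-1}=\Pi_4\circ\Pi_3^{-1}=\mathrm{id}$ and $\Pi_1\circ\Pi_4^{-1}(x,y,z)=(x,y,z+\tfrac mn)$. (For a transitive topological Anosov flow with a tame Birkhoff section bounded by $\gamma$, with orientable local invariant manifolds, such data arise with $n$, $m$, $p$ the linking number, the multiplicity and the number of boundary components at $\gamma$.) Fix a function $\rho:[0,1]\to[0,1]$ that is smooth and decreasing, with $\rho=1$ on $[0,\frac13]$, $\rho'<0$ on $(\frac13,\frac23)$ and $\rho=0$ on $[\frac23,1]$. **Construction.** For $0<r_2<r_1$ let $Q(r_1,r_2)=\{|x|\le r_1,\ |y|\le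 r_1,\ |xy|\le r_1r_2\}$, $\mathbb V(r_1,r_2)=Q(r_1,r_2)\times\mathbb R/\mathbb Z$, let $R(r_1,r_2)\subset M$ be the union over $i$ of the closures of $\{q\in W_i\setminus\gamma:\Pi_i(q)\in\mathbb V(r_1,r_2)\}$, and let $M_R(r_1,r_2)=M\setminus\mathrm{int}\,R(r_1,r_2)$. Let $\varphi:\partial M_R(r_1,r_2)\to\partial\mathbb V(r_1,r_2)$ be given in the coordinates $(x,y,z)=\Pi_i(q)$ by the identity, except that * if $m<0$, then $\varphi(r_1,y,z)=(r_1,y,z+\frac{|m|}n\rho(\frac y{r_2}))$ on the annulus $x=r_1$, $0\le y\le r_2$ of the first quadrant; * if $m>0$, then $\varphi(r_1,y,z)=(r_1,y,z+\frac{|m|}n\rho(-\frac y{r_2}))$ on the annulus $x=r_1$, $-r_2\le y\le0$ of the fourth quadrant. Let $N(r_1,r_2)=M_R(r_1,r_2)\sqcup_\varphi\mathbb V(r_1,r_2)$ be the space obtained by glueing along the boundaries. **Proposition.** For fixed data as above there is $\varepsilon>0$ such that for all $0<r_2<r_1<\varepsilon$ the following holds. There are a smooth atlas on $N(r_1,r_2)$,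 a smooth vector field $Y$ and a smooth flow $\psi_t$ generated by $Y$ such that the inclusions of $M_R(r_1,r_2)$ and of $\mathbb V(r_1,r_2)$ into $N(r_1,r_2)$ are diffeomorphisms onto their images (embeddings that locally, also at boundary points, extend to diffeomorphisms between open sets) and send $X_\Gamma$, respectively $X_{(\lambda,n,p)}$, to $Y$. For every such atlas, vector field and flow, $N(r_1,r_2)$ is a closed smooth $3$-manifold and $\psi_t$ is an Anosov flow: there are a Riemannian metric on $N(r_1,r_2)$, a $D\psi_t$-invariant splitting $TN=E^s\oplus\mathrm{span}(Y)\oplus E^u$ into continuous line bundles and constants $C>0$, $0<\mu<1$ with $\|D\psi_tv\|\le C\mu^t\|v\|$ for $v\in E^s$, $t\ge0$, and $\|D\psi_tv\|\le C\mu^{-t}\|v\|$ for $v\in E^u$, $t\le0$. -/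

import Mathlib

open Set Topology Manifold
open scoped ContDiff

noncomputable section

/-- The model space of `3`-manifolds. -/
abbrev E3 : Type := EuclideanSpace ℝ (Fin 3)

section Splittings

variable {N : Type*} [TopologicalSpace N] [ChartedSpace E3 N] [IsManifold 𝓘(ℝ, E3) ∞ N]

/-- A smooth vector field `X` on a `3`-manifold and the smooth complete flow `ψ` generated by it. -/
structure IsSmoothFlowOf (X : ∀ x : N, TangentSpace 𝓘(ℝ, E3) x) (ψ : Flow ℝ N) : Prop where
  smooth_field : ContMDiff 𝓘(ℝ, E3) 𝓘(ℝ, E3).tangent ∞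
    (fun x : N => (⟨x, X x⟩ : TangentBundle 𝓘(ℝ, E3) N))
  smooth_flow : ContMDiff (𝓘(ℝ, ℝ).prod 𝓘(ℝ, E3)) 𝓘(ℝ, E3) ∞ (fun q : ℝ × N => ψ q.1 q.2)
  generates : ∀ x : N, IsMIntegralCurve (fun t : ℝ => ψ t x) X

/-- A continuous line subbundle of the tangent bundle: locally it is spanned by a continuous
non-vanishing vector field. -/
def IsLineField (E : ∀ x : N, Submodule ℝ (TangentSpace 𝓘(ℝ, E3) x)) : Prop :=
  ∀ x : N, ∃ U ∈ 𝓝 x, ∃ v : ∀ y : N, TangentSpace 𝓘(ℝ, E3) y,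
    ContinuousOn (fun y : N => (⟨y, v y⟩ : TangentBundle 𝓘(ℝ, E3) N)) U ∧
    ∀ y ∈ U, v y ≠ 0 ∧ E y = Submodule.span ℝ {v y}

/-- `TN = Es ⊕ span X ⊕ Eu` is a splitting into continuous line bundles, invariant by the
derivative of the flow `ψ`. -/
structure IsInvariantSplitting (X : ∀ x : N, TangentSpace 𝓘(ℝ, E3) x) (ψ : Flow ℝ N)
    (Es Eu : ∀ x : N, Submodule ℝ (TangentSpace 𝓘(ℝ, E3) x)) : Prop where
  nonsingular : ∀ x, X x ≠ 0
  lineField_s : IsLineField Es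
  lineField_u : IsLineField Eu
  direct : ∀ x, DirectSum.IsInternal ![Es x, Submodule.span ℝ {X x}, Eu x]
  invariant_s : ∀ t x, (Es x).map
    (mfderiv 𝓘(ℝ, E3) 𝓘(ℝ, E3) (ψ t) x).toLinearMap = Es (ψ t x)
  invariant_u : ∀ t x, (Eu x).map
    (mfderiv 𝓘(ℝ, E3) 𝓘(ℝ, E3) (ψ t) x).toLinearMap = Eu (ψ t x)

variable (N) in
/-- Smooth Riemannian metrics on a `3`-manifold. -/
abbrev SmoothMetric : Type _ :=
  Bundle.ContMDiffRiemannianMetric 𝓘(ℝ, E3) ∞ E3 (fun x : N => TangentSpace 𝓘(ℝ, E3) x)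

/-- The norm of a tangent vector for a Riemannian metric. -/
def metricNorm (g : SmoothMetric N) (x : N) (v : TangentSpace 𝓘(ℝ, E3) x) : ℝ :=
  Real.sqrt (g.inner x v v)

/-- The flow `ψ` generated by the non-singular smooth vector field `X` on the closed manifold `N`
is Anosov. -/
def IsAnosovFlow (X : ∀ x : N, TangentSpace 𝓘(ℝ, E3) x) (ψ : Flow ℝ N) : Prop :=
  CompactSpace N ∧ T2Space N ∧ IsSmoothFlowOf X ψ ∧
  ∃ (g : SmoothMetric N) (Es Eu : ∀ x : N, Submodule ℝ (TangentSpace 𝓘(ℝ, E3) x)) (C μ : ℝ),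
    IsInvariantSplitting X ψ Es Eu ∧ 0 < C ∧ 0 < μ ∧ μ < 1 ∧
    (∀ x, ∀ v ∈ Es x, ∀ t : ℝ, 0 ≤ t →
      metricNorm g (ψ t x) (mfderiv 𝓘(ℝ, E3) 𝓘(ℝ, E3) (ψ t) x v) ≤
        C * μ ^ t * metricNorm g x v) ∧
    (∀ x, ∀ v ∈ Eu x, ∀ t : ℝ, t ≤ 0 →
      metricNorm g (ψ t x) (mfderiv 𝓘(ℝ, E3) 𝓘(ℝ, E3) (ψ t) x v) ≤
        C * μ ^ (-t) * metricNorm g x v)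

end Splittings

section SingularFlow

variable {M : Type*} [TopologicalSpace M]

/-- `γ` is a periodic orbit of the flow `φ`. -/
def IsPeriodicOrbit (φ : Flow ℝ M) (γ : Set M) : Prop :=
  ∃ x : M, (∃ T : ℝ, 0 < T ∧ φ T x = x) ∧ (∃ t : ℝ, φ t x ≠ x) ∧ γ = range (fun t : ℝ => φ t x)

/-- An almost-Anosov structure in the complement of `γ`, with stretching factor `lam`: on the
complement (which carries a smooth atlas) there are a smooth vector field whose flow is a
reparametrization of `φ`, and a splitting and a Riemannian metric for which the splitting is
invariant and is contracted/expanded exactly at the rate `lam`. -/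
structure AlmostAnosovStructure (φ : Flow ℝ M) (γ : Set M) (lam : ℝ)
    [ChartedSpace E3 {x : M // x ∉ γ}] [IsManifold 𝓘(ℝ, E3) ∞ {x : M // x ∉ γ}] where
  lam_pos : 0 < lam
  lam_lt_one : lam < 1
  X : ∀ x : {x : M // x ∉ γ}, TangentSpace 𝓘(ℝ, E3) x
  flow : Flow ℝ {x : M // x ∉ γ}
  isSmoothFlowOf : IsSmoothFlowOf X flow
  reparametrization : ∀ x : {x : M // x ∉ γ}, ∃ h : ℝ ≃o ℝ, h 0 = 0 ∧
    ∀ t : ℝ, (flow t x : M) = φ (h t) x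
  Es : ∀ x : {x : M // x ∉ γ}, Submodule ℝ (TangentSpace 𝓘(ℝ, E3) x)
  Eu : ∀ x : {x : M // x ∉ γ}, Submodule ℝ (TangentSpace 𝓘(ℝ, E3) x)
  splitting : IsInvariantSplitting X flow Es Eu
  metric : SmoothMetric {x : M // x ∉ γ}
  rate_s : ∀ x, ∀ v ∈ Es x, ∀ t : ℝ, 0 ≤ t →
    metricNorm metric (flow t x) (mfderiv 𝓘(ℝ, E3) 𝓘(ℝ, E3) (flow t) x v) =
      lam ^ t * metricNorm metric x v
  rate_u : ∀ x, ∀ v ∈ Eu x, ∀ t : ℝ, t ≤ 0 →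
    metricNorm metric (flow t x) (mfderiv 𝓘(ℝ, E3) 𝓘(ℝ, E3) (flow t) x v) =
      lam ^ (-t) * metricNorm metric x v

end SingularFlow

/-- The space `ℝ² × ℝ/ℤ`. Its smooth structure is the one for which the covering
`liftProj : ℝ³ → ℝ² × ℝ/ℤ` is a local diffeomorphism; smoothness of maps from or to it is
expressed below through local lifts to `ℝ³`. -/
abbrev AffineModel : Type := ℝ × ℝ × UnitAddCircle

/-- The covering `ℝ³ → ℝ² × ℝ/ℤ`. -/
def liftProj (u : ℝ × ℝ × ℝ) : AffineModel := (u.1, u.2.1, (u.2.2 : UnitAddCircle))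

/-- The affine vector field `(log λ · x, - log λ · y, 1 / (n k))`. -/
def affineField (lam : ℝ) (n k : ℕ) (u : ℝ × ℝ × ℝ) : ℝ × ℝ × ℝ :=
  (Real.log lam * u.1, -Real.log lam * u.2.1, 1 / ((n : ℝ) * (k : ℝ)))

/-- The closed quadrants `𝔻₁, …, 𝔻₄` of the plane, in circular order. -/
def quadrant : Fin 4 → Set (ℝ × ℝ) :=
  ![{w | 0 ≤ w.1 ∧ 0 ≤ w.2}, {w | w.1 ≤ 0 ∧ 0 ≤ w.2},
    {w | w.1 ≤ 0 ∧ w.2 ≤ 0}, {w | 0 ≤ w.1 ∧ w.2 ≤ 0}]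

/-- The vertical translation relating the `i`-th and the `j`-th normal coordinates of the same
point: from the fourth to the first quadrant it is `s`, and it is trivial between the other
consecutive quadrants. -/
def holonomy (s : ℝ) (i j : Fin 4) : UnitAddCircle :=
  if i = 3 ∧ j = 0 then (s : UnitAddCircle)
  else if i = 0 ∧ j = 3 then -(s : UnitAddCircle)
  else 0

/-- A system of normal coordinates at `γ`, with parameters `n`, `k` (called `p` in the
normal form `X_(λ,n,p)`) and `m`. The set `quad i` is the punctured quadrant `W_i ∖ γ` of the
neighbourhood `W` of `γ`, and `chart i` is the chart `Π_i` on it (its values elsewhere are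
irrelevant). -/
structure NormalCoordinates {M : Type*} [TopologicalSpace M] {φ : Flow ℝ M} {γ : Set M} {lam : ℝ}
    [ChartedSpace E3 {x : M // x ∉ γ}] [IsManifold 𝓘(ℝ, E3) ∞ {x : M // x ∉ γ}]
    (A : AlmostAnosovStructure φ γ lam) (n k : ℕ) (m : ℤ) where
  W : Set M
  isOpen_W : IsOpen W
  subset_W : γ ⊆ W
  quad : Fin 4 → Set {x : M // x ∉ γ}
  iUnion_quad : ⋃ i, quad i = {q : {x : M // x ∉ γ} | (q : M) ∈ W}
  closed_quad : ∀ i, ∃ F : Set {x : M // x ∉ γ}, IsClosed F ∧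
    quad i = F ∩ {q : {x : M // x ∉ γ} | (q : M) ∈ W}
  chart : Fin 4 → {x : M // x ∉ γ} → AffineModel
  mem_quadrant : ∀ i, ∀ q ∈ quad i, ((chart i q).1, (chart i q).2.1) ∈ quadrant i \ {(0, 0)}
  injOn_chart : ∀ i, InjOn (chart i) (quad i)
  /-- The image of each chart contains a punctured neighbourhood of `{0} × ℝ/ℤ` in
  `𝔻_i × ℝ/ℤ`. -/
  image_chart : ∃ δ : ℝ, 0 < δ ∧ ∀ i, ∀ c : AffineModel,
    (c.1, c.2.1) ∈ quadrant i \ {(0, 0)} → |c.1| < δ → |c.2.1| < δ → ∃ q ∈ quad i, chart i q = c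
  /-- A point of `W ∖ γ` tends to `γ` if and only if its planar coordinates tend to zero. -/
  nhdsSet_iff : ∀ O : Set M, O ∈ 𝓝ˢ γ ↔ γ ⊆ O ∧ ∃ δ : ℝ, 0 < δ ∧ ∀ i, ∀ q ∈ quad i,
    |(chart i q).1| < δ → |(chart i q).2.1| < δ → (q : M) ∈ O
  /-- Each chart is the restriction of smooth local coordinates defined near every point `q` of its
  quadrant, which send the vector field to the affine one and the stable and unstable directions
  to the first two coordinate axes; and in these coordinates the charts of the neighbouring
  quadrants are given by the prescribed vertical translations. -/
  smooth_chart : ∀ i, ∀ q ∈ quad i, ∃ f : {x : M // x ∉ γ} → ℝ × ℝ × ℝ,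
    IsLocalDiffeomorphAt 𝓘(ℝ, E3) 𝓘(ℝ, ℝ × ℝ × ℝ) ∞ f q ∧
    ∀ᶠ q' in 𝓝 q,
      mfderiv 𝓘(ℝ, E3) 𝓘(ℝ, ℝ × ℝ × ℝ) f q' (A.X q') = affineField lam n k (f q') ∧
      (A.Es q').map (mfderiv 𝓘(ℝ, E3) 𝓘(ℝ, ℝ × ℝ × ℝ) f q').toLinearMap =
        Submodule.span ℝ {((1, 0, 0) : ℝ × ℝ × ℝ)} ∧
      (A.Eu q').map (mfderiv 𝓘(ℝ, E3) 𝓘(ℝ, ℝ × ℝ × ℝ) f q').toLinearMap =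
        Submodule.span ℝ {((0, 1, 0) : ℝ × ℝ × ℝ)} ∧
      ∀ j, q' ∈ quad j →
        chart j q' = liftProj (f q') + (0, 0, holonomy ((m : ℝ) / (n : ℝ)) i j)

/-- The planar cross-shaped region: in each quadrant it is bounded by the axes, by the segments
`|x| = r₁, |y| ≤ r₂` and `|y| = r₁, |x| ≤ r₂`, and by an arc of the hyperbola `|x y| = r₁ r₂`. -/
def crossRegion (r₁ r₂ : ℝ) : Set (ℝ × ℝ) :=
  {w | |w.1| ≤ r₁ ∧ |w.2| ≤ r₁ ∧ |w.1 * w.2| ≤ r₁ * r₂}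

/-- The cross-shaped neighbourhood `𝕍(r₁, r₂)` of `{0} × ℝ/ℤ`. -/
def affineCross (r₁ r₂ : ℝ) : Set AffineModel := {c | (c.1, c.2.1) ∈ crossRegion r₁ r₂}

/-- The auxiliary function `ρ : [0, 1] → [0, 1]` of the twist map. -/
structure IsTwistProfile (ρ : ℝ → ℝ) : Prop where
  smooth : ContDiffOn ℝ ∞ ρ (Icc 0 1)
  antitone : AntitoneOn ρ (Icc 0 1)
  eq_one : ∀ t ∈ Icc (0 : ℝ) (1 / 3), ρ t = 1
  deriv_neg : ∀ t ∈ Ioo (1 / 3 : ℝ) (2 / 3), deriv ρ t < 0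
  eq_zero : ∀ t ∈ Icc (2 / 3 : ℝ) 1, ρ t = 0

/-- The glueing map in the coordinates of the `i`-th quadrant. If `m < 0` it is a twist along the
entrance annulus `x = r₁, 0 ≤ y ≤ r₂` of the first quadrant, if `m > 0` it is a twist along the
entrance annulus `x = r₁, -r₂ ≤ y ≤ 0` of the fourth quadrant, and it is the identity on the rest. -/
def twist (ρ : ℝ → ℝ) (n : ℕ) (m : ℤ) (r₁ r₂ : ℝ) (i : Fin 4) (c : AffineModel) : AffineModel :=
  open Classical in
  if m < 0 ∧ i = 0 ∧ c.1 = r₁ ∧ c.2.1 ∈ Icc 0 r₂ then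
    (c.1, c.2.1, c.2.2 + ((|(m : ℝ)| / n * ρ (c.2.1 / r₂) : ℝ) : UnitAddCircle))
  else if 0 < m ∧ i = 3 ∧ c.1 = r₁ ∧ c.2.1 ∈ Icc (-r₂) 0 then
    (c.1, c.2.1, c.2.2 + ((|(m : ℝ)| / n * ρ (-c.2.1 / r₂) : ℝ) : UnitAddCircle))
  else c

namespace NormalCoordinates

variable {M : Type*} [TopologicalSpace M] {φ : Flow ℝ M} {γ : Set M} {lam : ℝ}
  [ChartedSpace E3 {x : M // x ∉ γ}] [IsManifold 𝓘(ℝ, E3) ∞ {x : M // x ∉ γ}]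
  {A : AlmostAnosovStructure φ γ lam} {n k : ℕ} {m : ℤ}

/-- The cross-shaped neighbourhood `R(r₁, r₂)` of `γ`. -/
def singularCross (C : NormalCoordinates A n k m) (r₁ r₂ : ℝ) : Set M :=
  ⋃ i, closure {x : M | ∃ q ∈ C.quad i, (q : M) = x ∧ C.chart i q ∈ affineCross r₁ r₂}

/-- `M_R(r₁, r₂)`, the complement of the interior of `R(r₁, r₂)`. -/
def outer (C : NormalCoordinates A n k m) (r₁ r₂ : ℝ) : Set M :=
  (interior (C.singularCross r₁ r₂))ᶜ

/-- The graph of the glueing map `∂ M_R(r₁, r₂) → ∂ 𝕍(r₁, r₂)`. -/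
def Glue (C : NormalCoordinates A n k m) (ρ : ℝ → ℝ) (r₁ r₂ : ℝ) (x : M) (c : AffineModel) : Prop :=
  x ∈ frontier (C.outer r₁ r₂) ∧
    ∃ i, ∃ q ∈ C.quad i, (q : M) = x ∧ c = twist ρ n m r₁ r₂ i (C.chart i q)

/-- The relation on the disjoint union of `M_R(r₁, r₂)` and `𝕍(r₁, r₂)` that identifies a boundary
point of the former with its image by the glueing map. -/
inductive GlueRel (C : NormalCoordinates A n k m) (ρ : ℝ → ℝ) (r₁ r₂ : ℝ) :
    C.outer r₁ r₂ ⊕ affineCross r₁ r₂ → C.outer r₁ r₂ ⊕ affineCross r₁ r₂ → Prop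
  | glue (x : C.outer r₁ r₂) (c : affineCross r₁ r₂) (h : C.Glue ρ r₁ r₂ x c) :
      GlueRel C ρ r₁ r₂ (Sum.inl x) (Sum.inr c)

/-- The space `N(r₁, r₂)`, with the quotient topology. -/
def GluedSpace (C : NormalCoordinates A n k m) (ρ : ℝ → ℝ) (r₁ r₂ : ℝ) : Type _ :=
  Quot (C.GlueRel ρ r₁ r₂)

instance (C : NormalCoordinates A n k m) (ρ : ℝ → ℝ) (r₁ r₂ : ℝ) :
    TopologicalSpace (C.GluedSpace ρ r₁ r₂) :=
  inferInstanceAs (TopologicalSpace (Quot (C.GlueRel ρ r₁ r₂)))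

/-- The inclusion `M_R(r₁, r₂) → N(r₁, r₂)`. -/
def inclOuter (C : NormalCoordinates A n k m) (ρ : ℝ → ℝ) (r₁ r₂ : ℝ)
    (x : C.outer r₁ r₂) : C.GluedSpace ρ r₁ r₂ :=
  Quot.mk _ (Sum.inl x)

/-- The inclusion `𝕍(r₁, r₂) → N(r₁, r₂)`. -/
def inclAffine (C : NormalCoordinates A n k m) (ρ : ℝ → ℝ) (r₁ r₂ : ℝ)
    (c : affineCross r₁ r₂) : C.GluedSpace ρ r₁ r₂ :=
  Quot.mk _ (Sum.inr c)

/-- The smooth atlas on `N(r₁, r₂)`, the vector field `Y` and the flow `ψ` form a smooth model: `ψ`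
is generated by the smooth field `Y`, and both inclusions are diffeomorphisms onto their images
(topological embeddings which at every point, boundary points included, extend locally to a
diffeomorphism between open sets) that send the vector fields `X_Γ` and `X_(λ,n,p)` to `Y`. -/
structure IsSmoothModel (C : NormalCoordinates A n k m) (ρ : ℝ → ℝ) (r₁ r₂ : ℝ)
    [ChartedSpace E3 (C.GluedSpace ρ r₁ r₂)] [IsManifold 𝓘(ℝ, E3) ∞ (C.GluedSpace ρ r₁ r₂)]
    (Y : ∀ x : C.GluedSpace ρ r₁ r₂, TangentSpace 𝓘(ℝ, E3) x)
    (ψ : Flow ℝ (C.GluedSpace ρ r₁ r₂)) : Prop where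
  isSmoothFlowOf : IsSmoothFlowOf Y ψ
  isEmbedding_outer : IsEmbedding (C.inclOuter ρ r₁ r₂)
  isEmbedding_affine : IsEmbedding (C.inclAffine ρ r₁ r₂)
  outer_subset : C.outer r₁ r₂ ⊆ γᶜ
  smooth_outer : ∀ q : {x : M // x ∉ γ}, (q : M) ∈ C.outer r₁ r₂ →
    ∃ f : {x : M // x ∉ γ} → C.GluedSpace ρ r₁ r₂,
      IsLocalDiffeomorphAt 𝓘(ℝ, E3) 𝓘(ℝ, E3) ∞ f q ∧
      (∀ᶠ q' : {x : M // x ∉ γ} in 𝓝 q, ∀ h : (q' : M) ∈ C.outer r₁ r₂, f q' = C.inclOuter ρ r₁ r₂ ⟨q', h⟩) ∧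
      mfderiv 𝓘(ℝ, E3) 𝓘(ℝ, E3) f q (A.X q) = Y (f q)
  smooth_affine : ∀ u : ℝ × ℝ × ℝ, liftProj u ∈ affineCross r₁ r₂ →
    ∃ f : ℝ × ℝ × ℝ → C.GluedSpace ρ r₁ r₂,
      IsLocalDiffeomorphAt 𝓘(ℝ, ℝ × ℝ × ℝ) 𝓘(ℝ, E3) ∞ f u ∧
      (∀ᶠ u' in 𝓝 u, ∀ h : liftProj u' ∈ affineCross r₁ r₂,
        f u' = C.inclAffine ρ r₁ r₂ ⟨liftProj u', h⟩) ∧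
      mfderiv 𝓘(ℝ, ℝ × ℝ × ℝ) 𝓘(ℝ, E3) f u (affineField lam n k u) = Y (f u)

end NormalCoordinates

end

/-!
The glued flow is shown to exist as a smooth flow, and then to preserve two complementary fields of cones
that are expanded in opposite directions of time.

**Smooth models.** Around the boundary of the cross the glueing map extends to a map `glueMap`, locally
equal to the normal coordinates followed by a vertical shear by a function `T` of `x y`. The product
`x y` is a first integral of the affine field, so that these shears preserve the field, and the shifts in
the four quadrants are chosen so as to absorb the holonomy `m / n` (`exists_isShear`,
`exists_isGlueLift`). The complement of a small box, mapped by `outerMap`, and the interior of the cross,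
mapped by `liftMap` from its covering, are therefore two open parametrizations of the glued space whose
transitions are smooth and match the vector fields. They provide the atlas (`exists_smooth_atlas`) and the
field (`exists_field`); compactness turns the local flows into a flow (`exists_isSmoothModel`).
In an arbitrary smooth model nothing is known a priori about the ring beyond the boundary of
`M_R(r₁, r₂)`, but orbits map to orbits there, and each leaves the cross in one direction of time; flowing
along them shows that `outerMap` is a local diffeomorphism (`isLocalDiffeomorphAt_outerMap`).

**Adapted norms.** Near `γ`, the almost-Anosov metric on `E^s` and the form `dx` are multiplied by the
same factor by the flow, hence their ratio is flow-invariant. Every orbit near `γ` meets a fixed compact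
annulus, and the ratio is bounded. Cutting off its logarithm, slowly as a function of the logarithm of
the distance to `γ`, gives a norm on `E^s` equal to `|dx|` close to `γ` and contracted at the rate
`√λ` everywhere; likewise with `|dy|` on `E^u` (`exists_adaptedSizes`). This determines `ε`.

**Cones.** Write `a`, `b` for the components of a vector along `E^s` and `E^u`, modulo the flow
direction. The cones are given by `|a| ≤ |b|` over `M_R(r₁, r₂)` and by `|y a| ≤ |x b|` in the cross. The
latter is invariant by the affine flow; it follows from the former where an orbit enters the cross, as
`|y| < |x|` there, and implies it where the orbit leaves, as `|x| < |y|` there. The twist acts by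
`y a ↦ y a + c (y a + x b)`, `x b ↦ x b - c (y a + x b)`, and since its slope has the sign opposite to
`x y` one has `c ≤ 0`, so that it preserves the dominance of `x b` and increases `|x b|`
(`abs_le_of_shear`). Hence the cones are invariant and `|b|` grows like `λ^(-t/2)` (`unstableCone`,
`mem_flow`). Reversing time exchanges the roles of entrance and exit (`stableCone`).

**Anosov property.** By compactness, sizes of vectors in the cones are comparable with norms modulo the
flow direction (`exists_outer_comparable`, `exists_affine_comparable`). Thus each point has vectors
uniformly expanded, modulo the field, in either direction of time (`exists_expanded`). Pulling such
vectors back along the orbit and passing to a limit gives vectors contracted modulo the field for all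
times (`exists_transverse_limit`); the drift along the field is a convergent geometric series, and adding
a multiple of the field yields contracted vectors (`exists_stable_vector`). These are the vectors whose
iterates tend to zero, which makes the splitting invariant and closed, hence continuous
(`isAnosovFlow_of_transverse`).
-/

noncomputable section
set_option linter.unusedSectionVars false

local notation "𝓔" => 𝓘(ℝ, E3)

local notation "ℝ³" => ℝ × ℝ × ℝ

/-! ### Riemannian metrics -/

section
variable {N : Type*} [TopologicalSpace N] [ChartedSpace E3 N] [IsManifold 𝓔 ∞ N]

theorem metricNorm_nonneg (g : SmoothMetric N) (x : N) (v : TangentSpace 𝓔 x) :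
    0 ≤ metricNorm g x v := Real.sqrt_nonneg _

theorem metricNorm_smul (g : SmoothMetric N) (x : N) (c : ℝ) (v : TangentSpace 𝓔 x) :
    metricNorm g x (c • v) = |c| * metricNorm g x v := by
  unfold metricNorm
  rw [map_smul, map_smul, smul_apply, smul_eq_mul, smul_eq_mul, ← mul_assoc,
    Real.sqrt_mul (mul_self_nonneg c), Real.sqrt_mul_self_eq_abs]

theorem metricNorm_pos (g : SmoothMetric N) (x : N) {v : TangentSpace 𝓔 x} (hv : v ≠ 0) :
    0 < metricNorm g x v := Real.sqrt_pos.2 (g.pos x v hv)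

theorem metricNorm_add_le (g : SmoothMetric N) (x : N) (v w : TangentSpace 𝓔 x) :
    metricNorm g x (v + w) ≤ metricNorm g x v + metricNorm g x w := by
  let := g.toRiemannianMetric.toCore x
  let : NormedAddCommGroup (TangentSpace 𝓔 x) :=
    InnerProductSpace.Core.toNormedAddCommGroup (𝕜 := ℝ)
  have := norm_add_le v w
  exact this

open scoped Bundle in
theorem continuous_metricNorm (g : SmoothMetric N) :
    Continuous (fun V : TangentBundle 𝓔 N => metricNorm g V.1 V.2) := by
  refine Real.continuous_sqrt.comp ?_
  let : Bundle.RiemannianBundle (fun x : N => TangentSpace 𝓔 x) := ⟨g.toContinuousRiemannianMetric.toRiemannianMetric⟩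
  have := Continuous.inner_bundle (F := E3) (E := fun x : N => TangentSpace 𝓔 x)
    (b := fun V : TangentBundle 𝓔 N => V.1) (v := fun V => V.2) (w := fun V => V.2)
    continuous_id continuous_id
  exact this

open scoped Bundle in
theorem continuous_inner_field (g : SmoothMetric N) {Y : ∀ x : N, TangentSpace 𝓔 x}
    (hY : Continuous (fun x : N => (⟨x, Y x⟩ : TangentBundle 𝓔 N))) :
    Continuous (fun V : TangentBundle 𝓔 N => g.inner V.1 V.2 (Y V.1)) := by
  let : Bundle.RiemannianBundle (fun x : N => TangentSpace 𝓔 x) := ⟨g.toContinuousRiemannianMetric.toRiemannianMetric⟩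
  have := Continuous.inner_bundle (F := E3) (E := fun x : N => TangentSpace 𝓔 x)
    (b := fun V : TangentBundle 𝓔 N => V.1) (v := fun V => V.2) (w := fun V => Y V.1)
    continuous_id (hY.comp (FiberBundle.continuous_proj E3 _))
  exact this

theorem convex_setOf_symm_posDef (V : Type*) [AddCommGroup V] [Module ℝ V] [TopologicalSpace V]
    [IsTopologicalAddGroup V] [ContinuousConstSMul ℝ V] :
    Convex ℝ {B : V →L[ℝ] V →L[ℝ] ℝ | (∀ v w, B v w = B w v) ∧ ∀ v, v ≠ 0 → 0 < B v v} := by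
  intro B hB B' hB' a c ha hc hac
  refine ⟨fun v w => ?_, fun v hv => ?_⟩
  · simp [hB.1 v w, hB'.1 v w]
  · have h1 := hB.2 v hv
    have h2 := hB'.2 v hv
    simp only [add_apply, smul_apply, smul_eq_mul]
    rcases ha.eq_or_lt with rfl | ha
    · have : c = 1 := by linarith
      subst this; simpa using h2
    · positivity

theorem isVonNBounded_setOf_posDef {V : Type*} [NormedAddCommGroup V] [NormedSpace ℝ V]
    [FiniteDimensional ℝ V] (B : V →L[ℝ] V →L[ℝ] ℝ) (hB : ∀ v, v ≠ 0 → 0 < B v v) :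
    Bornology.IsVonNBounded ℝ {v : V | B v v < 1} := by
  rcases subsingleton_or_nontrivial V with hV | hV
  · rw [NormedSpace.isVonNBounded_iff]
    exact Bornology.IsBounded.all _ 
  have : ProperSpace V := FiniteDimensional.proper ℝ V
  have hc : Continuous (fun v : V => B v v) := B.continuous.clm_apply continuous_id
  obtain ⟨v0, hv0, hmin⟩ := (isCompact_sphere (0 : V) 1).exists_isMinOn
    ((NormedSpace.sphere_nonempty (x := (0 : V)) (r := 1)).2 zero_le_one) hc.continuousOn
  have hv00 : v0 ≠ 0 := by
    rintro rfl; simp at hv0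
  rw [NormedSpace.isVonNBounded_iff, isBounded_iff_forall_norm_le]
  refine ⟨1 / (B v0 v0) + 1, fun v hv => ?_⟩
  have h0 := hB v0 hv00
  by_cases h : v = 0
  · subst h; simp; positivity
  have hn : 0 < ‖v‖ := norm_pos_iff.2 h
  have h1 : B v0 v0 ≤ B (‖v‖⁻¹ • v) (‖v‖⁻¹ • v) := hmin (by simp [norm_smul, hn.ne'])
  simp only [map_smul, smul_apply, smul_eq_mul] at h1
  have hv' : B v v < 1 := hv
  have h2 : B v0 v0 * ‖v‖ ^ 2 ≤ B v v := by
    calc _ ≤ (‖v‖⁻¹ * (‖v‖⁻¹ * B v v)) * ‖v‖ ^ 2 := by gcongr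
      _ = B v v := by field_simp
  by_contra! hlt
  have h3 : 1 < B v0 v0 * ‖v‖ := by
    have := mul_lt_mul_of_pos_left hlt h0
    have h4 : B v0 v0 * (1 / B v0 v0 + 1) = 1 + B v0 v0 := by field_simp
    linarith
  have h5 : 1 < ‖v‖ := by
    have : 0 < 1 / B v0 v0 := by positivity
    linarith
  nlinarith

section
variable {B : Type*} [TopologicalSpace B] [ChartedSpace E3 B]
  {F : Type*} [NormedAddCommGroup F] [InnerProductSpace ℝ F]
  (E : B → Type*) [TopologicalSpace (Bundle.TotalSpace F E)]
  [∀ b, TopologicalSpace (E b)] [∀ b, AddCommGroup (E b)] [∀ b, Module ℝ (E b)]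
  [FiberBundle F E] [VectorBundle ℝ F E] [ContMDiffVectorBundle ∞ F E 𝓔]

variable (F) in
/-- Local existence of metrics; convexity of the conditions makes a partition of unity applicable. -/
theorem exists_local_contMDiffRiemannianMetric (x : B) : ∃ U ∈ 𝓝 x,
    ∃ s : ∀ b : B, E b →L[ℝ] E b →L[ℝ] ℝ,
    ContMDiffOn 𝓔 ((𝓔).prod 𝓘(ℝ, F →L[ℝ] F →L[ℝ] ℝ)) ∞
      (fun b => Bundle.TotalSpace.mk' (F →L[ℝ] F →L[ℝ] ℝ) b (s b)) U ∧
    ∀ y ∈ U, (∀ v w, s y v w = s y w v) ∧ ∀ v, v ≠ 0 → 0 < s y v v := by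
  let e := trivializationAt (F →L[ℝ] F →L[ℝ] ℝ) (fun b : B => E b →L[ℝ] E b →L[ℝ] ℝ) x
  let e₁ := trivializationAt F E x
  let c : F →L[ℝ] F →L[ℝ] ℝ := innerSL ℝ
  have hc : ∀ v w, c v w = inner ℝ v w := fun v w => rfl
  refine ⟨e.baseSet, e.open_baseSet.mem_nhds (mem_baseSet_trivializationAt _ _ x),
    fun b => e.symm b c, ?_, ?_⟩
  · refine (Bundle.Trivialization.contMDiffOn_section_baseSet_iff (F := F →L[ℝ] F →L[ℝ] ℝ)
      (IB := 𝓔) (n := ∞) (E := fun b : B => E b →L[ℝ] E b →L[ℝ] ℝ) e).2 ?_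
    refine (contMDiffOn_const (c := c)).congr fun y hy => ?_
    rw [e.apply_mk_symm hy]
  · intro y hy
    have hy1 : y ∈ e₁.baseSet := hy.1
    have key : ∀ v w : E y, e.symm y c v w = inner ℝ (e₁ ⟨y, v⟩).2 (e₁ ⟨y, w⟩).2 := by
      intro v w
      have h1 := inCoordinates_apply_eq₂ (𝕜 := ℝ) (F₁ := F) (F₂ := F) (F₃ := ℝ)
        (E₁ := E) (E₂ := E)
        (E₃ := fun _ : B => ℝ) (x₀ := x) (x := y) (ϕ := e.symm y c)
        (v := (e₁ ⟨y, v⟩).2) (w := (e₁ ⟨y, w⟩).2) hy1 hy1 (by simp)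
      have h2 : ContinuousLinearMap.inCoordinates F E
          (F →L[ℝ] ℝ) (fun x : B => E x →L[ℝ] ℝ) x y x y
          (e.symm y c) = c := by
        have h3 : (e ⟨y, e.symm y c⟩).2 = c := by
          rw [e.apply_mk_symm hy]
        exact h3
      rw [h2] at h1
      rw [e₁.symm_apply_apply_mk hy1, e₁.symm_apply_apply_mk hy1] at h1
      rw [hc] at h1; simpa using h1.symm
    refine ⟨fun v w => ?_, fun v hv => ?_⟩
    · simp only [key]; exact real_inner_comm _ _
    · rw [key]
      refine real_inner_self_pos.2 fun h0 => hv ?_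
      have := e₁.symm_apply_apply_mk hy1 v
      rw [h0] at this
      rw [← this]
      rw [← e₁.symmL_apply (R := ℝ) hy1]
      exact map_zero _

theorem exists_contMDiffRiemannianMetric [IsManifold 𝓔 ∞ B] [FiniteDimensional ℝ F]
    [∀ b, IsTopologicalAddGroup (E b)] [∀ b, ContinuousSMul ℝ (E b)]
    [SigmaCompactSpace B] [T2Space B] :
    Nonempty (Bundle.ContMDiffRiemannianMetric 𝓔 ∞ F E) := by
  obtain ⟨s, hs⟩ := exists_contMDiffSection_forall_mem_convex_of_local (n := ⊤) 𝓔
    (F_fiber := F →L[ℝ] F →L[ℝ] ℝ)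
    (fun b : B => E b →L[ℝ] E b →L[ℝ] ℝ)
    (fun x => {B | (∀ v w, B v w = B w v) ∧ ∀ v, v ≠ 0 → 0 < B v v})
    (fun x => convex_setOf_symm_posDef (E x)) (exists_local_contMDiffRiemannianMetric F E)
  refine ⟨⟨s, fun b => (hs b).1, fun b => (hs b).2, fun b => ?_, s.contMDiff⟩⟩
  let e : E b ≃L[ℝ] F := Bundle.Trivialization.continuousLinearEquivAt ℝ (trivializationAt F E b) _
      (FiberBundle.mem_baseSet_trivializationAt' b)
  let m : (E b →L[ℝ] E b →L[ℝ] ℝ) ≃L[ℝ] (F →L[ℝ] F →L[ℝ] ℝ) :=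
      e.arrowCongr (e.arrowCongr (ContinuousLinearEquiv.refl ℝ ℝ))
  have A (v : F) : m (s b) v v = s b (e.symm v) (e.symm v) := by simp [m]
  have h := isVonNBounded_setOf_posDef (m (s b)) (fun v hv => by
    rw [A]; exact (hs b).2 _ (by simpa using hv))
  have h2 := h.image (e.symm : F →L[ℝ] E b)
  refine h2.subset ?_
  intro v hv
  refine ⟨e v, ?_, by simp⟩
  simpa [A] using hv
end

variable (N) in
theorem exists_smoothMetric [SigmaCompactSpace N] [T2Space N] : Nonempty (SmoothMetric N) :=
  exists_contMDiffRiemannianMetric (F := E3) (fun x : N => TangentSpace 𝓔 x)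
end

/-! ### Norms modulo the flow direction -/

section
variable {N : Type*} [TopologicalSpace N] [ChartedSpace E3 N] [IsManifold 𝓔 ∞ N]

/-- On a compact set of parameters and base points, an absolutely homogeneous function is bounded by a
multiple of a positive one: locally, both are compared on the unit sphere of a trivialization. -/
theorem exists_bound_of_homogeneous {T : Type*} [TopologicalSpace T] {S : Set (T × N)}
    (hS : IsCompact S) {F : T → TangentBundle 𝓔 N → ℝ} {G : TangentBundle 𝓔 N → ℝ}
    (hF : Continuous (Function.uncurry F)) (hG : Continuous G)
    (hFh : ∀ t p (c : ℝ) (v : TangentSpace 𝓔 p), F t ⟨p, c • v⟩ = |c| * F t ⟨p, v⟩)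
    (hGh : ∀ p (c : ℝ) (v : TangentSpace 𝓔 p), G ⟨p, c • v⟩ = |c| * G ⟨p, v⟩)
    (hGpos : ∀ p (v : TangentSpace 𝓔 p), v ≠ 0 → 0 < G ⟨p, v⟩) :
    ∃ K : ℝ, 0 < K ∧ ∀ t p (v : TangentSpace 𝓔 p), (t, p) ∈ S → F t ⟨p, v⟩ ≤ K * G ⟨p, v⟩ := by
  have hG0 : ∀ p, G ⟨p, (0 : TangentSpace 𝓔 p)⟩ = 0 := fun p => by
    simpa using hGh p 0 0
  have hF0 : ∀ t p, F t ⟨p, (0 : TangentSpace 𝓔 p)⟩ = 0 := fun t p => by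
    simpa using hFh t p 0 0
  have hGn : ∀ p (v : TangentSpace 𝓔 p), 0 ≤ G ⟨p, v⟩ := fun p v => by
    by_cases h : v = 0
    · subst h; rw [hG0]
    · exact (hGpos p v h).le
  have loc : ∀ x : T × N, ∃ K : ℝ, 0 < K ∧ ∀ᶠ y in 𝓝 x,
      ∀ v : TangentSpace 𝓔 y.2, F y.1 ⟨y.2, v⟩ ≤ K * G ⟨y.2, v⟩ := by
    rintro ⟨t₀, p₀⟩
    let e := trivializationAt E3 (TangentSpace 𝓔 : N → Type _) p₀
    have hp₀ : p₀ ∈ e.baseSet := FiberBundle.mem_baseSet_trivializationAt' p₀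
    -- the sphere of the model fibre, transported to the nearby fibres
    let σ : (T × N) × E3 → TangentBundle 𝓔 N := fun z => ⟨z.1.2, e.symm z.1.2 z.2⟩
    have hσ : ∀ v : E3, ContinuousAt σ ((t₀, p₀), v) := by
      intro v
      have h1 : ContinuousOn (fun z : N × E3 => (⟨z.1, e.symm z.1 z.2⟩ : TangentBundle 𝓔 N))
          (e.baseSet ×ˢ univ) := e.continuousOn_symm
      have h2 : ContinuousAt (fun z : N × E3 => (⟨z.1, e.symm z.1 z.2⟩ : TangentBundle 𝓔 N))
          (p₀, v) := h1.continuousAt ((e.open_baseSet.prod isOpen_univ).mem_nhds ⟨hp₀, trivial⟩)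
      have h3 : Continuous (fun z : (T × N) × E3 => (z.1.2, z.2)) := by fun_prop
      exact ContinuousAt.comp (x := ((t₀, p₀), v)) h2 h3.continuousAt
    have hFσ : ∀ v : E3, ContinuousAt (fun z : (T × N) × E3 => F z.1.1 (σ z)) ((t₀, p₀), v) := by
      intro v
      exact hF.continuousAt.comp (f := fun z : (T × N) × E3 => (z.1.1, σ z))
        (ContinuousAt.prodMk (by fun_prop) (hσ v))
    have hGσ : ∀ v : E3, ContinuousAt (fun z : (T × N) × E3 => G (σ z)) ((t₀, p₀), v) := by
      intro v
      exact hG.continuousAt.comp (hσ v)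
    have hpos : ∀ (p : N) (v : E3), p ∈ e.baseSet → v ≠ 0 → 0 < G ⟨p, e.symm p v⟩ := by
      intro p v hp hv
      refine hGpos _ _ fun h => hv ?_
      have h1 := e.apply_mk_symm hp v
      have h2 := e.apply_mk_symm hp 0
      have h3 : e.symm p 0 = 0 := by rw [← e.symmL_apply (R := ℝ) hp, map_zero]
      rw [h] at h1
      rw [h3, h1] at h2
      exact congrArg Prod.snd h2
    obtain ⟨K₀, hK₀⟩ := (isCompact_sphere (0 : E3) 1).bddAbove_image
      (f := fun v : E3 => F t₀ (σ ((t₀, p₀), v)) / G (σ ((t₀, p₀), v))) (by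
        intro v hv
        have hv0 : v ≠ 0 := by rintro rfl; simp at hv
        refine ContinuousAt.continuousWithinAt (ContinuousAt.div ?_ ?_ (hpos p₀ v hp₀ hv0).ne')
        · exact ContinuousAt.comp (f := fun v : E3 => (((t₀, p₀), v) : (T × N) × E3))
            (hFσ v) (by fun_prop)
        · exact ContinuousAt.comp (f := fun v : E3 => (((t₀, p₀), v) : (T × N) × E3))
            (hGσ v) (by fun_prop))
    refine ⟨|K₀| + 1, by positivity, ?_⟩
    have key : ∀ᶠ y in 𝓝 ((t₀, p₀) : T × N), ∀ v ∈ Metric.sphere (0 : E3) 1,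
        F y.1 (σ (y, v)) < (|K₀| + 1) * G (σ (y, v)) := by
      refine (isCompact_sphere (0 : E3) 1).eventually_forall_of_forall_eventually
        (P := fun y v => F y.1 (σ (y, v)) < (|K₀| + 1) * G (σ (y, v))) ?_
      intro v hv
      have hv0 : v ≠ 0 := by rintro rfl; simp at hv
      refine (hFσ v).eventually_lt ((continuousAt_const).mul (hGσ v)) ?_
      have h1 := hK₀ ⟨v, hv, rfl⟩
      have h2 : 0 < G (σ ((t₀, p₀), v)) := hpos p₀ v hp₀ hv0
      simp only at h1
      rw [div_le_iff₀ h2] at h1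
      refine h1.trans_lt ?_
      gcongr
      linarith [le_abs_self K₀]
    have hbase : ∀ᶠ y in 𝓝 ((t₀, p₀) : T × N), y.2 ∈ e.baseSet :=
      continuous_snd.continuousAt.eventually (e.open_baseSet.mem_nhds hp₀)
    filter_upwards [key, hbase] with y hy hyb v
    by_cases hv : v = 0
    · subst hv; rw [hF0, hG0, mul_zero]
    let w : E3 := (e ⟨y.2, v⟩).2
    have hw : e.symm y.2 w = v := e.symm_apply_apply_mk hyb v
    have hw0 : w ≠ 0 := by
      intro h
      rw [h] at hw
      rw [← e.symmL_apply (R := ℝ) hyb, map_zero] at hw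
      exact hv hw.symm
    have hn : 0 < ‖w‖ := norm_pos_iff.2 hw0
    have h1 := hy (‖w‖⁻¹ • w) (by simp [norm_smul, hn.ne'])
    have h2 : σ (y, ‖w‖⁻¹ • w) = ⟨y.2, ‖w‖⁻¹ • v⟩ := by
      simp only [σ]
      congr 1
      rw [← e.symmL_apply (R := ℝ) hyb, map_smul, e.symmL_apply hyb, hw]
    rw [h2, hFh, hGh, abs_of_pos (inv_pos.2 hn)] at h1
    have h3 : ‖w‖⁻¹ * F y.1 ⟨y.2, v⟩ < ‖w‖⁻¹ * ((|K₀| + 1) * G ⟨y.2, v⟩) := by linarith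
    exact (lt_of_mul_lt_mul_left h3 (inv_pos.2 hn).le).le
  choose K hK hU using loc
  obtain ⟨t, -, ht⟩ := hS.elim_nhds_subcover (fun x => {y | ∀ v : TangentSpace 𝓔 y.2,
    F y.1 ⟨y.2, v⟩ ≤ K x * G ⟨y.2, v⟩}) (fun x _ => hU x)
  refine ⟨∑ x ∈ t, K x + 1, by have := Finset.sum_nonneg (s := t) (fun x _ => (hK x).le); linarith,
    fun s p v hsp => ?_⟩
  obtain ⟨x, hx, hxy⟩ := mem_iUnion₂.1 (ht hsp)
  refine (hxy v).trans (mul_le_mul_of_nonneg_right ?_ (hGn p v))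
  have := Finset.single_le_sum (f := K) (fun x _ => (hK x).le) hx
  linarith

variable (g : SmoothMetric N) (Y : ∀ x : N, TangentSpace 𝓔 x)

/-- The coefficient of `Y` in the `g`-orthogonal decomposition of a tangent vector. -/
def fieldCoeff (p : N) (v : TangentSpace 𝓔 p) : ℝ :=
  g.inner p v (Y p) / g.inner p (Y p) (Y p)

/-- The norm of the class of a tangent vector modulo `Y`, that is, the norm of its component
orthogonal to `Y`. -/
def transverseNorm (p : N) (v : TangentSpace 𝓔 p) : ℝ :=
  metricNorm g p (v - fieldCoeff g Y p v • Y p)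

theorem fieldCoeff_add (p : N) (v w : TangentSpace 𝓔 p) :
    fieldCoeff g Y p (v + w) = fieldCoeff g Y p v + fieldCoeff g Y p w := by
  simp [fieldCoeff, add_div]

theorem fieldCoeff_smul (p : N) (c : ℝ) (v : TangentSpace 𝓔 p) :
    fieldCoeff g Y p (c • v) = c * fieldCoeff g Y p v := by
  simp [fieldCoeff, mul_div_assoc]

theorem fieldCoeff_self {p : N} (h : Y p ≠ 0) : fieldCoeff g Y p (Y p) = 1 :=
  div_self (g.pos p _ h).ne'

theorem transverseNorm_nonneg (p : N) (v : TangentSpace 𝓔 p) :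
    0 ≤ transverseNorm g Y p v := metricNorm_nonneg _ _ _

theorem transverseNorm_smul (p : N) (c : ℝ) (v : TangentSpace 𝓔 p) :
    transverseNorm g Y p (c • v) = |c| * transverseNorm g Y p v := by
  rw [transverseNorm, fieldCoeff_smul, mul_smul, ← smul_sub, metricNorm_smul]; rfl

theorem transverseNorm_add_field {p : N} (h : Y p ≠ 0) (v : TangentSpace 𝓔 p) (c : ℝ) :
    transverseNorm g Y p (v + c • Y p) = transverseNorm g Y p v := by
  rw [transverseNorm, fieldCoeff_add, fieldCoeff_smul, fieldCoeff_self g Y h, transverseNorm]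
  congr 1
  module

theorem metricNorm_le_add (p : N) (v : TangentSpace 𝓔 p) :
    metricNorm g p v ≤ transverseNorm g Y p v + |fieldCoeff g Y p v| * metricNorm g p (Y p) := by
  rw [← metricNorm_smul]
  refine le_trans (le_of_eq ?_) (metricNorm_add_le _ _ _ _)
  congr 1
  module

theorem sq_transverseNorm {p : N} (h : Y p ≠ 0) (v : TangentSpace 𝓔 p) :
    transverseNorm g Y p v =
      Real.sqrt (g.inner p v v - (g.inner p v (Y p)) ^ 2 / g.inner p (Y p) (Y p)) := by
  have h0 : g.inner p (Y p) (Y p) ≠ 0 := (g.pos p _ h).ne'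
  rw [transverseNorm, metricNorm]
  congr 1
  have h1 : g.inner p (Y p) v = g.inner p v (Y p) := g.symm p _ _
  simp only [map_sub, map_smul, sub_apply, smul_apply, smul_eq_mul, fieldCoeff, h1]
  field_simp
  ring

theorem transverseNorm_le_metricNorm {p : N} (h : Y p ≠ 0) (v : TangentSpace 𝓔 p) :
    transverseNorm g Y p v ≤ metricNorm g p v := by
  rw [sq_transverseNorm g Y h, metricNorm]
  refine Real.sqrt_le_sqrt ?_
  have := g.pos p _ h
  have : 0 ≤ (g.inner p v (Y p)) ^ 2 / g.inner p (Y p) (Y p) := by positivity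
  linarith

variable {Y}
theorem continuous_inner_self : Continuous (fun V : TangentBundle 𝓔 N => g.inner V.1 V.2 V.2) := by
  have := (continuous_metricNorm g).pow 2
  refine this.congr fun V => ?_
  by_cases h : V.2 = 0
  · simp [metricNorm, h]
  · exact Real.sq_sqrt (g.pos V.1 V.2 h).le

variable (hY : Continuous (fun x : N => (⟨x, Y x⟩ : TangentBundle 𝓔 N))) (hY0 : ∀ x, Y x ≠ 0)
include hY hY0

theorem continuous_fieldCoeff :
    Continuous (fun V : TangentBundle 𝓔 N => fieldCoeff g Y V.1 V.2) := by
  have h2 : Continuous (fun V : TangentBundle 𝓔 N => g.inner V.1 (Y V.1) (Y V.1)) :=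
    (continuous_inner_self g).comp (hY.comp (FiberBundle.continuous_proj E3 _))
  exact (continuous_inner_field g hY).div h2 fun V => (g.pos _ _ (hY0 _)).ne'

theorem continuous_transverseNorm :
    Continuous (fun V : TangentBundle 𝓔 N => transverseNorm g Y V.1 V.2) := by
  have h2 : Continuous (fun V : TangentBundle 𝓔 N => g.inner V.1 (Y V.1) (Y V.1)) :=
    (continuous_inner_self g).comp (hY.comp (FiberBundle.continuous_proj E3 _))
  have : Continuous (fun V : TangentBundle 𝓔 N => Real.sqrt (g.inner V.1 V.2 V.2 -
      (g.inner V.1 V.2 (Y V.1)) ^ 2 / g.inner V.1 (Y V.1) (Y V.1))) :=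
    Real.continuous_sqrt.comp ((continuous_inner_self g).sub
      (((continuous_inner_field g hY).pow 2).div h2 fun V => (g.pos _ _ (hY0 _)).ne'))
  exact this.congr fun V => (sq_transverseNorm g Y (hY0 _) _).symm
end

/-! ### Vectors contracted modulo the flow direction -/

section
variable {N : Type*} [TopologicalSpace N] [ChartedSpace E3 N] [IsManifold 𝓔 ∞ N]
  {ψ : Flow ℝ N}

section smoothFlow
variable (hψ : ContMDiff (𝓘(ℝ, ℝ).prod 𝓔) 𝓔 ∞ (fun q : ℝ × N => ψ q.1 q.2))
include hψ

theorem contMDiff_flow_apply (t : ℝ) : ContMDiff 𝓔 𝓔 ∞ (ψ t) :=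
  hψ.comp (contMDiff_const.prodMk contMDiff_id)

theorem mdifferentiable_flow_apply (t : ℝ) : MDifferentiable 𝓔 𝓔 (ψ t) :=
  (contMDiff_flow_apply hψ t).mdifferentiable (by simp)

theorem tangentMap_flow_add (s t : ℝ) (V : TangentBundle 𝓔 N) :
    tangentMap 𝓔 𝓔 (ψ (s + t)) V =
      tangentMap 𝓔 𝓔 (ψ s) (tangentMap 𝓔 𝓔 (ψ t) V) := by
  have : ψ (s + t) = ψ s ∘ ψ t := funext fun x => ψ.map_add s t x
  rw [this]
  exact tangentMap_comp_at V (mdifferentiable_flow_apply hψ s _) (mdifferentiable_flow_apply hψ t _)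

omit hψ in
theorem tangentMap_flow_zero (V : TangentBundle 𝓔 N) :
    tangentMap 𝓔 𝓔 (ψ 0) V = V := by
  rw [ψ.map_zero, tangentMap_id]; rfl

theorem continuous_tangentMap_flow :
    Continuous (fun z : ℝ × TangentBundle 𝓔 N =>
      tangentMap 𝓔 𝓔 (ψ z.1) z.2) := by
  have h1 : Continuous (tangentMap (𝓘(ℝ, ℝ).prod 𝓔) 𝓔 (fun q : ℝ × N => ψ q.1 q.2)) :=
    hψ.continuous_tangentMap (by simp)
  have h2 : Continuous (equivTangentBundleProd 𝓘(ℝ, ℝ) ℝ 𝓔 N).symm :=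
    (contMDiff_equivTangentBundleProd_symm (n := 0)).continuous
  have h3 : Continuous (fun t : ℝ => (⟨t, 0⟩ : TangentBundle 𝓘(ℝ, ℝ) ℝ)) := by
    exact (Bundle.contMDiff_zeroSection ℝ (TangentSpace 𝓘(ℝ, ℝ) : ℝ → Type _) (IB := 𝓘(ℝ, ℝ)) (n := 0)).continuous
  have h4 := h1.comp (h2.comp ((h3.comp continuous_fst).prodMk
    (continuous_snd (X := ℝ) (Y := TangentBundle 𝓔 N))))
  refine h4.congr fun z => ?_
  rcases z with ⟨t, p, v⟩
  have h5 : HasMFDerivAt 𝓔 (𝓘(ℝ, ℝ).prod 𝓔) (fun x : N => (t, x)) p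
      ((0 : TangentSpace 𝓔 p →L[ℝ] TangentSpace 𝓘(ℝ, ℝ) t).prod
        (ContinuousLinearMap.id ℝ (TangentSpace 𝓔 p))) :=
    (hasMFDerivAt_const t p).prodMk (hasMFDerivAt_id p)
  have h6 := ((hψ.mdifferentiable (by simp)) (t, p)).hasMFDerivAt.comp p h5
  have h7 := h6.mfderiv
  simp only [tangentMap, Function.comp]
  congr 1
  rw [show (ψ t) = (fun q : ℝ × N => ψ q.1 q.2) ∘ (fun x : N => (t, x)) from rfl, h7]
  rfl
end smoothFlow

section stable
variable [CompactSpace N] (g : SmoothMetric N) {Y : ∀ x : N, TangentSpace 𝓔 x}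
  (hψ : ContMDiff (𝓘(ℝ, ℝ).prod 𝓔) 𝓔 ∞ (fun q : ℝ × N => ψ q.1 q.2))
  (hY : Continuous (fun x : N => (⟨x, Y x⟩ : TangentBundle 𝓔 N))) (hY0 : ∀ x, Y x ≠ 0)
  (hYψ : ∀ t x, mfderiv 𝓔 𝓔 (ψ t) x (Y x) = Y (ψ t x))

include hY0 hYψ in
theorem transverseNorm_flow_smul_add (t : ℝ) (p : N) (c d : ℝ) (v : TangentSpace 𝓔 p) :
    transverseNorm g Y (ψ t p) (mfderiv 𝓔 𝓔 (ψ t) p (c • (v + d • Y p))) =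
      |c| * transverseNorm g Y (ψ t p) (mfderiv 𝓔 𝓔 (ψ t) p v) := by
  rw [map_smul, map_add, map_smul, hYψ, transverseNorm_smul, transverseNorm_add_field _ _ (hY0 _)]

include hψ hY hY0 hYψ in
/-- The drift of the `Y`-component along the flow is controlled by the transverse norm. -/
theorem exists_bound_fieldCoeff_flow : ∃ K : ℝ, 0 < K ∧ ∀ s ∈ Icc (0 : ℝ) 1, ∀ p,
    ∀ v : TangentSpace 𝓔 p,
    |fieldCoeff g Y (ψ s p) (mfderiv 𝓔 𝓔 (ψ s) p v) - fieldCoeff g Y p v| ≤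
      K * transverseNorm g Y p v := by
  obtain ⟨K, hK, h⟩ := exists_bound_of_homogeneous (N := N) (T := ℝ)
    (S := Icc 0 1 ×ˢ univ) (isCompact_Icc.prod isCompact_univ)
    (F := fun s V => |fieldCoeff g Y (tangentMap 𝓔 𝓔 (ψ s) V).1
      (tangentMap 𝓔 𝓔 (ψ s) V).2 - fieldCoeff g Y V.1 V.2|)
    (G := fun V => metricNorm g V.1 V.2)
    ((((continuous_fieldCoeff g hY hY0).comp (continuous_tangentMap_flow hψ)).sub
      ((continuous_fieldCoeff g hY hY0).comp continuous_snd)).abs)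
    (continuous_metricNorm g)
    (fun t p c v => by
      simp only [tangentMap, map_smul, fieldCoeff_smul]
      rw [← mul_sub, abs_mul])
    (fun p c v => metricNorm_smul g p c v) (fun p v hv => metricNorm_pos g p hv)
  refine ⟨K, hK, fun s hs p v => ?_⟩
  have h1 := h s p (v - fieldCoeff g Y p v • Y p) ⟨hs, trivial⟩
  simp only [tangentMap] at h1
  refine le_trans (le_of_eq ?_) h1
  congr 1
  have e1 : fieldCoeff g Y p (v - fieldCoeff g Y p v • Y p) = 0 := by
    rw [sub_eq_add_neg, ← neg_smul, fieldCoeff_add, fieldCoeff_smul, fieldCoeff_self _ _ (hY0 _)]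
    ring
  have e2 : mfderiv 𝓔 𝓔 (ψ s) p (v - fieldCoeff g Y p v • Y p) =
      mfderiv 𝓔 𝓔 (ψ s) p v + (-fieldCoeff g Y p v) • Y (ψ s p) := by
    rw [map_sub, map_smul, hYψ]; module
  rw [e1, e2, fieldCoeff_add, fieldCoeff_smul, fieldCoeff_self _ _ (hY0 _)]
  ring

theorem isBounded_setOf_metricNorm_le (p : N) (r : ℝ) :
    Bornology.IsBounded {v : E3 | metricNorm g p v ≤ r} := by
  have h := g.isVonNBounded p
  have h' : Bornology.IsVonNBounded ℝ {v : E3 | g.inner p v v < 1} := h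
  rw [NormedSpace.isVonNBounded_iff, isBounded_iff_forall_norm_le] at h'
  obtain ⟨R, hR⟩ := h'
  rw [isBounded_iff_forall_norm_le]
  refine ⟨(|r| + 1) * R, fun v hv => ?_⟩
  have h0 : 0 < |r| + 1 := by positivity
  have h1 : metricNorm g p (((|r| + 1)⁻¹ : ℝ) • v : TangentSpace 𝓔 p) < 1 := by
    have h3 := metricNorm_smul g p (|r| + 1)⁻¹ (v : TangentSpace 𝓔 p)
    refine lt_of_eq_of_lt h3 ?_
    rw [abs_of_pos (inv_pos.2 h0), inv_mul_lt_iff₀ h0]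
    have : metricNorm g p v ≤ r := hv
    linarith [le_abs_self r]
  have h2 : ‖(((|r| + 1)⁻¹ : ℝ) • v : E3)‖ ≤ R := by
    refine hR _ ?_
    have h3 := (Real.sqrt_lt' one_pos).1 h1
    simpa using h3
  rw [norm_smul, norm_inv, Real.norm_of_nonneg h0.le, inv_mul_le_iff₀ h0] at h2
  exact h2

include hψ hY hY0 hYψ in
/-- If each point has a vector contracted modulo `Y` along its past orbit, then each point has one
contracted along its whole orbit: vectors at `ψ n p` are pulled back to `p`, and a limit is taken as
`n → ∞`. -/
theorem exists_transverse_limit {C μ : ℝ}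
    (hS : ∀ p, ∃ w : TangentSpace 𝓔 p, transverseNorm g Y p w ≠ 0 ∧ ∀ s t : ℝ, s ≤ t → t ≤ 0 →
      transverseNorm g Y (ψ t p) (mfderiv 𝓔 𝓔 (ψ t) p w) ≤
      C * μ ^ (t - s) * transverseNorm g Y (ψ s p) (mfderiv 𝓔 𝓔 (ψ s) p w)) (p : N) :
    ∃ v : TangentSpace 𝓔 p, transverseNorm g Y p v = 1 ∧ ∀ s t : ℝ, s ≤ t →
      transverseNorm g Y (ψ t p) (mfderiv 𝓔 𝓔 (ψ t) p v) ≤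
      C * μ ^ (t - s) * transverseNorm g Y (ψ s p) (mfderiv 𝓔 𝓔 (ψ s) p v) := by
  let TN : TangentBundle 𝓔 N → ℝ := fun V => transverseNorm g Y V.1 V.2
  let T : ℝ → TangentBundle 𝓔 N → TangentBundle 𝓔 N :=
    fun t => tangentMap 𝓔 𝓔 (ψ t)
  have hTN : Continuous TN := continuous_transverseNorm g hY hY0
  have hT : ∀ t, Continuous (T t) := fun t =>
    (continuous_tangentMap_flow hψ).comp (continuous_const.prodMk continuous_id)
  have hadd : ∀ s t V, T (s + t) V = T s (T t V) := tangentMap_flow_add hψ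
  have hmk : Continuous (fun v : E3 => (⟨p, v⟩ : TangentBundle 𝓔 N)) :=
    FiberBundle.continuous_totalSpaceMk E3 (TangentSpace 𝓔 : N → Type _) p
  -- normalized vectors contracted up to time `n`: a decreasing sequence of compact sets
  let A : ℕ → Set E3 := fun n => {v | TN ⟨p, v⟩ = 1 ∧ fieldCoeff g Y p v = 0 ∧
    ∀ s t : ℝ, s ≤ t → t ≤ n → TN (T t ⟨p, v⟩) ≤ C * μ ^ (t - s) * TN (T s ⟨p, v⟩)}
  have hcont : ∀ t, Continuous (fun v : E3 => TN (T t ⟨p, v⟩)) := fun t =>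
    hTN.comp ((hT t).comp hmk)
  have hclosed : ∀ n, IsClosed (A n) := by
    intro n
    refine IsClosed.inter (isClosed_eq (hTN.comp hmk) continuous_const) (IsClosed.inter
      (isClosed_eq ((continuous_fieldCoeff g hY hY0).comp hmk) continuous_const) ?_)
    have : {v : E3 | ∀ s t : ℝ, s ≤ t → t ≤ n → TN (T t ⟨p, v⟩) ≤ C * μ ^ (t - s) * TN (T s ⟨p, v⟩)} =
        ⋂ (s : ℝ) (t : ℝ) (_ : s ≤ t) (_ : t ≤ n),
          {v : E3 | TN (T t ⟨p, v⟩) ≤ C * μ ^ (t - s) * TN (T s ⟨p, v⟩)} := by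
      ext v; simp
    have hc : IsClosed {v : E3 | ∀ s t : ℝ, s ≤ t → t ≤ n →
        TN (T t ⟨p, v⟩) ≤ C * μ ^ (t - s) * TN (T s ⟨p, v⟩)} := by
      rw [this]
      exact isClosed_iInter fun s => isClosed_iInter fun t => isClosed_iInter fun _ =>
        isClosed_iInter fun _ => isClosed_le (hcont t) (continuous_const.mul (hcont s))
    exact hc
  have hbdd : Bornology.IsBounded (A 0) := by
    refine (isBounded_setOf_metricNorm_le g p 1).subset fun v hv => ?_
    have h1 := metricNorm_le_add g Y p v
    have h2 : transverseNorm g Y p v = 1 := hv.1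
    have h3 : fieldCoeff g Y p v = 0 := hv.2.1
    rw [h2, h3] at h1
    simpa using h1
  have hne : ∀ n, (A n).Nonempty := by
    intro n
    -- the past of `ψ n p` contains the orbit of `p` up to time `n`
    obtain ⟨w, hw0, hw⟩ := hS (ψ n p)
    have hw' : ∀ s t : ℝ, s ≤ t → t ≤ 0 →
      TN (T t ⟨ψ n p, w⟩) ≤ C * μ ^ (t - s) * TN (T s ⟨ψ n p, w⟩) := hw
    have hV : (T (-n) ⟨ψ n p, w⟩).1 = p := by
      simp [T, tangentMap, ← ψ.map_add]
    have hTV : ∀ t : ℝ, T t (T (-n) ⟨ψ n p, w⟩) = T (t - n) ⟨ψ n p, w⟩ := fun t => by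
      rw [← hadd, sub_eq_add_neg]
    have hV0 : TN (T (-n) ⟨ψ n p, w⟩) ≠ 0 := by
      intro h0
      have h1 := hw' (-n) 0 (by simp) le_rfl
      rw [h0, mul_zero] at h1
      have h2 : T 0 ⟨ψ n p, w⟩ = ⟨ψ n p, w⟩ := tangentMap_flow_zero _
      rw [h2] at h1
      exact hw0 (le_antisymm h1 (transverseNorm_nonneg _ _ _ _))
    generalize T (-n) ⟨ψ n p, w⟩ = V at hV hTV hV0
    obtain ⟨p', v⟩ := V
    simp only at hV
    subst hV
    have hr : ∀ t, TN (T t ⟨p', (TN ⟨p', v⟩)⁻¹ • (v + (-fieldCoeff g Y p' v) • Y p')⟩) =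
        |(TN ⟨p', v⟩)⁻¹| * TN (T t ⟨p', v⟩) := fun t =>
      transverseNorm_flow_smul_add g hY0 hYψ t p' _ _ v
    refine ⟨(TN ⟨p', v⟩)⁻¹ • (v + (-fieldCoeff g Y p' v) • Y p'), ?_, ?_, ?_⟩
    · have h1 := hr 0
      have h2 : ∀ V, T 0 V = V := tangentMap_flow_zero
      rw [h2, h2] at h1
      refine h1.trans ?_
      have h3 : 0 < TN ⟨p', v⟩ := lt_of_le_of_ne (transverseNorm_nonneg _ _ _ _) hV0.symm
      rw [abs_of_pos (inv_pos.2 h3), inv_mul_cancel₀ hV0]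
    · rw [fieldCoeff_smul, fieldCoeff_add, fieldCoeff_smul, fieldCoeff_self _ _ (hY0 _)]
      ring
    · intro s t hst htn
      rw [hr, hr, hTV, hTV, mul_left_comm]
      refine mul_le_mul_of_nonneg_left ?_ (abs_nonneg _)
      have := hw' (s - n) (t - n) (by linarith) (by linarith)
      rwa [sub_sub_sub_cancel_right] at this
  have hanti : ∀ n, A (n + 1) ⊆ A n := fun n v hv => ⟨hv.1, hv.2.1, fun s t hst htn =>
    hv.2.2 s t hst (htn.trans (by push_cast; linarith))⟩
  obtain ⟨v, hv⟩ := IsCompact.nonempty_iInter_of_sequence_nonempty_isCompact_isClosed A hanti hne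
    (Metric.isCompact_of_isClosed_isBounded (hclosed 0) hbdd) hclosed
  rw [mem_iInter] at hv
  refine ⟨v, (hv 0).1, fun s t hst => ?_⟩
  obtain ⟨n, hn⟩ := exists_nat_ge t
  exact (hv n).2.2 s t hst hn

include hψ hY hY0 hYψ in
/-- A vector contracted modulo `Y` becomes contracted after adding a suitable multiple of `Y`. -/
theorem exists_stable_vector {C μ : ℝ} (hμ : 0 < μ) (hμ1 : μ < 1)
    (hS : ∀ p, ∃ w : TangentSpace 𝓔 p, transverseNorm g Y p w ≠ 0 ∧ ∀ s t : ℝ, s ≤ t → t ≤ 0 →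
      transverseNorm g Y (ψ t p) (mfderiv 𝓔 𝓔 (ψ t) p w) ≤
      C * μ ^ (t - s) * transverseNorm g Y (ψ s p) (mfderiv 𝓔 𝓔 (ψ s) p w)) :
    ∃ C' : ℝ, 0 < C' ∧ ∀ p, ∃ v : TangentSpace 𝓔 p, transverseNorm g Y p v = 1 ∧
      (∀ t : ℝ, 0 ≤ t → metricNorm g (ψ t p) (mfderiv 𝓔 𝓔 (ψ t) p v) ≤ C' * μ ^ t) ∧
      ∀ s t : ℝ, s ≤ t →
      transverseNorm g Y (ψ t p) (mfderiv 𝓔 𝓔 (ψ t) p v) ≤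
      C * μ ^ (t - s) * transverseNorm g Y (ψ s p) (mfderiv 𝓔 𝓔 (ψ s) p v) := by
  obtain ⟨K, hK, hKb⟩ := exists_bound_fieldCoeff_flow g hψ hY hY0 hYψ
  obtain ⟨M, hM⟩ : ∃ M : ℝ, ∀ x, metricNorm g x (Y x) ≤ M := by
    obtain ⟨M, hM⟩ := isCompact_univ.bddAbove_image
      ((continuous_metricNorm g).comp hY).continuousOn
    exact ⟨M, fun x => hM ⟨x, trivial, rfl⟩⟩
  refine ⟨|C| + (K * |C| / μ + K * |C| / (1 - μ) / μ) * |M| + 1, by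
    have : 0 < 1 - μ := by linarith
    positivity, fun p => ?_⟩
  obtain ⟨v, hv1, hv⟩ := exists_transverse_limit g hψ hY hY0 hYψ hS p
  let T : ℝ → TangentBundle 𝓔 N → TangentBundle 𝓔 N :=
    fun t => tangentMap 𝓔 𝓔 (ψ t)
  have hadd : ∀ s t V, T (s + t) V = T s (T t V) := tangentMap_flow_add hψ
  let η : ℝ → ℝ := fun t => fieldCoeff g Y (T t ⟨p, v⟩).1 (T t ⟨p, v⟩).2
  have hq : ∀ t : ℝ, 0 ≤ t → transverseNorm g Y (T t ⟨p, v⟩).1 (T t ⟨p, v⟩).2 ≤ |C| * μ ^ t := by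
    intro t ht
    have h0 := hv 0 t ht
    have h2 : T 0 ⟨p, v⟩ = ⟨p, v⟩ := tangentMap_flow_zero _
    have h3 : transverseNorm g Y (T 0 ⟨p, v⟩).1 (T 0 ⟨p, v⟩).2 = 1 := by rw [h2]; exact hv1
    have h4 : transverseNorm g Y (T t ⟨p, v⟩).1 (T t ⟨p, v⟩).2 ≤
      C * μ ^ (t - 0) * transverseNorm g Y (T 0 ⟨p, v⟩).1 (T 0 ⟨p, v⟩).2 := h0
    rw [h3, mul_one, sub_zero] at h4
    refine h4.trans ?_
    gcongr
    exact le_abs_self C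
  have hstep : ∀ t s : ℝ, 0 ≤ t → s ∈ Icc (0 : ℝ) 1 → |η (s + t) - η t| ≤ K * |C| * μ ^ t := by
    intro t s ht hs
    have h1 := hKb s hs (T t ⟨p, v⟩).1 (T t ⟨p, v⟩).2
    have h2 : η (s + t) = fieldCoeff g Y (T s (T t ⟨p, v⟩)).1 (T s (T t ⟨p, v⟩)).2 := by
      simp only [η]; rw [hadd]
    rw [h2]
    refine (h1 : |fieldCoeff g Y (T s (T t ⟨p, v⟩)).1 (T s (T t ⟨p, v⟩)).2 - η t| ≤ _).trans ?_
    rw [mul_assoc]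
    exact mul_le_mul_of_nonneg_left (hq t ht) hK.le
  have hgeo : ∀ n : ℕ, dist (η n) (η (n + 1 : ℕ)) ≤ K * |C| * μ ^ n := by
    intro n
    rw [dist_comm, Real.dist_eq]
    have := hstep n 1 (Nat.cast_nonneg n) ⟨zero_le_one, le_rfl⟩
    rw [Real.rpow_natCast] at this
    convert this using 4
    push_cast; ring
  obtain ⟨τ, hτ⟩ := cauchySeq_tendsto_of_complete
    (cauchySeq_of_le_geometric (f := fun n : ℕ => η n) μ _ hμ1 hgeo)
  have hτd : ∀ t : ℝ, 0 ≤ t → |η t - τ| ≤ (K * |C| / μ + K * |C| / (1 - μ) / μ) * μ ^ t := by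
    intro t ht
    have h1 := dist_le_of_le_geometric_of_tendsto (f := fun n : ℕ => η n) μ _ hμ1 hgeo hτ ⌊t⌋₊
    have hfl : (⌊t⌋₊ : ℝ) ≤ t := Nat.floor_le ht
    have hfl' : t < ⌊t⌋₊ + 1 := Nat.lt_floor_add_one t
    have h2 := hstep ⌊t⌋₊ (t - ⌊t⌋₊) (Nat.cast_nonneg _) ⟨by linarith, by linarith⟩
    rw [sub_add_cancel, Real.rpow_natCast] at h2
    rw [Real.dist_eq] at h1
    have h3 : μ ^ ⌊t⌋₊ ≤ μ ^ t / μ := by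
      rw [le_div_iff₀ hμ, ← pow_succ, ← Real.rpow_natCast]
      exact Real.rpow_le_rpow_of_exponent_ge hμ hμ1.le (by push_cast; linarith)
    have h1μ : 0 < 1 - μ := by linarith
    calc |η t - τ| ≤ |η t - η ⌊t⌋₊| + |η ⌊t⌋₊ - τ| := abs_sub_le _ _ _
      _ ≤ K * |C| * μ ^ ⌊t⌋₊ + K * |C| * μ ^ ⌊t⌋₊ / (1 - μ) := add_le_add h2 h1
      _ ≤ K * |C| * (μ ^ t / μ) + K * |C| * (μ ^ t / μ) / (1 - μ) := by gcongr
      _ = _ := by field_simp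
  have hflow : ∀ t, mfderiv 𝓔 𝓔 (ψ t) p (v + (-τ) • Y p) =
      mfderiv 𝓔 𝓔 (ψ t) p v + (-τ) • Y (ψ t p) := fun t => by
    rw [map_add, map_smul, hYψ]
  refine ⟨v + (-τ) • Y p, ?_, ?_, ?_⟩
  · rw [transverseNorm_add_field _ _ (hY0 _), hv1]
  · intro t ht
    refine (metricNorm_le_add g Y _ _).trans ?_
    rw [hflow, transverseNorm_add_field _ _ (hY0 _), fieldCoeff_add, fieldCoeff_smul,
      fieldCoeff_self _ _ (hY0 _), mul_one, ← sub_eq_add_neg]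
    have h1 := hq t ht
    have h2 := hτd t ht
    have h3 : metricNorm g (ψ t p) (Y (ψ t p)) ≤ |M| := (hM _).trans (le_abs_self M)
    have h4 : 0 < μ ^ t := Real.rpow_pos_of_pos hμ t
    have h1μ : 0 < 1 - μ := by linarith
    calc _ ≤ |C| * μ ^ t + ((K * |C| / μ + K * |C| / (1 - μ) / μ) * μ ^ t) * |M| :=
          add_le_add h1 (mul_le_mul h2 h3 (metricNorm_nonneg _ _ _) (by positivity))
      _ ≤ _ := by nlinarith
  · intro s t hst
    rw [hflow, hflow, transverseNorm_add_field _ _ (hY0 _), transverseNorm_add_field _ _ (hY0 _)]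
    exact hv s t hst
end stable
end

/-! ### Line fields with closed total space -/

section
variable {N : Type*} [TopologicalSpace N] [ChartedSpace E3 N] [IsManifold 𝓔 ∞ N]

/-- A family of lines whose total space is closed in the tangent bundle is a continuous line
field. -/
theorem isLineField_of_isClosed (v : ∀ x : N, TangentSpace 𝓔 x) (hv : ∀ x, v x ≠ 0)
    (hE : IsClosed {V : TangentBundle 𝓔 N | V.2 ∈ Submodule.span ℝ {v V.1}}) :
    IsLineField (fun x => Submodule.span ℝ {v x}) := by
  intro x₀
  let e := trivializationAt E3 (TangentSpace 𝓔 : N → Type _) x₀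
  have hx₀ : x₀ ∈ e.baseSet := FiberBundle.mem_baseSet_trivializationAt' x₀
  let w : N → E3 := fun y => (e ⟨y, v y⟩).2
  have hw : ∀ y ∈ e.baseSet, e.symm y (w y) = v y := fun y hy => e.symm_apply_apply_mk hy (v y)
  have hsmul : ∀ y ∈ e.baseSet, ∀ (c : ℝ) (u : E3), e.symm y (c • u) = c • e.symm y u :=
    fun y hy c u => by
      rw [← e.symmL_apply (R := ℝ) hy, map_smul, e.symmL_apply (R := ℝ) hy]
  have hinj : ∀ y ∈ e.baseSet, ∀ u u' : E3, e.symm y u = e.symm y u' → u = u' := by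
    intro y hy u u' h
    have h1 := e.apply_mk_symm hy u
    have h2 := e.apply_mk_symm hy u'
    rw [h, h2] at h1
    exact (congrArg Prod.snd h1).symm
  have hw0 : ∀ y ∈ e.baseSet, w y ≠ 0 := by
    intro y hy h
    have h1 := hw y hy
    rw [h, ← e.symmL_apply (R := ℝ) hy, map_zero] at h1
    exact hv y h1.symm
  -- the lines in the trivialization, as a closed relation
  let P : N → E3 → Prop := fun y u => e.symm y u ∈ Submodule.span ℝ {v y}
  have hP : ∀ y ∈ e.baseSet, ∀ u, P y u ↔ ∃ c : ℝ, u = c • w y := by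
    intro y hy u
    simp only [P, Submodule.mem_span_singleton]
    refine exists_congr fun c => ⟨fun h => hinj y hy _ _ ?_, fun h => ?_⟩
    · rw [hsmul y hy, hw y hy, h]
    · rw [h, hsmul y hy, hw y hy]
  have hPc : ∀ y ∈ e.baseSet, ∀ u, ¬ P y u → ∀ᶠ z : N × E3 in 𝓝 (y, u), ¬ P z.1 z.2 := by
    intro y hy u hu
    have h1 : ContinuousOn (fun z : N × E3 => (⟨z.1, e.symm z.1 z.2⟩ : TangentBundle 𝓔 N))
        (e.baseSet ×ˢ univ) := e.continuousOn_symm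
    have h2 : ContinuousAt (fun z : N × E3 => (⟨z.1, e.symm z.1 z.2⟩ : TangentBundle 𝓔 N))
        (y, u) := h1.continuousAt ((e.open_baseSet.prod isOpen_univ).mem_nhds ⟨hy, trivial⟩)
    exact h2.eventually (hE.isOpen_compl.mem_nhds hu)
  let ℓ : E3 → ℝ := fun u => inner ℝ (w x₀) u
  have hℓ : Continuous ℓ := by fun_prop
  have hℓs : ∀ (c : ℝ) (u : E3), ℓ (c • u) = c * ℓ u := fun c u => by simp [ℓ, inner_smul_right]
  have hn₀ : 0 < ‖w x₀‖ := norm_pos_iff.2 (hw0 x₀ hx₀)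
  have hU : ∀ᶠ y in 𝓝 x₀, ∀ u ∈ Metric.sphere (0 : E3) 1, P y u → ‖w x₀‖ / 2 < |ℓ u| := by
    refine (isCompact_sphere (0 : E3) 1).eventually_forall_of_forall_eventually
      (P := fun y u => P y u → ‖w x₀‖ / 2 < |ℓ u|) fun u hu => ?_
    by_cases h : P x₀ u
    · obtain ⟨c, rfl⟩ := (hP x₀ hx₀ u).1 h
      have h1 : ‖w x₀‖ / 2 < |ℓ (c • w x₀)| := by
        rw [hℓs, abs_mul]
        have h2 : |c| * ‖w x₀‖ = 1 := by simpa [norm_smul] using hu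
        have h3 : ℓ (w x₀) = ‖w x₀‖ * ‖w x₀‖ := real_inner_self_eq_norm_mul_norm _
        rw [h3, abs_mul_self, ← mul_assoc, h2]
        linarith
      have h2 : ∀ᶠ z : N × E3 in 𝓝 (x₀, c • w x₀), ‖w x₀‖ / 2 < |ℓ z.2| :=
        (hℓ.comp continuous_snd).abs.continuousAt.eventually (lt_mem_nhds h1)
      exact h2.mono fun z hz _ => hz
    · exact (hPc x₀ hx₀ u h).mono fun z hz hz' => absurd hz' hz
  have hU2 := hU.and (e.open_baseSet.mem_nhds hx₀)
  obtain ⟨U, hUs, hUo, hxU⟩ := eventually_nhds_iff.1 hU2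
  have hℓw : ∀ y ∈ U, ‖w x₀‖ / 2 * ‖w y‖ < |ℓ (w y)| := by
    intro y hy
    have h0 : 0 < ‖w y‖ := norm_pos_iff.2 (hw0 y (hUs y hy).2)
    have h1 := (hUs y hy).1 (‖w y‖⁻¹ • w y) (by simp [norm_smul, h0.ne'])
      ((hP y (hUs y hy).2 _).2 ⟨_, rfl⟩)
    rw [hℓs, abs_mul, abs_of_pos (inv_pos.2 h0), lt_inv_mul_iff₀ h0] at h1
    linarith
  have hℓw0 : ∀ y ∈ U, ℓ (w y) ≠ 0 := by
    intro y hy h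
    have := hℓw y hy
    rw [h, abs_zero] at this
    have h2 : 0 ≤ ‖w x₀‖ / 2 * ‖w y‖ := by positivity
    linarith
  let u : N → E3 := fun y => (ℓ (w y))⁻¹ • w y
  have hu : ∀ y ∈ U, ℓ (u y) = 1 := fun y hy => by
    simp only [u]; rw [hℓs, inv_mul_cancel₀ (hℓw0 y hy)]
  have hub : ∀ y ∈ U, u y ∈ Metric.closedBall (0 : E3) (2 / ‖w x₀‖) := by
    intro y hy
    have h1 := hℓw y hy
    have h2 : 0 < |ℓ (w y)| := abs_pos.2 (hℓw0 y hy)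
    simp only [u, Metric.mem_closedBall, dist_zero_right, norm_smul, norm_inv, Real.norm_eq_abs]
    rw [inv_mul_le_iff₀ h2, ← mul_div_assoc, le_div_iff₀ hn₀]
    linarith
  have huniq : ∀ y ∈ U, ∀ z, P y z → ℓ z = 1 → z = u y := by
    intro y hy z hz hz1
    obtain ⟨c, rfl⟩ := (hP y (hUs y hy).2 z).1 hz
    rw [hℓs] at hz1
    simp only [u]
    congr 1
    exact eq_inv_of_mul_eq_one_left hz1
  have hcont : ContinuousOn u U := by
    intro y hy
    refine ContinuousAt.continuousWithinAt ?_
    rw [ContinuousAt, Metric.tendsto_nhds]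
    intro ε hε
    have hK : IsCompact (Metric.closedBall (0 : E3) (2 / ‖w x₀‖) ∩ (Metric.ball (u y) ε)ᶜ) :=
      (isCompact_closedBall _ _).inter_right Metric.isOpen_ball.isClosed_compl
    have h1 : ∀ᶠ y' in 𝓝 y, ∀ z ∈ Metric.closedBall (0 : E3) (2 / ‖w x₀‖) ∩ (Metric.ball (u y) ε)ᶜ,
        ¬ (P y' z ∧ ℓ z = 1) := by
      refine hK.eventually_forall_of_forall_eventually
        (P := fun y' z => ¬ (P y' z ∧ ℓ z = 1)) fun z hz => ?_
      by_cases hz1 : ℓ z = 1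
      · have h2 : ¬ P y z := fun h => hz.2 (by
          rw [huniq y hy z h hz1]; exact Metric.mem_ball_self hε)
        exact (hPc y (hUs y hy).2 z h2).mono fun a ha h => ha h.1
      · have h2 : ∀ᶠ a : N × E3 in 𝓝 (y, z), ℓ a.2 ≠ 1 :=
          (hℓ.comp continuous_snd).continuousAt.eventually
            (isOpen_ne.mem_nhds (show (ℓ ∘ Prod.snd) (y, z) ≠ 1 from hz1))
        exact h2.mono fun a ha h => ha h.2
    filter_upwards [h1, hUo.mem_nhds hy] with y' hy' hyU
    by_contra hd
    exact hy' (u y') ⟨hub y' hyU, hd⟩ ⟨(hP y' (hUs y' hyU).2 _).2 ⟨_, rfl⟩, hu y' hyU⟩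
  refine ⟨U, hUo.mem_nhds hxU, fun y => e.symm y (u y), ?_, fun y hy => ?_⟩
  · have h1 : ContinuousOn (fun z : N × E3 => (⟨z.1, e.symm z.1 z.2⟩ : TangentBundle 𝓔 N))
        (e.baseSet ×ˢ univ) := e.continuousOn_symm
    exact h1.comp (continuousOn_id.prodMk hcont) fun y hy => ⟨(hUs y hy).2, trivial⟩
  · have h1 : e.symm y (u y) = (ℓ (w y))⁻¹ • v y := by
      simp only [u]; rw [hsmul y (hUs y hy).2, hw y (hUs y hy).2]
    have h2 : (ℓ (w y))⁻¹ ≠ 0 := inv_ne_zero (hℓw0 y hy)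
    show e.symm y (u y) ≠ 0 ∧ Submodule.span ℝ {v y} = Submodule.span ℝ {e.symm y (u y)}
    rw [h1]
    exact ⟨smul_ne_zero h2 (hv y), (Submodule.span_singleton_smul_eq (IsUnit.mk0 _ h2) _).symm⟩
end

/-! ### A criterion for Anosov flows -/

section
variable {N : Type*} [TopologicalSpace N] [ChartedSpace E3 N] [IsManifold 𝓔 ∞ N]

/-- A vector field is invariant by its flow. -/
theorem IsSmoothFlowOf.mfderiv_field {X : ∀ x : N, TangentSpace 𝓔 x} {ψ : Flow ℝ N}
    (h : IsSmoothFlowOf X ψ) (t : ℝ) (x : N) :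
    mfderiv 𝓔 𝓔 (ψ t) x (X x) = X (ψ t x) := by
  have h1 := h.generates x t
  have h0 := h.generates x 0
  have h0' : HasMFDerivAt 𝓘(ℝ, ℝ) 𝓔 (fun s : ℝ => ψ s x) 0
      ((1 : ℝ →L[ℝ] ℝ).smulRight (X (ψ 0 x))) := h0
  have h1' : HasMFDerivAt 𝓘(ℝ, ℝ) 𝓔 (fun s : ℝ => ψ s x) (t + 0)
      ((1 : ℝ →L[ℝ] ℝ).smulRight (X (ψ (t + 0) x))) := by rw [add_zero]; exact h1
  have h2 : HasMFDerivAt 𝓘(ℝ, ℝ) 𝓘(ℝ, ℝ) (fun s : ℝ => t + s) 0 (ContinuousLinearMap.id ℝ ℝ) :=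
    ((hasFDerivAt_id (0 : ℝ)).const_add t).hasMFDerivAt
  have h3 := HasMFDerivAt.comp (0 : ℝ) (f := fun s : ℝ => t + s) (g := fun s : ℝ => ψ s x) h1' h2
  have h4 : HasMFDerivAt 𝓔 𝓔 (ψ t) (ψ 0 x) (mfderiv 𝓔 𝓔 (ψ t) (ψ 0 x)) :=
    (mdifferentiable_flow_apply h.smooth_flow t _).hasMFDerivAt
  have h5 := HasMFDerivAt.comp (0 : ℝ) (f := fun s : ℝ => ψ s x) (g := ψ t) h4 h0'
  have h6 : (ψ t ∘ fun s : ℝ => ψ s x) = ((fun s : ℝ => ψ s x) ∘ fun s => t + s) :=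
    funext fun s => (ψ.map_add t s x).symm
  rw [h6] at h5
  have h7 := hasMFDerivAt_unique h3 h5
  have h8 := congrArg (fun A : ℝ →L[ℝ] E3 => A (1 : ℝ)) h7
  have h9 : ∀ y, y = x → mfderiv 𝓔 𝓔 (ψ t) y (X y) = X (ψ (t + 0) x) →
      mfderiv 𝓔 𝓔 (ψ t) x (X x) = X (ψ t x) := by
    rintro y rfl h
    rw [add_zero] at h
    exact h
  refine h9 (ψ 0 x) (ψ.map_zero_apply x) ?_
  have h10 : (1 : ℝ) • X (ψ (t + 0) x) = mfderiv 𝓔 𝓔 (ψ t) (ψ 0 x) ((1 : ℝ) • X (ψ 0 x)) := h8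
  rw [one_smul, one_smul] at h10
  exact h10.symm

variable [CompactSpace N] [T2Space N] (g : SmoothMetric N) {Y : ∀ x : N, TangentSpace 𝓔 x}
  {ψ : Flow ℝ N}
  (hψ : ContMDiff (𝓘(ℝ, ℝ).prod 𝓔) 𝓔 ∞ (fun q : ℝ × N => ψ q.1 q.2))
  (hY : Continuous (fun x : N => (⟨x, Y x⟩ : TangentBundle 𝓔 N))) (hY0 : ∀ x, Y x ≠ 0)
  (hYψ : ∀ t x, mfderiv 𝓔 𝓔 (ψ t) x (Y x) = Y (ψ t x))

omit [CompactSpace N] [T2Space N] in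
include hψ in
theorem eq_zero_of_mfderiv_flow_eq_zero (t : ℝ) (p : N) (v : TangentSpace 𝓔 p) :
    mfderiv 𝓔 𝓔 (ψ t) p v = 0 → v = 0 := by
  intro h
  have h1 := tangentMap_flow_add hψ (-t) t ⟨p, v⟩
  rw [neg_add_cancel, tangentMap_flow_zero] at h1
  have h2 : tangentMap 𝓔 𝓔 (ψ t) ⟨p, v⟩ = ⟨ψ t p, 0⟩ := by
    show (⟨ψ t p, mfderiv 𝓔 𝓔 (ψ t) p v⟩ : TangentBundle 𝓔 N) = _
    rw [h]
  rw [h2] at h1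
  have h3 : tangentMap 𝓔 𝓔 (ψ (-t)) ⟨ψ t p, 0⟩ =
      (⟨ψ (-t) (ψ t p), 0⟩ : TangentBundle 𝓔 N) := by
    show (⟨ψ (-t) (ψ t p), mfderiv 𝓔 𝓔 (ψ (-t)) (ψ t p) 0⟩ : TangentBundle 𝓔 N) = _
    rw [map_zero]
  rw [h3] at h1
  have h4 : ∀ (x : N) (V : TangentBundle 𝓔 N), V = ⟨x, 0⟩ → V.2 = 0 := by rintro x _ rfl; rfl
  exact h4 _ _ h1

omit [T2Space N] in
include hψ hY hY0 hYψ in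
/-- Three vector fields `v`, `Y`, `w`, of which the first is contracted by the flow and the last is
not contracted modulo `Y`, are linearly independent, and the multiples of the first
are the vectors whose forward iterates tend to zero. -/
theorem mem_span_iff_tendsto_metricNorm {C μ C' : ℝ} (hμ : 0 < μ) (hμ1 : μ < 1) {p : N}
    {v w : TangentSpace 𝓔 p} (hv1 : transverseNorm g Y p v = 1)
    (hv : ∀ t : ℝ, 0 ≤ t → metricNorm g (ψ t p) (mfderiv 𝓔 𝓔 (ψ t) p v) ≤ C' * μ ^ t)
    (hw : ∀ t : ℝ, 0 ≤ t →
      1 ≤ C * transverseNorm g Y (ψ t p) (mfderiv 𝓔 𝓔 (ψ t) p w)) (hC : 0 < C) :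
    LinearIndependent ℝ ![v, Y p, w] ∧ ∀ V : TangentSpace 𝓔 p,
      V ∈ Submodule.span ℝ {v} ↔ Filter.Tendsto (fun t : ℝ =>
        metricNorm g (ψ t p) (mfderiv 𝓔 𝓔 (ψ t) p V)) Filter.atTop (𝓝 0) := by
  have hlim0 : Filter.Tendsto (fun t : ℝ => C' * μ ^ t) Filter.atTop (𝓝 0) := by
    have := (tendsto_rpow_atTop_of_base_lt_one μ (by linarith) hμ1).const_mul C'
    simpa using this
  have hlimv : Filter.Tendsto (fun t : ℝ =>
      metricNorm g (ψ t p) (mfderiv 𝓔 𝓔 (ψ t) p v)) Filter.atTop (𝓝 0) :=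
    squeeze_zero' (Filter.Eventually.of_forall fun t => metricNorm_nonneg _ _ _)
      ((Filter.eventually_ge_atTop 0).mono hv) hlim0
  obtain ⟨m₀, hm₀, hm₀Y⟩ : ∃ m₀ : ℝ, 0 < m₀ ∧ ∀ x, m₀ ≤ metricNorm g x (Y x) := by
    have h1 : Continuous (fun x : N => metricNorm g x (Y x)) := (continuous_metricNorm g).comp hY
    obtain ⟨x₀, -, h2⟩ := isCompact_univ.exists_isMinOn (s := (univ : Set N)) ⟨p, trivial⟩ h1.continuousOn
    exact ⟨_, metricNorm_pos g _ (hY0 x₀), fun x => h2 (mem_univ x)⟩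
  -- a combination that is contracted is a multiple of `v`
  have key : ∀ a b c : ℝ, Filter.Tendsto (fun t : ℝ => metricNorm g (ψ t p)
      (mfderiv 𝓔 𝓔 (ψ t) p (a • v + b • Y p + c • w))) Filter.atTop (𝓝 0) →
      b = 0 ∧ c = 0 := by
    intro a b c hlim
    have e1 : ∀ t : ℝ, metricNorm g (ψ t p)
        (mfderiv 𝓔 𝓔 (ψ t) p (b • Y p + c • w)) ≤ metricNorm g (ψ t p)
      (mfderiv 𝓔 𝓔 (ψ t) p (a • v + b • Y p + c • w)) +
      |-a| * metricNorm g (ψ t p) (mfderiv 𝓔 𝓔 (ψ t) p v) := by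
      intro t
      rw [← metricNorm_smul]
      refine le_trans (le_of_eq ?_) (metricNorm_add_le _ _ _ _)
      congr 1
      rw [← map_smul, ← map_add]
      congr 1
      module
    have l1 : Filter.Tendsto (fun t : ℝ => metricNorm g (ψ t p)
        (mfderiv 𝓔 𝓔 (ψ t) p (b • Y p + c • w))) Filter.atTop (𝓝 0) := by
      refine squeeze_zero (fun t => metricNorm_nonneg _ _ _) e1 ?_
      simpa using hlim.add (hlimv.const_mul |-a|)
    have hc : c = 0 := by
      have e2 : ∀ t : ℝ, 0 ≤ t → |c| ≤ C * metricNorm g (ψ t p)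
          (mfderiv 𝓔 𝓔 (ψ t) p (b • Y p + c • w)) := by
        intro t ht
        have e3 := transverseNorm_le_metricNorm g Y (hY0 (ψ t p))
          (mfderiv 𝓔 𝓔 (ψ t) p (b • Y p + c • w))
        have e4 : mfderiv 𝓔 𝓔 (ψ t) p (b • Y p + c • w) =
            c • mfderiv 𝓔 𝓔 (ψ t) p w + b • Y (ψ t p) := by
          rw [map_add, map_smul, map_smul, hYψ, add_comm]
        rw [e4] at e3 ⊢
        rw [transverseNorm_add_field g Y (hY0 _), transverseNorm_smul] at e3
        have := hw t ht
        have h5 := abs_nonneg c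
        calc |c| ≤ |c| * (C * transverseNorm g Y (ψ t p) (mfderiv 𝓔 𝓔 (ψ t) p w)) :=
              le_mul_of_one_le_right h5 this
          _ = C * (|c| * transverseNorm g Y (ψ t p) (mfderiv 𝓔 𝓔 (ψ t) p w)) := by ring
          _ ≤ _ := by gcongr
      have l2 := l1.const_mul C
      rw [mul_zero] at l2
      have := ge_of_tendsto l2 ((Filter.eventually_ge_atTop 0).mono e2)
      exact abs_eq_zero.1 (le_antisymm this (abs_nonneg c))
    refine ⟨?_, hc⟩
    subst hc
    have e2 : ∀ t : ℝ, |b| * m₀ ≤ metricNorm g (ψ t p)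
        (mfderiv 𝓔 𝓔 (ψ t) p (b • Y p + (0 : ℝ) • w)) := by
      intro t
      rw [zero_smul, add_zero, map_smul, hYψ, metricNorm_smul]
      exact mul_le_mul_of_nonneg_left (hm₀Y _) (abs_nonneg b)
    have h6 := ge_of_tendsto l1 (Filter.Eventually.of_forall e2)
    have : |b| ≤ 0 := by
      by_contra h
      push Not at h
      have := mul_pos h hm₀
      linarith
    exact abs_eq_zero.1 (le_antisymm this (abs_nonneg b))
  have hli : LinearIndependent ℝ ![v, Y p, w] := by
    rw [Fintype.linearIndependent_iff]
    intro c hc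
    simp only [Fin.sum_univ_three, Matrix.cons_val_zero, Matrix.cons_val_one, Matrix.cons_val] at hc
    have h1 := key (c 0) (c 1) (c 2) (by
      rw [hc]; simp [metricNorm])
    rw [h1.1, h1.2, zero_smul, zero_smul, add_zero, add_zero] at hc
    have h2 := transverseNorm_smul g Y p (c 0) v
    rw [hc, hv1, mul_one] at h2
    have h3 := transverseNorm_smul g Y p 0 v
    rw [zero_smul, abs_zero, zero_mul] at h3
    rw [h3] at h2
    intro i
    fin_cases i
    · exact abs_eq_zero.1 h2.symm
    · exact h1.1
    · exact h1.2
  refine ⟨hli, fun V => ⟨fun h => ?_, fun h => ?_⟩⟩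
  · obtain ⟨a, rfl⟩ := Submodule.mem_span_singleton.1 h
    have : ∀ t : ℝ, metricNorm g (ψ t p) (mfderiv 𝓔 𝓔 (ψ t) p (a • v)) =
        |a| * metricNorm g (ψ t p) (mfderiv 𝓔 𝓔 (ψ t) p v) := fun t => by
      rw [map_smul, metricNorm_smul]
    simp only [this]
    simpa using hlimv.const_mul |a|
  · have hfr : Module.finrank ℝ (TangentSpace 𝓔 p) = 3 := by
      show Module.finrank ℝ E3 = 3
      simp
    have : FiniteDimensional ℝ (TangentSpace 𝓔 p) := inferInstanceAs (FiniteDimensional ℝ E3)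
    have hsp := hli.span_eq_top_of_card_eq_finrank' (by simp [hfr])
    have hV : V ∈ Submodule.span ℝ (range ![v, Y p, w]) := by rw [hsp]; trivial
    obtain ⟨c, hc⟩ := (Submodule.mem_span_range_iff_exists_fun ℝ).1 hV
    simp only [Fin.sum_univ_three, Matrix.cons_val_zero, Matrix.cons_val_one, Matrix.cons_val] at hc
    rw [← hc] at h ⊢
    obtain ⟨h1, h2⟩ := key _ _ _ h
    rw [h1, h2, zero_smul, zero_smul, add_zero, add_zero]
    exact Submodule.smul_mem _ _ (Submodule.mem_span_singleton_self v)

include hψ hY hY0 hYψ in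
/-- The stable directions form a continuous invariant line field. They are the vectors whose iterates
tend to zero; on them the contraction is uniform, so that they form a closed set. -/
theorem isLineField_and_invariant_of_stable {C μ C' : ℝ} (hμ : 0 < μ) (hμ1 : μ < 1)
    {v w : ∀ p : N, TangentSpace 𝓔 p} (hv1 : ∀ p, transverseNorm g Y p (v p) = 1)
    (hv : ∀ p, ∀ t : ℝ, 0 ≤ t →
      metricNorm g (ψ t p) (mfderiv 𝓔 𝓔 (ψ t) p (v p)) ≤ C' * μ ^ t)
    (hw : ∀ p, ∀ t : ℝ, 0 ≤ t →
      1 ≤ C * transverseNorm g Y (ψ t p) (mfderiv 𝓔 𝓔 (ψ t) p (w p))) (hC : 0 < C) :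
    IsLineField (fun p => Submodule.span ℝ {v p}) ∧
    (∀ t p, (Submodule.span ℝ {v p}).map
      (mfderiv 𝓔 𝓔 (ψ t) p).toLinearMap = Submodule.span ℝ {v (ψ t p)}) ∧
    ∀ p, ∀ V ∈ Submodule.span ℝ {v p}, ∀ t : ℝ, 0 ≤ t →
      metricNorm g (ψ t p) (mfderiv 𝓔 𝓔 (ψ t) p V) ≤ C' * μ ^ t * metricNorm g p V := by
  have hchar := fun p => (mem_span_iff_tendsto_metricNorm g hψ hY hY0 hYψ hμ hμ1 (hv1 p) (hv p)
    (hw p) hC).2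
  have hv0 : ∀ p, v p ≠ 0 := by
    intro p h
    have h1 := hv1 p
    have h3 := transverseNorm_smul g Y p 0 (v p)
    rw [zero_smul, abs_zero, zero_mul, ← h, h1] at h3
    exact one_ne_zero h3
  have hest : ∀ p, ∀ V ∈ Submodule.span ℝ {v p}, ∀ t : ℝ, 0 ≤ t →
      metricNorm g (ψ t p) (mfderiv 𝓔 𝓔 (ψ t) p V) ≤ C' * μ ^ t * metricNorm g p V := by
    intro p V hV t ht
    obtain ⟨a, rfl⟩ := Submodule.mem_span_singleton.1 hV
    have h1 := hv p t ht
    have h2 := transverseNorm_le_metricNorm g Y (hY0 p) (v p)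
    rw [hv1] at h2
    have h3 : 0 ≤ C' * μ ^ t := (metricNorm_nonneg _ _ _).trans h1
    rw [map_smul, metricNorm_smul, metricNorm_smul]
    calc |a| * _ ≤ |a| * (C' * μ ^ t) := by gcongr
      _ = C' * μ ^ t * (|a| * 1) := by ring
      _ ≤ _ := by gcongr
  refine ⟨isLineField_of_isClosed v hv0 ?_, fun t p => ?_, hest⟩
  · have : {V : TangentBundle 𝓔 N | V.2 ∈ Submodule.span ℝ {v V.1}} =
        ⋂ t ∈ Ici (0 : ℝ), {V : TangentBundle 𝓔 N |
          metricNorm g (tangentMap 𝓔 𝓔 (ψ t) V).1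
            (tangentMap 𝓔 𝓔 (ψ t) V).2 ≤ C' * μ ^ t * metricNorm g V.1 V.2} := by
      ext V
      simp only [mem_iInter, mem_ofPred_eq, mem_Ici]
      refine ⟨fun h t ht => hest V.1 V.2 h t ht, fun h => (hchar V.1 V.2).2 ?_⟩
      refine squeeze_zero' (Filter.Eventually.of_forall fun t => metricNorm_nonneg _ _ _)
        ((Filter.eventually_ge_atTop 0).mono h) ?_
      have := ((tendsto_rpow_atTop_of_base_lt_one μ (by linarith) hμ1).const_mul C').mul_const
        (metricNorm g V.1 V.2)
      simpa using this
    rw [this]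
    refine isClosed_biInter fun t _ => isClosed_le ?_ ?_
    · exact (continuous_metricNorm g).comp
        ((contMDiff_flow_apply hψ t).continuous_tangentMap (by simp))
    · exact continuous_const.mul (continuous_metricNorm g)
  · have h1 : mfderiv 𝓔 𝓔 (ψ t) p (v p) ∈ Submodule.span ℝ {v (ψ t p)} := by
      rw [hchar]
      have h2 := (hchar p (v p)).1 (Submodule.mem_span_singleton_self _)
      have h3 := h2.comp (Filter.tendsto_atTop_add_const_right _ t Filter.tendsto_id)
      refine h3.congr fun s => ?_
      have h4 := tangentMap_flow_add hψ s t ⟨p, v p⟩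
      exact congrArg (fun V : TangentBundle 𝓔 N => metricNorm g V.1 V.2) h4
    obtain ⟨a, ha⟩ := Submodule.mem_span_singleton.1 h1
    have ha0 : a ≠ 0 := by
      rintro rfl
      rw [zero_smul] at ha
      exact hv0 p (eq_zero_of_mfderiv_flow_eq_zero hψ t p _ ha.symm)
    rw [Submodule.map_span, image_singleton]
    show Submodule.span ℝ {mfderiv 𝓔 𝓔 (ψ t) p (v p)} = _
    rw [← ha]
    exact Submodule.span_singleton_smul_eq (IsUnit.mk0 a ha0) _

/-- Sufficient condition for a flow on a closed manifold to be Anosov: every point has a tangent vector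
which the flow contracts, modulo `Y`, along the past orbit of the point, and one with this property for
the reversed flow. -/
theorem isAnosovFlow_of_transverse (h : IsSmoothFlowOf Y ψ) (hY0 : ∀ x, Y x ≠ 0) {C μ : ℝ}
    (hμ : 0 < μ) (hμ1 : μ < 1)
    (hS : ∀ p, ∃ w : TangentSpace 𝓔 p, transverseNorm g Y p w ≠ 0 ∧ ∀ s t : ℝ, s ≤ t → t ≤ 0 →
      transverseNorm g Y (ψ t p) (mfderiv 𝓔 𝓔 (ψ t) p w) ≤
      C * μ ^ (t - s) * transverseNorm g Y (ψ s p) (mfderiv 𝓔 𝓔 (ψ s) p w))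
    (hU : ∀ p, ∃ w : TangentSpace 𝓔 p, transverseNorm g Y p w ≠ 0 ∧ ∀ s t : ℝ, s ≤ t → t ≤ 0 →
      transverseNorm g Y (ψ (-t) p) (mfderiv 𝓔 𝓔 (ψ (-t)) p w) ≤
      C * μ ^ (t - s) * transverseNorm g Y (ψ (-s) p) (mfderiv 𝓔 𝓔 (ψ (-s)) p w)) :
    IsAnosovFlow Y ψ := by
  have hψ := h.smooth_flow
  have hYψ := h.mfderiv_field
  have hY : Continuous (fun x : N => (⟨x, Y x⟩ : TangentBundle 𝓔 N)) :=
    h.smooth_field.continuous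
  have hψr : ContMDiff (𝓘(ℝ, ℝ).prod 𝓔) 𝓔 ∞
      (fun q : ℝ × N => ψ.reverse q.1 q.2) := by
    have h1 : ContMDiff (𝓘(ℝ, ℝ).prod 𝓔) (𝓘(ℝ, ℝ).prod 𝓔) ∞
        (fun q : ℝ × N => (-q.1, q.2)) :=
      (contDiff_neg.contMDiff.comp contMDiff_fst).prodMk contMDiff_snd
    exact hψ.comp h1
  have hYr : ∀ t x, mfderiv 𝓔 𝓔 (ψ.reverse t) x (Y x) = Y (ψ.reverse t x) :=
    fun t x => hYψ (-t) x
  obtain ⟨C₁, hC₁, hs⟩ := exists_stable_vector g hψ hY hY0 hYψ hμ hμ1 hS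
  obtain ⟨C₂, hC₂, hu⟩ := exists_stable_vector g hψr hY hY0 hYr hμ hμ1 hU
  choose vs hvs1 hvs hvs' using hs
  choose vu hvu1 hvu hvu' using hu
  have hT0 : ∀ (p : N) (V : TangentSpace 𝓔 p), transverseNorm g Y (ψ 0 p)
      (mfderiv 𝓔 𝓔 (ψ 0) p V) = transverseNorm g Y p V := fun p V =>
    congrArg (fun W : TangentBundle 𝓔 N => transverseNorm g Y W.1 W.2)
      (tangentMap_flow_zero (ψ := ψ) ⟨p, V⟩)
  have hpos : ∀ p : N, 0 < C := by
    intro p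
    have h1 := hvs' p 0 0 le_rfl
    rw [hT0, hvs1, sub_zero, Real.rpow_zero, mul_one, mul_one] at h1
    linarith
  -- positivity of `C` needs a point; the statement is void on the empty manifold
  by_cases hN : IsEmpty N
  · have hli : ∀ (p : N), False := fun p => hN.elim p
    exact ⟨inferInstance, inferInstance, h, g, fun _ => ⊥, fun _ => ⊥, 1, μ,
      ⟨fun p => (hli p).elim, fun p => (hli p).elim, fun p => (hli p).elim, fun p => (hli p).elim,
        fun _ p => (hli p).elim, fun _ p => (hli p).elim⟩, one_pos, hμ, hμ1,
        fun p => (hli p).elim, fun p => (hli p).elim⟩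
  rw [not_isEmpty_iff] at hN
  have hC : 0 < C := hpos hN.some
  have hpow : ∀ t : ℝ, 0 ≤ t → μ ^ t ≤ 1 := fun t ht => Real.rpow_le_one hμ.le hμ1.le ht
  have hwu : ∀ p, ∀ t : ℝ, 0 ≤ t →
      1 ≤ C * transverseNorm g Y (ψ t p) (mfderiv 𝓔 𝓔 (ψ t) p (vu p)) := by
    intro p t ht
    have h1 := hvu' p (-t) 0 (by linarith)
    have e0 : ψ.reverse 0 = ψ 0 := by show ψ (-0) = ψ 0; rw [neg_zero]
    have e1 : ψ.reverse (-t) = ψ t := by show ψ (- -t) = ψ t; rw [neg_neg]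
    rw [e0, e1, hT0, hvu1, zero_sub, neg_neg] at h1
    refine h1.trans ?_
    have := transverseNorm_nonneg g Y (ψ t p) (mfderiv 𝓔 𝓔 (ψ t) p (vu p))
    gcongr
    exact mul_le_of_le_one_right hC.le (hpow t ht)
  have hws : ∀ p, ∀ t : ℝ, 0 ≤ t → 1 ≤ C * transverseNorm g Y (ψ.reverse t p)
      (mfderiv 𝓔 𝓔 (ψ.reverse t) p (vs p)) := by
    intro p t ht
    have h1 := hvs' p (-t) 0 (by linarith)
    rw [hT0, hvs1, zero_sub, neg_neg] at h1
    refine h1.trans ?_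
    have := transverseNorm_nonneg g Y (ψ (-t) p) (mfderiv 𝓔 𝓔 (ψ (-t)) p (vs p))
    show C * μ ^ t * _ ≤ C * transverseNorm g Y (ψ (-t) p) (mfderiv 𝓔 𝓔 (ψ (-t)) p (vs p))
    gcongr
    exact mul_le_of_le_one_right hC.le (hpow t ht)
  obtain ⟨s1, s2, s3⟩ := isLineField_and_invariant_of_stable g hψ hY hY0 hYψ hμ hμ1 hvs1 hvs hwu hC
  obtain ⟨u1, u2, u3⟩ := isLineField_and_invariant_of_stable g hψr hY hY0 hYr hμ hμ1 hvu1 hvu hws hC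
  refine ⟨inferInstance, inferInstance, h, g, fun p => Submodule.span ℝ {vs p},
    fun p => Submodule.span ℝ {vu p}, max C₁ C₂, μ, ⟨hY0, s1, u1, fun p => ?_, s2, fun t p => ?_⟩,
    lt_max_of_lt_left hC₁, hμ, hμ1, fun p V hV t ht => ?_, fun p V hV t ht => ?_⟩
  · have hli := (mem_span_iff_tendsto_metricNorm g hψ hY hY0 hYψ hμ hμ1 (hvs1 p) (hvs p)
      (hwu p) hC).1
    have hfr : Module.finrank ℝ (TangentSpace 𝓔 p) = 3 := by
      show Module.finrank ℝ E3 = 3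
      simp
    have : FiniteDimensional ℝ (TangentSpace 𝓔 p) := inferInstanceAs (FiniteDimensional ℝ E3)
    have hsp := hli.span_eq_top_of_card_eq_finrank' (by simp [hfr])
    have e : ![Submodule.span ℝ {vs p}, Submodule.span ℝ {Y p}, Submodule.span ℝ {vu p}] =
        fun i => Submodule.span ℝ {![vs p, Y p, vu p] i} := by
      funext i; fin_cases i <;> rfl
    show DirectSum.IsInternal ![Submodule.span ℝ {vs p}, Submodule.span ℝ {Y p}, Submodule.span ℝ {vu p}]
    rw [e]
    refine DirectSum.isInternal_submodule_of_iSupIndep_of_iSup_eq_top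
      hli.iSupIndep_span_singleton ?_
    rw [← Submodule.span_range_eq_iSup]
    exact hsp
  · have h1 := u2 (-t) p
    have e1 : ψ.reverse (-t) = ψ t := by show ψ (- -t) = ψ t; rw [neg_neg]
    rw [e1] at h1
    exact h1
  · refine (s3 p V hV t ht).trans ?_
    have := metricNorm_nonneg g p V
    have := Real.rpow_nonneg hμ.le t
    gcongr
    exact le_max_left _ _
  · have h1 := u3 p V hV (-t) (by linarith)
    have e1 : ψ.reverse (-t) = ψ t := by show ψ (- -t) = ψ t; rw [neg_neg]
    rw [e1] at h1
    refine h1.trans ?_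
    have := metricNorm_nonneg g p V
    have := Real.rpow_nonneg hμ.le (-t)
    gcongr
    exact le_max_right _ _
end

/-! ### Real induction and local diffeomorphisms -/

/-- Real induction for a transitive relation: it holds between the ends of an interval as soon
as it holds between each point and the points close enough to it. -/
theorem rel_of_locally_rel {R : ℝ → ℝ → Prop} {a b : ℝ} (hab : a ≤ b)
    (htrans : ∀ s t u, a ≤ s → s ≤ t → t ≤ u → u ≤ b → R s t → R t u → R s u)
    (hl : ∀ t ∈ Icc a b, ∃ ε > 0, ∀ s ∈ Icc a b, t - ε < s → s ≤ t → R s t)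
    (hr : ∀ t ∈ Icc a b, ∃ ε > 0, ∀ s ∈ Icc a b, t ≤ s → s < t + ε → R t s) : R a b := by
  let S : Set ℝ := {t | t ∈ Icc a b ∧ R a t}
  have haS : a ∈ S := by
    obtain ⟨ε, hε, h⟩ := hr a ⟨le_rfl, hab⟩
    exact ⟨⟨le_rfl, hab⟩, h a ⟨le_rfl, hab⟩ le_rfl (by linarith)⟩
  have hbdd : BddAbove S := ⟨b, fun t ht => ht.1.2⟩
  have hc : sSup S ∈ Icc a b := ⟨le_csSup hbdd haS, csSup_le ⟨a, haS⟩ fun t ht => ht.1.2⟩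
  have hcS : R a (sSup S) := by
    obtain ⟨ε, hε, h⟩ := hl _ hc
    obtain ⟨s, hs, hs'⟩ := exists_lt_of_lt_csSup ⟨a, haS⟩ (show sSup S - ε < sSup S by linarith)
    have hsc := le_csSup hbdd hs
    exact htrans a s _ le_rfl hs.1.1 hsc hc.2 hs.2 (h s hs.1 hs' hsc)
  rcases hc.2.eq_or_lt with h | h
  · rwa [h] at hcS
  exfalso
  obtain ⟨ε, hε, h'⟩ := hr _ hc
  have h1 : sSup S < min b (sSup S + ε / 2) := lt_min h (by linarith)
  have h2 : min b (sSup S + ε / 2) ∈ Icc a b := ⟨hc.1.trans h1.le, min_le_left _ _⟩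
  have h3 := h' _ h2 h1.le ((min_le_right _ _).trans_lt (by linarith))
  have h4 : min b (sSup S + ε / 2) ∈ S :=
    ⟨h2, htrans a _ _ le_rfl hc.1 h1.le h2.2 hcS h3⟩
  exact absurd (le_csSup hbdd h4) (not_le.2 h1)

section LocalDiffeo
variable {E H E' H' : Type*} [NormedAddCommGroup E] [NormedSpace ℝ E] [TopologicalSpace H]
  [NormedAddCommGroup E'] [NormedSpace ℝ E'] [TopologicalSpace H']
  {I : ModelWithCorners ℝ E H} {J : ModelWithCorners ℝ E' H'}
  {X X' : Type*} [TopologicalSpace X] [ChartedSpace H X] [TopologicalSpace X'] [ChartedSpace H' X']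
  {f f' : X → X'} {x : X}

theorem IsLocalDiffeomorphAt.eventually (hf : IsLocalDiffeomorphAt I J ∞ f x) :
    ∀ᶠ y in 𝓝 x, IsLocalDiffeomorphAt I J ∞ f y := by
  obtain ⟨Φ, hx, h⟩ := hf
  filter_upwards [Φ.open_source.mem_nhds hx] with y hy
  exact ⟨Φ, hy, h⟩

theorem IsLocalDiffeomorphAt.map_nhds (hf : IsLocalDiffeomorphAt I J ∞ f x) :
    Filter.map f (𝓝 x) = 𝓝 (f x) := by
  obtain ⟨Φ, hx, h⟩ := hf
  have h1 : f =ᶠ[𝓝 x] Φ := Filter.eventuallyEq_of_mem (Φ.open_source.mem_nhds hx) h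
  rw [Filter.map_congr h1, h hx]
  exact Φ.toOpenPartialHomeomorph.map_nhds_eq hx

theorem IsLocalDiffeomorphAt.congr (hf : IsLocalDiffeomorphAt I J ∞ f x) (h : f' =ᶠ[𝓝 x] f) :
    IsLocalDiffeomorphAt I J ∞ f' x := by
  obtain ⟨Φ, hx, hΦ⟩ := hf
  obtain ⟨U, hU, hUo, hxU⟩ := eventually_nhds_iff.1 h
  let Ψ := Φ.toOpenPartialHomeomorph.restrOpen U hUo
  refine ⟨⟨Ψ.toPartialEquiv, Ψ.open_source, Ψ.open_target,
    Φ.contMDiffOn_toFun.mono ?_, Φ.contMDiffOn_invFun.mono ?_⟩, ?_, ?_⟩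
  · exact inter_subset_left
  · exact inter_subset_left
  · exact ⟨hx, hxU⟩
  · intro y hy
    rw [hU y hy.2]
    exact hΦ hy.1

theorem IsLocalDiffeomorphAt.mfderiv_injective (hf : IsLocalDiffeomorphAt I J ∞ f x) :
    Function.Injective (mfderiv I J f x) := by
  rw [← hf.mfderivToContinuousLinearEquiv_coe (by simp)]
  exact ContinuousLinearEquiv.injective _

theorem IsLocalDiffeomorphAt.mfderiv_surjective (hf : IsLocalDiffeomorphAt I J ∞ f x) :
    Function.Surjective (mfderiv I J f x) := by
  rw [← hf.mfderivToContinuousLinearEquiv_coe (by simp)]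
  exact ContinuousLinearEquiv.surjective _

/-- A local diffeomorphism has a local inverse with the expected properties near a point. -/
theorem IsLocalDiffeomorphAt.exists_inverse (hf : IsLocalDiffeomorphAt I J ∞ f x) :
    ∃ f' : X' → X, IsLocalDiffeomorphAt J I ∞ f' (f x) ∧ f' (f x) = x ∧
      (∀ᶠ y in 𝓝 (f x), f (f' y) = y) ∧ ∀ᶠ y in 𝓝 x, f' (f y) = y :=
  ⟨hf.localInverse, hf.localInverse_isLocalDiffeomorphAt,
    hf.localInverse_left_inv hf.localInverse_mem_target, hf.localInverse_eventuallyEq_right,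
    hf.localInverse_eventuallyEq_left⟩

end LocalDiffeo

/-! ### Planar coordinates near the periodic orbit -/

variable {M : Type*} [TopologicalSpace M] {φ : Flow ℝ M} {γ : Set M} {lam : ℝ}

set_option hygiene false in
/-- The complement of `γ`. -/
local notation "M₀" => {x : M // x ∉ γ}

variable [ChartedSpace E3 M₀] [IsManifold 𝓔 ∞ M₀]
  {A : AlmostAnosovStructure φ γ lam} {n k : ℕ} {m : ℤ}

namespace NormalCoordinates
variable (C : NormalCoordinates A n k m)

/-- The union of the four punctured quadrants. -/
def dom : Set M₀ := {q | (q : M) ∈ C.W}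

open Classical in
/-- The first coordinate of a point near `γ`; it does not depend on the quadrant used. -/
def xc (q : M₀) : ℝ :=
  if h : ∃ i, q ∈ C.quad i then (C.chart h.choose q).1 else 0

open Classical in
/-- The second coordinate of a point near `γ`. -/
def yc (q : M₀) : ℝ :=
  if h : ∃ i, q ∈ C.quad i then (C.chart h.choose q).2.1 else 0

theorem isOpen_dom : IsOpen C.dom := C.isOpen_W.preimage continuous_subtype_val

theorem mem_dom_iff {q : M₀} : q ∈ C.dom ↔ ∃ i, q ∈ C.quad i := by
  rw [← mem_iUnion, C.iUnion_quad]; rfl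

theorem mem_dom_of_quad {q : M₀} {i} (h : q ∈ C.quad i) : q ∈ C.dom :=
  C.mem_dom_iff.2 ⟨i, h⟩

theorem chart_planar_eq {q : M₀} {i j} (hi : q ∈ C.quad i) (hj : q ∈ C.quad j) :
    (C.chart i q).1 = (C.chart j q).1 ∧ (C.chart i q).2.1 = (C.chart j q).2.1 := by
  obtain ⟨f, -, hf⟩ := C.smooth_chart i q hi
  have h := (hf.self_of_nhds).2.2.2
  rw [h i hi, h j hj]
  simp

theorem xc_eq {q : M₀} {i} (hi : q ∈ C.quad i) : C.xc q = (C.chart i q).1 := by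
  have h : ∃ i, q ∈ C.quad i := ⟨i, hi⟩
  rw [xc, dif_pos h]
  exact (C.chart_planar_eq h.choose_spec hi).1

theorem yc_eq {q : M₀} {i} (hi : q ∈ C.quad i) : C.yc q = (C.chart i q).2.1 := by
  have h : ∃ i, q ∈ C.quad i := ⟨i, hi⟩
  rw [yc, dif_pos h]
  exact (C.chart_planar_eq h.choose_spec hi).2

theorem mem_quadrant_xy {q : M₀} {i} (hi : q ∈ C.quad i) :
    (C.xc q, C.yc q) ∈ quadrant i := by
  rw [C.xc_eq hi, C.yc_eq hi]; exact (C.mem_quadrant i q hi).1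

theorem xy_ne_zero {q : M₀} (hq : q ∈ C.dom) : ¬ (C.xc q = 0 ∧ C.yc q = 0) := by
  obtain ⟨i, hi⟩ := C.mem_dom_iff.1 hq
  rw [C.xc_eq hi, C.yc_eq hi]
  rintro ⟨h1, h2⟩
  exact (C.mem_quadrant i q hi).2 (by rw [h1, h2]; rfl)

/-- `f` is a smooth lift to `ℝ³` of the normal coordinates near `q`, a point of the `i`-th
quadrant. -/
structure IsLift (i : Fin 4) (f : M₀ → ℝ³) (q : M₀) : Prop where
  isLocalDiffeomorphAt : IsLocalDiffeomorphAt 𝓔 𝓘(ℝ, ℝ³) ∞ f q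
  mem_dom : q ∈ C.dom
  field : mfderiv 𝓔 𝓘(ℝ, ℝ³) f q (A.X q) = affineField lam n k (f q)
  map_Es : (A.Es q).map (mfderiv 𝓔 𝓘(ℝ, ℝ³) f q).toLinearMap =
        Submodule.span ℝ {((1, 0, 0) : ℝ³)}
  map_Eu : (A.Eu q).map (mfderiv 𝓔 𝓘(ℝ, ℝ³) f q).toLinearMap =
        Submodule.span ℝ {((0, 1, 0) : ℝ³)}
  chart_eq : ∀ j, q ∈ C.quad j →
        C.chart j q = liftProj (f q) + (0, 0, holonomy ((m : ℝ) / (n : ℝ)) i j)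
  fst_eq : (f q).1 = C.xc q
  snd_eq : (f q).2.1 = C.yc q

theorem exists_isLift {q : M₀} {i} (hi : q ∈ C.quad i) :
    ∃ f, ∀ᶠ q' in 𝓝 q, C.IsLift i f q' := by
  obtain ⟨f, hf, hf'⟩ := C.smooth_chart i q hi
  refine ⟨f, ?_⟩
  filter_upwards [hf', hf.eventually, C.isOpen_dom.mem_nhds (C.mem_dom_of_quad hi)]
    with q' ⟨h1, h2, h3, h4⟩ h5 h6
  obtain ⟨j, hj⟩ := C.mem_dom_iff.1 h6
  refine ⟨h5, h6, h1, h2, h3, h4, ?_, ?_⟩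
  · rw [C.xc_eq hj, h4 j hj]; simp [liftProj]
  · rw [C.yc_eq hj, h4 j hj]; simp [liftProj]

theorem exists_isLift' {q : M₀} (hq : q ∈ C.dom) :
    ∃ i f, q ∈ C.quad i ∧ ∀ᶠ q' in 𝓝 q, C.IsLift i f q' := by
  obtain ⟨i, hi⟩ := C.mem_dom_iff.1 hq
  obtain ⟨f, hf⟩ := C.exists_isLift hi
  exact ⟨i, f, hi, hf⟩

theorem contMDiffAt_xc {q : M₀} (hq : q ∈ C.dom) :
    ContMDiffAt 𝓔 𝓘(ℝ, ℝ) ∞ C.xc q := by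
  obtain ⟨i, f, hi, hf⟩ := C.exists_isLift' hq
  have h1 : ContMDiffAt 𝓔 𝓘(ℝ, ℝ) ∞ (Prod.fst ∘ f) q :=
    ContMDiffAt.comp q contDiff_fst.contMDiff.contMDiffAt
      hf.self_of_nhds.isLocalDiffeomorphAt.contMDiffAt
  exact h1.congr_of_eventuallyEq (hf.mono fun q' h => h.fst_eq.symm)

theorem contMDiffAt_yc {q : M₀} (hq : q ∈ C.dom) :
    ContMDiffAt 𝓔 𝓘(ℝ, ℝ) ∞ C.yc q := by
  obtain ⟨i, f, hi, hf⟩ := C.exists_isLift' hq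
  have h1 : ContMDiffAt 𝓔 𝓘(ℝ, ℝ) ∞ ((fun u : ℝ³ => u.2.1) ∘ f) q :=
    ContMDiffAt.comp q (contDiff_fst.comp contDiff_snd).contMDiff.contMDiffAt
      hf.self_of_nhds.isLocalDiffeomorphAt.contMDiffAt
  exact h1.congr_of_eventuallyEq (hf.mono fun q' h => h.snd_eq.symm)

/-- The planar coordinates of the points near `q ∈ dom` fill a neighbourhood of those of `q`. -/
theorem map_xy_nhds {q : M₀} (hq : q ∈ C.dom) :
    Filter.map (fun q' => (C.xc q', C.yc q')) (𝓝 q) = 𝓝 (C.xc q, C.yc q) := by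
  obtain ⟨i, f, hi, hf⟩ := C.exists_isLift' hq
  have h0 := hf.self_of_nhds
  have h1 : (fun q' => (C.xc q', C.yc q')) =ᶠ[𝓝 q]
      (fun u : ℝ³ => (u.1, u.2.1)) ∘ f :=
    hf.mono fun q' h => by simp [h.fst_eq, h.snd_eq]
  rw [Filter.map_congr h1, ← Filter.map_map, h0.isLocalDiffeomorphAt.map_nhds,
    ← h0.fst_eq, ← h0.snd_eq]
  have h2 : (fun u : ℝ³ => (u.1, u.2.1)) =
    Prod.map id Prod.fst := rfl
  rw [h2, nhds_prod_eq (x := (f q).1) (y := (f q).2.1),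
    show 𝓝 (f q) = 𝓝 (f q).1 ×ˢ 𝓝 (f q).2 from nhds_prod_eq, ← Filter.prod_map_map_eq', Filter.map_id]
  congr 1
  exact map_fst_nhds _

/-- A point of the neighbourhood lies in each quadrant in which its planar coordinates lie. -/
theorem mem_quad_of_mem_quadrant {q : M₀} (hq : q ∈ C.dom) {j : Fin 4}
    (hj : (C.xc q, C.yc q) ∈ quadrant j) : q ∈ C.quad j := by
  obtain ⟨F, hF, hFj⟩ := C.closed_quad j
  rw [hFj]
  refine ⟨?_, hq⟩
  rw [← hF.closure_eq, mem_closure_iff_frequently]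
  let D : ℝ × ℝ := ![(1, 1), (-1, 1), (-1, -1), (1, -1)] j
  have hlim : Filter.Tendsto (fun t : ℝ => (C.xc q, C.yc q) + t • D) (𝓝[>] 0)
      (𝓝 (C.xc q, C.yc q)) := by
    have : Continuous (fun t : ℝ => (C.xc q, C.yc q) + t • D) := by fun_prop
    have h1 := this.tendsto 0
    simp only [zero_smul, add_zero] at h1
    exact h1.mono_left nhdsWithin_le_nhds
  have hfr : ∃ᶠ w in 𝓝 (C.xc q, C.yc q), ∀ i, w ∈ quadrant i → i = j := by
    refine hlim.frequently (Filter.Eventually.frequently ?_)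
    filter_upwards [self_mem_nhdsWithin] with t ht i hi
    have ht' : (0 : ℝ) < t := ht
    revert hj hi
    fin_cases j <;> fin_cases i <;>
      simp [quadrant, D] <;> intros <;> linarith
  rw [← C.map_xy_nhds hq, Filter.frequently_map] at hfr
  refine (hfr.and_eventually (C.isOpen_dom.mem_nhds hq)).mono ?_
  rintro q' ⟨h1, h2⟩
  obtain ⟨i, hi⟩ := C.mem_dom_iff.1 h2
  have := h1 i (C.mem_quadrant_xy hi)
  subst this
  rw [hFj] at hi
  exact hi.1

end NormalCoordinates

/-! ### The covering of the affine model, and boxes around the periodic orbit -/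

theorem holonomy_self (s : ℝ) (i : Fin 4) : holonomy s i i = 0 := by
  fin_cases i <;> simp [holonomy]

theorem continuous_liftProj : Continuous liftProj := by
  unfold liftProj
  exact continuous_fst.prodMk ((continuous_fst.comp continuous_snd).prodMk
    (continuous_quotient_mk'.comp (continuous_snd.comp continuous_snd)))

theorem liftProj_add_int (u : ℝ³) (j : ℤ) : liftProj (u + (0, 0, (j : ℝ))) = liftProj u := by
  simp [liftProj]

theorem exists_int_of_liftProj_eq {u u' : ℝ³} (h : liftProj u = liftProj u') :
    ∃ j : ℤ, u = u' + (0, 0, (j : ℝ)) := by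
  simp only [liftProj, Prod.mk.injEq] at h
  obtain ⟨h1, h2, h3⟩ := h
  have : ((u.2.2 - u'.2.2 : ℝ) : UnitAddCircle) = 0 := by
    rw [AddCircle.coe_sub, h3, sub_self]
  obtain ⟨j, hj⟩ := (AddCircle.coe_eq_zero_iff 1).1 this
  refine ⟨j, ?_⟩
  ext
  · simp [h1]
  · simp [h2]
  · simp at hj ⊢; linarith

theorem exists_liftProj_eq (c : AffineModel) : ∃ u : ℝ³, liftProj u = c ∧ u.2.2 ∈ Icc (0:ℝ) 1 := by
  obtain ⟨x, y, z⟩ := c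
  have hz : z ∈ (fun t : ℝ => (t : UnitAddCircle)) '' Ico 0 (0 + 1) := by
    rw [AddCircle.coe_image_Ico_eq]; trivial
  obtain ⟨t, ht, rfl⟩ := hz
  exact ⟨(x, y, t), rfl, ⟨ht.1, by simpa using ht.2.le⟩⟩

theorem exists_mem_quadrant (w : ℝ × ℝ) : ∃ i, w ∈ quadrant i := by
  rcases le_total 0 w.1 with h1 | h1 <;> rcases le_total 0 w.2 with h2 | h2
  · exact ⟨0, h1, h2⟩
  · exact ⟨3, h1, h2⟩
  · exact ⟨1, h1, h2⟩
  · exact ⟨2, h1, h2⟩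

theorem isClosed_quadrant (i : Fin 4) : IsClosed (quadrant i) := by
  have h1 : IsClosed {w : ℝ × ℝ | 0 ≤ w.1} := isClosed_le continuous_const continuous_fst
  have h2 : IsClosed {w : ℝ × ℝ | 0 ≤ w.2} := isClosed_le continuous_const continuous_snd
  have h3 : IsClosed {w : ℝ × ℝ | w.1 ≤ 0} := isClosed_le continuous_fst continuous_const
  have h4 : IsClosed {w : ℝ × ℝ | w.2 ≤ 0} := isClosed_le continuous_snd continuous_const
  fin_cases i
  · exact h1.inter h2
  · exact h3.inter h2
  · exact h3.inter h4
  · exact h1.inter h4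

namespace NormalCoordinates
variable (C : NormalCoordinates A n k m)

/-- The size of the neighbourhood of `γ` covered by the normal coordinates. -/
def rad : ℝ := C.image_chart.choose

theorem rad_pos : 0 < C.rad := C.image_chart.choose_spec.1

/-- The normal coordinates take all values near the origin. -/
theorem exists_chart_eq (i : Fin 4) (c : AffineModel) (h : (c.1, c.2.1) ∈ quadrant i)
    (h0 : ¬ (c.1 = 0 ∧ c.2.1 = 0)) (h1 : |c.1| < C.rad) (h2 : |c.2.1| < C.rad) :
    ∃ q ∈ C.quad i, C.chart i q = c :=
  C.image_chart.choose_spec.2 i c ⟨h, fun h => h0 (by simpa using h)⟩ h1 h2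

theorem IsLift.liftProj_eq {C : NormalCoordinates A n k m} {i : Fin 4}
    {f : M₀ → ℝ³} {q : M₀} (h : C.IsLift i f q)
    (hi : q ∈ C.quad i) : liftProj (f q) = C.chart i q := by
  rw [h.chart_eq i hi, holonomy_self]
  show liftProj (f q) = liftProj (f q) + 0
  rw [add_zero]

include C in
theorem nonempty_compl : Nonempty M₀ := by
  have h := C.rad_pos
  have h2 : |C.rad / 2| < C.rad := by rw [abs_of_pos (by linarith)]; linarith
  obtain ⟨q, -, -⟩ := C.exists_chart_eq 0 (C.rad / 2, C.rad / 2, 0)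
    ⟨by show 0 ≤ C.rad / 2; linarith, by show 0 ≤ C.rad / 2; linarith⟩
    (by rintro ⟨h1, -⟩; simp at h1; linarith) h2 h2
  exact ⟨q⟩

/-- The point of the `i`-th quadrant with given lifted coordinates. -/
def pt (i : Fin 4) (u : ℝ³) : M₀ :=
  @Function.invFunOn _ _ C.nonempty_compl (C.chart i) (C.quad i) (liftProj u)

/-- The lifted coordinates of the points of the `i`-th quadrant that are close to `γ`. -/
def ptDom (i : Fin 4) : Set ℝ³ :=
  {u | (u.1, u.2.1) ∈ quadrant i ∧ ¬ (u.1 = 0 ∧ u.2.1 = 0) ∧ |u.1| < C.rad ∧ |u.2.1| < C.rad}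

theorem pt_spec {i : Fin 4} {u : ℝ³} (hu : u ∈ C.ptDom i) :
    C.pt i u ∈ C.quad i ∧ C.chart i (C.pt i u) = liftProj u := by
  have h := C.exists_chart_eq i (liftProj u) hu.1 hu.2.1 hu.2.2.1 hu.2.2.2
  have := C.nonempty_compl
  exact ⟨Function.invFunOn_mem h, Function.invFunOn_eq h⟩

theorem continuousOn_pt (i : Fin 4) : ContinuousOn (C.pt i) (C.ptDom i) := by
  intro u hu
  obtain ⟨h1, h2⟩ := C.pt_spec hu
  obtain ⟨f, hf⟩ := C.exists_isLift h1
  have h0 := hf.self_of_nhds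
  obtain ⟨f', hf', hf'q, hr, -⟩ := h0.isLocalDiffeomorphAt.exists_inverse
  obtain ⟨j, hj⟩ := exists_int_of_liftProj_eq (h2.symm.trans (h0.liftProj_eq h1).symm)
  have hc : ContinuousAt f' (f (C.pt i u)) := hf'.contMDiffAt.continuousAt
  have hsub : Filter.Tendsto (fun v : ℝ³ => v - (0, 0, (j : ℝ))) (𝓝 u) (𝓝 (f (C.pt i u))) := by
    have : Continuous (fun v : ℝ³ => v - (0, 0, (j : ℝ))) := by fun_prop
    have h3 := this.tendsto u
    rwa [sub_eq_of_eq_add hj] at h3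
  have h4 := hc.tendsto.comp hsub
  have hf2 : ∀ᶠ v in 𝓝 (f (C.pt i u)), C.IsLift i f (f' v) := by
    have h5 := hc.tendsto
    rw [hf'q] at h5
    exact h5.eventually hf
  have h6 : (f' ∘ fun v : ℝ³ => v - (0, 0, (j : ℝ))) =ᶠ[𝓝[C.ptDom i] u] C.pt i := by
    filter_upwards [nhdsWithin_le_nhds (hsub.eventually (hr.and hf2)), self_mem_nhdsWithin]
      with v ⟨hv1, hv2⟩ hv
    obtain ⟨h7, h8⟩ := C.pt_spec hv
    have h9 : f' (v - (0, 0, (j : ℝ))) ∈ C.quad i := by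
      refine C.mem_quad_of_mem_quadrant hv2.mem_dom ?_
      rw [← hv2.fst_eq, ← hv2.snd_eq, hv1]
      simpa using hv.1
    refine C.injOn_chart i h9 h7 ?_
    rw [h8, ← hv2.liftProj_eq h9, hv1]
    conv_rhs => rw [← sub_add_cancel v (0, 0, (j : ℝ)), liftProj_add_int]
  have h10 : C.pt i u = f' (f (C.pt i u)) := hf'q.symm
  rw [ContinuousWithinAt, h10]
  exact (h4.mono_left nhdsWithin_le_nhds).congr' h6

/-- The points near `γ` with both coordinates of absolute value at most `s`. -/
def box (s : ℝ) : Set M₀ := {q | q ∈ C.dom ∧ |C.xc q| ≤ s ∧ |C.yc q| ≤ s}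

/-- The points of the box outside the open box of size `s'`. -/
def annulus (s' s : ℝ) : Set M₀ := {q | q ∈ C.box s ∧ (s' ≤ |C.xc q| ∨ s' ≤ |C.yc q|)}

theorem isCompact_annulus {s' s : ℝ} (hs' : 0 < s') (hs : s < C.rad) :
    IsCompact (C.annulus s' s) := by
  let S : Fin 4 → Set ℝ³ := fun i => {u | (u.1, u.2.1) ∈ quadrant i ∧
    (s' ≤ |u.1| ∨ s' ≤ |u.2.1|)} ∩ (Icc (-s) s ×ˢ Icc (-s) s ×ˢ Icc 0 1)
  have hS : ∀ i, IsCompact (S i) := by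
    intro i
    refine (isCompact_Icc.prod (isCompact_Icc.prod isCompact_Icc)).inter_left ?_
    have e1 : Continuous (fun u : ℝ³ => (u.1, u.2.1)) := by fun_prop
    refine ((isClosed_quadrant i).preimage e1).inter ?_
    have e2 : IsClosed {u : ℝ³ | s' ≤ |u.1|} := isClosed_le continuous_const (by fun_prop)
    have e3 : IsClosed {u : ℝ³ | s' ≤ |u.2.1|} := isClosed_le continuous_const (by fun_prop)
    exact e2.union e3
  have hSd : ∀ i, S i ⊆ C.ptDom i := by
    rintro i u ⟨⟨h1, h2⟩, h3, h4, -⟩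
    refine ⟨h1, ?_, (abs_le.2 h3).trans_lt hs, (abs_le.2 h4).trans_lt hs⟩
    rintro ⟨h5, h6⟩
    rw [h5, h6] at h2
    simp at h2
    linarith
  have : C.annulus s' s = ⋃ i, C.pt i '' S i := by
    ext q
    simp only [mem_iUnion, mem_image]
    constructor
    · rintro ⟨⟨hq, h1, h2⟩, h3⟩
      obtain ⟨i, hi⟩ := C.mem_dom_iff.1 hq
      obtain ⟨u, hu, hu2⟩ := exists_liftProj_eq (C.chart i q)
      have hx : u.1 = C.xc q := by rw [C.xc_eq hi, ← hu]; rfl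
      have hy : u.2.1 = C.yc q := by rw [C.yc_eq hi, ← hu]; rfl
      have hmem : u ∈ S i := by
        refine ⟨⟨?_, ?_⟩, ?_, ?_, hu2⟩
        · rw [hx, hy]; exact C.mem_quadrant_xy hi
        · rwa [hx, hy]
        · rw [hx]; exact abs_le.1 h1
        · show u.2.1 ∈ _; rw [hy]; exact abs_le.1 h2
      obtain ⟨h7, h8⟩ := C.pt_spec (hSd i hmem)
      exact ⟨i, u, hmem, C.injOn_chart i h7 hi (h8.trans hu)⟩
    · rintro ⟨i, u, hu, rfl⟩
      obtain ⟨h7, h8⟩ := C.pt_spec (hSd i hu)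
      obtain ⟨⟨h1, h2⟩, h3, h4, -⟩ := hu
      have hx : C.xc (C.pt i u) = u.1 := by rw [C.xc_eq h7, h8]; rfl
      have hy : C.yc (C.pt i u) = u.2.1 := by rw [C.yc_eq h7, h8]; rfl
      refine ⟨⟨C.mem_dom_of_quad h7, ?_, ?_⟩, ?_⟩
      · rw [hx]; exact abs_le.2 h3
      · rw [hy]; exact abs_le.2 h4
      · rwa [hx, hy]
  rw [this]
  exact isCompact_iUnion fun i => (hS i).image_of_continuousOn ((C.continuousOn_pt i).mono (hSd i))

/-- The points with small coordinates, together with `γ`, form a neighbourhood of `γ`. -/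
theorem box_union_mem_nhdsSet {s : ℝ} (hs : 0 < s) (S : Set M₀)
    (hS : ∀ q ∈ C.dom, |C.xc q| < s → |C.yc q| < s → q ∈ S) :
    (Subtype.val '' S ∪ γ : Set M) ∈ 𝓝ˢ γ := by
  rw [C.nhdsSet_iff]
  refine ⟨subset_union_right, s, hs, fun i q hq h1 h2 => Or.inl ⟨q, hS q (C.mem_dom_of_quad hq) ?_ ?_, rfl⟩⟩
  · rwa [C.xc_eq hq]
  · rwa [C.yc_eq hq]

variable [T2Space M]

/-- A relatively closed subset of the box is closed in `M` once `γ` is added. -/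
theorem isClosed_image_union (hγ : IsCompact γ) {s : ℝ} (hs : s < C.rad)
    {S : Set M₀} (hSb : S ⊆ C.box s)
    (hS : ∀ q ∈ C.dom, q ∉ S → ∀ᶠ q' in 𝓝 q, q' ∉ S) : IsClosed (Subtype.val '' S ∪ γ : Set M) := by
  have hemb : IsOpenEmbedding (Subtype.val : M₀ → M) :=
    hγ.isClosed.isOpen_compl.isOpenEmbedding_subtypeVal
  rw [← isOpen_compl_iff, isOpen_iff_mem_nhds]
  intro x hx
  simp only [mem_compl_iff, mem_union, not_or] at hx
  obtain ⟨hxS, hxγ⟩ := hx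
  have key : ∀ᶠ q' in 𝓝 (⟨x, hxγ⟩ : M₀), q' ∉ S := by
    have hx' : (⟨x, hxγ⟩ : M₀) ∉ S := fun h => hxS ⟨_, h, rfl⟩
    by_cases hd : (⟨x, hxγ⟩ : M₀) ∈ C.dom
    · exact hS _ hd hx'
    -- a point outside the domain is far from `γ`, hence only meets a compact part of the box
    obtain ⟨U, V, hU, hV, hγU, hxV, hUV⟩ := hγ.separation_of_notMem hxγ
    obtain ⟨-, δ, hδ, h⟩ := (C.nhdsSet_iff U).1 (hU.mem_nhdsSet.2 hγU)
    have hK := (C.isCompact_annulus hδ hs).isClosed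
    have hxK : (⟨x, hxγ⟩ : M₀) ∉ C.annulus δ s := fun h => hd h.1.1
    filter_upwards [hK.isOpen_compl.mem_nhds hxK, (hV.preimage continuous_subtype_val).mem_nhds hxV]
      with q' h1 h2 h3
    have h4 := hSb h3
    refine h1 ⟨h4, ?_⟩
    by_contra h5
    push Not at h5
    obtain ⟨i, hi⟩ := C.mem_dom_iff.1 h4.1
    have := h i q' hi (by rw [← C.xc_eq hi]; exact h5.1) (by rw [← C.yc_eq hi]; exact h5.2)
    exact disjoint_left.1 hUV this h2
  have h2 : Subtype.val '' {q' : M₀ | q' ∉ S} ∈ 𝓝 x := by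
    have := hemb.map_nhds_eq ⟨x, hxγ⟩
    rw [← this]
    exact Filter.image_mem_map key
  filter_upwards [h2]
  rintro _ ⟨q', hq', rfl⟩
  simp only [mem_compl_iff, mem_union, not_or]
  exact ⟨by rintro ⟨q, hq, h⟩; exact hq' (Subtype.ext h ▸ hq), q'.2⟩

end NormalCoordinates

/-! ### The cross-shaped region and its boundary -/

/-- The interior of the cross-shaped region. -/
def crossInterior (r₁ r₂ : ℝ) : Set (ℝ × ℝ) :=
  {w | |w.1| < r₁ ∧ |w.2| < r₁ ∧ |w.1 * w.2| < r₁ * r₂}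

theorem isClosed_crossRegion (r₁ r₂ : ℝ) : IsClosed (crossRegion r₁ r₂) := by
  have e1 : IsClosed {w : ℝ × ℝ | |w.1| ≤ r₁} := isClosed_le (by fun_prop) continuous_const
  have e2 : IsClosed {w : ℝ × ℝ | |w.2| ≤ r₁} := isClosed_le (by fun_prop) continuous_const
  have e3 : IsClosed {w : ℝ × ℝ | |w.1 * w.2| ≤ r₁ * r₂} := isClosed_le (by fun_prop) continuous_const
  exact e1.inter (e2.inter e3)

theorem isOpen_crossInterior (r₁ r₂ : ℝ) : IsOpen (crossInterior r₁ r₂) := by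
  have e1 : IsOpen {w : ℝ × ℝ | |w.1| < r₁} := isOpen_lt (by fun_prop) continuous_const
  have e2 : IsOpen {w : ℝ × ℝ | |w.2| < r₁} := isOpen_lt (by fun_prop) continuous_const
  have e3 : IsOpen {w : ℝ × ℝ | |w.1 * w.2| < r₁ * r₂} := isOpen_lt (by fun_prop) continuous_const
  exact e1.inter (e2.inter e3)

theorem crossInterior_subset (r₁ r₂ : ℝ) : crossInterior r₁ r₂ ⊆ crossRegion r₁ r₂ :=
  fun _ h => ⟨h.1.le, h.2.1.le, h.2.2.le⟩

theorem smul_mem_crossInterior {r₁ r₂ : ℝ} (h1 : 0 < r₁) (h2 : 0 < r₂) {w : ℝ × ℝ}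
    (hw : w ∈ crossRegion r₁ r₂) {c : ℝ} (hc : 0 < c) (hc1 : c < 1) : c • w ∈ crossInterior r₁ r₂ := by
  obtain ⟨h3, h4, h5⟩ := hw
  refine ⟨?_, ?_, ?_⟩
  · simp only [Prod.smul_fst, smul_eq_mul, abs_mul, abs_of_pos hc]; nlinarith [abs_nonneg w.1]
  · simp only [Prod.smul_snd, smul_eq_mul, abs_mul, abs_of_pos hc]; nlinarith [abs_nonneg w.2]
  · have : (c • w).1 * (c • w).2 = c * c * (w.1 * w.2) := by simp; ring
    rw [this, abs_mul, abs_of_pos (mul_pos hc hc)]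
    have h6 : 0 < r₁ * r₂ := mul_pos h1 h2
    have h7 : c * c < 1 := by nlinarith
    have h8 : 0 < c * c := mul_pos hc hc
    nlinarith [abs_nonneg (w.1 * w.2)]

namespace NormalCoordinates
variable (C : NormalCoordinates A n k m)

/-- The trace of the cross-shaped region in the complement of `γ`. -/
def cross (r₁ r₂ : ℝ) : Set M₀ :=
  {q | q ∈ C.dom ∧ (C.xc q, C.yc q) ∈ crossRegion r₁ r₂}

/-- The trace of the interior of the cross-shaped region in the complement of `γ`. -/
def crossInt (r₁ r₂ : ℝ) : Set M₀ :=
  {q | q ∈ C.dom ∧ (C.xc q, C.yc q) ∈ crossInterior r₁ r₂}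

theorem continuousAt_xy {q : M₀} (hq : q ∈ C.dom) :
    ContinuousAt (fun q' => (C.xc q', C.yc q')) q :=
  (C.contMDiffAt_xc hq).continuousAt.prodMk (C.contMDiffAt_yc hq).continuousAt

theorem eventually_mem_dom_and {q : M₀} (hq : q ∈ C.dom) {s : Set (ℝ × ℝ)}
    (hs : IsOpen s) (h : (C.xc q, C.yc q) ∈ s) :
    ∀ᶠ q' in 𝓝 q, q' ∈ C.dom ∧ (C.xc q', C.yc q') ∈ s :=
  Filter.Eventually.and (show ∀ᶠ q' in 𝓝 q, q' ∈ C.dom from C.isOpen_dom.mem_nhds hq) ((C.continuousAt_xy hq).eventually (hs.mem_nhds h))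

theorem isOpen_crossInt (r₁ r₂ : ℝ) : IsOpen (C.crossInt r₁ r₂) :=
  isOpen_iff_mem_nhds.2 fun _ hq => C.eventually_mem_dom_and hq.1 (isOpen_crossInterior r₁ r₂) hq.2

theorem singularCross_eq (r₁ r₂ : ℝ) :
    C.singularCross r₁ r₂ = closure (Subtype.val '' C.cross r₁ r₂) := by
  rw [singularCross, ← closure_iUnion_of_finite]
  congr 1
  ext x
  simp only [mem_iUnion, mem_image]
  constructor
  · rintro ⟨i, q, hq, rfl, h⟩
    refine ⟨q, ⟨C.mem_dom_of_quad hq, ?_⟩, rfl⟩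
    rw [C.xc_eq hq, C.yc_eq hq]; exact h
  · rintro ⟨q, ⟨hq, h⟩, rfl⟩
    obtain ⟨i, hi⟩ := C.mem_dom_iff.1 hq
    refine ⟨i, q, hi, rfl, ?_⟩
    rw [C.xc_eq hi, C.yc_eq hi] at h; exact h

/-- The coordinates of a point can be scaled by factors close to `1`, within any neighbourhood of it. -/
theorem frequently_scaled {q : M₀} (hq : q ∈ C.dom) {P : ℝ → Prop} {l : Filter ℝ} [l.NeBot]
    (hl : l ≤ 𝓝 1) (hP : ∀ᶠ c in l, P c) :
    ∃ᶠ q' in 𝓝 q, q' ∈ C.dom ∧ ∃ c, P c ∧ (C.xc q', C.yc q') = c • (C.xc q, C.yc q) := by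
  have hlim : Filter.Tendsto (fun t : ℝ => t • (C.xc q, C.yc q)) l (𝓝 (C.xc q, C.yc q)) := by
    have : Continuous (fun t : ℝ => t • (C.xc q, C.yc q)) := by fun_prop
    have h1 := this.tendsto 1
    rw [one_smul] at h1
    exact h1.mono_left hl
  have hfr : ∃ᶠ w in 𝓝 (C.xc q, C.yc q), ∃ c, P c ∧ w = c • (C.xc q, C.yc q) :=
    hlim.frequently (hP.mono fun c hc => ⟨c, hc, rfl⟩).frequently
  rw [← C.map_xy_nhds hq, Filter.frequently_map] at hfr
  have hd : ∀ᶠ q' in 𝓝 q, q' ∈ C.dom := C.isOpen_dom.mem_nhds hq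
  exact hd.and_frequently hfr

section orbit
omit [ChartedSpace E3 M₀] [IsManifold 𝓔 ∞ M₀]

theorem _root_.IsPeriodicOrbit.isCompact (h : IsPeriodicOrbit φ γ) : IsCompact γ := by
  obtain ⟨x, ⟨T, hT, hTx⟩, -, rfl⟩ := h
  have hp : Function.Periodic (fun t : ℝ => φ t x) T := fun t => by
    show φ (t + T) x = φ t x
    rw [φ.map_add, hTx]
  exact hp.compact_of_continuous hT.ne' (by fun_prop)

/-- A periodic orbit with an interior point is open, since the flow is transitive on it. -/
theorem _root_.IsPeriodicOrbit.isOpen_of_mem_interior (h : IsPeriodicOrbit φ γ) {p : M}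
    (hp : p ∈ interior γ) : IsOpen γ := by
  obtain ⟨x, -, -, hγ⟩ := h
  have hinv : ∀ t, ∀ y, φ t y ∈ γ → y ∈ γ := by
    intro t y hy
    rw [hγ] at hy ⊢
    obtain ⟨s, hs⟩ := hy
    refine ⟨-t + s, ?_⟩
    have hs' : φ s x = φ t y := hs
    show φ (-t + s) x = y
    rw [φ.map_add, hs', ← φ.map_add, neg_add_cancel, φ.map_zero_apply]
  rw [isOpen_iff_mem_nhds]
  intro y hy
  have hpγ := interior_subset hp
  rw [hγ] at hpγ hy
  obtain ⟨s, rfl⟩ := hpγ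
  obtain ⟨t, rfl⟩ := hy
  have hc : Continuous (φ (s - t)) := by fun_prop
  have h1 : φ (s - t) (φ t x) = φ s x := by rw [← φ.map_add, sub_add_cancel]
  have h2 : φ (s - t) ⁻¹' (interior γ) ∈ 𝓝 (φ t x) :=
    hc.continuousAt.preimage_mem_nhds (by rw [h1]; exact isOpen_interior.mem_nhds hp)
  exact Filter.mem_of_superset h2 fun z hz => hinv _ _ (interior_subset hz)
end orbit

variable [T2Space M] (hγ : IsPeriodicOrbit φ γ) {r₁ r₂ : ℝ} (h2 : 0 < r₂) (h21 : r₂ < r₁)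
  (h1 : r₁ < C.rad)
include hγ h2 h21 h1

theorem isClosed_cross_union : IsClosed (Subtype.val '' C.cross r₁ r₂ ∪ γ : Set M) := by
  refine C.isClosed_image_union hγ.isCompact h1 (fun q hq => ⟨hq.1, hq.2.1, hq.2.2.1⟩) fun q hq hqS => ?_
  have h3 : (C.xc q, C.yc q) ∈ (crossRegion r₁ r₂)ᶜ := fun h => hqS ⟨hq, h⟩
  exact (C.eventually_mem_dom_and hq (isClosed_crossRegion r₁ r₂).isOpen_compl h3).mono
    fun q' h4 h5 => h4.2 h5.2

theorem isOpen_crossInt_union : IsOpen (Subtype.val '' C.crossInt r₁ r₂ ∪ γ : Set M) := by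
  have hemb : IsOpenEmbedding (Subtype.val : M₀ → M) :=
    hγ.isCompact.isClosed.isOpen_compl.isOpenEmbedding_subtypeVal
  have h3 : (Subtype.val '' C.crossInt r₁ r₂ ∪ γ : Set M) ∈ 𝓝ˢ γ := by
    refine C.box_union_mem_nhdsSet h2 _ fun q hq hx hy => ⟨hq, hx.trans h21, hy.trans h21, ?_⟩
    show |C.xc q * C.yc q| < _
    rw [abs_mul]
    calc _ ≤ r₂ * |C.yc q| := by gcongr
      _ ≤ r₂ * r₂ := by gcongr
      _ < r₁ * r₂ := by gcongr
  rw [isOpen_iff_mem_nhds]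
  rintro x (⟨q, hq, rfl⟩ | hx)
  · exact Filter.mem_of_superset ((hemb.isOpenMap _ (C.isOpen_crossInt r₁ r₂)).mem_nhds ⟨q, hq, rfl⟩)
      subset_union_left
  · exact mem_nhdsSet_iff_forall.1 h3 x hx

theorem subset_closure_cross : γ ⊆ closure (Subtype.val '' C.cross r₁ r₂) := by
  intro p hp
  by_contra hcl
  have h3 : p ∈ interior γ := by
    refine mem_interior.2 ⟨(Subtype.val '' C.crossInt r₁ r₂ ∪ γ) ∩
      (closure (Subtype.val '' C.cross r₁ r₂))ᶜ, ?_,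
      (C.isOpen_crossInt_union hγ h2 h21 h1).inter isClosed_closure.isOpen_compl, Or.inr hp, hcl⟩
    rintro x ⟨⟨q, hq, rfl⟩ | hx, h4⟩
    · have h5 : (q : M) ∈ Subtype.val '' C.cross r₁ r₂ :=
        ⟨q, ⟨hq.1, crossInterior_subset _ _ hq.2⟩, rfl⟩
      exact absurd (subset_closure h5) h4
    · exact hx
  have h4 : γ ∈ 𝓝ˢ γ := (hγ.isOpen_of_mem_interior h3).mem_nhdsSet.2 Subset.rfl
  obtain ⟨-, δ, hδ, h⟩ := (C.nhdsSet_iff γ).1 h4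
  obtain ⟨c, hc, hcδ⟩ := exists_between (lt_min hδ C.rad_pos)
  have hca : |c| = c := abs_of_pos hc
  obtain ⟨q, hq, hqc⟩ := C.exists_chart_eq 0 (c, c, 0)
    (show 0 ≤ c ∧ 0 ≤ c from ⟨hc.le, hc.le⟩) (fun h => hc.ne' h.1)
    (by show |c| < _; rw [hca]; exact hcδ.trans_le (min_le_right _ _))
    (by show |c| < _; rw [hca]; exact hcδ.trans_le (min_le_right _ _))
  refine q.2 (h 0 q hq ?_ ?_)
  · rw [hqc]; show |c| < _; rw [hca]; exact hcδ.trans_le (min_le_left _ _)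
  · rw [hqc]; show |c| < _; rw [hca]; exact hcδ.trans_le (min_le_left _ _)

/-- The interior of `R(r₁, r₂)`: scaling the coordinates moves a boundary point out of the cross. -/
theorem interior_singularCross :
    interior (C.singularCross r₁ r₂) = Subtype.val '' C.crossInt r₁ r₂ ∪ γ := by
  rw [C.singularCross_eq]
  apply Subset.antisymm
  · intro x hx
    by_cases hxγ : x ∈ γ
    · exact Or.inr hxγ
    refine Or.inl ⟨⟨x, hxγ⟩, ?_, rfl⟩
    have hsub : ∀ q : M₀, (q : M) ∈ closure (Subtype.val '' C.cross r₁ r₂) →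
        q ∈ C.cross r₁ r₂ := by
      intro q hq
      rcases closure_minimal subset_union_left (C.isClosed_cross_union hγ h2 h21 h1) hq with
        ⟨q', hq', h⟩ | h
      · rwa [← Subtype.ext h]
      · exact absurd h q.2
    have hq : (⟨x, hxγ⟩ : M₀) ∈ C.cross r₁ r₂ := hsub _ (interior_subset hx)
    refine ⟨hq.1, ?_⟩
    by_contra hni
    have hnear : ∀ᶠ q' in 𝓝 (⟨x, hxγ⟩ : M₀), q' ∈ C.cross r₁ r₂ := by
      filter_upwards [(isOpen_interior.preimage continuous_subtype_val).mem_nhds hx] with q' hq'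
      exact hsub q' (interior_subset hq')
    have hf := C.frequently_scaled hq.1 (P := fun c => 1 < c) (l := 𝓝[>] 1) nhdsWithin_le_nhds
      self_mem_nhdsWithin
    obtain ⟨q', ⟨-, c, hc, hxy⟩, hq'⟩ := (hf.and_eventually hnear).exists
    have h3 := hq'.2
    rw [hxy] at h3
    apply hni
    have hc0 : (0 : ℝ) < c := zero_lt_one.trans hc
    have := smul_mem_crossInterior (h2.trans h21) h2 h3 (inv_pos.2 hc0) (inv_lt_one_of_one_lt₀ hc)
    rwa [smul_smul, inv_mul_cancel₀ hc0.ne', one_smul] at this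
  · refine interior_maximal ?_ (C.isOpen_crossInt_union hγ h2 h21 h1)
    rintro x (⟨q, hq, rfl⟩ | hx)
    · exact subset_closure ⟨q, ⟨hq.1, crossInterior_subset _ _ hq.2⟩, rfl⟩
    · exact C.subset_closure_cross hγ h2 h21 h1 hx

theorem outer_subset_compl : C.outer r₁ r₂ ⊆ γᶜ := by
  intro x hx hxγ
  rw [outer, C.interior_singularCross hγ h2 h21 h1] at hx
  exact hx (Or.inr hxγ)

theorem mem_outer_iff {q : M₀} : (q : M) ∈ C.outer r₁ r₂ ↔ q ∉ C.crossInt r₁ r₂ := by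
  rw [outer, C.interior_singularCross hγ h2 h21 h1, mem_compl_iff, not_iff_not]
  constructor
  · rintro (⟨q', h, hq⟩ | h)
    · rwa [← Subtype.ext hq]
    · exact absurd h q.2
  · exact fun h => Or.inl ⟨q, h, rfl⟩

theorem mem_frontier_outer_iff {q : M₀} :
    (q : M) ∈ frontier (C.outer r₁ r₂) ↔ q ∈ C.cross r₁ r₂ ∧ q ∉ C.crossInt r₁ r₂ := by
  rw [outer, frontier_compl, frontier, interior_interior, mem_sdiff,
    show (q : M) ∉ interior (C.singularCross r₁ r₂) ↔ q ∉ C.crossInt r₁ r₂ from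
      C.mem_outer_iff hγ h2 h21 h1]
  refine and_congr_left fun hq => ⟨fun h => ?_, fun h => ?_⟩
  · have h3 : (q : M) ∈ Subtype.val '' C.cross r₁ r₂ ∪ γ := by
      refine closure_minimal ?_ (C.isClosed_cross_union hγ h2 h21 h1) h
      rw [C.interior_singularCross hγ h2 h21 h1]
      refine union_subset_union_left _ (image_mono fun q' h' => ⟨h'.1, crossInterior_subset _ _ h'.2⟩)
    rcases h3 with ⟨q', hq', h4⟩ | h4
    · rwa [← Subtype.ext h4]
    · exact absurd h4 q.2
  · rw [C.interior_singularCross hγ h2 h21 h1]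
    have hf := C.frequently_scaled h.1 (P := fun c => 0 < c ∧ c < 1) (l := 𝓝[<] 1) nhdsWithin_le_nhds
      (by filter_upwards [self_mem_nhdsWithin, nhdsWithin_le_nhds (lt_mem_nhds zero_lt_one)]
            with c hc hc0 using ⟨hc0, hc⟩)
    have hq' : q ∈ closure (C.crossInt r₁ r₂) := by
      rw [mem_closure_iff_frequently]
      refine hf.mono ?_
      rintro q' ⟨hd, c, ⟨hc0, hc1⟩, hxy⟩
      refine ⟨hd, ?_⟩
      rw [hxy]
      exact smul_mem_crossInterior (h2.trans h21) h2 h.2 hc0 hc1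
    have := image_closure_subset_closure_image (continuous_subtype_val) (mem_image_of_mem Subtype.val hq')
    exact closure_mono subset_union_left this

/-! ### Orbits near the periodic orbit -/

omit [T2Space M] hγ h2 h21 h1
section flow

theorem hasDerivAt_lift {i : Fin 4} {f : M₀ → ℝ³} {q : M₀} {t : ℝ}
    (hf : C.IsLift i f (A.flow t q)) : HasDerivAt (fun s => f (A.flow s q))
      (affineField lam n k (f (A.flow t q))) t := by
  have h1 : HasMFDerivAt 𝓘(ℝ, ℝ) 𝓔 (fun s : ℝ => A.flow s q) t
    ((1 : ℝ →L[ℝ] ℝ).smulRight (A.X (A.flow t q))) := A.isSmoothFlowOf.generates q t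
  have h3 := (hf.isLocalDiffeomorphAt.mdifferentiableAt (by simp)).hasMFDerivAt.comp t h1
  let D : E3 →L[ℝ] ℝ³ := mfderiv 𝓔 𝓘(ℝ, ℝ³) f (A.flow t q)
  let v : E3 := A.X (A.flow t q)
  have h4 : HasFDerivAt (f ∘ fun s => A.flow s q) (D.comp ((1 : ℝ →L[ℝ] ℝ).smulRight v)) t :=
    h3.hasFDerivAt
  have h5 : D ((1 : ℝ) • v) = affineField lam n k (f (A.flow t q)) := by
    rw [one_smul]; exact hf.field
  rw [← h5]
  exact h4.hasDerivAt

theorem hasDerivAt_xy {q : M₀} {t : ℝ} (h : A.flow t q ∈ C.dom) :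
    HasDerivAt (fun s => C.xc (A.flow s q)) (Real.log lam * C.xc (A.flow t q)) t ∧
    HasDerivAt (fun s => C.yc (A.flow s q)) (-Real.log lam * C.yc (A.flow t q)) t := by
  obtain ⟨i, f, hi, hf⟩ := C.exists_isLift' h
  have h0 := hf.self_of_nhds
  have h1 := C.hasDerivAt_lift h0
  have hc : Continuous (fun s => A.flow s q) := by fun_prop
  have h2 := hc.continuousAt.eventually hf
  have h3 : HasDerivAt (fun s => (f (A.flow s q)).1) (Real.log lam * (f (A.flow t q)).1) t := h1.fst
  have h4 : HasDerivAt (fun s => (f (A.flow s q)).2.1) (-Real.log lam * (f (A.flow t q)).2.1) t :=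
    h1.snd.fst
  rw [← h0.fst_eq, ← h0.snd_eq]
  exact ⟨h3.congr_of_eventuallyEq (h2.mono fun s hs => hs.fst_eq.symm),
    h4.congr_of_eventuallyEq (h2.mono fun s hs => hs.snd_eq.symm)⟩

theorem _root_.eq_exp_mul_of_hasDerivAt {g : ℝ → ℝ} {c a b : ℝ} (hab : a ≤ b)
    (h : ∀ t ∈ Icc a b, HasDerivAt g (c * g t) t) : g b = Real.exp (c * (b - a)) * g a := by
  have h1 : ∀ t ∈ Icc a b, HasDerivAt (fun t => Real.exp (-c * (t - a)) * g t) 0 t := by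
    intro t ht
    have e1 : HasDerivAt (fun t => Real.exp (-c * (t - a))) (Real.exp (-c * (t - a)) * (-c * 1)) t :=
      (((hasDerivAt_id t).sub_const a).const_mul (-c)).exp
    exact (e1.mul (h t ht)).congr_deriv (by ring)
  have h2 := constant_of_has_deriv_right_zero (a := a) (b := b)
    (fun t ht => (h1 t ht).continuousAt.continuousWithinAt)
    (fun t ht => (h1 t ⟨ht.1, ht.2.le⟩).hasDerivWithinAt) b ⟨hab, le_rfl⟩
  simp only [sub_self, mul_zero, Real.exp_zero, one_mul] at h2
  rw [← h2, ← mul_assoc, ← Real.exp_add]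
  simp

theorem xy_flow {q : M₀} {a b : ℝ} (hab : a ≤ b)
    (h : ∀ t ∈ Icc a b, A.flow t q ∈ C.dom) :
    C.xc (A.flow b q) = Real.exp (Real.log lam * (b - a)) * C.xc (A.flow a q) ∧
    C.yc (A.flow b q) = Real.exp (-Real.log lam * (b - a)) * C.yc (A.flow a q) :=
  ⟨eq_exp_mul_of_hasDerivAt (g := fun s => C.xc (A.flow s q)) hab fun t ht => (C.hasDerivAt_xy (h t ht)).1,
   eq_exp_mul_of_hasDerivAt (g := fun s => C.yc (A.flow s q)) hab fun t ht => (C.hasDerivAt_xy (h t ht)).2⟩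

/-- The coordinates along an orbit, for either direction `σ = ±1` of time. -/
theorem xy_flow_dir {q : M₀} {σ T : ℝ} (hσ : σ = 1 ∨ σ = -1) (hT : 0 ≤ T)
    (h : ∀ t ∈ Icc 0 T, A.flow (σ * t) q ∈ C.dom) :
    C.xc (A.flow (σ * T) q) = Real.exp (Real.log lam * (σ * T)) * C.xc q ∧
    C.yc (A.flow (σ * T) q) = Real.exp (-Real.log lam * (σ * T)) * C.yc q := by
  rcases hσ with rfl | rfl
  · have := C.xy_flow hT (q := q) (by simpa using h)
    simpa [A.flow.map_zero_apply] using this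
  · have h3 : ∀ t ∈ Icc (-T) 0, A.flow t q ∈ C.dom := fun t ht => by
      have := h (-t) ⟨by linarith [ht.2], by linarith [ht.1]⟩
      simpa using this
    have := C.xy_flow (by linarith) h3
    rw [A.flow.map_zero_apply] at this
    rw [this.1, this.2]
    constructor <;> (rw [← mul_assoc (Real.exp _), ← Real.exp_add]; ring_nf; simp)

variable [T2Space M]
/-- An orbit stays in the domain of the coordinates as long as the linear flow started at the same
coordinates stays in a smaller square. -/
theorem flow_mem_dom {q : M₀} (hq : q ∈ C.dom) {s : ℝ} (hs : s < C.rad) {σ T : ℝ}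
    (hσ : σ = 1 ∨ σ = -1) (hT : 0 ≤ T)
    (h : ∀ t ∈ Icc 0 T, |Real.exp (Real.log lam * (σ * t)) * C.xc q| ≤ s ∧
      |Real.exp (-Real.log lam * (σ * t)) * C.yc q| ≤ s) :
    ∀ t ∈ Icc 0 T, A.flow (σ * t) q ∈ C.dom := by
  obtain ⟨δ, hδ, hδs⟩ : ∃ δ > 0, ∀ t ∈ Icc 0 T, δ ≤ |Real.exp (Real.log lam * (σ * t)) * C.xc q| ∨
      δ ≤ |Real.exp (-Real.log lam * (σ * t)) * C.yc q| := by
    have hc : Continuous (fun t : ℝ => max |Real.exp (Real.log lam * (σ * t)) * C.xc q|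
      |Real.exp (-Real.log lam * (σ * t)) * C.yc q|) := by fun_prop
    obtain ⟨t₀, -, ht⟩ := isCompact_Icc.exists_isMinOn (nonempty_Icc.2 hT) hc.continuousOn
    refine ⟨_, ?_, fun t ht' => le_max_iff.1 (ht ht')⟩
    show 0 < max _ _
    rw [lt_max_iff, abs_pos, abs_pos]
    by_contra hcon
    push Not at hcon
    simp only [mul_eq_zero, Real.exp_ne_zero, false_or] at hcon
    exact C.xy_ne_zero hq hcon
  have hc : Continuous (fun t : ℝ => A.flow (σ * t) q) := by fun_prop
  let R : ℝ → ℝ → Prop := fun a b => (∀ t ∈ Icc 0 a, A.flow (σ * t) q ∈ C.dom) →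
    ∀ t ∈ Icc 0 b, A.flow (σ * t) q ∈ C.dom
  have : R 0 T := by
    refine rel_of_locally_rel hT (fun _ _ _ _ _ _ _ h1 h2 h3 => h2 (h1 h3)) ?_ ?_
    · intro t ht
      by_cases hd : A.flow (σ * t) q ∈ C.dom
      · obtain ⟨ε, hε, hb⟩ := Metric.mem_nhds_iff.1 (hc.continuousAt.preimage_mem_nhds (C.isOpen_dom.mem_nhds hd))
        refine ⟨ε, hε, fun s hs hst hst' hs' τ hτ => ?_⟩
        by_cases hτs : τ ≤ s
        · exact hs' τ ⟨hτ.1, hτs⟩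
        · refine hb (show τ ∈ _ from ?_)
          rw [Metric.mem_ball, Real.dist_eq, abs_lt]
          constructor <;> linarith [hτ.2]
      · have hK := (C.isCompact_annulus hδ hs).isClosed
        have hnK : A.flow (σ * t) q ∉ C.annulus δ s := fun h => hd h.1.1
        obtain ⟨ε, hε, hb⟩ := Metric.mem_nhds_iff.1
          (hc.continuousAt.preimage_mem_nhds (hK.isOpen_compl.mem_nhds hnK))
        refine ⟨ε, hε, fun s hs' hst hst' hs'' => ?_⟩
        exfalso
        have h5 := C.xy_flow_dir hσ hs'.1 hs''
        have h6 := h s hs'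
        have h7 := hδs s hs'
        refine hb (show s ∈ _ from ?_) ⟨⟨hs'' s ⟨hs'.1, le_rfl⟩, ?_, ?_⟩, ?_⟩
        · rw [Metric.mem_ball, Real.dist_eq, abs_lt]
          constructor <;> linarith
        · rw [h5.1]; exact h6.1
        · rw [h5.2]; exact h6.2
        · rw [h5.1, h5.2]; exact h7
    · intro t ht
      by_cases hd : A.flow (σ * t) q ∈ C.dom
      · obtain ⟨ε, hε, hb⟩ := Metric.mem_nhds_iff.1 (hc.continuousAt.preimage_mem_nhds (C.isOpen_dom.mem_nhds hd))
        refine ⟨ε, hε, fun s hs hst hst' hs' τ hτ => ?_⟩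
        by_cases hτs : τ ≤ t
        · exact hs' τ ⟨hτ.1, hτs⟩
        · refine hb (show τ ∈ _ from ?_)
          rw [Metric.mem_ball, Real.dist_eq, abs_lt]
          constructor <;> linarith [hτ.2]
      · exact ⟨1, one_pos, fun s hs hst hst' hs' => absurd (hs' t ⟨ht.1, le_rfl⟩) hd⟩
  refine this fun t ht => ?_
  have : t = 0 := le_antisymm ht.2 ht.1
  rw [this, mul_zero, A.flow.map_zero_apply]
  exact hq

end flow
end NormalCoordinates

/-! ### Derivatives of flows -/

/-- The time interval during which an orbit stays in an open set can be chosen locally uniformly. -/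
theorem Flow.eventually_forall_mem {X : Type*} [TopologicalSpace X] (ψ : Flow ℝ X) {O : Set X}
    (hO : IsOpen O) {a b : ℝ} {x : X} (h : ∀ t ∈ Icc a b, ψ t x ∈ O) :
    ∀ᶠ y in 𝓝 x, ∀ t ∈ Icc a b, ψ t y ∈ O := by
  refine isCompact_Icc.eventually_forall_of_forall_eventually (P := fun y t => ψ t y ∈ O)
    fun t ht => ?_
  have : Continuous (fun z : X × ℝ => ψ z.2 z.1) := ψ.continuous continuous_snd continuous_fst
  exact this.continuousAt.eventually (hO.mem_nhds (h t ht))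

section
variable {E H : Type*} [NormedAddCommGroup E] [NormedSpace ℝ E] [TopologicalSpace H]
  {I : ModelWithCorners ℝ E H} {X : Type*} [TopologicalSpace X] [ChartedSpace H X] [IsManifold I ∞ X]
  {E' H' : Type*} [NormedAddCommGroup E'] [NormedSpace ℝ E'] [TopologicalSpace H']
  {J : ModelWithCorners ℝ E' H'} {X' : Type*} [TopologicalSpace X'] [ChartedSpace H' X']
  [IsManifold J ∞ X']

theorem continuousOn_tangentMap_of_contMDiffAt {f : X → X'} {O : Set X} (hO : IsOpen O)
    (hf : ∀ x ∈ O, ContMDiffAt I J ∞ f x) :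
    ContinuousOn (tangentMap I J f) {V : TangentBundle I X | V.1 ∈ O} := by
  have h1 : ContMDiffOn I J ∞ f O := fun x hx => (hf x hx).contMDiffWithinAt
  have h2 := h1.continuousOn_tangentMapWithin (by simp) hO.uniqueMDiffOn
  exact h2.congr fun V hV => (tangentMapWithin_eq_tangentMap (hO.uniqueMDiffOn _ hV)
    ((hf _ hV).mdifferentiableAt (by simp))).symm

theorem continuousOn_mfderiv_apply {F : Type*} [NormedAddCommGroup F] [NormedSpace ℝ F] {f : X → F}
    {O : Set X} (hO : IsOpen O) (hf : ∀ x ∈ O, ContMDiffAt I 𝓘(ℝ, F) ∞ f x) :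
    ContinuousOn (fun V : TangentBundle I X => (mfderiv I 𝓘(ℝ, F) f V.1 V.2 : F))
      {V : TangentBundle I X | V.1 ∈ O} := by
  have h1 := continuousOn_tangentMap_of_contMDiffAt hO hf
  have h2 := (contMDiff_snd_tangentBundle_modelSpace F 𝓘(ℝ, F) (n := 0)).continuous
  exact h2.comp_continuousOn h1
end

namespace AlmostAnosovStructure
variable (A)

/-- The derivative of the flow, applied to a vector. -/
def D (t : ℝ) (q : M₀) (v : TangentSpace 𝓔 q) :
    TangentSpace 𝓔 (A.flow t q) := mfderiv 𝓔 𝓔 (A.flow t) q v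

include A in
theorem log_lam_neg : Real.log lam < 0 := Real.log_neg A.lam_pos A.lam_lt_one

theorem D_mem_Es (t : ℝ) {q : M₀} {v : TangentSpace 𝓔 q} (hv : v ∈ A.Es q) :
    A.D t q v ∈ A.Es (A.flow t q) := by
  rw [← A.splitting.invariant_s]; exact ⟨v, hv, rfl⟩

theorem D_mem_Eu (t : ℝ) {q : M₀} {v : TangentSpace 𝓔 q} (hv : v ∈ A.Eu q) :
    A.D t q v ∈ A.Eu (A.flow t q) := by
  rw [← A.splitting.invariant_u]; exact ⟨v, hv, rfl⟩

theorem metricNorm_D_s {t : ℝ} (ht : 0 ≤ t) {q : M₀} {v : TangentSpace 𝓔 q}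
    (hv : v ∈ A.Es q) : metricNorm A.metric (A.flow t q) (A.D t q v) =
      Real.exp (Real.log lam * t) * metricNorm A.metric q v := by
  rw [← Real.rpow_def_of_pos A.lam_pos]
  exact A.rate_s q v hv t ht

theorem metricNorm_D_u {t : ℝ} (ht : 0 ≤ t) {q : M₀} {v : TangentSpace 𝓔 q}
    (hv : v ∈ A.Eu q) : metricNorm A.metric (A.flow t q) (A.D t q v) =
      Real.exp (-Real.log lam * t) * metricNorm A.metric q v := by
  have h1 := A.rate_u (A.flow t q) _ (A.D_mem_Eu t hv) (-t) (by linarith)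
  have h2 := tangentMap_flow_add A.isSmoothFlowOf.smooth_flow (-t) t ⟨q, v⟩
  rw [neg_add_cancel, tangentMap_flow_zero] at h2
  have h3 := congrArg (fun V : TangentBundle 𝓔 M₀ => metricNorm A.metric V.1 V.2) h2
  have h4 : metricNorm A.metric q v =
      lam ^ (- -t) * metricNorm A.metric (A.flow t q) (A.D t q v) := h3.trans h1
  rw [h4, Real.rpow_def_of_pos A.lam_pos, ← mul_assoc, ← Real.exp_add]
  simp
end AlmostAnosovStructure

/-! ### A slowly varying cutoff -/

namespace NormalCoordinates
variable (C : NormalCoordinates A n k m)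

section cutoff
variable {ℓ : M₀ → ℝ} (hℓ : ContinuousOn ℓ C.dom)
  (hinv : ∀ q a b, a ≤ b → (∀ t ∈ Icc a b, A.flow t q ∈ C.dom) → ℓ (A.flow b q) = ℓ (A.flow a q))
include hℓ hinv

variable [T2Space M]

/-- A function on the domain of the coordinates that is invariant by the flow is bounded near `γ`:
every orbit near `γ` reaches a fixed compact annulus, forward or backward in time. -/
theorem exists_bound_of_invariant {δ : ℝ} (hδ : 0 < δ) (hδr : δ < C.rad) :
    ∃ K : ℝ, 0 ≤ K ∧ ∀ q ∈ C.box δ, |ℓ q| ≤ K := by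
  obtain ⟨K, hK⟩ := (C.isCompact_annulus hδ hδr).exists_bound_of_continuousOn
    (hℓ.mono fun q hq => hq.1.1)
  have hl := A.log_lam_neg
  refine ⟨max K 0, le_max_right _ _, fun q hq => le_max_of_le_left ?_⟩
  obtain ⟨hd, hx, hy⟩ := hq
  have hexp1 : ∀ (w T t : ℝ), w ≠ 0 → T = Real.log (δ / |w|) / -Real.log lam → t ≤ T →
      Real.exp (-Real.log lam * t) * |w| ≤ δ := by
    intro w T t hw hT ht
    have hw' : 0 < |w| := abs_pos.2 hw
    rw [← le_div_iff₀ hw', ← Real.le_log_iff_exp_le (by positivity)]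
    have : Real.log (δ / |w|) = -Real.log lam * T := by
      rw [hT, mul_div_cancel_of_imp' fun h => absurd h (neg_ne_zero.2 hl.ne)]
    rw [this]
    exact mul_le_mul_of_nonneg_left ht (by linarith)
  have hexpT : ∀ (w T : ℝ), w ≠ 0 → T = Real.log (δ / |w|) / -Real.log lam →
      Real.exp (-Real.log lam * T) * |w| = δ := by
    intro w T hw hT
    have hw' : 0 < |w| := abs_pos.2 hw
    have : -Real.log lam * T = Real.log (δ / |w|) := by
      rw [hT, mul_div_cancel_of_imp' fun h => absurd h (neg_ne_zero.2 hl.ne)]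
    rw [this, Real.exp_log (by positivity)]
    field_simp
  have hT0 : ∀ w : ℝ, w ≠ 0 → |w| ≤ δ → 0 ≤ Real.log (δ / |w|) / -Real.log lam := by
    intro w hw hwδ
    have hw' : 0 < |w| := abs_pos.2 hw
    exact div_nonneg (Real.log_nonneg ((one_le_div hw').2 hwδ)) (by linarith)
  have hexp2 : ∀ (w t : ℝ), |w| ≤ δ → 0 ≤ t → Real.exp (Real.log lam * t) * |w| ≤ δ := by
    intro w t hw ht
    have h1 : Real.exp (Real.log lam * t) ≤ 1 := Real.exp_le_one_iff.2 (by nlinarith)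
    nlinarith [abs_nonneg w, Real.exp_pos (Real.log lam * t)]
  by_cases h0 : C.xc q = 0
  · have h0' : C.yc q ≠ 0 := fun h => C.xy_ne_zero hd ⟨h0, h⟩
    set T := Real.log (δ / |C.yc q|) / -Real.log lam with hT
    have hst := C.flow_mem_dom hd hδr (σ := 1) (T := T) (Or.inl rfl) (hT0 _ h0' hy) fun t ht => by
      rw [abs_mul, abs_mul, Real.abs_exp, Real.abs_exp, one_mul]
      exact ⟨hexp2 _ _ hx ht.1, hexp1 _ T _ h0' hT ht.2⟩
    have hxy := C.xy_flow_dir (Or.inl rfl) (hT0 _ h0' hy) hst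
    have h1 := hinv q 0 T (hT0 _ h0' hy) fun t ht => by simpa using hst t ht
    rw [A.flow.map_zero_apply] at h1
    rw [← h1]
    refine hK _ ⟨⟨by simpa using hst T ⟨hT0 _ h0' hy, le_rfl⟩, ?_, ?_⟩, Or.inr ?_⟩
    all_goals rw [one_mul] at hxy
    · rw [hxy.1, abs_mul, Real.abs_exp]; exact hexp2 _ _ hx (hT0 _ h0' hy)
    · rw [hxy.2, abs_mul, Real.abs_exp]; exact (hexpT _ T h0' hT).le
    · rw [hxy.2, abs_mul, Real.abs_exp]; exact (hexpT _ T h0' hT).ge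
  · set T := Real.log (δ / |C.xc q|) / -Real.log lam with hT
    have hst := C.flow_mem_dom hd hδr (σ := -1) (T := T) (Or.inr rfl) (hT0 _ h0 hx) fun t ht => by
      rw [abs_mul, abs_mul, Real.abs_exp, Real.abs_exp,
        show Real.log lam * (-1 * t) = -Real.log lam * t by ring,
        show -Real.log lam * (-1 * t) = Real.log lam * t by ring]
      exact ⟨hexp1 _ T _ h0 hT ht.2, hexp2 _ _ hy ht.1⟩
    have hxy := C.xy_flow_dir (Or.inr rfl) (hT0 _ h0 hx) hst
    have h1 := hinv q (-T) 0 (by linarith [hT0 _ h0 hx]) fun t ht => by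
      have := hst (-t) ⟨by linarith [ht.2], by linarith [ht.1]⟩
      simpa using this
    rw [A.flow.map_zero_apply] at h1
    rw [h1]
    rw [show Real.log lam * (-1 * T) = -Real.log lam * T by ring,
        show -Real.log lam * (-1 * T) = Real.log lam * T by ring, neg_one_mul] at hxy
    refine hK _ ⟨⟨by simpa using hst T ⟨hT0 _ h0 hx, le_rfl⟩, ?_, ?_⟩, Or.inl ?_⟩
    · rw [hxy.1, abs_mul, Real.abs_exp]; exact (hexpT _ T h0 hT).le
    · rw [hxy.2, abs_mul, Real.abs_exp]; exact hexp2 _ _ hy (hT0 _ h0 hx)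
    · rw [hxy.1, abs_mul, Real.abs_exp]; exact (hexpT _ T h0 hT).ge

/-- A flow-invariant function on the domain of the coordinates can be cut off to a bounded function on
the whole complement of `γ` that varies slowly along the orbits. -/
theorem exists_slow_cutoff (hγ : IsCompact γ) : ∃ ε : ℝ, 0 < ε ∧ ∃ (η : M₀ → ℝ) (K : ℝ),
    (∀ q, |η q| ≤ K) ∧ (∀ q ∈ C.dom, |C.xc q| < ε → |C.yc q| < ε → η q = -ℓ q) ∧
    ∀ q t, 0 ≤ t → |η (A.flow t q) - η q| ≤ -Real.log lam / 2 * t := by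
  have hl := A.log_lam_neg
  set δ := C.rad / 2 with hδd
  have hδ : 0 < δ := by have := C.rad_pos; positivity
  have hδr : δ < C.rad := by have := C.rad_pos; linarith
  obtain ⟨K, hK0, hK⟩ := C.exists_bound_of_invariant hℓ hinv hδ hδr
  -- `χ` varies at rate at most `|log λ| / κ`, hence `χ ℓ` at rate at most `K |log λ| / κ < |log λ| / 2`
  set κ := 2 * K + 1 with hκ
  have hκ0 : 0 < κ := by positivity
  let nrm : M₀ → ℝ := fun q => max |C.xc q| |C.yc q|
  have hnrm : ∀ q ∈ C.dom, 0 < nrm q := by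
    intro q hq
    by_contra h
    have h' : nrm q ≤ 0 := not_lt.1 h
    exact C.xy_ne_zero hq ⟨abs_nonpos_iff.1 ((le_max_left _ _).trans h'),
      abs_nonpos_iff.1 ((le_max_right _ _).trans h')⟩
  -- a logarithmic cutoff: one near `γ`, zero outside the box of size `δ`
  let χ : M₀ → ℝ := fun q => max 0 (min 1 (Real.log (δ / nrm q) / κ))
  let η : M₀ → ℝ := by
    classical exact fun q => if q ∈ C.dom then -(χ q * ℓ q) else 0
  have hη : ∀ q ∈ C.dom, η q = -(χ q * ℓ q) := fun q hq => if_pos hq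
  have hη' : ∀ q, q ∉ C.dom → η q = 0 := fun q hq => if_neg hq
  have hχ01 : ∀ q, 0 ≤ χ q ∧ χ q ≤ 1 := fun q =>
    ⟨le_max_left _ _, max_le zero_le_one (min_le_left _ _)⟩
  have hχ0 : ∀ q ∈ C.dom, q ∉ C.box δ → χ q = 0 := by
    intro q hq hqb
    have h1 : δ < nrm q := by
      by_contra h
      have h' : nrm q ≤ δ := not_lt.1 h
      exact hqb ⟨hq, (le_max_left _ _).trans h', (le_max_right _ _).trans h'⟩
    refine max_eq_left ((min_le_right _ _).trans ?_)
    refine div_nonpos_of_nonpos_of_nonneg (Real.log_nonpos (by have := hnrm q hq; positivity) ?_) hκ0.le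
    exact (div_le_one (hnrm q hq)).2 h1.le
  have hη0 : ∀ q, q ∉ C.box δ → η q = 0 := by
    intro q hq
    by_cases hd : q ∈ C.dom
    · rw [hη q hd, hχ0 q hd hq, zero_mul, neg_zero]
    · exact hη' q hd
  -- the variation along an orbit segment in the domain
  have hvar : ∀ q a b, a ≤ b → (∀ t ∈ Icc a b, A.flow t q ∈ C.dom) →
      |η (A.flow b q) - η (A.flow a q)| ≤ -Real.log lam / 2 * (b - a) := by
    intro q a b hab hd
    have hxy := C.xy_flow hab hd
    have ha := hd a ⟨le_rfl, hab⟩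
    have hb := hd b ⟨hab, le_rfl⟩
    have hba : 0 ≤ b - a := by linarith
    rw [hη _ ha, hη _ hb, hinv q a b hab hd]
    by_cases hbig : |ℓ (A.flow a q)| ≤ K
    · set r := Real.exp (Real.log lam * (b - a)) with hr
      have hr1 : r ≤ 1 := Real.exp_le_one_iff.2 (by nlinarith)
      have hr0 : 0 < r := Real.exp_pos _
      have hri : Real.exp (-Real.log lam * (b - a)) = r⁻¹ := by
        rw [hr, ← Real.exp_neg]; ring_nf
      have hri1 : 1 ≤ r⁻¹ := (one_le_inv₀ hr0).2 hr1
      rw [hri] at hxy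
      have hna := hnrm _ ha
      have hnb := hnrm _ hb
      have h1 : nrm (A.flow b q) ≤ r⁻¹ * nrm (A.flow a q) := by
        refine max_le ?_ ?_
        · rw [hxy.1, abs_mul, abs_of_pos hr0]
          have := le_max_left |C.xc (A.flow a q)| |C.yc (A.flow a q)|
          calc r * |C.xc (A.flow a q)| ≤ r⁻¹ * |C.xc (A.flow a q)| := by gcongr; linarith
            _ ≤ _ := by gcongr
        · rw [hxy.2, abs_mul, abs_of_pos (inv_pos.2 hr0)]
          have := le_max_right |C.xc (A.flow a q)| |C.yc (A.flow a q)|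
          gcongr
      have h2 : r * nrm (A.flow a q) ≤ nrm (A.flow b q) := by
        rw [mul_max_of_nonneg _ _ hr0.le]
        refine max_le ?_ ?_
        · refine le_max_of_le_left ?_
          rw [hxy.1, abs_mul, abs_of_pos hr0]
        · refine le_max_of_le_right ?_
          rw [hxy.2, abs_mul, abs_of_pos (inv_pos.2 hr0)]
          gcongr; linarith
      have hlogr : Real.log r = Real.log lam * (b - a) := Real.log_exp _
      have h3 : |Real.log (δ / nrm (A.flow b q)) / κ - Real.log (δ / nrm (A.flow a q)) / κ| ≤
          -Real.log lam * (b - a) / κ := by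
        rw [← sub_div, abs_div, abs_of_pos hκ0]
        gcongr
        rw [Real.log_div hδ.ne' hnb.ne', Real.log_div hδ.ne' hna.ne', abs_le]
        have e1 := Real.log_le_log hnb h1
        have e2 := Real.log_le_log (by positivity) h2
        rw [Real.log_mul (by positivity) hna.ne', Real.log_inv] at e1
        rw [Real.log_mul (by positivity) hna.ne'] at e2
        rw [hlogr] at e1 e2
        constructor <;> linarith
      have h4 : |χ (A.flow b q) - χ (A.flow a q)| ≤ -Real.log lam * (b - a) / κ := by
        refine le_trans ?_ h3
        refine (abs_max_sub_max_le_max _ _ _ _).trans (max_le (by simp) ?_)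
        exact (abs_min_sub_min_le_max _ _ _ _).trans (max_le (by simp) le_rfl)
      have h5 : -(χ (A.flow b q) * ℓ (A.flow a q)) - -(χ (A.flow a q) * ℓ (A.flow a q)) =
        -((χ (A.flow b q) - χ (A.flow a q)) * ℓ (A.flow a q)) := by ring
      rw [h5, abs_neg, abs_mul]
      calc _ ≤ -Real.log lam * (b - a) / κ * K := by gcongr; exact (abs_nonneg _).trans h4
        _ = -Real.log lam * (b - a) * (K / κ) := by ring
        _ ≤ -Real.log lam * (b - a) * (1 / 2) := by
          refine mul_le_mul_of_nonneg_left ?_ (mul_nonneg (by linarith) hba)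
          rw [div_le_div_iff₀ hκ0 two_pos]; linarith
        _ = _ := by ring
    · have e1 : A.flow a q ∉ C.box δ := fun h => hbig (hK _ h)
      have e2 : A.flow b q ∉ C.box δ := fun h => hbig (by
        rw [← hinv q a b hab hd]; exact hK _ h)
      rw [hχ0 _ ha e1, hχ0 _ hb e2]
      simp only [zero_mul, sub_self, abs_zero]
      exact mul_nonneg (by linarith) hba
  refine ⟨δ * Real.exp (-κ), by positivity, η, K, fun q => ?_, fun q hq hx hy => ?_, fun q t ht => ?_⟩
  · by_cases hq : q ∈ C.box δ
    · rw [hη q hq.1, abs_neg, abs_mul, abs_of_nonneg (hχ01 q).1]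
      calc _ ≤ 1 * K := mul_le_mul (hχ01 q).2 (hK q hq) (abs_nonneg _) zero_le_one
        _ = K := one_mul K
    · rw [hη0 q hq, abs_zero]; exact hK0
  · have h1 : nrm q < δ * Real.exp (-κ) := max_lt hx hy
    have h2 := hnrm q hq
    have h3 : χ q = 1 := by
      show max 0 (min 1 (Real.log (δ / nrm q) / κ)) = 1
      have h4 : 1 ≤ Real.log (δ / nrm q) / κ := by
        rw [one_le_div hκ0, Real.le_log_iff_exp_le (by positivity), le_div_iff₀ h2]
        calc _ ≤ Real.exp κ * (δ * Real.exp (-κ)) := by gcongr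
          _ = δ * (Real.exp κ * Real.exp (-κ)) := by ring
          _ = δ := by rw [← Real.exp_add]; simp
      rw [min_eq_left h4]; simp
    rw [hη q hq, h3, one_mul]
  · have hclosed : IsClosed (C.box δ) := by
      have h1 := C.isClosed_image_union hγ hδr (S := C.box δ) Subset.rfl fun q hq hqS => by
        have h3 : (C.xc q, C.yc q) ∈ ({w : ℝ × ℝ | |w.1| ≤ δ} ∩ {w : ℝ × ℝ | |w.2| ≤ δ})ᶜ :=
          fun h => hqS ⟨hq, h⟩
        have e1 : IsClosed {w : ℝ × ℝ | |w.1| ≤ δ} := isClosed_le (by fun_prop) continuous_const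
        have e2 : IsClosed {w : ℝ × ℝ | |w.2| ≤ δ} := isClosed_le (by fun_prop) continuous_const
        exact (C.eventually_mem_dom_and hq (e1.inter e2).isOpen_compl h3).mono
          fun q' h4 h5 => h4.2 h5.2
      have h2 := h1.preimage (continuous_subtype_val (p := fun x : M => x ∉ γ))
      convert h2 using 1
      ext q
      constructor
      · exact fun h => Or.inl ⟨q, h, rfl⟩
      · rintro (⟨q', h, h'⟩ | h)
        · rwa [← Subtype.ext h']
        · exact absurd h q.2
    have hc : Continuous (fun s : ℝ => A.flow s q) := by fun_prop
    let R : ℝ → ℝ → Prop := fun a b => |η (A.flow b q) - η (A.flow a q)| ≤ -Real.log lam / 2 * (b - a)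
    -- near each time the orbit is either in the domain or outside the box
    have hloc : ∀ s : ℝ, ∃ ε > 0, ∀ a b, a ≤ b → s - ε < a → b < s + ε → R a b := by
      intro s
      by_cases hd : A.flow s q ∈ C.dom
      · obtain ⟨ε, hε, hb⟩ := Metric.mem_nhds_iff.1
          (hc.continuousAt.preimage_mem_nhds (C.isOpen_dom.mem_nhds hd))
        refine ⟨ε, hε, fun a b hab h1 h2 => hvar q a b hab fun τ hτ => hb (show τ ∈ _ from ?_)⟩
        rw [Metric.mem_ball, Real.dist_eq, abs_lt]
        constructor <;> linarith [hτ.1, hτ.2]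
      · have hnb : A.flow s q ∉ C.box δ := fun h => hd h.1
        obtain ⟨ε, hε, hb⟩ := Metric.mem_nhds_iff.1
          (hc.continuousAt.preimage_mem_nhds (hclosed.isOpen_compl.mem_nhds hnb))
        refine ⟨ε, hε, fun a b hab h1 h2 => ?_⟩
        have e1 := hη0 _ (hb (show a ∈ _ by
          rw [Metric.mem_ball, Real.dist_eq, abs_lt]; constructor <;> linarith))
        have e2 := hη0 _ (hb (show b ∈ _ by
          rw [Metric.mem_ball, Real.dist_eq, abs_lt]; constructor <;> linarith))
        show |η (A.flow b q) - η (A.flow a q)| ≤ _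
        rw [e1, e2, sub_self, abs_zero]
        exact mul_nonneg (by linarith) (by linarith)
    have : R 0 t := by
      refine rel_of_locally_rel ht ?_ ?_ ?_
      · intro a b c _ _ _ _ h1 h2
        calc _ ≤ |η (A.flow c q) - η (A.flow b q)| + |η (A.flow b q) - η (A.flow a q)| := abs_sub_le _ _ _
          _ ≤ -Real.log lam / 2 * (c - b) + -Real.log lam / 2 * (b - a) := add_le_add h2 h1
          _ = _ := by ring
      · intro s hs
        obtain ⟨ε, hε, h⟩ := hloc s
        exact ⟨ε, hε, fun a _ h1 h2 => h a s h2 h1 (by linarith)⟩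
      · intro s hs
        obtain ⟨ε, hε, h⟩ := hloc s
        exact ⟨ε, hε, fun b _ h1 h2 => h s b h1 (by linarith) h2⟩
    have h3 : |η (A.flow t q) - η (A.flow 0 q)| ≤ -Real.log lam / 2 * (t - 0) := this
    rwa [A.flow.map_zero_apply, sub_zero] at h3
end cutoff
end NormalCoordinates

/-! ### Norms adapted to the coordinates -/

/-- The differential of a vector-valued function, with values in the vector space itself. -/
def vderiv {X : Type*} [TopologicalSpace X] [ChartedSpace E3 X] {F : Type*} [NormedAddCommGroup F]
    [NormedSpace ℝ F] (f : X → F) (q : X) : TangentSpace 𝓔 q →L[ℝ] F :=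
  mfderiv 𝓔 𝓘(ℝ, F) f q

namespace NormalCoordinates
variable (C : NormalCoordinates A n k m)

/-- For an invariant line field on which the flow stretches the metric exactly at the same rate as it
stretches a coordinate, the ratio of both is an invariant function. -/
theorem exists_invariant_ratio
    {E : ∀ x : M₀, Submodule ℝ (TangentSpace 𝓔 x)} (hE : IsLineField E)
    {κ : ℝ} (hDE : ∀ t q, ∀ v ∈ E q, A.D t q v ∈ E (A.flow t q))
    (hrate : ∀ t, 0 ≤ t → ∀ q, ∀ v ∈ E q, metricNorm A.metric (A.flow t q) (A.D t q v) =
      Real.exp (κ * t) * metricNorm A.metric q v)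
    {cc : M₀ → ℝ} (hcc : ∀ q ∈ C.dom, ContMDiffAt 𝓔 𝓘(ℝ, ℝ) ∞ cc q)
    (hflow : ∀ q T, 0 ≤ T → (∀ t ∈ Icc 0 T, A.flow t q ∈ C.dom) →
      cc (A.flow T q) = Real.exp (κ * T) * cc q)
    (hne : ∀ q ∈ C.dom, ∀ v ∈ E q, v ≠ 0 → vderiv cc q v ≠ 0) :
    ∃ ℓ : M₀ → ℝ, ContinuousOn ℓ C.dom ∧
      (∀ q a b, a ≤ b → (∀ t ∈ Icc a b, A.flow t q ∈ C.dom) → ℓ (A.flow b q) = ℓ (A.flow a q)) ∧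
      ∀ q ∈ C.dom, ∀ v ∈ E q, metricNorm A.metric q v =
        Real.exp (ℓ q) * |vderiv cc q v| := by
  have hspan : ∀ q, ∃ v : TangentSpace 𝓔 q, v ≠ 0 ∧ E q = Submodule.span ℝ {v} := by
    intro q
    obtain ⟨U, hU, v, -, hv⟩ := hE q
    exact ⟨v q, hv q (mem_of_mem_nhds hU)⟩
  choose v hv0 hvE using hspan
  have hvm : ∀ q, v q ∈ E q := fun q => by rw [hvE]; exact Submodule.mem_span_singleton_self _
  let dc : ∀ q : M₀, TangentSpace 𝓔 q → ℝ := fun q w =>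
    vderiv cc q w
  have hdcs : ∀ q (a : ℝ) (w : TangentSpace 𝓔 q), dc q (a • w) = a * dc q w :=
    fun q a w => (vderiv cc q).map_smul a w
  let ℓ : M₀ → ℝ := fun q => Real.log (metricNorm A.metric q (v q) / |dc q (v q)|)
  have hmul : ∀ q ∈ C.dom, ∀ w ∈ E q, metricNorm A.metric q w = Real.exp (ℓ q) * |dc q w| := by
    intro q hq w hw
    rw [hvE] at hw
    obtain ⟨a, rfl⟩ := Submodule.mem_span_singleton.1 hw
    have h1 : 0 < |dc q (v q)| := abs_pos.2 (hne q hq _ (hvm q) (hv0 q))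
    have h2 := metricNorm_pos A.metric q (hv0 q)
    rw [metricNorm_smul, hdcs, abs_mul, Real.exp_log (by positivity)]
    field_simp
  have hℓ : ∀ q ∈ C.dom, ∀ w ∈ E q, w ≠ 0 → ℓ q = Real.log (metricNorm A.metric q w / |dc q w|) := by
    intro q hq w hw hw0
    have h1 : 0 < |dc q w| := abs_pos.2 (hne q hq _ hw hw0)
    rw [hmul q hq w hw, mul_div_cancel_right₀ _ h1.ne', Real.log_exp]
  refine ⟨ℓ, ?_, ?_, hmul⟩
  · intro q hq
    refine ContinuousAt.continuousWithinAt ?_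
    obtain ⟨U, hU, w, hwc, hw⟩ := hE q
    have h1 : ContinuousAt (fun y => (⟨y, w y⟩ : TangentBundle 𝓔 M₀)) q :=
      hwc.continuousAt hU
    have h2 : ContinuousAt (fun y => metricNorm A.metric y (w y)) q :=
      ContinuousAt.comp (f := fun y => (⟨y, w y⟩ : TangentBundle 𝓔 M₀))
        (continuous_metricNorm A.metric).continuousAt h1
    have h3 : ContinuousAt (fun y => dc y (w y)) q := by
      have h4 := (continuousOn_mfderiv_apply (I := 𝓔) C.isOpen_dom hcc).continuousAt
        (x := (⟨q, w q⟩ : TangentBundle 𝓔 M₀))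
        ((C.isOpen_dom.preimage (FiberBundle.continuous_proj E3 _)).mem_nhds hq)
      exact ContinuousAt.comp (f := fun y => (⟨y, w y⟩ : TangentBundle 𝓔 M₀)) h4 h1
    have hwq := hw q (mem_of_mem_nhds hU)
    have hwE : ∀ y ∈ U, w y ∈ E y := fun y hy => by
      rw [(hw y hy).2]; exact Submodule.mem_span_singleton_self _
    have h5 : ContinuousAt (fun y => Real.log (metricNorm A.metric y (w y) / |dc y (w y)|)) q := by
      have h6 : 0 < |dc q (w q)| := abs_pos.2 (hne q hq _ (hwE q (mem_of_mem_nhds hU)) hwq.1)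
      have h7 := metricNorm_pos A.metric q hwq.1
      exact (h2.div h3.abs h6.ne').log (div_pos h7 h6).ne'
    refine h5.congr ?_
    filter_upwards [hU, C.isOpen_dom.mem_nhds hq] with y hy hyd
    exact (hℓ y hyd _ (hwE y hy) (hw y hy).1).symm
  · intro q a b hab hd
    set p := A.flow a q with hp
    have hfb : A.flow b q = A.flow (b - a) p := by rw [hp, ← A.flow.map_add, sub_add_cancel]
    have hd' : ∀ t ∈ Icc 0 (b - a), A.flow t p ∈ C.dom := by
      intro t ht
      rw [hp, ← A.flow.map_add]
      exact hd _ ⟨by linarith [ht.1], by linarith [ht.2]⟩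
    have hba : 0 ≤ b - a := by linarith
    rw [hfb]
    set T := b - a
    have hpd : p ∈ C.dom := hd a ⟨le_rfl, hab⟩
    have hTd : A.flow T p ∈ C.dom := hd' T ⟨hba, le_rfl⟩
    have h1 : cc ∘ A.flow T =ᶠ[𝓝 p] (fun r => Real.exp (κ * T) * r) ∘ cc := by
      filter_upwards [A.flow.eventually_forall_mem C.isOpen_dom hd'] with p' hp'
      exact hflow p' T hba hp'
    have h2 : HasMFDerivAt 𝓔 𝓘(ℝ, ℝ) (cc ∘ A.flow T) p _ :=
      ((hcc _ hTd).mdifferentiableAt (by simp)).hasMFDerivAt.comp p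
        (mdifferentiable_flow_apply A.isSmoothFlowOf.smooth_flow T p).hasMFDerivAt
    have h3 : HasMFDerivAt 𝓘(ℝ, ℝ) 𝓘(ℝ, ℝ) (fun r : ℝ => Real.exp (κ * T) * r) (cc p)
        (Real.exp (κ * T) • ContinuousLinearMap.id ℝ ℝ) :=
      ((hasFDerivAt_id (cc p)).const_mul (Real.exp (κ * T))).hasMFDerivAt
    have h4 := h3.comp p ((hcc p hpd).mdifferentiableAt (by simp)).hasMFDerivAt
    have h5 := hasMFDerivAt_unique (h4.congr_of_eventuallyEq h1) h2
    have h6 : dc (A.flow T p) (A.D T p (v p)) = Real.exp (κ * T) * dc p (v p) :=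
      (congrArg (fun L : E3 →L[ℝ] ℝ => L (v p)) h5).symm
    have hDv := hDE T p (v p) (hvm p)
    have hDv0 : A.D T p (v p) ≠ 0 := fun h =>
      hv0 p (eq_zero_of_mfderiv_flow_eq_zero A.isSmoothFlowOf.smooth_flow T p (v p) h)
    rw [hℓ _ hTd _ hDv hDv0, h6, hrate T hba p _ (hvm p), abs_mul, Real.abs_exp,
      mul_div_mul_left _ _ (Real.exp_ne_zero _)]

theorem mfderiv_xc_eq {i : Fin 4} {f : M₀ → ℝ³} {q : M₀}
    (hf : ∀ᶠ q' in 𝓝 q, C.IsLift i f q') (v : TangentSpace 𝓔 q) :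
    vderiv C.xc q v =
      (vderiv f q v).1 := by
  have h1 : C.xc =ᶠ[𝓝 q] Prod.fst ∘ f := hf.mono fun q' h => h.fst_eq.symm
  have h2 : HasMFDerivAt 𝓘(ℝ, ℝ³) 𝓘(ℝ, ℝ) (Prod.fst : ℝ³ → ℝ) (f q)
    (ContinuousLinearMap.fst ℝ ℝ (ℝ × ℝ)) := hasFDerivAt_fst.hasMFDerivAt
  have h3 := h2.comp q (hf.self_of_nhds.isLocalDiffeomorphAt.mdifferentiableAt (by simp)).hasMFDerivAt
  rw [vderiv, (h3.congr_of_eventuallyEq h1).mfderiv]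
  rfl

theorem mfderiv_yc_eq {i : Fin 4} {f : M₀ → ℝ³} {q : M₀}
    (hf : ∀ᶠ q' in 𝓝 q, C.IsLift i f q') (v : TangentSpace 𝓔 q) :
    vderiv C.yc q v =
      (vderiv f q v).2.1 := by
  have h1 : C.yc =ᶠ[𝓝 q] (fun u : ℝ³ => u.2.1) ∘ f := hf.mono fun q' h => h.snd_eq.symm
  have h2 : HasMFDerivAt 𝓘(ℝ, ℝ³) 𝓘(ℝ, ℝ) (fun u : ℝ³ => u.2.1) (f q)
    ((ContinuousLinearMap.fst ℝ ℝ ℝ).comp (ContinuousLinearMap.snd ℝ ℝ (ℝ × ℝ))) :=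
      (hasFDerivAt_fst.comp (f q) hasFDerivAt_snd).hasMFDerivAt
  have h3 := h2.comp q (hf.self_of_nhds.isLocalDiffeomorphAt.mdifferentiableAt (by simp)).hasMFDerivAt
  rw [vderiv, (h3.congr_of_eventuallyEq h1).mfderiv]
  rfl

variable {C} in
theorem IsLift.apply_Es {i : Fin 4} {f : M₀ → ℝ³} {q : M₀}
    (hf : C.IsLift i f q) {v : TangentSpace 𝓔 q} (hv : v ∈ A.Es q) :
    ∃ a : ℝ, vderiv f q v = (a, 0, 0) := by
  have h1 : vderiv f q v ∈
      Submodule.span ℝ {((1, 0, 0) : ℝ³)} := by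
    rw [← hf.map_Es]; exact ⟨v, hv, rfl⟩
  obtain ⟨a, ha⟩ := Submodule.mem_span_singleton.1 h1
  exact ⟨a, by rw [← ha]; simp⟩

variable {C} in
theorem IsLift.apply_Eu {i : Fin 4} {f : M₀ → ℝ³} {q : M₀}
    (hf : C.IsLift i f q) {v : TangentSpace 𝓔 q} (hv : v ∈ A.Eu q) :
    ∃ a : ℝ, vderiv f q v = (0, a, 0) := by
  have h1 : vderiv f q v ∈
      Submodule.span ℝ {((0, 1, 0) : ℝ³)} := by
    rw [← hf.map_Eu]; exact ⟨v, hv, rfl⟩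
  obtain ⟨a, ha⟩ := Submodule.mem_span_singleton.1 h1
  exact ⟨a, by rw [← ha]; simp⟩

variable {C} in
theorem IsLift.exists_Es {i : Fin 4} {f : M₀ → ℝ³} {q : M₀}
    (hf : C.IsLift i f q) (a : ℝ) : ∃ v ∈ A.Es q,
    vderiv f q v = (a, 0, 0) := by
  have h1 : ((a, 0, 0) : ℝ³) ∈ (A.Es q).map (mfderiv 𝓔 𝓘(ℝ, ℝ³) f q).toLinearMap := by
    rw [hf.map_Es]; exact Submodule.mem_span_singleton.2 ⟨a, by simp⟩
  obtain ⟨v, hv, h⟩ := h1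
  exact ⟨v, hv, h⟩

variable {C} in
theorem IsLift.exists_Eu {i : Fin 4} {f : M₀ → ℝ³} {q : M₀}
    (hf : C.IsLift i f q) (a : ℝ) : ∃ v ∈ A.Eu q,
    vderiv f q v = (0, a, 0) := by
  have h1 : ((0, a, 0) : ℝ³) ∈ (A.Eu q).map (mfderiv 𝓔 𝓘(ℝ, ℝ³) f q).toLinearMap := by
    rw [hf.map_Eu]; exact Submodule.mem_span_singleton.2 ⟨a, by simp⟩
  obtain ⟨v, hv, h⟩ := h1
  exact ⟨v, hv, h⟩

/-- Weights `hs` and `hu` by which the metric is multiplied on the two line bundles, so that it agrees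
with the coordinates on the box of size `ε` around `γ` and remains contracted, respectively
expanded, at half the logarithmic rate. -/
structure AdaptedSizes (ε : ℝ) where
  /-- the weight on `Es` -/
  hs : M₀ → ℝ
  /-- the weight on `Eu` -/
  hu : M₀ → ℝ
  /-- a bound for both weights and their inverses -/
  bd : ℝ
  bd_pos : 0 < bd
  hs_le : ∀ q, hs q ≤ bd
  hu_le : ∀ q, hu q ≤ bd
  le_hs : ∀ q, bd⁻¹ ≤ hs q
  le_hu : ∀ q, bd⁻¹ ≤ hu q
  hs_eq : ∀ q ∈ C.dom, |C.xc q| < ε → |C.yc q| < ε → ∀ v ∈ A.Es q,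
    hs q * metricNorm A.metric q v = |vderiv C.xc q v|
  hu_eq : ∀ q ∈ C.dom, |C.xc q| < ε → |C.yc q| < ε → ∀ v ∈ A.Eu q,
    hu q * metricNorm A.metric q v = |vderiv C.yc q v|
  hs_flow : ∀ q t, 0 ≤ t → ∀ v ∈ A.Es q,
    hs (A.flow t q) * metricNorm A.metric (A.flow t q) (A.D t q v) ≤
      Real.exp (Real.log lam / 2 * t) * (hs q * metricNorm A.metric q v)
  hu_flow : ∀ q t, 0 ≤ t → ∀ v ∈ A.Eu q,
    Real.exp (-(Real.log lam / 2 * t)) * (hu q * metricNorm A.metric q v) ≤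
      hu (A.flow t q) * metricNorm A.metric (A.flow t q) (A.D t q v)

/-- The weights are `exp η`, where `η` is the cutoff of minus the logarithm of the ratio of the metric to
the coordinate; the size `ε` of the box is the one where the cutoff is trivial. -/
theorem exists_adaptedSizes [T2Space M] (hγ : IsCompact γ) :
    ∃ ε : ℝ, 0 < ε ∧ ε ≤ C.rad ∧ Nonempty (C.AdaptedSizes ε) := by
  have hinj : ∀ q ∈ C.dom, ∃ i f, ∀ᶠ q' in 𝓝 q, C.IsLift i f q' := fun q hq => by
    obtain ⟨i, f, -, h⟩ := C.exists_isLift' hq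
    exact ⟨i, f, h⟩
  obtain ⟨ℓs, hs1, hs2, hs3⟩ := C.exists_invariant_ratio A.splitting.lineField_s (κ := Real.log lam)
    (fun t q v hv => A.D_mem_Es t hv) (fun t ht q v hv => A.metricNorm_D_s ht hv)
    (fun q hq => C.contMDiffAt_xc hq)
    (fun q T hT h => by
      have := (C.xy_flow hT h).1
      rwa [A.flow.map_zero_apply, sub_zero] at this)
    (fun q hq v hv hv0 h => by
      obtain ⟨i, f, hf⟩ := hinj q hq
      rw [C.mfderiv_xc_eq hf] at h
      obtain ⟨a, ha⟩ := hf.self_of_nhds.apply_Es hv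
      rw [ha] at h
      have h' : a = 0 := h
      subst h'
      exact hv0 (hf.self_of_nhds.isLocalDiffeomorphAt.mfderiv_injective (ha.trans (map_zero _).symm)))
  obtain ⟨ℓu, hu1, hu2, hu3⟩ := C.exists_invariant_ratio A.splitting.lineField_u (κ := -Real.log lam)
    (fun t q v hv => A.D_mem_Eu t hv) (fun t ht q v hv => A.metricNorm_D_u ht hv)
    (fun q hq => C.contMDiffAt_yc hq)
    (fun q T hT h => by
      have := (C.xy_flow hT h).2
      rwa [A.flow.map_zero_apply, sub_zero] at this)
    (fun q hq v hv hv0 h => by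
      obtain ⟨i, f, hf⟩ := hinj q hq
      rw [C.mfderiv_yc_eq hf] at h
      obtain ⟨a, ha⟩ := hf.self_of_nhds.apply_Eu hv
      rw [ha] at h
      have h' : a = 0 := h
      subst h'
      exact hv0 (hf.self_of_nhds.isLocalDiffeomorphAt.mfderiv_injective (ha.trans (map_zero _).symm)))
  obtain ⟨εs, hεs, ηs, Ks, hηs1, hηs2, hηs3⟩ := C.exists_slow_cutoff hs1 hs2 hγ
  obtain ⟨εu, hεu, ηu, Ku, hηu1, hηu2, hηu3⟩ := C.exists_slow_cutoff hu1 hu2 hγ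
  have hle1 : min (min εs εu) C.rad ≤ εs := (min_le_left _ _).trans (min_le_left _ _)
  have hle2 : min (min εs εu) C.rad ≤ εu := (min_le_left _ _).trans (min_le_right _ _)
  refine ⟨min (min εs εu) C.rad, lt_min (lt_min hεs hεu) C.rad_pos, min_le_right _ _,
    ⟨⟨fun q => Real.exp (ηs q), fun q => Real.exp (ηu q), Real.exp (max Ks Ku), Real.exp_pos _,
    fun q => ?_, fun q => ?_, fun q => ?_, fun q => ?_, fun q hq hx hy v hv => ?_,
    fun q hq hx hy v hv => ?_, fun q t ht v hv => ?_, fun q t ht v hv => ?_⟩⟩⟩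
  · exact Real.exp_le_exp.2 ((le_abs_self _).trans ((hηs1 q).trans (le_max_left _ _)))
  · exact Real.exp_le_exp.2 ((le_abs_self _).trans ((hηu1 q).trans (le_max_right _ _)))
  · rw [← Real.exp_neg]
    exact Real.exp_le_exp.2 (neg_le.1 ((neg_le_abs _).trans ((hηs1 q).trans (le_max_left _ _))))
  · rw [← Real.exp_neg]
    exact Real.exp_le_exp.2 (neg_le.1 ((neg_le_abs _).trans ((hηu1 q).trans (le_max_right _ _))))
  · rw [hηs2 q hq (hx.trans_le hle1) (hy.trans_le hle1), hs3 q hq v hv, ← mul_assoc, ← Real.exp_add]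
    simp
  · rw [hηu2 q hq (hx.trans_le hle2) (hy.trans_le hle2), hu3 q hq v hv, ← mul_assoc, ← Real.exp_add]
    simp
  · rw [A.metricNorm_D_s ht hv, ← mul_assoc, ← mul_assoc, ← Real.exp_add, ← Real.exp_add]
    have := (abs_le.1 (hηs3 q t ht)).2
    refine mul_le_mul_of_nonneg_right (Real.exp_le_exp.2 ?_) (metricNorm_nonneg A.metric q v)
    linarith
  · rw [A.metricNorm_D_u ht hv, ← mul_assoc, ← mul_assoc, ← Real.exp_add, ← Real.exp_add]
    have := (abs_le.1 (hηu3 q t ht)).1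
    refine mul_le_mul_of_nonneg_right (Real.exp_le_exp.2 ?_) (metricNorm_nonneg A.metric q v)
    linarith
end NormalCoordinates

/-! ### Twist profiles and shears -/

section profile
variable {ρ : ℝ → ℝ}

/-- The profile, extended to the real line by constants. -/
def extendProfile (ρ : ℝ → ℝ) (s : ℝ) : ℝ := ρ (max 0 (min 1 s))

theorem extendProfile_eq {s : ℝ} (hs : s ∈ Icc (0 : ℝ) 1) : extendProfile ρ s = ρ s := by
  rw [extendProfile, min_eq_right hs.2, max_eq_right hs.1]

theorem extendProfile_eq_one (hρ : IsTwistProfile ρ) {s : ℝ} (hs : s ≤ 1 / 3) :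
    extendProfile ρ s = 1 :=
  hρ.eq_one _ ⟨le_max_left _ _, max_le (by norm_num) ((min_le_right _ _).trans hs)⟩

theorem extendProfile_eq_zero (hρ : IsTwistProfile ρ) {s : ℝ} (hs : 2 / 3 ≤ s) :
    extendProfile ρ s = 0 :=
  hρ.eq_zero _ ⟨le_max_of_le_right (le_min (by norm_num) hs), max_le zero_le_one (min_le_left _ _)⟩

theorem antitone_extendProfile (hρ : IsTwistProfile ρ) : Antitone (extendProfile ρ) := by
  intro s t hst
  exact hρ.antitone ⟨le_max_left _ _, max_le zero_le_one (min_le_left _ _)⟩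
    ⟨le_max_left _ _, max_le zero_le_one (min_le_left _ _)⟩
    (max_le_max le_rfl (min_le_min le_rfl hst))

theorem contDiff_extendProfile (hρ : IsTwistProfile ρ) : ContDiff ℝ ∞ (extendProfile ρ) := by
  rw [contDiff_iff_contDiffAt]
  intro s
  rcases lt_or_ge s (1 / 3) with h | h
  · refine (contDiffAt_const (c := (1 : ℝ))).congr_of_eventuallyEq ?_
    filter_upwards [gt_mem_nhds h] with t ht using extendProfile_eq_one hρ ht.le
  rcases lt_or_ge (2 / 3) s with h' | h'
  · refine (contDiffAt_const (c := (0 : ℝ))).congr_of_eventuallyEq ?_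
    filter_upwards [lt_mem_nhds h'] with t ht using extendProfile_eq_zero hρ ht.le
  · have hI : Icc (0 : ℝ) 1 ∈ 𝓝 s := Icc_mem_nhds (by linarith) (by linarith)
    refine (hρ.smooth.contDiffAt hI).congr_of_eventuallyEq ?_
    filter_upwards [hI] with t ht using extendProfile_eq ht

theorem deriv_extendProfile_nonpos (hρ : IsTwistProfile ρ) (s : ℝ) :
    deriv (extendProfile ρ) s ≤ 0 := (antitone_extendProfile hρ).deriv_nonpos

theorem deriv_extendProfile_eq_zero (hρ : IsTwistProfile ρ) {s : ℝ} (hs : s < 1 / 3) :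
    deriv (extendProfile ρ) s = 0 := by
  have : extendProfile ρ =ᶠ[𝓝 s] fun _ => 1 := by
    filter_upwards [gt_mem_nhds hs] with t ht using extendProfile_eq_one hρ ht.le
  rw [this.deriv_eq, deriv_const]

/-- The vertical shift, as a function of `x y`, that turns the holonomy of the normal coordinates
across the positive `x`-axis into a smooth twist supported in `c₀ / 3 ≤ |x y| ≤ 2 c₀ / 3`. -/
def shift (ρ : ℝ → ℝ) (n : ℕ) (m : ℤ) (c₀ s : ℝ) : ℝ :=
  if m < 0 then -(m : ℝ) / n * extendProfile ρ (s / c₀)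
  else (m : ℝ) / n * (extendProfile ρ (-s / c₀) - 1)

variable (hρ : IsTwistProfile ρ) {n : ℕ} {m : ℤ} {c₀ : ℝ} (hc : 0 < c₀)
include hρ

theorem contDiff_shift : ContDiff ℝ ∞ (shift ρ n m c₀) := by
  have h := contDiff_extendProfile hρ
  by_cases hm : m < 0
  · have e : shift ρ n m c₀ = fun s => -(m : ℝ) / n * extendProfile ρ (s / c₀) :=
      funext fun s => if_pos hm
    rw [e]
    exact contDiff_const.mul (h.comp (contDiff_id.div_const _))
  · have e : shift ρ n m c₀ = fun s => (m : ℝ) / n * (extendProfile ρ (-s / c₀) - 1) :=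
      funext fun s => if_neg hm
    rw [e]
    exact contDiff_const.mul ((h.comp (contDiff_neg.div_const _)).sub contDiff_const)

include hc

theorem shift_eq_zero {s : ℝ} (hs : 2 * c₀ / 3 ≤ s) : shift ρ n m c₀ s = 0 := by
  unfold shift
  split_ifs with hm
  · rw [extendProfile_eq_zero hρ, mul_zero]
    rw [le_div_iff₀ hc]; linarith
  · rw [extendProfile_eq_one hρ, sub_self, mul_zero]
    rw [div_le_iff₀ hc]; linarith

theorem shift_eq_neg {s : ℝ} (hs : s ≤ -(2 * c₀ / 3)) : shift ρ n m c₀ s = -((m : ℝ) / n) := by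
  unfold shift
  split_ifs with hm
  · rw [extendProfile_eq_one hρ]
    · ring
    · rw [div_le_iff₀ hc]; linarith
  · rw [extendProfile_eq_zero hρ]
    · ring
    · rw [le_div_iff₀ hc]; linarith

/-- The slope of the shift has the sign opposite to `s`; this is why the annulus that carries the twist
depends on the sign of `m`. -/
theorem deriv_shift_aux (s : ℝ) : s * deriv (shift ρ n m c₀) s ≤ 0 ∧
    (deriv (shift ρ n m c₀) s ≠ 0 → c₀ / 3 ≤ |s|) := by
  have hd : Differentiable ℝ (extendProfile ρ) := (contDiff_extendProfile hρ).differentiable (by simp)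
  by_cases hm : m < 0
  · have e : shift ρ n m c₀ = fun s => -(m : ℝ) / n * extendProfile ρ (s / c₀) :=
      funext fun s => if_pos hm
    have h1 : HasDerivAt (shift ρ n m c₀)
        (-(m : ℝ) / n * (deriv (extendProfile ρ) (s / c₀) * (1 / c₀))) s := by
      rw [e]
      exact ((hd (s / c₀)).hasDerivAt.comp s ((hasDerivAt_id s).div_const c₀)).const_mul _
    rw [h1.deriv]
    have hm' : (m : ℝ) < 0 := by exact_mod_cast hm
    have hn : 0 ≤ -(m : ℝ) / n := div_nonneg (by linarith) (Nat.cast_nonneg n)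
    by_cases hs : s / c₀ < 1 / 3
    · rw [deriv_extendProfile_eq_zero hρ hs]
      simp
    · have hs' : c₀ / 3 ≤ s := by
        rw [not_lt, le_div_iff₀ hc] at hs; linarith
      have hs0 : 0 ≤ s := by linarith
      have h2 := deriv_extendProfile_nonpos hρ (s / c₀)
      have h3 : 0 ≤ 1 / c₀ := by positivity
      refine ⟨mul_nonpos_of_nonneg_of_nonpos hs0 (mul_nonpos_of_nonneg_of_nonpos hn
        (mul_nonpos_of_nonpos_of_nonneg h2 h3)), fun _ => ?_⟩
      rwa [abs_of_nonneg hs0]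
  · have e : shift ρ n m c₀ = fun s => (m : ℝ) / n * (extendProfile ρ (-s / c₀) - 1) :=
      funext fun s => if_neg hm
    have h1 : HasDerivAt (shift ρ n m c₀)
        ((m : ℝ) / n * (deriv (extendProfile ρ) (-s / c₀) * (-1 / c₀))) s := by
      rw [e]
      exact (((hd (-s / c₀)).hasDerivAt.comp s
        (((hasDerivAt_id s).neg).div_const c₀)).sub_const 1).const_mul _
    rw [h1.deriv]
    have hm' : 0 ≤ (m : ℝ) := by exact_mod_cast not_lt.1 hm
    have hn : 0 ≤ (m : ℝ) / n := div_nonneg hm' (Nat.cast_nonneg n)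
    by_cases hs : -s / c₀ < 1 / 3
    · rw [deriv_extendProfile_eq_zero hρ hs]
      simp
    · have hs' : c₀ / 3 ≤ -s := by
        rw [not_lt, le_div_iff₀ hc] at hs; linarith
      have hs0 : s ≤ 0 := by linarith
      have h2 := deriv_extendProfile_nonpos hρ (-s / c₀)
      have h3 : -1 / c₀ ≤ 0 := div_nonpos_of_nonpos_of_nonneg (by norm_num) hc.le
      refine ⟨mul_nonpos_of_nonpos_of_nonneg hs0 (mul_nonneg hn
        (mul_nonneg_of_nonpos_of_nonpos h2 h3)), fun _ => ?_⟩
      rw [abs_of_nonpos hs0]; exact hs'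

end profile

/-- The vertical shift applied in the coordinates of the `i`-th quadrant. -/
def quadShift (ρ : ℝ → ℝ) (n : ℕ) (m : ℤ) (c₀ : ℝ) (i : Fin 4) (w : ℝ × ℝ) : ℝ :=
  if |w.2| < w.1 then
    if i = 0 then shift ρ n m c₀ (w.1 * w.2)
    else if i = 3 then shift ρ n m c₀ (w.1 * w.2) + (m : ℝ) / n else 0
  else 0

/-- A function of `x y` by which the normal coordinates are sheared vertically. The sign of the slope
makes the shear preserve the cones; the third condition keeps it away from the faces `x y = 0`. -/
structure IsShear (c₀ : ℝ) (T : ℝ → ℝ) : Prop where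
  contDiff : ContDiff ℝ ∞ T
  mul_deriv_nonpos : ∀ s, s * deriv T s ≤ 0
  le_abs : ∀ s, deriv T s ≠ 0 → c₀ / 3 ≤ |s|

/-- Away from the origin, the shifts in the different quadrants and the holonomy combine locally to a
shear that depends smoothly on `x y`. -/
theorem exists_isShear {ρ : ℝ → ℝ} (hρ : IsTwistProfile ρ) {n : ℕ} {m : ℤ} {c₀ s₀ : ℝ} (hc : 0 < c₀)
    (hs₀ : 0 < s₀) (hsc : s₀ * s₀ = 2 * c₀ / 3) {i : Fin 4} {w : ℝ × ℝ} (hw : w ∈ quadrant i)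
    (hfar : s₀ < |w.1| ∨ s₀ < |w.2|) :
    ∃ T, IsShear c₀ T ∧ ((∀ s, T s = 0) ∨ |w.2| < w.1) ∧
      ∀ᶠ w' in 𝓝 w, ∀ j, w' ∈ quadrant j →
        holonomy ((m : ℝ) / n) i j + (quadShift ρ n m c₀ j w' : UnitAddCircle) =
          (T (w'.1 * w'.2) : UnitAddCircle) := by
  have hzero : IsShear c₀ (fun _ => 0) := ⟨contDiff_const, by simp, by simp⟩
  have hc1 : Continuous (fun w : ℝ × ℝ => w.1) := continuous_fst
  have hc2 : Continuous (fun w : ℝ × ℝ => w.2) := continuous_snd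
  rcases lt_trichotomy |w.2| w.1 with h | h | h
  · have hx : 0 < w.1 := (abs_nonneg _).trans_lt h
    have hs : ∀ s, HasDerivAt (shift ρ n m c₀) (deriv (shift ρ n m c₀) s) s := fun s =>
      (((contDiff_shift hρ (n := n) (m := m) (c₀ := c₀)).differentiable (by simp)) s).hasDerivAt
    have hd : ∀ (κ s : ℝ), deriv (fun s => shift ρ n m c₀ s + κ) s = deriv (shift ρ n m c₀) s :=
      fun κ s => ((hs s).add_const κ).deriv
    have hsh : ∀ κ : ℝ, IsShear c₀ (fun s => shift ρ n m c₀ s + κ) := fun κ =>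
      ⟨(contDiff_shift hρ).add contDiff_const, fun s => by
        rw [hd]; exact (deriv_shift_aux hρ hc s).1, fun s => by
        rw [hd]; exact (deriv_shift_aux hρ hc s).2⟩
    refine ⟨_, hsh (if i = 0 then 0 else (m : ℝ) / n), Or.inr h, ?_⟩
    have hn : ∀ᶠ w' : ℝ × ℝ in 𝓝 w, |w'.2| < w'.1 :=
      (isOpen_lt hc2.abs hc1).mem_nhds h
    filter_upwards [hn] with w' hw' j hj
    have hx' : 0 < w'.1 := (abs_nonneg _).trans_lt hw'
    have hi : i = 0 ∨ i = 3 := by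
      revert hw; fin_cases i <;> simp [quadrant] <;> intros <;> linarith
    have hj' : j = 0 ∨ j = 3 := by
      revert hj; fin_cases j <;> simp [quadrant] <;> intros <;> linarith
    rw [quadShift, if_pos hw']
    rcases hi with rfl | rfl <;> rcases hj' with rfl | rfl <;>
      simp [holonomy, add_comm]
  · have hx : 0 < w.1 := by
      rcases hfar with h1 | h1
      · rw [abs_of_nonneg (h ▸ abs_nonneg _)] at h1; linarith
      · linarith
    have hy : w.2 ≠ 0 := by
      intro h0
      rw [h0, abs_zero] at h; linarith
    have hx0 : s₀ < w.1 := by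
      rcases hfar with h1 | h1
      · rwa [abs_of_pos hx] at h1
      · rwa [h] at h1
    refine ⟨_, hzero, Or.inl fun _ => rfl, ?_⟩
    have hn1 : ∀ᶠ w' : ℝ × ℝ in 𝓝 w, 0 < w'.1 := (isOpen_lt continuous_const hc1).mem_nhds hx
    rcases lt_or_gt_of_ne hy with hy | hy
    · have hn2 : ∀ᶠ w' : ℝ × ℝ in 𝓝 w, w'.2 < 0 := (isOpen_lt hc2 continuous_const).mem_nhds hy
      have hn3 : ∀ᶠ w' : ℝ × ℝ in 𝓝 w, w'.1 * w'.2 < -(2 * c₀ / 3) :=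
        (isOpen_lt (hc1.mul hc2) continuous_const).mem_nhds (by
          rw [abs_of_neg hy] at h
          show w.1 * w.2 < _
          have : w.2 = -w.1 := by linarith
          rw [this]; nlinarith)
      have hi : i = 3 := by revert hw; fin_cases i <;> simp [quadrant] <;> intros <;> linarith
      filter_upwards [hn1, hn2, hn3] with w' h1 h2 h3 j hj
      have hj' : j = 3 := by revert hj; fin_cases j <;> simp [quadrant] <;> intros <;> linarith
      subst hi hj'
      rw [holonomy_self, zero_add, quadShift]
      by_cases h4 : |w'.2| < w'.1
      · rw [if_pos h4, if_neg (by decide), if_pos rfl, shift_eq_neg hρ hc h3.le, neg_add_cancel]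
      · rw [if_neg h4]
    · have hn2 : ∀ᶠ w' : ℝ × ℝ in 𝓝 w, 0 < w'.2 := (isOpen_lt continuous_const hc2).mem_nhds hy
      have hn3 : ∀ᶠ w' : ℝ × ℝ in 𝓝 w, 2 * c₀ / 3 < w'.1 * w'.2 :=
        (isOpen_lt continuous_const (hc1.mul hc2)).mem_nhds (by
          rw [abs_of_pos hy] at h
          show _ < w.1 * w.2
          rw [h]; nlinarith)
      have hi : i = 0 := by revert hw; fin_cases i <;> simp [quadrant] <;> intros <;> linarith
      filter_upwards [hn1, hn2, hn3] with w' h1 h2 h3 j hj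
      have hj' : j = 0 := by revert hj; fin_cases j <;> simp [quadrant] <;> intros <;> linarith
      subst hi hj'
      rw [holonomy_self, zero_add, quadShift]
      by_cases h4 : |w'.2| < w'.1
      · rw [if_pos h4, if_pos rfl, shift_eq_zero hρ hc h3.le]
      · rw [if_neg h4]
  · refine ⟨_, hzero, Or.inl fun _ => rfl, ?_⟩
    have hn : ∀ᶠ w' : ℝ × ℝ in 𝓝 w, w'.1 < |w'.2| := (isOpen_lt hc1 hc2.abs).mem_nhds h
    have hn1 : ∀ᶠ w' : ℝ × ℝ in 𝓝 w, 0 < w.2 → 0 < w'.2 := by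
      by_cases h0 : 0 < w.2
      · exact (show ∀ᶠ w' : ℝ × ℝ in 𝓝 w, 0 < w'.2 from (isOpen_lt continuous_const hc2).mem_nhds h0).mono fun _ h _ => h
      · exact Filter.Eventually.of_forall fun _ h => absurd h h0
    have hn2 : ∀ᶠ w' : ℝ × ℝ in 𝓝 w, w.2 < 0 → w'.2 < 0 := by
      by_cases h0 : w.2 < 0
      · exact (show ∀ᶠ w' : ℝ × ℝ in 𝓝 w, w'.2 < 0 from (isOpen_lt hc2 continuous_const).mem_nhds h0).mono fun _ h _ => h
      · exact Filter.Eventually.of_forall fun _ h => absurd h h0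
    filter_upwards [hn, hn1, hn2] with w' h1 h2 h3 j hj
    rw [quadShift, if_neg (not_lt.2 h1.le)]
    have hol : holonomy ((m : ℝ) / n) i j = 0 := by
      unfold holonomy
      split_ifs with h4 h5
      · exfalso
        obtain ⟨rfl, rfl⟩ := h4
        have h6 : 0 ≤ w.1 ∧ w.2 ≤ 0 := hw
        have h7 : 0 ≤ w'.1 ∧ 0 ≤ w'.2 := hj
        rw [abs_of_nonpos h6.2] at h
        linarith [h3 (by linarith)]
      · exfalso
        obtain ⟨rfl, rfl⟩ := h5
        have h6 : 0 ≤ w.1 ∧ 0 ≤ w.2 := hw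
        have h7 : 0 ≤ w'.1 ∧ w'.2 ≤ 0 := hj
        rw [abs_of_nonneg h6.2] at h
        linarith [h2 (by linarith)]
      · rfl
    rw [hol, zero_add]

/-- The vertical shear of `ℝ³` by a function of `x y`. -/
def shear (T : ℝ → ℝ) (u : ℝ³) : ℝ³ := (u.1, u.2.1, u.2.2 + T (u.1 * u.2.1))

theorem contDiff_shear {T : ℝ → ℝ} (hT : ContDiff ℝ ∞ T) : ContDiff ℝ ∞ (shear T) := by
  unfold shear
  have h1 : ContDiff ℝ ∞ (fun u : ℝ³ => u.1) := contDiff_fst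
  have h2 : ContDiff ℝ ∞ (fun u : ℝ³ => u.2.1) := contDiff_fst.comp contDiff_snd
  have h3 : ContDiff ℝ ∞ (fun u : ℝ³ => u.2.2) := contDiff_snd.comp contDiff_snd
  exact h1.prodMk (h2.prodMk (h3.add (hT.comp (h1.mul h2))))

/-- The shear as a diffeomorphism. -/
def shearDiffeo (T : ℝ → ℝ) (hT : ContDiff ℝ ∞ T) :
    Diffeomorph 𝓘(ℝ, ℝ³) 𝓘(ℝ, ℝ³) ℝ³ ℝ³ ∞ where
  toFun := shear T
  invFun := shear (-T)
  left_inv u := by simp [shear]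
  right_inv u := by simp [shear]
  contMDiff_toFun := (contDiff_shear hT).contMDiff
  contMDiff_invFun := (contDiff_shear hT.neg).contMDiff

theorem hasFDerivAt_shear {T : ℝ → ℝ} (hT : ContDiff ℝ ∞ T) (u : ℝ³) :
    ∃ L : ℝ³ →L[ℝ] ℝ³, HasFDerivAt (shear T) L u ∧ ∀ v : ℝ³,
      L v = (v.1, v.2.1, v.2.2 + deriv T (u.1 * u.2.1) * (u.2.1 * v.1 + u.1 * v.2.1)) := by
  have h1 : HasFDerivAt (fun u : ℝ³ => u.1) (ContinuousLinearMap.fst ℝ ℝ (ℝ × ℝ)) u :=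
    hasFDerivAt_fst
  have h2 : HasFDerivAt (fun u : ℝ³ => u.2.1)
    ((ContinuousLinearMap.fst ℝ ℝ ℝ).comp (ContinuousLinearMap.snd ℝ ℝ (ℝ × ℝ))) u :=
    hasFDerivAt_fst.comp u hasFDerivAt_snd
  have h3 : HasFDerivAt (fun u : ℝ³ => u.2.2)
    ((ContinuousLinearMap.snd ℝ ℝ ℝ).comp (ContinuousLinearMap.snd ℝ ℝ (ℝ × ℝ))) u :=
    hasFDerivAt_snd.comp u hasFDerivAt_snd
  have h4 := ((hT.differentiable (by simp)) (u.1 * u.2.1)).hasDerivAt.comp_hasFDerivAt u (h1.mul h2)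
  refine ⟨_, h1.prodMk (h2.prodMk (h3.add h4)), fun v => ?_⟩
  simp
  ring

theorem IsLocalDiffeomorphAt.trans {E H E' H' E'' H'' : Type*} [NormedAddCommGroup E]
    [NormedSpace ℝ E] [TopologicalSpace H] [NormedAddCommGroup E'] [NormedSpace ℝ E']
    [TopologicalSpace H'] [NormedAddCommGroup E''] [NormedSpace ℝ E''] [TopologicalSpace H'']
    {I : ModelWithCorners ℝ E H} {J : ModelWithCorners ℝ E' H'} {K : ModelWithCorners ℝ E'' H''}
    {X X' X'' : Type*} [TopologicalSpace X] [ChartedSpace H X] [TopologicalSpace X']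
    [ChartedSpace H' X'] [TopologicalSpace X''] [ChartedSpace H'' X''] {f : X → X'} {g : X' → X''}
    {x : X} (hf : IsLocalDiffeomorphAt I J ∞ f x) (hg : IsLocalDiffeomorphAt J K ∞ g (f x)) :
    IsLocalDiffeomorphAt I K ∞ (g ∘ f) x := by
  obtain ⟨Φ, hx, heq⟩ := hf
  obtain ⟨Ψ, hy, heq'⟩ := hg
  refine ⟨Φ.trans Ψ, by simp [hx, ← heq.eq_of_mem hx, hy], ?_⟩
  intro y ⟨hyl, hyr⟩
  have hfy : f y ∈ Ψ.source := by rwa [heq.eq_of_mem hyl]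
  simp [← heq.eq_of_mem hyl, ← heq'.eq_of_mem hfy]

/-! ### The glueing map around the boundary -/

namespace NormalCoordinates
variable (C : NormalCoordinates A n k m)

/-- The data of a glueing: `γ` is periodic, `ρ` is a twist profile, and the cross-shaped region of
sizes `r₁`, `r₂` lies in the range of the normal coordinates. -/
structure IsGlueingData (ρ : ℝ → ℝ) (r₁ r₂ : ℝ) : Prop where
  isPeriodicOrbit : IsPeriodicOrbit φ γ
  isTwistProfile : IsTwistProfile ρ
  one_le_n : 1 ≤ n
  one_le_k : 1 ≤ k
  pos : 0 < r₂
  lt : r₂ < r₁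
  lt_rad : r₁ < C.rad

/-- A size of boxes contained in the cross-shaped region and inside which the twist vanishes. -/
def coreSize (r₁ r₂ : ℝ) : ℝ := Real.sqrt (2 * (r₁ * r₂) / 3)

/-- The planar ring on which the glueing map is extended. -/
def ringPlane (R r₁ r₂ : ℝ) : Set (ℝ × ℝ) :=
  {w | |w.1| < R ∧ |w.2| < R ∧ (coreSize r₁ r₂ < |w.1| ∨ coreSize r₁ r₂ < |w.2|)}

theorem isOpen_ringPlane (R r₁ r₂ : ℝ) : IsOpen (ringPlane R r₁ r₂) := by
  have e1 : IsOpen {w : ℝ × ℝ | |w.1| < R} := isOpen_lt (by fun_prop) continuous_const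
  have e2 : IsOpen {w : ℝ × ℝ | |w.2| < R} := isOpen_lt (by fun_prop) continuous_const
  have e3 : IsOpen {w : ℝ × ℝ | coreSize r₁ r₂ < |w.1|} := isOpen_lt continuous_const (by fun_prop)
  have e4 : IsOpen {w : ℝ × ℝ | coreSize r₁ r₂ < |w.2|} := isOpen_lt continuous_const (by fun_prop)
  exact e1.inter (e2.inter (e3.union e4))

/-- The region around the boundary of the cross on which the glueing map is extended. -/
def ringDom (r₁ r₂ : ℝ) : Set M₀ :=
  {q | q ∈ C.dom ∧ (C.xc q, C.yc q) ∈ ringPlane C.rad r₁ r₂}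

theorem isOpen_ringDom (r₁ r₂ : ℝ) : IsOpen (C.ringDom r₁ r₂) :=
  isOpen_iff_mem_nhds.2 fun _ hq => C.eventually_mem_dom_and hq.1 (isOpen_ringPlane _ r₁ r₂) hq.2

open Classical in
/-- The extension of the glueing map to the ring around the boundary of the cross. -/
def glueMap (ρ : ℝ → ℝ) (r₁ r₂ : ℝ) (q : M₀) : AffineModel :=
  if h : ∃ i, q ∈ C.quad i then
    C.chart h.choose q + (0, 0, (quadShift ρ n m (r₁ * r₂) h.choose (C.xc q, C.yc q) : UnitAddCircle))
  else 0

/-- `g` is a local lift of the extended glueing map, obtained by composing normal coordinates with the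
shear `T`. -/
structure IsGlueLift (ρ : ℝ → ℝ) (r₁ r₂ : ℝ) (g : M₀ → ℝ³) (T : ℝ → ℝ)
    (q : M₀) : Prop where
  isLocalDiffeomorphAt : IsLocalDiffeomorphAt 𝓔 𝓘(ℝ, ℝ³) ∞ g q
  mem : q ∈ C.ringDom r₁ r₂
  liftProj_eq : liftProj (g q) = C.glueMap ρ r₁ r₂ q
  fst_eq : (g q).1 = C.xc q
  snd_eq : (g q).2.1 = C.yc q
  field : vderiv g q (A.X q) = affineField lam n k (g q)
  apply_Es : ∀ v ∈ A.Es q, vderiv g q v =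
    (vderiv C.xc q v, 0, deriv T (C.xc q * C.yc q) * (C.yc q * vderiv C.xc q v))
  apply_Eu : ∀ v ∈ A.Eu q, vderiv g q v =
    (0, vderiv C.yc q v, deriv T (C.xc q * C.yc q) * (C.xc q * vderiv C.yc q v))
  exists_Es : ∀ a : ℝ, ∃ v ∈ A.Es q, vderiv C.xc q v = a
  exists_Eu : ∀ a : ℝ, ∃ v ∈ A.Eu q, vderiv C.yc q v = a

variable {C} {ρ : ℝ → ℝ} {r₁ r₂ : ℝ}

namespace IsGlueingData
variable (S : C.IsGlueingData ρ r₁ r₂)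
include S

theorem pos₁ : 0 < r₁ := S.pos.trans S.lt

theorem mul_pos : 0 < r₁ * r₂ := _root_.mul_pos S.pos₁ S.pos

theorem coreSize_pos : 0 < coreSize r₁ r₂ := Real.sqrt_pos.2 (by have := S.mul_pos; positivity)

theorem coreSize_sq : coreSize r₁ r₂ * coreSize r₁ r₂ = 2 * (r₁ * r₂) / 3 :=
  Real.mul_self_sqrt (by have := S.mul_pos; positivity)

theorem coreSize_lt : coreSize r₁ r₂ < r₁ := by
  have h1 := S.coreSize_sq
  have h2 : r₁ * r₂ < r₁ * r₁ := mul_lt_mul_of_pos_left S.lt S.pos₁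
  have h3 := S.pos₁
  have h4 := S.mul_pos
  by_contra h
  push Not at h
  nlinarith

theorem mem_ringPlane_of_boundary {w : ℝ × ℝ} (h : w ∈ crossRegion r₁ r₂)
    (h' : w ∉ crossInterior r₁ r₂) : w ∈ ringPlane C.rad r₁ r₂ := by
  refine ⟨h.1.trans_lt S.lt_rad, h.2.1.trans_lt S.lt_rad, ?_⟩
  by_contra hn
  push Not at hn
  refine h' ⟨hn.1.trans_lt S.coreSize_lt, hn.2.trans_lt S.coreSize_lt, ?_⟩
  have h1 := S.coreSize_sq
  have h4 := S.mul_pos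
  rw [abs_mul]
  have := mul_le_mul hn.1 hn.2 (abs_nonneg _) S.coreSize_pos.le
  linarith

/-- The shift compensates the holonomy: the shifted charts agree on common faces. -/
theorem chart_add_eq {q : M₀} (hq : q ∈ C.ringDom r₁ r₂) {i j : Fin 4}
    (hi : q ∈ C.quad i) (hj : q ∈ C.quad j) :
    C.chart j q + (0, 0, (quadShift ρ n m (r₁ * r₂) j (C.xc q, C.yc q) : UnitAddCircle)) =
    C.chart i q + (0, 0, (quadShift ρ n m (r₁ * r₂) i (C.xc q, C.yc q) : UnitAddCircle)) := by
  obtain ⟨T, -, -, hT⟩ := exists_isShear S.isTwistProfile (n := n) (m := m) S.mul_pos S.coreSize_pos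
    S.coreSize_sq (C.mem_quadrant_xy hi) hq.2.2.2
  have h0 := hT.self_of_nhds
  have h1 := h0 j (C.mem_quadrant_xy hj)
  have h2 := h0 i (C.mem_quadrant_xy hi)
  rw [holonomy_self, zero_add] at h2
  obtain ⟨f, hf⟩ := C.exists_isLift hi
  have h3 := hf.self_of_nhds
  rw [h3.chart_eq j hj, ← h3.liftProj_eq hi, h2, ← h1, add_assoc]
  simp

theorem glueMap_eq {q : M₀} (hq : q ∈ C.ringDom r₁ r₂) {i : Fin 4}
    (hi : q ∈ C.quad i) : C.glueMap ρ r₁ r₂ q =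
    C.chart i q + (0, 0, (quadShift ρ n m (r₁ * r₂) i (C.xc q, C.yc q) : UnitAddCircle)) := by
  have h : ∃ i, q ∈ C.quad i := ⟨i, hi⟩
  rw [glueMap, dif_pos h]
  exact S.chart_add_eq hq hi h.choose_spec

theorem glueMap_fst {q : M₀} (hq : q ∈ C.ringDom r₁ r₂) :
    (C.glueMap ρ r₁ r₂ q).1 = C.xc q ∧ (C.glueMap ρ r₁ r₂ q).2.1 = C.yc q := by
  obtain ⟨i, hi⟩ := C.mem_dom_iff.1 hq.1
  rw [S.glueMap_eq hq hi, C.xc_eq hi, C.yc_eq hi]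
  simp

theorem injOn_glueMap : InjOn (C.glueMap ρ r₁ r₂) (C.ringDom r₁ r₂) := by
  intro q hq q' hq' h
  obtain ⟨i, hi⟩ := C.mem_dom_iff.1 hq.1
  have h1 := S.glueMap_fst hq
  have h2 := S.glueMap_fst hq'
  rw [h] at h1
  have hx : C.xc q = C.xc q' := h1.1.symm.trans h2.1
  have hy : C.yc q = C.yc q' := h1.2.symm.trans h2.2
  have hi' : q' ∈ C.quad i :=
    C.mem_quad_of_mem_quadrant hq'.1 (by rw [← hx, ← hy]; exact C.mem_quadrant_xy hi)
  rw [S.glueMap_eq hq hi, S.glueMap_eq hq' hi', hx, hy] at h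
  exact C.injOn_chart i hi hi' (add_right_cancel h)

theorem exists_glueMap_eq {c : AffineModel} (hc : (c.1, c.2.1) ∈ ringPlane C.rad r₁ r₂) :
    ∃ q ∈ C.ringDom r₁ r₂, C.glueMap ρ r₁ r₂ q = c := by
  obtain ⟨i, hi⟩ := exists_mem_quadrant (c.1, c.2.1)
  obtain ⟨q, hq, hqc⟩ := C.exists_chart_eq i
    (c - (0, 0, (quadShift ρ n m (r₁ * r₂) i (c.1, c.2.1) : UnitAddCircle))) (by simpa using hi)
    (by
      rintro ⟨h1, h2⟩
      simp only [Prod.fst_sub, sub_zero, Prod.snd_sub] at h1 h2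
      have h3 := hc.2.2
      rw [h1, h2] at h3
      have := S.coreSize_pos
      simp at h3; linarith)
    (by simpa using hc.1) (by simpa using hc.2.1)
  have hx : C.xc q = c.1 := by rw [C.xc_eq hq, hqc]; simp
  have hy : C.yc q = c.2.1 := by rw [C.yc_eq hq, hqc]; simp
  have hqD : q ∈ C.ringDom r₁ r₂ := ⟨C.mem_dom_of_quad hq, by rw [hx, hy]; exact hc⟩
  exact ⟨q, hqD, by rw [S.glueMap_eq hqD hq, hqc, hx, hy, sub_add_cancel]⟩

/-- Near each point of the ring, the glueing map lifts to a shear of normal coordinates, and the shear is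
trivial away from the sector `|y| < x`. -/
theorem exists_isGlueLift {q : M₀} (hq : q ∈ C.ringDom r₁ r₂) :
    ∃ g T, IsShear (r₁ * r₂) T ∧ ((∀ s, T s = 0) ∨ |C.yc q| < C.xc q) ∧
      ∀ᶠ q' in 𝓝 q, C.IsGlueLift ρ r₁ r₂ g T q' := by
  obtain ⟨i, f, hi, hf⟩ := C.exists_isLift' hq.1
  obtain ⟨T, hT, hT0, hTe⟩ := exists_isShear S.isTwistProfile (n := n) (m := m) S.mul_pos S.coreSize_pos
    S.coreSize_sq (C.mem_quadrant_xy hi) hq.2.2.2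
  refine ⟨shear T ∘ f, T, hT, hT0, ?_⟩
  filter_upwards [hf.eventually_nhds, (C.continuousAt_xy hq.1).eventually hTe,
    (C.isOpen_ringDom r₁ r₂).mem_nhds hq] with q' hf' hT' hq'
  have h0 := hf'.self_of_nhds
  obtain ⟨j, hj⟩ := C.mem_dom_iff.1 hq'.1
  obtain ⟨L, hL, hLv⟩ := hasFDerivAt_shear hT.contDiff (f q')
  have hd : ∀ v, vderiv (shear T ∘ f) q' v = L (vderiv f q' v) := by
    intro v
    have h1 : HasMFDerivAt 𝓘(ℝ, ℝ³) 𝓘(ℝ, ℝ³) (shear T) (f q') L := hL.hasMFDerivAt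
    have h2 := h1.comp q' (h0.isLocalDiffeomorphAt.mdifferentiableAt (by simp)).hasMFDerivAt
    rw [vderiv, h2.mfderiv]
    rfl
  have hX : vderiv f q' (A.X q') = affineField lam n k (f q') := h0.field
  have hx := C.mfderiv_xc_eq hf'
  have hy := C.mfderiv_yc_eq hf'
  refine ⟨?_, hq', ?_, h0.fst_eq, h0.snd_eq, ?_, ?_, ?_, ?_, ?_⟩
  · exact h0.isLocalDiffeomorphAt.trans ((shearDiffeo T hT.contDiff).isLocalDiffeomorph (f q'))
  · rw [S.glueMap_eq hq' hj, h0.chart_eq j hj, add_assoc]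
    have h3 := hT' j (C.mem_quadrant_xy hj)
    simp only [Prod.mk_add_mk, add_zero, h3, h0.fst_eq, h0.snd_eq, Function.comp, shear]
    simp [liftProj, h0.fst_eq, h0.snd_eq]
  · rw [hd, hLv, hX]
    simp only [affineField, shear, Function.comp]
    ext
    · rfl
    · rfl
    · show _ + deriv T _ * _ = _; ring
  · intro v hv
    obtain ⟨a, ha⟩ := h0.apply_Es hv
    rw [hd, hLv, hx, ha, h0.fst_eq, h0.snd_eq]
    simp
  · intro v hv
    obtain ⟨a, ha⟩ := h0.apply_Eu hv
    rw [hd, hLv, hy, ha, h0.fst_eq, h0.snd_eq]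
    simp
  · intro a
    obtain ⟨v, hv, h⟩ := h0.exists_Es a
    exact ⟨v, hv, by rw [hx, h]⟩
  · intro a
    obtain ⟨v, hv, h⟩ := h0.exists_Eu a
    exact ⟨v, hv, by rw [hy, h]⟩

/-- On the boundary of the cross, the extended glueing map is the prescribed one. -/
theorem twist_eq_glueMap {q : M₀} (hq : q ∈ C.cross r₁ r₂) (hq' : q ∉ C.crossInt r₁ r₂)
    {i : Fin 4} (hi : q ∈ C.quad i) :
    twist ρ n m r₁ r₂ i (C.chart i q) = C.glueMap ρ r₁ r₂ q := by
  have hD : q ∈ C.ringDom r₁ r₂ :=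
    ⟨hq.1, S.mem_ringPlane_of_boundary hq.2 fun h => hq' ⟨hq.1, h⟩⟩
  rw [S.glueMap_eq hD hi]
  have hx := C.xc_eq hi
  have hy := C.yc_eq hi
  have hquad := C.mem_quadrant_xy hi
  obtain ⟨-, hcr⟩ := hq
  have hni : (C.xc q, C.yc q) ∉ crossInterior r₁ r₂ := fun h => hq' ⟨hD.1, h⟩
  generalize hcc : C.chart i q = c at *
  obtain ⟨x, y, z⟩ := c
  simp only at hx hy
  rw [hx, hy] at hcr hni hquad
  rw [hx, hy]
  have hr1 := S.pos₁
  have hr2 := S.pos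
  have hlt := S.lt
  have hne : r₁ ≠ 0 := hr1.ne'
  obtain ⟨hc1, hc2, hc3⟩ := hcr
  simp only at hc1 hc2 hc3
  -- on the part of the boundary with `|y| < x` and `x < r₁`, one has `|x y| = r₁ r₂`
  have hb : |y| < x → x ≠ r₁ → |x * y| = r₁ * r₂ := by
    intro h h'
    refine le_antisymm hc3 (not_lt.1 fun h4 => hni ⟨?_, ?_, h4⟩)
    · rw [abs_of_pos ((abs_nonneg y).trans_lt h)] at hc1 ⊢
      exact lt_of_le_of_ne hc1 h'
    · exact h.trans_le ((le_abs_self x).trans hc1)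
  have hxr : x = r₁ → |y| ≤ r₂ := by
    rintro rfl
    rw [abs_mul, abs_of_pos hr1] at hc3
    exact le_of_mul_le_mul_left hc3 hr1
  have hzero : ∀ s : ℝ, s = 0 → (x, y, z) = (x, y, z) + ((0, 0, (s : UnitAddCircle)) : AffineModel) := by
    rintro _ rfl; simp
  have htw : ∀ s s' : ℝ, s = s' → (x, y, z + (s : UnitAddCircle)) =
      (x, y, z) + ((0, 0, (s' : UnitAddCircle)) : AffineModel) := by
    rintro s _ rfl; simp
  have hm : m < 0 → |(m : ℝ)| = -(m : ℝ) := fun h => abs_of_neg (by exact_mod_cast h)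
  have hm' : 0 < m → |(m : ℝ)| = (m : ℝ) := fun h => abs_of_pos (by exact_mod_cast h)
  unfold twist quadShift
  simp only
  by_cases hyx : |y| < x
  swap
  · have hxy : x ≠ r₁ := fun h => hyx ((hxr h).trans_lt (hlt.trans_eq h.symm))
    rw [if_neg hyx, if_neg (fun h => hxy h.2.2.1), if_neg (fun h => hxy h.2.2.1)]
    exact hzero 0 rfl
  have hx0 : 0 < x := (abs_nonneg y).trans_lt hyx
  rw [if_pos hyx]
  have hdiv : x = r₁ → x * y / (r₁ * r₂) = y / r₂ := by
    rintro rfl; exact mul_div_mul_left _ _ hne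
  have hdiv' : x = r₁ → -(x * y) / (r₁ * r₂) = -y / r₂ := by
    rintro rfl; rw [← mul_neg]; exact mul_div_mul_left _ _ hne
  rcases lt_or_ge m 0 with hm0 | hm0
  · rw [if_neg (fun h : 0 < m ∧ _ => absurd h.1 hm0.not_gt)]
    by_cases hi0 : i = 0
    · subst hi0
      have hy0 : 0 ≤ y := hquad.2
      rw [if_pos rfl]
      by_cases hxr1 : x = r₁
      · have hyr := hxr hxr1
        rw [abs_of_nonneg hy0] at hyr
        rw [if_pos ⟨hm0, rfl, hxr1, hy0, hyr⟩]
        refine htw _ _ ?_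
        rw [shift, if_pos hm0, hdiv hxr1, hm hm0, extendProfile_eq]
        exact ⟨div_nonneg hy0 hr2.le, div_le_one_of_le₀ hyr hr2.le⟩
      · rw [if_neg fun h => hxr1 h.2.2.1]
        refine hzero _ (shift_eq_zero S.isTwistProfile S.mul_pos ?_)
        have := hb hyx hxr1
        rw [abs_of_nonneg (mul_nonneg hx0.le hy0)] at this
        have := S.mul_pos
        linarith
    · rw [if_neg fun h => hi0 h.2.1, if_neg hi0]
      by_cases hi3 : i = 3
      · subst hi3
        rw [if_pos rfl]
        refine hzero _ ?_
        rw [shift, if_pos hm0, extendProfile_eq_one S.isTwistProfile]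
        · ring
        · have : x * y / (r₁ * r₂) ≤ 0 :=
            div_nonpos_of_nonpos_of_nonneg (mul_nonpos_of_nonneg_of_nonpos hx0.le hquad.2) S.mul_pos.le
          linarith
      · rw [if_neg hi3]; exact hzero 0 rfl
  · rw [if_neg (fun h : m < 0 ∧ _ => absurd h.1 hm0.not_gt)]
    by_cases hi0 : i = 0
    · subst hi0
      rw [if_pos rfl, if_neg fun h => absurd h.2.1 (by decide)]
      refine hzero _ ?_
      rw [shift, if_neg hm0.not_gt, extendProfile_eq_one S.isTwistProfile]
      · ring
      · have : -(x * y) / (r₁ * r₂) ≤ 0 :=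
          div_nonpos_of_nonpos_of_nonneg (neg_nonpos.2 (mul_nonneg hx0.le hquad.2)) S.mul_pos.le
        linarith
    · rw [if_neg hi0]
      by_cases hi3 : i = 3
      · subst hi3
        have hy0 : y ≤ 0 := hquad.2
        rw [if_pos rfl]
        by_cases hxr1 : x = r₁
        · have hyr := hxr hxr1
          rw [abs_of_nonpos hy0] at hyr
          rcases hm0.eq_or_lt with rfl | hm1
          · rw [if_neg fun h => absurd h.1 (lt_irrefl _)]
            exact hzero _ (by simp [shift])
          · rw [if_pos ⟨hm1, rfl, hxr1, by linarith, hy0⟩]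
            refine htw _ _ ?_
            rw [shift, if_neg hm0.not_gt, hdiv' hxr1, hm' hm1, extendProfile_eq]
            · ring
            · exact ⟨div_nonneg (by linarith) hr2.le, div_le_one_of_le₀ hyr hr2.le⟩
        · rw [if_neg fun h => hxr1 h.2.2.1]
          refine hzero _ ?_
          rw [shift_eq_neg S.isTwistProfile S.mul_pos, neg_add_cancel]
          have := hb hyx hxr1
          rw [abs_of_nonpos (mul_nonpos_of_nonneg_of_nonpos hx0.le hy0)] at this
          have := S.mul_pos
          linarith
      · rw [if_neg (fun h => hi3 h.2.1), if_neg hi3]; exact hzero 0 rfl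

end IsGlueingData
end NormalCoordinates

/-! ### Topology of the glued space -/

theorem isOpenMap_liftProj : IsOpenMap liftProj := by
  have h : IsOpenMap (fun t : ℝ => (t : UnitAddCircle)) := QuotientAddGroup.isOpenMap_coe
  exact IsOpenMap.id.prodMap (IsOpenMap.id.prodMap h)

namespace NormalCoordinates
variable (C : NormalCoordinates A n k m)
  (ρ : ℝ → ℝ) (r₁ r₂ : ℝ)

open Classical in
/-- The inclusion of the cross `𝕍(r₁, r₂)`, with an irrelevant value at the points
outside. -/
def affineMap [Nonempty (C.GluedSpace ρ r₁ r₂)] (c : AffineModel) : C.GluedSpace ρ r₁ r₂ :=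
  if h : c ∈ affineCross r₁ r₂ then C.inclAffine ρ r₁ r₂ ⟨c, h⟩ else Classical.arbitrary _

open Classical in
/-- The inclusion of `M_R(r₁, r₂)`, extended to the ring around its boundary by the glueing map. -/
def outerMap [Nonempty (C.GluedSpace ρ r₁ r₂)] (q : M₀) : C.GluedSpace ρ r₁ r₂ :=
  if h : (q : M) ∈ C.outer r₁ r₂ then C.inclOuter ρ r₁ r₂ ⟨q, h⟩
  else C.affineMap ρ r₁ r₂ (C.glueMap ρ r₁ r₂ q)

/-- The complement of the box of size `coreSize r₁ r₂`, the domain of `outerMap`. -/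
def outerDom : Set M₀ := (C.box (coreSize r₁ r₂))ᶜ

/-- The interior of the cross `𝕍(r₁, r₂)`. -/
def affineInt (r₁ r₂ : ℝ) : Set AffineModel := {c | (c.1, c.2.1) ∈ crossInterior r₁ r₂}

theorem isOpen_affineInt : IsOpen (affineInt r₁ r₂) :=
  (isOpen_crossInterior r₁ r₂).preimage (by fun_prop)

theorem isClosed_affineCross : IsClosed (affineCross r₁ r₂) :=
  (isClosed_crossRegion r₁ r₂).preimage (by fun_prop)

theorem affineInt_subset : affineInt r₁ r₂ ⊆ affineCross r₁ r₂ :=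
  fun _ h => crossInterior_subset _ _ h

theorem isCompact_affineCross : IsCompact (affineCross r₁ r₂) := by
  have h : IsCompact ((Icc (-r₁) r₁ ×ˢ Icc (-r₁) r₁ ×ˢ univ : Set AffineModel)) :=
    isCompact_Icc.prod (isCompact_Icc.prod isCompact_univ)
  exact h.of_isClosed_subset (isClosed_affineCross r₁ r₂)
    fun c hc => ⟨abs_le.1 hc.1, abs_le.1 hc.2.1, trivial⟩

variable {C ρ r₁ r₂}

theorem isOpen_iff_preimage {Z : Set (C.GluedSpace ρ r₁ r₂)} :
    IsOpen Z ↔ IsOpen (C.inclOuter ρ r₁ r₂ ⁻¹' Z) ∧ IsOpen (C.inclAffine ρ r₁ r₂ ⁻¹' Z) := by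
  rw [show IsOpen Z ↔ IsOpen (Quot.mk (C.GlueRel ρ r₁ r₂) ⁻¹' Z) from
    (isQuotientMap_quot_mk.isOpen_preimage (s := Z)).symm, isOpen_sum_iff]
  rfl

theorem continuous_inclOuter : Continuous (C.inclOuter ρ r₁ r₂) :=
  continuous_def.2 fun _ h => (isOpen_iff_preimage.1 h).1

theorem continuous_inclAffine : Continuous (C.inclAffine ρ r₁ r₂) :=
  continuous_def.2 fun _ h => (isOpen_iff_preimage.1 h).2

theorem exists_incl_eq (a : C.GluedSpace ρ r₁ r₂) :
    (∃ x, C.inclOuter ρ r₁ r₂ x = a) ∨ ∃ c, C.inclAffine ρ r₁ r₂ c = a := by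
  obtain ⟨x | c, rfl⟩ := Quot.exists_rep a
  · exact Or.inl ⟨x, rfl⟩
  · exact Or.inr ⟨c, rfl⟩

namespace IsGlueingData
variable [T2Space M] (S : C.IsGlueingData ρ r₁ r₂)
include S

theorem zero_mem : (0 : AffineModel) ∈ affineInt r₁ r₂ := by
  refine ⟨?_, ?_, ?_⟩
  · simpa using S.pos₁
  · simpa using S.pos₁
  · simpa using S.mul_pos

theorem nonempty : Nonempty (C.GluedSpace ρ r₁ r₂) :=
  ⟨C.inclAffine ρ r₁ r₂ ⟨0, affineInt_subset r₁ r₂ S.zero_mem⟩⟩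

theorem mem_outer_iff {q : M₀} :
    (q : M) ∈ C.outer r₁ r₂ ↔ q ∉ C.crossInt r₁ r₂ :=
  C.mem_outer_iff S.isPeriodicOrbit S.pos S.lt S.lt_rad

theorem mem_ringDom_of_boundary {q : M₀} (h : q ∈ C.cross r₁ r₂)
    (h' : q ∉ C.crossInt r₁ r₂) : q ∈ C.ringDom r₁ r₂ :=
  ⟨h.1, S.mem_ringPlane_of_boundary h.2 fun h'' => h' ⟨h.1, h''⟩⟩

theorem glue_iff {q : M₀} {c : AffineModel} : C.Glue ρ r₁ r₂ q c ↔
    q ∈ C.cross r₁ r₂ ∧ q ∉ C.crossInt r₁ r₂ ∧ c = C.glueMap ρ r₁ r₂ q := by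
  rw [Glue, C.mem_frontier_outer_iff S.isPeriodicOrbit S.pos S.lt S.lt_rad, and_assoc]
  refine and_congr_right fun h1 => and_congr_right fun h2 => ?_
  constructor
  · rintro ⟨i, q', hq', h, rfl⟩
    rw [Subtype.ext h] at hq' ⊢
    exact S.twist_eq_glueMap h1 h2 hq'
  · rintro rfl
    obtain ⟨i, hi⟩ := C.mem_dom_iff.1 h1.1
    exact ⟨i, q, hi, rfl, (S.twist_eq_glueMap h1 h2 hi).symm⟩

theorem outer_notMem (x : C.outer r₁ r₂) : (x : M) ∉ γ :=
  fun h => C.outer_subset_compl S.isPeriodicOrbit S.pos S.lt S.lt_rad x.2 h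

theorem glue_left_unique {x x' : C.outer r₁ r₂} {c : AffineModel} (h : C.Glue ρ r₁ r₂ x c)
    (h' : C.Glue ρ r₁ r₂ x' c) : x = x' := by
  obtain ⟨h1, h2, h3⟩ := (S.glue_iff (q := ⟨x, S.outer_notMem x⟩)).1 h
  obtain ⟨h1', h2', h3'⟩ := (S.glue_iff (q := ⟨x', S.outer_notMem x'⟩)).1 h'
  have := S.injOn_glueMap (S.mem_ringDom_of_boundary h1 h2) (S.mem_ringDom_of_boundary h1' h2')
    (h3.symm.trans h3')
  exact Subtype.ext (congrArg (fun q : M₀ => (q : M)) this)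

theorem glue_right_unique {x : C.outer r₁ r₂} {c c' : AffineModel} (h : C.Glue ρ r₁ r₂ x c)
    (h' : C.Glue ρ r₁ r₂ x c') : c = c' := by
  obtain ⟨-, -, h3⟩ := (S.glue_iff (q := ⟨x, S.outer_notMem x⟩)).1 h
  obtain ⟨-, -, h3'⟩ := (S.glue_iff (q := ⟨x, S.outer_notMem x⟩)).1 h'
  rw [h3, h3']

/-- Each point of the glued space has a normal form: the point of `M_R(r₁, r₂)` if there is one, the
point of the cross otherwise. -/
theorem exists_normalForm : ∃ K : C.GluedSpace ρ r₁ r₂ → C.outer r₁ r₂ ⊕ affineCross r₁ r₂,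
    (∀ x, K (C.inclOuter ρ r₁ r₂ x) = Sum.inl x) ∧
    ∀ c : affineCross r₁ r₂, (∃ x : C.outer r₁ r₂, C.Glue ρ r₁ r₂ x c ∧
      K (C.inclAffine ρ r₁ r₂ c) = Sum.inl x) ∨
      ((∀ x : C.outer r₁ r₂, ¬ C.Glue ρ r₁ r₂ x c) ∧ K (C.inclAffine ρ r₁ r₂ c) = Sum.inr c) := by
  classical
  let K₀ : C.outer r₁ r₂ ⊕ affineCross r₁ r₂ → C.outer r₁ r₂ ⊕ affineCross r₁ r₂ :=
    Sum.elim Sum.inl fun c =>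
      if h : ∃ x : C.outer r₁ r₂, C.Glue ρ r₁ r₂ x c then Sum.inl h.choose else Sum.inr c
  refine ⟨Quot.lift K₀ ?_, fun x => rfl, fun c => ?_⟩
  · rintro _ _ ⟨x, c, h⟩
    have hex : ∃ x : C.outer r₁ r₂, C.Glue ρ r₁ r₂ x c := ⟨x, h⟩
    show Sum.inl x = dite _ _ _
    rw [dif_pos hex, S.glue_left_unique h hex.choose_spec]
  · by_cases hex : ∃ x : C.outer r₁ r₂, C.Glue ρ r₁ r₂ x c
    · exact Or.inl ⟨hex.choose, hex.choose_spec, dif_pos hex⟩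
    · exact Or.inr ⟨fun x h => hex ⟨x, h⟩, dif_neg hex⟩

theorem injective_inclOuter : Function.Injective (C.inclOuter ρ r₁ r₂) := by
  obtain ⟨K, hK, -⟩ := S.exists_normalForm
  intro x x' h
  have := congrArg K h
  rw [hK, hK] at this
  exact Sum.inl_injective this

theorem inclOuter_eq_iff {x : C.outer r₁ r₂} {c : affineCross r₁ r₂} :
    C.inclOuter ρ r₁ r₂ x = C.inclAffine ρ r₁ r₂ c ↔ C.Glue ρ r₁ r₂ x c := by
  constructor
  · obtain ⟨K, hK, hK'⟩ := S.exists_normalForm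
    intro h
    have := congrArg K h
    rw [hK] at this
    rcases hK' c with ⟨x', hx', h'⟩ | ⟨-, h'⟩
    · rw [h'] at this
      rwa [Sum.inl_injective this]
    · rw [h'] at this; cases this
  · exact fun h => Quot.sound (GlueRel.glue x c h)

theorem injective_inclAffine : Function.Injective (C.inclAffine ρ r₁ r₂) := by
  obtain ⟨K, hK, hK'⟩ := S.exists_normalForm
  intro c c' h
  have := congrArg K h
  rcases hK' c with ⟨x, hx, h1⟩ | ⟨-, h1⟩ <;> rcases hK' c' with ⟨x', hx', h2⟩ | ⟨-, h2⟩ <;>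
    rw [h1, h2] at this
  · obtain rfl := Sum.inl_injective this
    exact Subtype.ext (S.glue_right_unique hx hx')
  · cases this
  · cases this
  · exact Sum.inr_injective this

variable [Nonempty (C.GluedSpace ρ r₁ r₂)]

omit S [T2Space M] in
theorem affineMap_of_mem {c : AffineModel} (h : c ∈ affineCross r₁ r₂) :
    C.affineMap ρ r₁ r₂ c = C.inclAffine ρ r₁ r₂ ⟨c, h⟩ := dif_pos h

omit S [T2Space M] in
theorem outerMap_of_mem {q : M₀} (h : (q : M) ∈ C.outer r₁ r₂) :
    C.outerMap ρ r₁ r₂ q = C.inclOuter ρ r₁ r₂ ⟨q, h⟩ := dif_pos h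

theorem glueMap_mem_affineCross {q : M₀} (h : q ∈ C.ringDom r₁ r₂) :
    C.glueMap ρ r₁ r₂ q ∈ affineCross r₁ r₂ ↔ q ∈ C.cross r₁ r₂ := by
  have h1 := S.glueMap_fst h
  show ((C.glueMap ρ r₁ r₂ q).1, (C.glueMap ρ r₁ r₂ q).2.1) ∈ crossRegion r₁ r₂ ↔ _
  rw [h1.1, h1.2]
  exact ⟨fun h' => ⟨h.1, h'⟩, fun h' => h'.2⟩

theorem outerMap_eq_affineMap {q : M₀} (h : q ∈ C.ringDom r₁ r₂)
    (h' : q ∈ C.cross r₁ r₂) :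
    C.outerMap ρ r₁ r₂ q = C.affineMap ρ r₁ r₂ (C.glueMap ρ r₁ r₂ q) := by
  by_cases ho : (q : M) ∈ C.outer r₁ r₂
  · rw [outerMap_of_mem ho, affineMap_of_mem ((S.glueMap_mem_affineCross h).2 h'), S.inclOuter_eq_iff,
      S.glue_iff]
    exact ⟨h', S.mem_outer_iff.1 ho, rfl⟩
  · exact dif_neg ho

omit [Nonempty (C.GluedSpace ρ r₁ r₂)] in
theorem mem_crossInt_of_box {s : ℝ} (hs : s < r₁) (hs' : s * s < r₁ * r₂) {q : M₀}
    (h : q ∈ C.box s) : q ∈ C.crossInt r₁ r₂ := by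
  refine ⟨h.1, h.2.1.trans_lt hs, h.2.2.trans_lt hs, ?_⟩
  show |C.xc q * C.yc q| < _
  rw [abs_mul]
  exact (mul_le_mul h.2.1 h.2.2 (abs_nonneg _) ((abs_nonneg _).trans h.2.1)).trans_lt hs'

omit [Nonempty (C.GluedSpace ρ r₁ r₂)] in
theorem mem_outerDom_of_outer {q : M₀} (h : (q : M) ∈ C.outer r₁ r₂) :
    q ∈ C.outerDom r₁ r₂ := fun hb => S.mem_outer_iff.1 h (S.mem_crossInt_of_box S.coreSize_lt
      (by rw [S.coreSize_sq]; linarith [S.mul_pos]) hb)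

omit [Nonempty (C.GluedSpace ρ r₁ r₂)] in
theorem mem_ringDom_of_cross {q : M₀} (h : q ∈ C.outerDom r₁ r₂)
    (h' : q ∈ C.cross r₁ r₂) : q ∈ C.ringDom r₁ r₂ := by
  refine ⟨h'.1, h'.2.1.trans_lt S.lt_rad, h'.2.2.1.trans_lt S.lt_rad, ?_⟩
  by_contra hn
  push Not at hn
  exact h ⟨h'.1, hn⟩

omit [Nonempty (C.GluedSpace ρ r₁ r₂)] in
theorem ringDom_subset : C.ringDom r₁ r₂ ⊆ C.outerDom r₁ r₂ := by
  rintro q ⟨h1, -, -, h2⟩ ⟨-, h3⟩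
  rcases h2 with h2 | h2
  · exact absurd h3.1 (not_le.2 h2)
  · exact absurd h3.2 (not_le.2 h2)

theorem injOn_affineMap : InjOn (C.affineMap ρ r₁ r₂) (affineCross r₁ r₂) := by
  intro c hc c' hc' h
  rw [affineMap_of_mem hc, affineMap_of_mem hc'] at h
  exact congrArg Subtype.val (S.injective_inclAffine h)

/-- The two parametrizations overlap exactly as described by the extended glueing map. -/
theorem outerMap_eq_affineMap_iff {q : M₀} (hq : q ∈ C.outerDom r₁ r₂) {c : AffineModel}
    (hc : c ∈ affineCross r₁ r₂) : C.outerMap ρ r₁ r₂ q = C.affineMap ρ r₁ r₂ c ↔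
      q ∈ C.cross r₁ r₂ ∧ c = C.glueMap ρ r₁ r₂ q := by
  constructor
  · intro h
    by_cases ho : (q : M) ∈ C.outer r₁ r₂
    · rw [outerMap_of_mem ho, affineMap_of_mem hc, S.inclOuter_eq_iff, S.glue_iff] at h
      exact ⟨h.1, h.2.2⟩
    · rw [S.mem_outer_iff, not_not] at ho
      have h1 : q ∈ C.cross r₁ r₂ := ⟨ho.1, crossInterior_subset _ _ ho.2⟩
      have hD := S.mem_ringDom_of_cross hq h1
      rw [S.outerMap_eq_affineMap hD h1] at h
      exact ⟨h1, (S.injOn_affineMap ((S.glueMap_mem_affineCross hD).2 h1) hc h).symm⟩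
  · rintro ⟨h1, rfl⟩
    exact S.outerMap_eq_affineMap (S.mem_ringDom_of_cross hq h1) h1

theorem injOn_outerMap : InjOn (C.outerMap ρ r₁ r₂) (C.outerDom r₁ r₂) := by
  have key : ∀ q ∈ C.outerDom r₁ r₂, ∀ q' ∈ C.outerDom r₁ r₂, q' ∈ C.cross r₁ r₂ →
      C.outerMap ρ r₁ r₂ q = C.outerMap ρ r₁ r₂ q' → q = q' := by
    intro q hq q' hq' hc h
    have hD := S.mem_ringDom_of_cross hq' hc
    rw [S.outerMap_eq_affineMap hD hc, S.outerMap_eq_affineMap_iff hq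
      ((S.glueMap_mem_affineCross hD).2 hc)] at h
    exact (S.injOn_glueMap hD (S.mem_ringDom_of_cross hq h.1) h.2).symm
  intro q hq q' hq' h
  by_cases h1 : q' ∈ C.cross r₁ r₂
  · exact key q hq q' hq' h1 h
  by_cases h2 : q ∈ C.cross r₁ r₂
  · exact (key q' hq' q hq h2 h.symm).symm
  have ho : ∀ q, q ∉ C.cross r₁ r₂ → (q : M) ∈ C.outer r₁ r₂ := fun q h =>
    S.mem_outer_iff.2 fun h' => h ⟨h'.1, crossInterior_subset _ _ h'.2⟩
  rw [outerMap_of_mem (ho _ h1), outerMap_of_mem (ho _ h2)] at h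
  have := S.injective_inclOuter h
  exact Subtype.ext (congrArg (fun x : C.outer r₁ r₂ => (x : M)) this)

omit S [T2Space M] in
theorem continuousOn_affineMap : ContinuousOn (C.affineMap ρ r₁ r₂) (affineCross r₁ r₂) := by
  rw [continuousOn_iff_continuous_domRestrict]
  have : (affineCross r₁ r₂).domRestrict (C.affineMap ρ r₁ r₂) = C.inclAffine ρ r₁ r₂ :=
    funext fun c => affineMap_of_mem c.2
  rw [this]
  exact continuous_inclAffine

omit [Nonempty (C.GluedSpace ρ r₁ r₂)] [T2Space M] in
theorem continuousAt_glueMap {q : M₀} (h : q ∈ C.ringDom r₁ r₂) :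
    ContinuousAt (C.glueMap ρ r₁ r₂) q := by
  obtain ⟨g, T, -, -, hg⟩ := S.exists_isGlueLift h
  exact (continuous_liftProj.continuousAt.comp
    hg.self_of_nhds.isLocalDiffeomorphAt.contMDiffAt.continuousAt).congr (hg.mono fun q' h => h.liftProj_eq)

omit [Nonempty (C.GluedSpace ρ r₁ r₂)] [T2Space M] in
theorem map_glueMap_nhds {q : M₀} (h : q ∈ C.ringDom r₁ r₂) :
    Filter.map (C.glueMap ρ r₁ r₂) (𝓝 q) = 𝓝 (C.glueMap ρ r₁ r₂ q) := by
  obtain ⟨g, T, -, -, hg⟩ := S.exists_isGlueLift h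
  have h1 : C.glueMap ρ r₁ r₂ =ᶠ[𝓝 q] liftProj ∘ g := hg.mono fun q' h => h.liftProj_eq.symm
  rw [Filter.map_congr h1, ← Filter.map_map, hg.self_of_nhds.isLocalDiffeomorphAt.map_nhds,
    isOpenMap_liftProj.map_nhds_eq continuous_liftProj.continuousAt, hg.self_of_nhds.liftProj_eq]

omit [Nonempty (C.GluedSpace ρ r₁ r₂)] in
theorem isClosed_cross : IsClosed (C.cross r₁ r₂) := by
  have := (C.isClosed_cross_union S.isPeriodicOrbit S.pos S.lt S.lt_rad).preimage
    (continuous_subtype_val (p := fun x => x ∉ γ))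
  convert this using 1
  ext q
  constructor
  · exact fun h => Or.inl ⟨q, h, rfl⟩
  · rintro (⟨q', h, h'⟩ | h)
    · rwa [← Subtype.ext h']
    · exact absurd h q.2

omit S [Nonempty (C.GluedSpace ρ r₁ r₂)] in
theorem _root_.NormalCoordinates.isClosed_box (hγ : IsCompact γ) {s : ℝ} (hs : s < C.rad) :
    IsClosed (C.box s) := by
  have h1 : IsClosed (Subtype.val '' C.box s ∪ γ : Set M) := by
    refine C.isClosed_image_union hγ hs Subset.rfl fun q hq hqS => ?_
    have h2 : IsClosed {w : ℝ × ℝ | |w.1| ≤ s ∧ |w.2| ≤ s} := by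
      have e1 : IsClosed {w : ℝ × ℝ | |w.1| ≤ s} := isClosed_le (by fun_prop) continuous_const
      have e2 : IsClosed {w : ℝ × ℝ | |w.2| ≤ s} := isClosed_le (by fun_prop) continuous_const
      exact e1.inter e2
    exact (C.eventually_mem_dom_and hq h2.isOpen_compl fun h => hqS ⟨hq, h⟩).mono
      fun q' h4 h5 => h4.2 h5.2
  have := h1.preimage (continuous_subtype_val (p := fun x => x ∉ γ))
  convert this using 1
  ext q
  constructor
  · exact fun h => Or.inl ⟨q, h, rfl⟩
  · rintro (⟨q', h, h'⟩ | h)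
    · rwa [← Subtype.ext h']
    · exact absurd h q.2

omit [Nonempty (C.GluedSpace ρ r₁ r₂)] in
theorem isOpen_outerDom : IsOpen (C.outerDom r₁ r₂) :=
  (C.isClosed_box S.isPeriodicOrbit.isCompact (S.coreSize_lt.trans S.lt_rad)).isOpen_compl

theorem continuousOn_outerMap : ContinuousOn (C.outerMap ρ r₁ r₂) (C.outerDom r₁ r₂) := by
  intro q hq
  refine ContinuousAt.continuousWithinAt ?_
  have hcov : (𝓝 q) = 𝓝[{q' | (q' : M) ∈ C.outer r₁ r₂}] q ⊔ 𝓝[C.cross r₁ r₂ ∩ C.ringDom r₁ r₂] q ⊔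
      𝓝[{q' | q' ∈ C.cross r₁ r₂ ∧ q' ∉ C.outerDom r₁ r₂}] q := by
    rw [← nhdsWithin_union, ← nhdsWithin_union, eq_comm, nhdsWithin_eq_nhds]
    refine Filter.univ_mem' fun q' => ?_
    by_cases h1 : (q' : M) ∈ C.outer r₁ r₂
    · exact Or.inl (Or.inl h1)
    rw [S.mem_outer_iff, not_not] at h1
    have h2 : q' ∈ C.cross r₁ r₂ := ⟨h1.1, crossInterior_subset _ _ h1.2⟩
    by_cases h3 : q' ∈ C.outerDom r₁ r₂
    · exact Or.inl (Or.inr ⟨h2, S.mem_ringDom_of_cross h3 h2⟩)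
    · exact Or.inr ⟨h2, h3⟩
  have hbot : 𝓝[{q' | q' ∈ C.cross r₁ r₂ ∧ q' ∉ C.outerDom r₁ r₂}] q = ⊥ := by
    rw [← Filter.empty_mem_iff_bot]
    filter_upwards [nhdsWithin_le_nhds (S.isOpen_outerDom.mem_nhds hq), self_mem_nhdsWithin]
      with q' h1 h2 using h2.2 h1
  rw [hbot, sup_bot_eq] at hcov
  have h1 : IsClosed {q' : M₀ | (q' : M) ∈ C.outer r₁ r₂} :=
    (isOpen_interior.isClosed_compl).preimage continuous_subtype_val
  rw [ContinuousAt, hcov]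
  refine Filter.Tendsto.sup ?_ ?_
  · by_cases ho : (q : M) ∈ C.outer r₁ r₂
    · have : ContinuousWithinAt (C.outerMap ρ r₁ r₂) {q' | (q' : M) ∈ C.outer r₁ r₂} q := by
        rw [continuousWithinAt_iff_continuousAt_domRestrict (C.outerMap ρ r₁ r₂)
          (s := {q' : M₀ | (q' : M) ∈ C.outer r₁ r₂}) ho]
        have h3 : Continuous (fun q' : {q' : M₀ | (q' : M) ∈ C.outer r₁ r₂} =>
            C.inclOuter ρ r₁ r₂ ⟨q'.1, q'.2⟩) :=
          continuous_inclOuter.comp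
            ((continuous_subtype_val.comp continuous_subtype_val).subtype_mk _)
        refine h3.continuousAt.congr (Filter.Eventually.of_forall fun q' => ?_)
        exact (outerMap_of_mem q'.2).symm
      exact this
    · have h2 : 𝓝[{q' : M₀ | (q' : M) ∈ C.outer r₁ r₂}] q = ⊥ := by
        rwa [← notMem_closure_iff_nhdsWithin_eq_bot, h1.closure_eq]
      rw [h2]; exact Filter.tendsto_bot
  · by_cases hc : q ∈ C.cross r₁ r₂
    · have hD := S.mem_ringDom_of_cross hq hc
      have h3 : ContinuousWithinAt (C.affineMap ρ r₁ r₂ ∘ C.glueMap ρ r₁ r₂)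
          (C.cross r₁ r₂ ∩ C.ringDom r₁ r₂) q :=
        ContinuousWithinAt.comp (t := affineCross r₁ r₂)
          (continuousOn_affineMap _ ((S.glueMap_mem_affineCross hD).2 hc))
          (S.continuousAt_glueMap hD).continuousWithinAt
          fun q' h => (S.glueMap_mem_affineCross h.2).2 h.1
      exact h3.congr (fun q' h => S.outerMap_eq_affineMap h.2 h.1) (S.outerMap_eq_affineMap hD hc)
    · have h2 : 𝓝[C.cross r₁ r₂ ∩ C.ringDom r₁ r₂] q = ⊥ := by
        rw [← Filter.empty_mem_iff_bot]
        filter_upwards [nhdsWithin_le_nhds (S.isClosed_cross.isOpen_compl.mem_nhds hc),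
          self_mem_nhdsWithin] with q' h1 h2 using h1 h2.1
      rw [h2]; exact Filter.tendsto_bot

/-- The outer parametrization is open: near the boundary of the cross, its image contains both sides. -/
theorem isOpen_image_outerMap {Z : Set M₀} (hZ : IsOpen Z)
    (hZU : Z ⊆ C.outerDom r₁ r₂) : IsOpen (C.outerMap ρ r₁ r₂ '' Z) := by
  rw [isOpen_iff_preimage]
  constructor
  · have hemb : IsOpenEmbedding (Subtype.val : M₀ → M) :=
      S.isPeriodicOrbit.isCompact.isClosed.isOpen_compl.isOpenEmbedding_subtypeVal
    have : C.inclOuter ρ r₁ r₂ ⁻¹' (C.outerMap ρ r₁ r₂ '' Z) =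
        Subtype.val ⁻¹' ((Subtype.val : M₀ → M) '' Z) := by
      ext x
      have hx : C.outerMap ρ r₁ r₂ (⟨x, S.outer_notMem x⟩ : M₀) = C.inclOuter ρ r₁ r₂ x :=
        outerMap_of_mem (q := (⟨x, S.outer_notMem x⟩ : M₀)) x.2
      simp only [mem_preimage, mem_image]
      constructor
      · rintro ⟨q, hq, h⟩
        have := S.injOn_outerMap (hZU hq) (S.mem_outerDom_of_outer (q := ⟨x, S.outer_notMem x⟩) x.2)
          (h.trans hx.symm)
        exact ⟨q, hq, congrArg Subtype.val this⟩
      · rintro ⟨q, hq, h⟩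
        refine ⟨q, hq, ?_⟩
        rw [← hx]
        congr 1
        exact Subtype.ext h
    rw [this]
    exact (hemb.isOpenMap _ hZ).preimage continuous_subtype_val
  · have : C.inclAffine ρ r₁ r₂ ⁻¹' (C.outerMap ρ r₁ r₂ '' Z) =
        Subtype.val ⁻¹' (C.glueMap ρ r₁ r₂ '' (Z ∩ C.ringDom r₁ r₂)) := by
      ext c
      simp only [mem_preimage, mem_image]
      rw [← affineMap_of_mem c.2]
      constructor
      · rintro ⟨q, hq, h⟩
        rw [S.outerMap_eq_affineMap_iff (hZU hq) c.2] at h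
        exact ⟨q, ⟨hq, S.mem_ringDom_of_cross (hZU hq) h.1⟩, h.2.symm⟩
      · rintro ⟨q, ⟨hq, hD⟩, h⟩
        refine ⟨q, hq, (S.outerMap_eq_affineMap_iff (hZU hq) c.2).2 ⟨?_, h.symm⟩⟩
        exact (S.glueMap_mem_affineCross hD).1 (h ▸ c.2)
    rw [this]
    refine IsOpen.preimage continuous_subtype_val ?_
    rw [isOpen_iff_mem_nhds]
    rintro _ ⟨q, hq, rfl⟩
    rw [← S.map_glueMap_nhds hq.2]
    exact Filter.image_mem_map ((hZ.inter (C.isOpen_ringDom r₁ r₂)).mem_nhds hq)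

theorem isOpen_image_affineMap {Z : Set AffineModel} (hZ : IsOpen Z) (hZU : Z ⊆ affineInt r₁ r₂) :
    IsOpen (C.affineMap ρ r₁ r₂ '' Z) := by
  rw [isOpen_iff_preimage]
  constructor
  · have : C.inclOuter ρ r₁ r₂ ⁻¹' (C.affineMap ρ r₁ r₂ '' Z) = ∅ := by
      rw [eq_empty_iff_forall_notMem]
      rintro x ⟨c, hc, h⟩
      have hx : C.outerMap ρ r₁ r₂ (⟨x, S.outer_notMem x⟩ : M₀) = C.inclOuter ρ r₁ r₂ x :=
        outerMap_of_mem (q := (⟨x, S.outer_notMem x⟩ : M₀)) x.2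
      rw [← hx] at h
      have hU := S.mem_outerDom_of_outer (q := ⟨x, S.outer_notMem x⟩) x.2
      obtain ⟨h1, h2⟩ := (S.outerMap_eq_affineMap_iff hU (affineInt_subset r₁ r₂ (hZU hc))).1 h.symm
      have h3 := S.glueMap_fst (S.mem_ringDom_of_cross hU h1)
      have h4 := hZU hc
      rw [h2] at h4
      refine (S.mem_outer_iff (q := ⟨x, S.outer_notMem x⟩)).1 x.2 ⟨h1.1, ?_⟩
      rw [← h3.1, ← h3.2]
      exact h4
    rw [this]
    exact isOpen_empty
  · have : C.inclAffine ρ r₁ r₂ ⁻¹' (C.affineMap ρ r₁ r₂ '' Z) = Subtype.val ⁻¹' Z := by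
      ext c
      simp only [mem_preimage, mem_image]
      rw [← affineMap_of_mem c.2]
      constructor
      · rintro ⟨c', hc', h⟩
        rwa [← S.injOn_affineMap (affineInt_subset r₁ r₂ (hZU hc')) c.2 h]
      · exact fun h => ⟨c, h, rfl⟩
    rw [this]
    exact hZ.preimage continuous_subtype_val

/-- `M_R(r₁, r₂)` and the interior of the cross cover the glued space. -/
theorem cover (a : C.GluedSpace ρ r₁ r₂) : (∃ q : M₀, (q : M) ∈ C.outer r₁ r₂ ∧ C.outerMap ρ r₁ r₂ q = a) ∨
    ∃ c ∈ affineInt r₁ r₂, C.affineMap ρ r₁ r₂ c = a := by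
  rcases exists_incl_eq a with ⟨x, rfl⟩ | ⟨c, rfl⟩
  · exact Or.inl ⟨⟨x, S.outer_notMem x⟩, x.2, outerMap_of_mem (q := (⟨x, S.outer_notMem x⟩ : M₀)) x.2⟩
  · by_cases hc : (c : AffineModel) ∈ affineInt r₁ r₂
    · exact Or.inr ⟨c, hc, affineMap_of_mem c.2⟩
    · obtain ⟨q, hq, hqc⟩ := S.exists_glueMap_eq (S.mem_ringPlane_of_boundary c.2 hc)
      have h1 : q ∈ C.cross r₁ r₂ := (S.glueMap_mem_affineCross hq).1 (hqc ▸ c.2)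
      have h2 := S.glueMap_fst hq
      refine Or.inl ⟨q, S.mem_outer_iff.2 fun h => hc ?_, ?_⟩
      · rw [← hqc]
        show ((C.glueMap ρ r₁ r₂ q).1, (C.glueMap ρ r₁ r₂ q).2.1) ∈ crossInterior r₁ r₂
        rw [h2.1, h2.2]; exact h.2
      · rw [S.outerMap_eq_affineMap hq h1, hqc, affineMap_of_mem c.2]

omit [Nonempty (C.GluedSpace ρ r₁ r₂)] S [T2Space M] in
theorem _root_.NormalCoordinates.compactSpace_gluedSpace [CompactSpace M] :
    CompactSpace (C.GluedSpace ρ r₁ r₂) := by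
  have h1 : CompactSpace (C.outer r₁ r₂) :=
    isCompact_iff_compactSpace.1 (isOpen_interior.isClosed_compl).isCompact
  have h2 : CompactSpace (affineCross r₁ r₂) :=
    isCompact_iff_compactSpace.1 (isCompact_affineCross r₁ r₂)
  exact inferInstanceAs (CompactSpace (Quot (C.GlueRel ρ r₁ r₂)))

/-- Points inside one of the two parametrized open sets are separated there; a point of the core of the
cross and one of `M_R(r₁, r₂)` are separated by the boundary of an intermediate box. -/
theorem t2Space : T2Space (C.GluedSpace ρ r₁ r₂) := by
  have mixed : ∀ q : M₀, (q : M) ∈ C.outer r₁ r₂ → ∀ c ∈ affineInt r₁ r₂,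
      C.affineMap ρ r₁ r₂ c ∉ C.outerMap ρ r₁ r₂ '' C.outerDom r₁ r₂ →
      ∃ U V : Set (C.GluedSpace ρ r₁ r₂), IsOpen U ∧ IsOpen V ∧ C.outerMap ρ r₁ r₂ q ∈ U ∧
        C.affineMap ρ r₁ r₂ c ∈ V ∧ Disjoint U V := by
    intro q hq c hc hcn
    -- a size strictly between that of the core and the boundary of the cross
    obtain ⟨s, hs0, hs⟩ : ∃ s, coreSize r₁ r₂ < s ∧ s < min r₁ (Real.sqrt (r₁ * r₂)) := by
      refine exists_between (lt_min S.coreSize_lt (Real.lt_sqrt_of_sq_lt ?_))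
      rw [sq, S.coreSize_sq]; linarith [S.mul_pos]
    have hs1 := hs.trans_le (min_le_left _ _)
    have hs0' := S.coreSize_pos.trans hs0
    have hs2 : s * s < r₁ * r₂ := by
      rw [← sq]; exact (Real.lt_sqrt hs0'.le).1 (hs.trans_le (min_le_right _ _))
    have hcs : |c.1| ≤ coreSize r₁ r₂ ∧ |c.2.1| ≤ coreSize r₁ r₂ := by
      by_contra h
      refine hcn ?_
      have hr : (c.1, c.2.1) ∈ ringPlane C.rad r₁ r₂ := by
        refine ⟨hc.1.trans S.lt_rad, hc.2.1.trans S.lt_rad, ?_⟩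
        by_contra h'
        push Not at h'
        exact h h'
      obtain ⟨q', hq', hqc⟩ := S.exists_glueMap_eq hr
      refine ⟨q', S.ringDom_subset hq', ?_⟩
      rw [← hqc]
      exact S.outerMap_eq_affineMap hq'
        ((S.glueMap_mem_affineCross hq').1 (hqc ▸ affineInt_subset r₁ r₂ hc))
    have hbox : (C.box s)ᶜ ⊆ C.outerDom r₁ r₂ := compl_subset_compl.2 fun q' h =>
      ⟨h.1, h.2.1.trans hs0.le, h.2.2.trans hs0.le⟩
    have hZ : {c : AffineModel | |c.1| < s ∧ |c.2.1| < s} ⊆ affineInt r₁ r₂ := by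
      rintro c ⟨h1, h2⟩
      refine ⟨h1.trans hs1, h2.trans hs1, ?_⟩
      show |c.1 * c.2.1| < _
      rw [abs_mul]
      exact (mul_le_mul h1.le h2.le (abs_nonneg _) hs0'.le).trans_lt hs2
    have hZo : IsOpen {c : AffineModel | |c.1| < s ∧ |c.2.1| < s} := by
      have e1 : IsOpen {c : AffineModel | |c.1| < s} := isOpen_lt (by fun_prop) continuous_const
      have e2 : IsOpen {c : AffineModel | |c.2.1| < s} := isOpen_lt (by fun_prop) continuous_const
      exact e1.inter e2
    refine ⟨_, _, S.isOpen_image_outerMap (C.isClosed_box S.isPeriodicOrbit.isCompact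
      (hs1.trans S.lt_rad)).isOpen_compl hbox, S.isOpen_image_affineMap hZo hZ,
      mem_image_of_mem _ fun h => S.mem_outer_iff.1 hq (S.mem_crossInt_of_box hs1 hs2 h),
      mem_image_of_mem _ ⟨hcs.1.trans_lt hs0, hcs.2.trans_lt hs0⟩, ?_⟩
    rw [disjoint_left]
    rintro _ ⟨q', hq', rfl⟩ ⟨c', hc', h⟩
    obtain ⟨h1, h2⟩ := (S.outerMap_eq_affineMap_iff (hbox hq')
      (affineInt_subset r₁ r₂ (hZ hc'))).1 h.symm
    have h3 := S.glueMap_fst (S.mem_ringDom_of_cross (hbox hq') h1)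
    rw [← h2] at h3
    refine hq' ⟨h1.1, ?_, ?_⟩
    · rw [← h3.1]; exact hc'.1.le
    · rw [← h3.2]; exact hc'.2.le
  have hoo : ∀ q ∈ C.outerDom r₁ r₂, ∀ q' ∈ C.outerDom r₁ r₂,
      C.outerMap ρ r₁ r₂ q ≠ C.outerMap ρ r₁ r₂ q' →
      ∃ U V : Set (C.GluedSpace ρ r₁ r₂), IsOpen U ∧ IsOpen V ∧ C.outerMap ρ r₁ r₂ q ∈ U ∧
        C.outerMap ρ r₁ r₂ q' ∈ V ∧ Disjoint U V := by
    intro q hq q' hq' hne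
    obtain ⟨U, V, hU, hV, hqU, hqV, hUV⟩ := t2_separation (fun h => hne (congrArg _ h) : q ≠ q')
    refine ⟨_, _, S.isOpen_image_outerMap (hU.inter S.isOpen_outerDom) inter_subset_right,
      S.isOpen_image_outerMap (hV.inter S.isOpen_outerDom) inter_subset_right,
      mem_image_of_mem _ ⟨hqU, hq⟩, mem_image_of_mem _ ⟨hqV, hq'⟩, ?_⟩
    exact (hUV.mono inter_subset_left inter_subset_left).image S.injOn_outerMap inter_subset_right
      inter_subset_right
  have haa : ∀ c ∈ affineInt r₁ r₂, ∀ c' ∈ affineInt r₁ r₂,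
      C.affineMap ρ r₁ r₂ c ≠ C.affineMap ρ r₁ r₂ c' →
      ∃ U V : Set (C.GluedSpace ρ r₁ r₂), IsOpen U ∧ IsOpen V ∧ C.affineMap ρ r₁ r₂ c ∈ U ∧
        C.affineMap ρ r₁ r₂ c' ∈ V ∧ Disjoint U V := by
    intro q hq q' hq' hne
    obtain ⟨U, V, hU, hV, hqU, hqV, hUV⟩ := t2_separation (fun h => hne (congrArg _ h) : q ≠ q')
    refine ⟨_, _, S.isOpen_image_affineMap (hU.inter (isOpen_affineInt r₁ r₂)) inter_subset_right,
      S.isOpen_image_affineMap (hV.inter (isOpen_affineInt r₁ r₂)) inter_subset_right,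
      mem_image_of_mem _ ⟨hqU, hq⟩, mem_image_of_mem _ ⟨hqV, hq'⟩, ?_⟩
    exact (hUV.mono inter_subset_left inter_subset_left).image
      (S.injOn_affineMap.mono (affineInt_subset r₁ r₂)) inter_subset_right inter_subset_right
  refine ⟨fun a b hab => ?_⟩
  rcases S.cover a with ⟨q, hq, rfl⟩ | ⟨c, hc, rfl⟩ <;>
    rcases S.cover b with ⟨q', hq', rfl⟩ | ⟨c', hc', rfl⟩
  · exact hoo q (S.mem_outerDom_of_outer hq) q' (S.mem_outerDom_of_outer hq') hab
  · by_cases h : C.affineMap ρ r₁ r₂ c' ∈ C.outerMap ρ r₁ r₂ '' C.outerDom r₁ r₂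
    · obtain ⟨q', hq', h'⟩ := h
      rw [← h'] at hab ⊢
      exact hoo q (S.mem_outerDom_of_outer hq) q' hq' hab
    · exact mixed q hq c' hc' h
  · by_cases h : C.affineMap ρ r₁ r₂ c ∈ C.outerMap ρ r₁ r₂ '' C.outerDom r₁ r₂
    · obtain ⟨q, hq, h'⟩ := h
      rw [← h'] at hab ⊢
      exact hoo q hq q' (S.mem_outerDom_of_outer hq') hab
    · obtain ⟨U, V, hU, hV, h1, h2, h3⟩ := mixed q' hq' c hc h
      exact ⟨V, U, hV, hU, h2, h1, h3.symm⟩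
  · exact haa c hc c' hc' hab

end IsGlueingData
end NormalCoordinates

/-! ### Orbits in the glued space -/

section curves
variable {E H E' H' : Type*} [NormedAddCommGroup E] [NormedSpace ℝ E] [TopologicalSpace H]
  [NormedAddCommGroup E'] [NormedSpace ℝ E'] [TopologicalSpace H']
  {I : ModelWithCorners ℝ E H} {J : ModelWithCorners ℝ E' H'}
  {X X' : Type*} [TopologicalSpace X] [ChartedSpace H X] [TopologicalSpace X'] [ChartedSpace H' X']

/-- The curve `c` has velocity `w` at time `t`; the fibres of the tangent bundle being copies of the
model space, `w` is taken there. -/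
def HasVelocity (I : ModelWithCorners ℝ E H) (c : ℝ → X) (w : E) (t : ℝ) : Prop :=
  HasMFDerivAt 𝓘(ℝ, ℝ) I c t ((1 : ℝ →L[ℝ] ℝ).smulRight w : ℝ →L[ℝ] E)

theorem HasVelocity.comp {f : X → X'} {c : ℝ → X} {t : ℝ} {w : E} (hc : HasVelocity I c w t)
    (hf : MDifferentiableAt I J f (c t)) : HasVelocity J (f ∘ c) (mfderiv I J f (c t) w) t := by
  have h : HasMFDerivAt 𝓘(ℝ, ℝ) J (f ∘ c) t ((mfderiv I J f (c t)).comp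
    ((1 : ℝ →L[ℝ] ℝ).smulRight w : ℝ →L[ℝ] E)) := hf.hasMFDerivAt.comp t hc
  have h2 : ((mfderiv I J f (c t)).comp ((1 : ℝ →L[ℝ] ℝ).smulRight w : ℝ →L[ℝ] E)) =
      ((1 : ℝ →L[ℝ] ℝ).smulRight (mfderiv I J f (c t) w) : ℝ →L[ℝ] E') := by
    ext
    show (mfderiv I J f (c t)) ((1 : ℝ) • w) = (1 : ℝ) • _
    rw [one_smul, one_smul]
  exact (congrArg (fun D : ℝ →L[ℝ] E' => HasMFDerivAt 𝓘(ℝ, ℝ) J (f ∘ c) t D) h2).mp h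

theorem HasVelocity.congr {c c' : ℝ → X} {t : ℝ} {w w' : E} (hc : HasVelocity I c w t)
    (h : c' =ᶠ[𝓝 t] c) (hw : w' = w) : HasVelocity I c' w' t := by
  subst hw
  exact HasMFDerivAt.congr_of_eventuallyEq hc h

end curves

section
variable {N : Type*} [TopologicalSpace N] [ChartedSpace E3 N] [IsManifold 𝓔 ∞ N] [T2Space N]

/-- A continuous curve that is an integral curve in the interior of an interval follows the flow. -/
theorem IsSmoothFlowOf.eq_of_integralCurve {Y : ∀ x : N, TangentSpace 𝓔 x} {ψ : Flow ℝ N}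
    (h : IsSmoothFlowOf Y ψ) {c : ℝ → N} {a b : ℝ} (hab : a ≤ b) (hc : ContinuousOn c (Icc a b))
    (hd : ∀ t ∈ Ioo a b, HasVelocity 𝓔 c (Y (c t)) t) :
    c b = ψ (b - a) (c a) := by
  rcases hab.eq_or_lt with rfl | hab
  · rw [sub_self, ψ.map_zero_apply]
  obtain ⟨t₀, ht₀⟩ := exists_between hab
  have h1 : IsMIntegralCurveOn (I := 𝓔) c Y (Ioo a b) := fun t ht => (hd t ht).hasMFDerivWithinAt
  have h2 : IsMIntegralCurve (I := 𝓔) (fun t => ψ (t - t₀) (c t₀)) Y := by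
    have := (h.generates (c t₀)).comp_add (-t₀)
    exact this
  have h3 := isMIntegralCurveOn_Ioo_eqOn_of_contMDiff_boundaryless ht₀ (h.smooth_field.of_le (by simp))
    h1 (h2.isMIntegralCurveOn _) (by simp)
  have h4 : EqOn c (fun t => ψ (t - t₀) (c t₀)) (Icc a b) := by
    rw [← closure_Ioo hab.ne]
    refine h3.of_subset_closure ?_ (by fun_prop) subset_closure Subset.rfl
    rwa [closure_Ioo hab.ne]
  rw [h4 ⟨hab.le, le_rfl⟩, h4 ⟨le_rfl, hab.le⟩]
  show ψ (b - t₀) (c t₀) = ψ (b - a) (ψ (a - t₀) (c t₀))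
  rw [← ψ.map_add]
  congr 1; ring

end

variable {C : NormalCoordinates A n k m} {ρ : ℝ → ℝ} {r₁ r₂ : ℝ}

namespace NormalCoordinates

theorem _root_.AlmostAnosovStructure.hasVelocity_flow (A : AlmostAnosovStructure φ γ lam)
    (q : M₀) (t : ℝ) :
    HasVelocity 𝓔 (fun s : ℝ => A.flow s q) (A.X (A.flow t q)) t := A.isSmoothFlowOf.generates q t

namespace IsGlueingData
variable [T2Space M] (S : C.IsGlueingData ρ r₁ r₂) [Nonempty (C.GluedSpace ρ r₁ r₂)]
  [ChartedSpace E3 (C.GluedSpace ρ r₁ r₂)] [IsManifold 𝓔 ∞ (C.GluedSpace ρ r₁ r₂)]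
  {Y : ∀ x : C.GluedSpace ρ r₁ r₂, TangentSpace 𝓔 x}
  {ψ : Flow ℝ (C.GluedSpace ρ r₁ r₂)} (h : C.IsSmoothModel ρ r₁ r₂ Y ψ)
include S h

theorem outerMap_flow_of_outer {q : M₀} {a b : ℝ} (hab : a ≤ b)
    (hq : ∀ t ∈ Icc a b, (A.flow t q : M) ∈ C.outer r₁ r₂) :
    C.outerMap ρ r₁ r₂ (A.flow b q) = ψ (b - a) (C.outerMap ρ r₁ r₂ (A.flow a q)) := by
  have := S.t2Space
  have hcf : Continuous (fun t => A.flow t q) := by fun_prop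
  refine h.isSmoothFlowOf.eq_of_integralCurve (c := fun t => C.outerMap ρ r₁ r₂ (A.flow t q)) hab ?_ ?_
  · exact S.continuousOn_outerMap.comp hcf.continuousOn fun t ht => S.mem_outerDom_of_outer (hq t ht)
  · intro t ht
    have hqt := hq t (Ioo_subset_Icc_self ht)
    obtain ⟨f, hf, hfe, hfX⟩ := h.smooth_outer _ hqt
    have h1 := (A.hasVelocity_flow q t).comp (hf.mdifferentiableAt (by simp))
    have h2 : (fun t => C.outerMap ρ r₁ r₂ (A.flow t q)) =ᶠ[𝓝 t] f ∘ fun t => A.flow t q := by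
      filter_upwards [hcf.continuousAt.eventually hfe, Icc_mem_nhds ht.1 ht.2] with s hs hs'
      rw [outerMap_of_mem (hq s hs'), Function.comp, hs (hq s hs')]
    refine h1.congr h2 ?_
    rw [outerMap_of_mem hqt, ← hfe.self_of_nhds hqt]
    exact hfX.symm

theorem outerMap_flow_of_cross {q : M₀} {a b : ℝ} (hab : a ≤ b)
    (hq : ∀ t ∈ Icc a b, A.flow t q ∈ C.ringDom r₁ r₂ ∧ A.flow t q ∈ C.cross r₁ r₂) :
    C.outerMap ρ r₁ r₂ (A.flow b q) = ψ (b - a) (C.outerMap ρ r₁ r₂ (A.flow a q)) := by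
  have := S.t2Space
  have hcf : Continuous (fun t => A.flow t q) := by fun_prop
  refine h.isSmoothFlowOf.eq_of_integralCurve (c := fun t => C.outerMap ρ r₁ r₂ (A.flow t q)) hab ?_ ?_
  · exact S.continuousOn_outerMap.comp hcf.continuousOn fun t ht => S.ringDom_subset (hq t ht).1
  · intro t ht
    obtain ⟨hD, hcr⟩ := hq t (Ioo_subset_Icc_self ht)
    obtain ⟨g, T, -, -, hg⟩ := S.exists_isGlueLift hD
    have hg0 := hg.self_of_nhds
    have hV : liftProj (g (A.flow t q)) ∈ affineCross r₁ r₂ := by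
      rw [hg0.liftProj_eq]; exact (S.glueMap_mem_affineCross hD).2 hcr
    obtain ⟨f, hf, hfe, hfX⟩ := h.smooth_affine _ hV
    have h1 := (A.hasVelocity_flow q t).comp (hg0.isLocalDiffeomorphAt.mdifferentiableAt (by simp))
    have h1' := h1.comp (f := f) (c := g ∘ fun t => A.flow t q) (hf.mdifferentiableAt (by simp))
    have hc2 : ContinuousAt (g ∘ fun t => A.flow t q) t :=
      ContinuousAt.comp (f := fun t => A.flow t q)
        hg0.isLocalDiffeomorphAt.contMDiffAt.continuousAt hcf.continuousAt
    have h2 : (fun t => C.outerMap ρ r₁ r₂ (A.flow t q)) =ᶠ[𝓝 t] f ∘ g ∘ fun t => A.flow t q := by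
      filter_upwards [hc2.eventually hfe, Icc_mem_nhds ht.1 ht.2, hcf.continuousAt.eventually hg]
        with s hs hs' hgs
      obtain ⟨hDs, hcs⟩ := hq s hs'
      have hVs : liftProj (g (A.flow s q)) ∈ affineCross r₁ r₂ := by
        rw [hgs.liftProj_eq]; exact (S.glueMap_mem_affineCross hDs).2 hcs
      rw [S.outerMap_eq_affineMap hDs hcs, ← hgs.liftProj_eq, affineMap_of_mem hVs]
      exact (hs hVs).symm
    have h4 : mfderiv 𝓔 𝓘(ℝ, ℝ³) g (A.flow t q) (A.X (A.flow t q)) =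
      affineField lam n k (g (A.flow t q)) := hg0.field
    refine h1'.congr h2 ?_
    have h5 : C.outerMap ρ r₁ r₂ (A.flow t q) = f (g (A.flow t q)) := h2.self_of_nhds
    rw [h4, h5]
    exact hfX.symm

omit h [Nonempty (C.GluedSpace ρ r₁ r₂)] [ChartedSpace E3 (C.GluedSpace ρ r₁ r₂)]
  [IsManifold 𝓔 ∞ (C.GluedSpace ρ r₁ r₂)] [T2Space M] S in
theorem _root_.NormalCoordinates.eventually_xy_flow {q : M₀} (hq : q ∈ C.dom) :
    ∀ᶠ t in 𝓝 (0 : ℝ), C.xc (A.flow t q) = Real.exp (Real.log lam * t) * C.xc q ∧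
      C.yc (A.flow t q) = Real.exp (-Real.log lam * t) * C.yc q := by
  have hcf : Continuous (fun t => A.flow t q) := by fun_prop
  have h1 : ∀ᶠ t in 𝓝 (0 : ℝ), A.flow t q ∈ C.dom :=
    hcf.continuousAt.eventually_mem (C.isOpen_dom.mem_nhds (by rwa [A.flow.map_zero_apply]))
  obtain ⟨ε, hε, hb⟩ := Metric.eventually_nhds_iff_ball.1 h1
  filter_upwards [Metric.ball_mem_nhds 0 hε] with t ht
  rw [Metric.mem_ball, Real.dist_eq, sub_zero, abs_lt] at ht
  rcases le_total 0 t with h0 | h0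
  · have := C.xy_flow h0 fun s hs => hb s (by
      rw [Metric.mem_ball, Real.dist_eq, sub_zero, abs_lt]
      constructor <;> linarith [hs.1, hs.2])
    simpa using this
  · have := C.xy_flow h0 fun s hs => hb s (by
      rw [Metric.mem_ball, Real.dist_eq, sub_zero, abs_lt]
      constructor <;> linarith [hs.1, hs.2])
    rw [A.flow.map_zero_apply] at this
    rw [this.1, this.2, ← mul_assoc, ← mul_assoc, ← Real.exp_add, ← Real.exp_add]
    constructor
    · rw [show Real.log lam * t + Real.log lam * (0 - t) = 0 by ring, Real.exp_zero, one_mul]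
    · rw [show -Real.log lam * t + -Real.log lam * (0 - t) = 0 by ring, Real.exp_zero, one_mul]

omit h [Nonempty (C.GluedSpace ρ r₁ r₂)] [ChartedSpace E3 (C.GluedSpace ρ r₁ r₂)]
  [IsManifold 𝓔 ∞ (C.GluedSpace ρ r₁ r₂)] in
/-- On either side in time, a short orbit arc starting in the ring lies in `M_R(r₁, r₂)` or in the
cross. -/
theorem exists_local_arc {q : M₀} (hq : q ∈ C.ringDom r₁ r₂) :
    ∃ ε > 0, ((∀ t ∈ Ico 0 ε, (A.flow t q : M) ∈ C.outer r₁ r₂) ∨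
      ∀ t ∈ Ico 0 ε, A.flow t q ∈ C.ringDom r₁ r₂ ∧ A.flow t q ∈ C.cross r₁ r₂) ∧
      ((∀ t ∈ Ioc (-ε) 0, (A.flow t q : M) ∈ C.outer r₁ r₂) ∨
      ∀ t ∈ Ioc (-ε) 0, A.flow t q ∈ C.ringDom r₁ r₂ ∧ A.flow t q ∈ C.cross r₁ r₂) := by
  have hcf : Continuous (fun t => A.flow t q) := by fun_prop
  have hℓ := A.log_lam_neg
  have hD : ∀ᶠ t in 𝓝 (0 : ℝ), A.flow t q ∈ C.ringDom r₁ r₂ :=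
    hcf.continuousAt.eventually_mem ((C.isOpen_ringDom r₁ r₂).mem_nhds (by rwa [A.flow.map_zero_apply]))
  have hx : ∀ r : ℝ, ∀ᶠ t in 𝓝 (0 : ℝ), (|C.xc q| < r → |Real.exp (Real.log lam * t) * C.xc q| < r) ∧
      (r < |C.xc q| → r < |Real.exp (Real.log lam * t) * C.xc q|) := by
    intro r
    have hc : Continuous fun t => |Real.exp (Real.log lam * t) * C.xc q| := by fun_prop
    refine Filter.Eventually.and (Filter.eventually_imp_distrib_left.2 fun h => ?_)
      (Filter.eventually_imp_distrib_left.2 fun h => ?_)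
    · exact hc.continuousAt.eventually_lt continuousAt_const (by simpa)
    · exact continuousAt_const.eventually_lt hc.continuousAt (by simpa)
  have hy : ∀ r : ℝ, ∀ᶠ t in 𝓝 (0 : ℝ), (|C.yc q| < r → |Real.exp (-Real.log lam * t) * C.yc q| < r) ∧
      (r < |C.yc q| → r < |Real.exp (-Real.log lam * t) * C.yc q|) := by
    intro r
    have hc : Continuous fun t => |Real.exp (-Real.log lam * t) * C.yc q| := by fun_prop
    refine Filter.Eventually.and (Filter.eventually_imp_distrib_left.2 fun h => ?_)
      (Filter.eventually_imp_distrib_left.2 fun h => ?_)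
    · exact hc.continuousAt.eventually_lt continuousAt_const (by simpa)
    · exact continuousAt_const.eventually_lt hc.continuousAt (by simpa)
  obtain ⟨ε, hε, hb⟩ := Metric.eventually_nhds_iff_ball.1
    (hD.and ((C.eventually_xy_flow hq.1).and ((hx r₁).and (hy r₁))))
  have hb' : ∀ t, -ε < t → t < ε → _ := fun t h1 h2 => hb t (by
    rw [Metric.mem_ball, Real.dist_eq, sub_zero, abs_lt]; exact ⟨h1, h2⟩)
  have hxy : ∀ t, -ε < t → t < ε →
      C.xc (A.flow t q) * C.yc (A.flow t q) = C.xc q * C.yc q := by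
    intro t h1 h2
    obtain ⟨-, ⟨h3, h4⟩, -⟩ := hb' t h1 h2
    rw [h3, h4, mul_mul_mul_comm, ← Real.exp_add]
    simp
  -- stretching and contraction of the coordinates
  have hle : ∀ s a : ℝ, s ≤ 0 → |Real.exp s * a| ≤ |a| := fun s a hs => by
    rw [abs_mul, Real.abs_exp]
    exact mul_le_of_le_one_left (abs_nonneg _) (Real.exp_le_one_iff.2 hs)
  have hge : ∀ s a : ℝ, 0 ≤ s → |a| ≤ |Real.exp s * a| := fun s a hs => by
    rw [abs_mul, Real.abs_exp]
    exact le_mul_of_one_le_left (abs_nonneg _) (Real.one_le_exp hs)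
  refine ⟨ε, hε, ?_, ?_⟩
  · by_cases h0 : r₁ * r₂ ≤ |C.xc q * C.yc q|
    · refine Or.inl fun t ht => S.mem_outer_iff.2 fun hc => ?_
      have := hc.2.2.2
      simp only at this
      rw [hxy t (by linarith [ht.1]) ht.2] at this
      exact absurd this (not_lt.2 h0)
    push Not at h0
    rcases le_or_gt r₁ |C.yc q| with h1 | h1
    · refine Or.inl fun t ht => S.mem_outer_iff.2 fun hc => ?_
      have h2 : |C.yc (A.flow t q)| < r₁ := hc.2.2.1
      rw [(hb' t (by linarith [ht.1]) ht.2).2.1.2] at h2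
      linarith [hge (-Real.log lam * t) (C.yc q) (by nlinarith [ht.1])]
    rcases lt_or_ge r₁ |C.xc q| with h2 | h2
    · refine Or.inl fun t ht => S.mem_outer_iff.2 fun hc => ?_
      have h3 : |C.xc (A.flow t q)| < r₁ := hc.2.1
      obtain ⟨-, h4, h5, -⟩ := hb' t (by linarith [ht.1]) ht.2
      rw [h4.1] at h3
      linarith [h5.2 h2]
    · refine Or.inr fun t ht => ?_
      obtain ⟨h3, h4, -, h5⟩ := hb' t (by linarith [ht.1]) ht.2
      refine ⟨h3, h3.1, ?_, ?_, ?_⟩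
      · simp only; rw [h4.1]
        exact (hle (Real.log lam * t) (C.xc q) (by nlinarith [ht.1])).trans h2
      · simp only; rw [h4.2]; exact (h5.1 h1).le
      · simp only; rw [hxy t (by linarith [ht.1]) ht.2]; exact h0.le
  · by_cases h0 : r₁ * r₂ ≤ |C.xc q * C.yc q|
    · refine Or.inl fun t ht => S.mem_outer_iff.2 fun hc => ?_
      have := hc.2.2.2
      simp only at this
      rw [hxy t ht.1 (by linarith [ht.2])] at this
      exact absurd this (not_lt.2 h0)
    push Not at h0
    rcases le_or_gt r₁ |C.xc q| with h1 | h1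
    · refine Or.inl fun t ht => S.mem_outer_iff.2 fun hc => ?_
      have h2 : |C.xc (A.flow t q)| < r₁ := hc.2.1
      rw [(hb' t ht.1 (by linarith [ht.2])).2.1.1] at h2
      linarith [hge (Real.log lam * t) (C.xc q) (by nlinarith [ht.2])]
    rcases lt_or_ge r₁ |C.yc q| with h2 | h2
    · refine Or.inl fun t ht => S.mem_outer_iff.2 fun hc => ?_
      have h3 : |C.yc (A.flow t q)| < r₁ := hc.2.2.1
      obtain ⟨-, h4, -, h5⟩ := hb' t ht.1 (by linarith [ht.2])
      rw [h4.2] at h3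
      linarith [h5.2 h2]
    · refine Or.inr fun t ht => ?_
      obtain ⟨h3, h4, h5, -⟩ := hb' t ht.1 (by linarith [ht.2])
      refine ⟨h3, h3.1, ?_, ?_, ?_⟩
      · simp only; rw [h4.1]; exact (h5.1 h1).le
      · simp only; rw [h4.2]
        exact (hle (-Real.log lam * t) (C.yc q) (by nlinarith [ht.2])).trans h2
      · simp only; rw [hxy t ht.1 (by linarith [ht.2])]; exact h0.le

/-- Orbit arcs in the ring map to orbit arcs: each is locally composed of arcs in `M_R(r₁, r₂)` and arcs
in the cross, so that smoothness of `outerMap` across the boundary is not presupposed. -/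
theorem outerMap_flow_of_ringDom {q : M₀} {a b : ℝ} (hab : a ≤ b)
    (hq : ∀ t ∈ Icc a b, A.flow t q ∈ C.ringDom r₁ r₂) :
    C.outerMap ρ r₁ r₂ (A.flow b q) = ψ (b - a) (C.outerMap ρ r₁ r₂ (A.flow a q)) := by
  refine rel_of_locally_rel (R := fun s t => C.outerMap ρ r₁ r₂ (A.flow t q) =
    ψ (t - s) (C.outerMap ρ r₁ r₂ (A.flow s q))) hab ?_ ?_ ?_
  · intro s t u _ _ _ _ h1 h2
    rw [h2, h1, ← ψ.map_add]
    congr 1; ring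
  · intro t ht
    obtain ⟨ε, hε, -, h1⟩ := S.exists_local_arc (hq t ht)
    refine ⟨ε, hε, fun s hs hst hst' => ?_⟩
    rcases h1 with h1 | h1
    · refine S.outerMap_flow_of_outer h hst' fun u hu => ?_
      have := h1 (u - t) ⟨by linarith [hu.1], by linarith [hu.2]⟩
      rwa [← A.flow.map_add, sub_add_cancel] at this
    · refine S.outerMap_flow_of_cross h hst' fun u hu => ?_
      have := h1 (u - t) ⟨by linarith [hu.1], by linarith [hu.2]⟩
      rwa [← A.flow.map_add, sub_add_cancel] at this
  · intro t ht
    obtain ⟨ε, hε, h1, -⟩ := S.exists_local_arc (hq t ht)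
    refine ⟨ε, hε, fun s hs hst hst' => ?_⟩
    rcases h1 with h1 | h1
    · refine S.outerMap_flow_of_outer h hst fun u hu => ?_
      have := h1 (u - t) ⟨by linarith [hu.1], by linarith [hu.2]⟩
      rwa [← A.flow.map_add, sub_add_cancel] at this
    · refine S.outerMap_flow_of_cross h hst fun u hu => ?_
      have := h1 (u - t) ⟨by linarith [hu.1], by linarith [hu.2]⟩
      rwa [← A.flow.map_add, sub_add_cancel] at this

end IsGlueingData
end NormalCoordinates

section
variable {N : Type*} [TopologicalSpace N] [ChartedSpace E3 N] [IsManifold 𝓔 ∞ N]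
  {Y : ∀ x : N, TangentSpace 𝓔 x} {ψ : Flow ℝ N}

theorem IsSmoothFlowOf.isLocalDiffeomorphAt (h : IsSmoothFlowOf Y ψ) (t : ℝ) (x : N) :
    IsLocalDiffeomorphAt 𝓔 𝓔 ∞ (ψ t) x := by
  let Φ : Diffeomorph 𝓔 𝓔 N N ∞ :=
    { toFun := ψ t
      invFun := ψ (-t)
      left_inv := fun x => by rw [← ψ.map_add, neg_add_cancel, ψ.map_zero_apply]
      right_inv := fun x => by rw [← ψ.map_add, add_neg_cancel, ψ.map_zero_apply]
      contMDiff_toFun := contMDiff_flow_apply h.smooth_flow t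
      contMDiff_invFun := contMDiff_flow_apply h.smooth_flow (-t) }
  exact Φ.isLocalDiffeomorph x

theorem HasVelocity.unique {c : ℝ → N} {t : ℝ} {w w' : E3} (h : HasVelocity 𝓔 c w t)
    (h' : HasVelocity 𝓔 c w' t) : w = w' := by
  have h1 := hasMFDerivAt_unique h h'
  have h2 := congrArg (fun L : ℝ →L[ℝ] E3 => L 1) h1
  have h3 : (1 : ℝ) • w = (1 : ℝ) • w' := h2
  rwa [one_smul, one_smul] at h3

theorem IsSmoothFlowOf.hasVelocity (h : IsSmoothFlowOf Y ψ) (x : N) (t : ℝ) :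
    HasVelocity 𝓔 (fun s => ψ s x) (Y (ψ t x)) t := h.generates x t

end

/-! ### The outer parametrization of a smooth model -/

namespace NormalCoordinates

namespace IsGlueingData
variable [T2Space M] (S : C.IsGlueingData ρ r₁ r₂)
include S

/-- From each point of the cross in the ring, an orbit arc in the ring leads out of the cross. -/
theorem exists_exit {q : M₀} (hD : q ∈ C.ringDom r₁ r₂) (hc : q ∈ C.cross r₁ r₂) :
    ∃ σ T : ℝ, (σ = 1 ∨ σ = -1) ∧ 0 ≤ T ∧ (∀ t ∈ Icc 0 T, A.flow (σ * t) q ∈ C.ringDom r₁ r₂) ∧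
      A.flow (σ * T) q ∉ C.cross r₁ r₂ := by
  have hℓ := A.log_lam_neg
  obtain ⟨s, hs1, hs2⟩ := exists_between S.lt_rad
  have hs0 := S.pos₁.trans hs1
  have h0 := S.coreSize_pos
  -- the time needed to stretch a coordinate of absolute value `a` to the value `s`
  have htime : ∀ a : ℝ, coreSize r₁ r₂ < |a| → |a| ≤ r₁ → ∃ T, 0 ≤ T ∧ Real.exp (-Real.log lam * T) * |a| = s := by
    intro a ha ha'
    have ha0 := h0.trans ha
    refine ⟨Real.log (s / |a|) / (-Real.log lam), div_nonneg (Real.log_nonneg ?_) (by linarith), ?_⟩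
    · rw [le_div_iff₀ ha0]; linarith
    · rw [mul_div_cancel₀ _ (by linarith : -Real.log lam ≠ 0), Real.exp_log (by positivity)]
      field_simp
  have hmono : ∀ a t T : ℝ, t ≤ T → Real.exp (-Real.log lam * t) * |a| ≤ Real.exp (-Real.log lam * T) * |a| :=
    fun a t T h => mul_le_mul_of_nonneg_right (Real.exp_le_exp.2 (by nlinarith)) (abs_nonneg _)
  have hsmall : ∀ a t : ℝ, 0 ≤ t → Real.exp (Real.log lam * t) * |a| ≤ |a| := fun a t h =>
    mul_le_of_le_one_left (abs_nonneg _) (Real.exp_le_one_iff.2 (by nlinarith))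
  have hbig : ∀ a t : ℝ, 0 ≤ t → |a| ≤ Real.exp (-Real.log lam * t) * |a| := fun a t h =>
    le_mul_of_one_le_left (abs_nonneg _) (Real.one_le_exp (by nlinarith))
  rcases hD.2.2.2 with hx | hy
  · obtain ⟨T, hT, hTs⟩ := htime _ hx hc.2.1
    have hco : ∀ t ∈ Icc 0 T, |Real.exp (Real.log lam * (-1 * t)) * C.xc q| ≤ s ∧
        |Real.exp (-Real.log lam * (-1 * t)) * C.yc q| ≤ s := by
      intro t ht
      rw [abs_mul, abs_mul, Real.abs_exp, Real.abs_exp,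
        show Real.log lam * (-1 * t) = -Real.log lam * t by ring,
        show -Real.log lam * (-1 * t) = Real.log lam * t by ring]
      exact ⟨(hmono _ t T ht.2).trans hTs.le, (hsmall _ t ht.1).trans (hc.2.2.1.trans hs1.le)⟩
    have hdom := C.flow_mem_dom hD.1 hs2 (Or.inr rfl) hT hco
    have hxy : ∀ t ∈ Icc 0 T, |C.xc (A.flow (-1 * t) q)| = Real.exp (-Real.log lam * t) * |C.xc q| ∧
        |C.yc (A.flow (-1 * t) q)| ≤ s := by
      intro t ht
      have := C.xy_flow_dir (Or.inr rfl) ht.1 fun u hu => hdom u ⟨hu.1, hu.2.trans ht.2⟩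
      rw [this.1, this.2]
      refine ⟨?_, (hco t ht).2⟩
      rw [abs_mul, Real.abs_exp, show Real.log lam * (-1 * t) = -Real.log lam * t by ring]
    refine ⟨-1, T, Or.inr rfl, hT, fun t ht => ⟨hdom t ht, ?_, (hxy t ht).2.trans_lt hs2, Or.inl ?_⟩, fun h => ?_⟩
    · simp only; rw [(hxy t ht).1]
      exact ((hmono _ t T ht.2).trans hTs.le).trans_lt hs2
    · simp only; rw [(hxy t ht).1]
      exact hx.trans_le (hbig _ t ht.1)
    · have h1 : |C.xc (A.flow (-1 * T) q)| ≤ r₁ := h.2.1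
      rw [(hxy T ⟨hT, le_rfl⟩).1, hTs] at h1
      linarith
  · obtain ⟨T, hT, hTs⟩ := htime _ hy hc.2.2.1
    have hco : ∀ t ∈ Icc 0 T, |Real.exp (Real.log lam * (1 * t)) * C.xc q| ≤ s ∧
        |Real.exp (-Real.log lam * (1 * t)) * C.yc q| ≤ s := by
      intro t ht
      rw [abs_mul, abs_mul, Real.abs_exp, Real.abs_exp, one_mul]
      exact ⟨(hsmall _ t ht.1).trans (hc.2.1.trans hs1.le), (hmono _ t T ht.2).trans hTs.le⟩
    have hdom := C.flow_mem_dom hD.1 hs2 (Or.inl rfl) hT hco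
    have hxy : ∀ t ∈ Icc 0 T, |C.yc (A.flow (1 * t) q)| = Real.exp (-Real.log lam * t) * |C.yc q| ∧
        |C.xc (A.flow (1 * t) q)| ≤ s := by
      intro t ht
      have := C.xy_flow_dir (Or.inl rfl) ht.1 fun u hu => hdom u ⟨hu.1, hu.2.trans ht.2⟩
      rw [this.1, this.2]
      refine ⟨?_, (hco t ht).1⟩
      rw [abs_mul, Real.abs_exp, one_mul]
    refine ⟨1, T, Or.inl rfl, hT, fun t ht => ⟨hdom t ht, (hxy t ht).2.trans_lt hs2, ?_, Or.inr ?_⟩, fun h => ?_⟩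
    · simp only; rw [(hxy t ht).1]
      exact ((hmono _ t T ht.2).trans hTs.le).trans_lt hs2
    · simp only; rw [(hxy t ht).1]
      exact hy.trans_le (hbig _ t ht.1)
    · have h1 : |C.yc (A.flow (1 * T) q)| ≤ r₁ := h.2.2.1
      rw [(hxy T ⟨hT, le_rfl⟩).1, hTs] at h1
      linarith

variable [Nonempty (C.GluedSpace ρ r₁ r₂)]
  [ChartedSpace E3 (C.GluedSpace ρ r₁ r₂)] [IsManifold 𝓔 ∞ (C.GluedSpace ρ r₁ r₂)]
  {Y : ∀ x : C.GluedSpace ρ r₁ r₂, TangentSpace 𝓔 x}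
  {ψ : Flow ℝ (C.GluedSpace ρ r₁ r₂)} (h : C.IsSmoothModel ρ r₁ r₂ Y ψ)
include h

/-- Off the cross, `outerMap` inherits its properties from the inclusion of `M_R(r₁, r₂)`. -/
theorem eventuallyEq_of_notMem_cross {q : M₀} (hc : q ∉ C.cross r₁ r₂) :
    IsLocalDiffeomorphAt 𝓔 𝓔 ∞ (C.outerMap ρ r₁ r₂) q ∧
    mfderiv 𝓔 𝓔 (C.outerMap ρ r₁ r₂) q (A.X q) = Y (C.outerMap ρ r₁ r₂ q) := by
  have ho : ∀ q, q ∉ C.cross r₁ r₂ → (q : M) ∈ C.outer r₁ r₂ := fun q h =>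
    S.mem_outer_iff.2 fun h' => h ⟨h'.1, crossInterior_subset _ _ h'.2⟩
  obtain ⟨f, hf, hfe, hfX⟩ := h.smooth_outer q (ho q hc)
  have he : C.outerMap ρ r₁ r₂ =ᶠ[𝓝 q] f := by
    filter_upwards [hfe, S.isClosed_cross.isOpen_compl.mem_nhds hc] with q' h1 h2
    rw [outerMap_of_mem (ho q' h2), h1]
  refine ⟨hf.congr he, ?_⟩
  rw [he.mfderiv_eq, he.self_of_nhds]
  exact hfX

/-- In an arbitrary smooth model, `outerMap` is a local diffeomorphism also beyond the boundary, being
conjugate by the flows to itself at a point outside the cross. -/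
theorem isLocalDiffeomorphAt_outerMap {q : M₀} (hq : q ∈ C.outerDom r₁ r₂) :
    IsLocalDiffeomorphAt 𝓔 𝓔 ∞ (C.outerMap ρ r₁ r₂) q := by
  by_cases hc : q ∈ C.cross r₁ r₂
  swap
  · exact (S.eventuallyEq_of_notMem_cross h hc).1
  have hD := S.mem_ringDom_of_cross hq hc
  obtain ⟨σ, T, hσ, hT, harc, hex⟩ := S.exists_exit hD hc
  have hnear : ∀ᶠ q' in 𝓝 q, ∀ t ∈ Icc 0 T, A.flow (σ * t) q' ∈ C.ringDom r₁ r₂ := by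
    rcases hσ with rfl | rfl
    · simp only [one_mul] at harc ⊢
      exact A.flow.eventually_forall_mem (C.isOpen_ringDom r₁ r₂) harc
    · have := A.flow.eventually_forall_mem (C.isOpen_ringDom r₁ r₂) (x := q) (a := -T) (b := 0)
        fun t ht => by
          have := harc (-t) ⟨by linarith [ht.2], by linarith [ht.1]⟩
          simpa using this
      filter_upwards [this] with q' hq' t ht
      exact hq' _ ⟨by linarith [ht.2], by linarith [ht.1]⟩
  have hloc : C.outerMap ρ r₁ r₂ =ᶠ[𝓝 q] ψ (-(σ * T)) ∘ C.outerMap ρ r₁ r₂ ∘ A.flow (σ * T) := by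
    filter_upwards [hnear] with q' hq'
    show _ = ψ (-(σ * T)) (C.outerMap ρ r₁ r₂ (A.flow (σ * T) q'))
    rcases hσ with rfl | rfl
    · have := S.outerMap_flow_of_ringDom h hT (q := q') (by simpa using hq')
      rw [A.flow.map_zero_apply, sub_zero] at this
      rw [one_mul, this, ← ψ.map_add, neg_add_cancel, ψ.map_zero_apply]
    · have := S.outerMap_flow_of_ringDom h (a := -T) (b := 0) (by linarith) (q := q') (fun t ht => by
        have := hq' (-t) ⟨by linarith [ht.2], by linarith [ht.1]⟩
        simpa using this)
      rw [A.flow.map_zero_apply, zero_sub] at this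
      rw [neg_one_mul, this]
  have h2 := (S.eventuallyEq_of_notMem_cross h hex).1
  exact (((A.isSmoothFlowOf.isLocalDiffeomorphAt (σ * T) q).trans h2).trans
    (h.isSmoothFlowOf.isLocalDiffeomorphAt _ _)).congr hloc

theorem mfderiv_outerMap_field {q : M₀} (hq : q ∈ C.outerDom r₁ r₂) :
    mfderiv 𝓔 𝓔 (C.outerMap ρ r₁ r₂) q (A.X q) = Y (C.outerMap ρ r₁ r₂ q) := by
  by_cases hc : q ∈ C.cross r₁ r₂
  swap
  · exact (S.eventuallyEq_of_notMem_cross h hc).2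
  have hD := S.mem_ringDom_of_cross hq hc
  have hcf : Continuous (fun t => A.flow t q) := by fun_prop
  have h1 : ∀ᶠ t in 𝓝 (0 : ℝ), A.flow t q ∈ C.ringDom r₁ r₂ :=
    hcf.continuousAt.eventually_mem ((C.isOpen_ringDom r₁ r₂).mem_nhds (by rwa [A.flow.map_zero_apply]))
  obtain ⟨ε, hε, hb⟩ := Metric.eventually_nhds_iff_ball.1 h1
  have h2 : (fun t => ψ t (C.outerMap ρ r₁ r₂ q)) =ᶠ[𝓝 0] C.outerMap ρ r₁ r₂ ∘ fun t => A.flow t q := by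
    filter_upwards [Metric.ball_mem_nhds 0 hε] with t ht
    rw [Metric.mem_ball, Real.dist_eq, sub_zero, abs_lt] at ht
    rcases le_total 0 t with h0 | h0
    · have := S.outerMap_flow_of_ringDom h h0 (q := q) fun s hs => hb s (by
        rw [Metric.mem_ball, Real.dist_eq, sub_zero, abs_lt]
        constructor <;> linarith [hs.1, hs.2])
      rw [A.flow.map_zero_apply, sub_zero] at this
      exact this.symm
    · have := S.outerMap_flow_of_ringDom h h0 (q := q) fun s hs => hb s (by
        rw [Metric.mem_ball, Real.dist_eq, sub_zero, abs_lt]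
        constructor <;> linarith [hs.1, hs.2])
      rw [A.flow.map_zero_apply, zero_sub] at this
      rw [this, ← ψ.map_add, add_neg_cancel, ψ.map_zero_apply]; rfl
  have hd : MDifferentiableAt 𝓔 𝓔 (C.outerMap ρ r₁ r₂) (A.flow 0 q) := by
    rw [A.flow.map_zero_apply]
    exact (S.isLocalDiffeomorphAt_outerMap h hq).mdifferentiableAt (by simp)
  have h3 := ((A.hasVelocity_flow q 0).comp hd).congr h2 rfl
  have h4 := (h.isSmoothFlowOf.hasVelocity (C.outerMap ρ r₁ r₂ q) 0).unique h3
  have e1 : ∀ q', q' = q → (mfderiv 𝓔 𝓔 (C.outerMap ρ r₁ r₂) q' (A.X q') : E3) =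
      mfderiv 𝓔 𝓔 (C.outerMap ρ r₁ r₂) q (A.X q) := by rintro _ rfl; rfl
  have e2 : ∀ a, a = C.outerMap ρ r₁ r₂ q → (Y a : E3) = Y (C.outerMap ρ r₁ r₂ q) := by rintro _ rfl; rfl
  exact ((e1 _ (A.flow.map_zero_apply q)).symm.trans h4.symm).trans (e2 _ (ψ.map_zero_apply _))

theorem outerMap_flow {q : M₀} {a b : ℝ} (hab : a ≤ b)
    (hq : ∀ t ∈ Icc a b, A.flow t q ∈ C.outerDom r₁ r₂) :
    C.outerMap ρ r₁ r₂ (A.flow b q) = ψ (b - a) (C.outerMap ρ r₁ r₂ (A.flow a q)) := by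
  have := S.t2Space
  have hcf : Continuous (fun t => A.flow t q) := by fun_prop
  refine h.isSmoothFlowOf.eq_of_integralCurve (c := fun t => C.outerMap ρ r₁ r₂ (A.flow t q)) hab
    (S.continuousOn_outerMap.comp hcf.continuousOn hq) fun t ht => ?_
  have hqt := hq t (Ioo_subset_Icc_self ht)
  exact ((A.hasVelocity_flow q t).comp ((S.isLocalDiffeomorphAt_outerMap h hqt).mdifferentiableAt
    (by simp))).congr Filter.EventuallyEq.rfl (S.mfderiv_outerMap_field h hqt).symm

end IsGlueingData
end NormalCoordinates

/-! ### Differentials of the flow in the two parametrizations -/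

section tangentMap
variable {E H E' H' : Type*} [NormedAddCommGroup E] [NormedSpace ℝ E] [TopologicalSpace H]
  [NormedAddCommGroup E'] [NormedSpace ℝ E'] [TopologicalSpace H']
  {I : ModelWithCorners ℝ E H} {J : ModelWithCorners ℝ E' H'}
  {X X' : Type*} [TopologicalSpace X] [ChartedSpace H X] [IsManifold I 1 X]
  [TopologicalSpace X'] [ChartedSpace H' X'] [IsManifold J 1 X']

omit [IsManifold I 1 X] [IsManifold J 1 X'] in
theorem Filter.EventuallyEq.tangentMap_eq {f f' : X → X'} {x : X} (h : f =ᶠ[𝓝 x] f')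
    (v : TangentSpace I x) : tangentMap I J f ⟨x, v⟩ = tangentMap I J f' ⟨x, v⟩ := by
  have key : ∀ (y : X') (_ : y = f' x) (L L' : E →L[ℝ] E') (_ : L = L'),
      (⟨y, L v⟩ : TangentBundle J X') = ⟨f' x, L' v⟩ := by
    rintro _ rfl L _ rfl; rfl
  exact key _ h.self_of_nhds _ _ h.mfderiv_eq

end tangentMap

/-- The flow of the affine vector field. -/
def affineFlow (lam : ℝ) (n k : ℕ) (t : ℝ) (u : ℝ³) : ℝ³ :=
  (Real.exp (Real.log lam * t) * u.1, Real.exp (-Real.log lam * t) * u.2.1,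
    u.2.2 + t * (1 / ((n : ℝ) * (k : ℝ))))

theorem affineFlow_zero (lam : ℝ) (n k : ℕ) (u : ℝ³) : affineFlow lam n k 0 u = u := by
  simp [affineFlow]

theorem continuous_affineFlow (lam : ℝ) (n k : ℕ) (u : ℝ³) :
    Continuous fun t => affineFlow lam n k t u := by
  unfold affineFlow; fun_prop

theorem hasDerivAt_affineFlow (lam : ℝ) (n k : ℕ) (t : ℝ) (u : ℝ³) :
    HasDerivAt (fun t => affineFlow lam n k t u) (affineField lam n k (affineFlow lam n k t u)) t := by
  have h1 : ∀ c a : ℝ, HasDerivAt (fun t => Real.exp (c * t) * a) (c * (Real.exp (c * t) * a)) t := by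
    intro c a
    have := (((hasDerivAt_id t).const_mul c).exp).mul_const a
    exact this.congr_deriv (by simp; ring)
  have h2 : HasDerivAt (fun t => u.2.2 + t * (1 / ((n : ℝ) * (k : ℝ)))) (1 / ((n : ℝ) * (k : ℝ))) t := by
    have := ((hasDerivAt_id t).mul_const (1 / ((n : ℝ) * (k : ℝ)))).const_add u.2.2
    exact this.congr_deriv (by simp)
  exact (h1 _ _).prodMk ((h1 _ _).prodMk h2)

theorem affineFlow_fderiv (lam : ℝ) (n k : ℕ) (t : ℝ) (u : ℝ³) :
    ∃ L : ℝ³ →L[ℝ] ℝ³, HasFDerivAt (affineFlow lam n k t) L u ∧ ∀ v : ℝ³,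
      L v = (Real.exp (Real.log lam * t) * v.1, Real.exp (-Real.log lam * t) * v.2.1, v.2.2) := by
  have h1 : HasFDerivAt (fun u : ℝ³ => u.1) (ContinuousLinearMap.fst ℝ ℝ (ℝ × ℝ)) u :=
    hasFDerivAt_fst
  have h2 : HasFDerivAt (fun u : ℝ³ => u.2.1)
    ((ContinuousLinearMap.fst ℝ ℝ ℝ).comp (ContinuousLinearMap.snd ℝ ℝ (ℝ × ℝ))) u :=
    hasFDerivAt_fst.comp u hasFDerivAt_snd
  have h3 : HasFDerivAt (fun u : ℝ³ => u.2.2)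
    ((ContinuousLinearMap.snd ℝ ℝ ℝ).comp (ContinuousLinearMap.snd ℝ ℝ (ℝ × ℝ))) u :=
    hasFDerivAt_snd.comp u hasFDerivAt_snd
  refine ⟨_, (h1.const_mul _).prodMk ((h2.const_mul _).prodMk (h3.add_const _)), fun v => ?_⟩
  simp

/-- The lifted coordinates of the interior of the cross. -/
def liftInt (r₁ r₂ : ℝ) : Set ℝ³ := {u | (u.1, u.2.1) ∈ crossInterior r₁ r₂}

theorem isOpen_liftInt (r₁ r₂ : ℝ) : IsOpen (liftInt r₁ r₂) :=
  (isOpen_crossInterior r₁ r₂).preimage (by fun_prop)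

namespace NormalCoordinates

theorem liftProj_mem {u : ℝ³} (hu : u ∈ liftInt r₁ r₂) : liftProj u ∈ affineCross r₁ r₂ :=
  affineInt_subset r₁ r₂ hu

variable (C ρ r₁ r₂) in
/-- The inclusion of the cross, precomposed with the covering `ℝ³ → ℝ² × ℝ/ℤ`. -/
def liftMap [Nonempty (C.GluedSpace ρ r₁ r₂)] (u : ℝ³) : C.GluedSpace ρ r₁ r₂ :=
  C.affineMap ρ r₁ r₂ (liftProj u)

namespace IsGlueingData
variable [T2Space M] (S : C.IsGlueingData ρ r₁ r₂) [Nonempty (C.GluedSpace ρ r₁ r₂)]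
  [ChartedSpace E3 (C.GluedSpace ρ r₁ r₂)] [IsManifold 𝓔 ∞ (C.GluedSpace ρ r₁ r₂)]
  {Y : ∀ x : C.GluedSpace ρ r₁ r₂, TangentSpace 𝓔 x}
  {ψ : Flow ℝ (C.GluedSpace ρ r₁ r₂)} (h : C.IsSmoothModel ρ r₁ r₂ Y ψ)
include h

omit [T2Space M] in
/-- In a smooth model, `liftMap` is a local diffeomorphism that respects the vector fields. -/
theorem liftMap_spec {u : ℝ³} (hu : u ∈ liftInt r₁ r₂) :
    IsLocalDiffeomorphAt 𝓘(ℝ, ℝ³) 𝓔 ∞ (C.liftMap ρ r₁ r₂) u ∧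
    mfderiv 𝓘(ℝ, ℝ³) 𝓔 (C.liftMap ρ r₁ r₂) u (affineField lam n k u) =
      Y (C.liftMap ρ r₁ r₂ u) := by
  obtain ⟨f, hf, hfe, hfX⟩ := h.smooth_affine u (liftProj_mem hu)
  have he : C.liftMap ρ r₁ r₂ =ᶠ[𝓝 u] f := by
    filter_upwards [hfe, (isOpen_liftInt r₁ r₂).mem_nhds hu] with q' h1 h2
    rw [liftMap, affineMap_of_mem (liftProj_mem h2), h1]
  refine ⟨hf.congr he, ?_⟩
  rw [he.mfderiv_eq, he.self_of_nhds]
  exact hfX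

include S

theorem liftMap_flow {u : ℝ³} {a b : ℝ} (hab : a ≤ b)
    (hu : ∀ t ∈ Icc a b, affineFlow lam n k t u ∈ liftInt r₁ r₂) :
    C.liftMap ρ r₁ r₂ (affineFlow lam n k b u) =
      ψ (b - a) (C.liftMap ρ r₁ r₂ (affineFlow lam n k a u)) := by
  have := S.t2Space
  have hcf := continuous_affineFlow lam n k u
  refine h.isSmoothFlowOf.eq_of_integralCurve
    (c := fun t => C.liftMap ρ r₁ r₂ (affineFlow lam n k t u)) hab ?_ fun t ht => ?_
  · exact (continuousOn_affineMap.comp continuous_liftProj.continuousOn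
      fun u hu => liftProj_mem hu).comp hcf.continuousOn hu
  have hut := liftMap_spec h (hu t (Ioo_subset_Icc_self ht))
  have h1 : HasVelocity 𝓘(ℝ, ℝ³) (fun t => affineFlow lam n k t u)
      (affineField lam n k (affineFlow lam n k t u)) t :=
    (hasDerivAt_affineFlow lam n k t u).hasFDerivAt.hasMFDerivAt
  exact (h1.comp (hut.1.mdifferentiableAt (by simp))).congr Filter.EventuallyEq.rfl hut.2.symm

omit h [ChartedSpace E3 (C.GluedSpace ρ r₁ r₂)]
  [IsManifold 𝓔 ∞ (C.GluedSpace ρ r₁ r₂)] in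
/-- Inside the cross, the two parametrizations differ by a lift of the glueing map. -/
theorem outerMap_eventuallyEq_liftMap {q : M₀} (hc : q ∈ C.crossInt r₁ r₂)
    {g : M₀ → ℝ³} {T : ℝ → ℝ} (hg : ∀ᶠ q' in 𝓝 q, C.IsGlueLift ρ r₁ r₂ g T q') :
    C.outerMap ρ r₁ r₂ =ᶠ[𝓝 q] C.liftMap ρ r₁ r₂ ∘ g := by
  filter_upwards [hg, (C.isOpen_crossInt r₁ r₂).mem_nhds hc] with q' h1 h2
  rw [S.outerMap_eq_affineMap h1.mem ⟨h2.1, crossInterior_subset _ _ h2.2⟩, ← h1.liftProj_eq]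
  rfl

omit [T2Space M] S h [IsManifold 𝓔 ∞ (C.GluedSpace ρ r₁ r₂)] in
theorem mem_liftInt_of_isGlueLift {q : M₀} (hc : q ∈ C.crossInt r₁ r₂)
    {g : M₀ → ℝ³} {T : ℝ → ℝ} (hg : C.IsGlueLift ρ r₁ r₂ g T q) :
    g q ∈ liftInt r₁ r₂ := by
  show ((g q).1, (g q).2.1) ∈ crossInterior r₁ r₂
  rw [hg.fst_eq, hg.snd_eq]; exact hc.2

theorem tangentMap_outerMap_eq {q : M₀} (hc : q ∈ C.crossInt r₁ r₂)
    {g : M₀ → ℝ³} {T : ℝ → ℝ} (hg : ∀ᶠ q' in 𝓝 q, C.IsGlueLift ρ r₁ r₂ g T q')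
    (v : TangentSpace 𝓔 q) :
    tangentMap 𝓔 𝓔 (C.outerMap ρ r₁ r₂) ⟨q, v⟩ =
      tangentMap 𝓘(ℝ, ℝ³) 𝓔 (C.liftMap ρ r₁ r₂) ⟨g q, vderiv g q v⟩ := by
  have h0 := S.outerMap_eventuallyEq_liftMap hc hg
  have hg0 := hg.self_of_nhds
  have h1 := tangentMap_comp_at (⟨q, v⟩ : TangentBundle 𝓔 M₀)
    (f := g) (g := C.liftMap ρ r₁ r₂)
    ((liftMap_spec h (mem_liftInt_of_isGlueLift hc hg0)).1.mdifferentiableAt (by simp))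
    (hg0.isLocalDiffeomorphAt.mdifferentiableAt (by simp))
  have h2 : tangentMap 𝓔 𝓔 (C.outerMap ρ r₁ r₂) ⟨q, v⟩ =
      tangentMap 𝓔 𝓔 (C.liftMap ρ r₁ r₂ ∘ g) ⟨q, v⟩ := h0.tangentMap_eq v
  rw [h2, h1]
  rfl

/-- The differential of the inclusion of `M_R(r₁, r₂)` intertwines the differentials of the flows along
orbit arcs. -/
theorem tangentMap_flow_outerMap {q : M₀} {σ T : ℝ} (hσ : σ = 1 ∨ σ = -1) (hT : 0 ≤ T)
    (hq : ∀ t ∈ Icc 0 T, A.flow (σ * t) q ∈ C.outerDom r₁ r₂) (v : TangentSpace 𝓔 q) :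
    tangentMap 𝓔 𝓔 (ψ (σ * T))
      (tangentMap 𝓔 𝓔 (C.outerMap ρ r₁ r₂) ⟨q, v⟩) =
    tangentMap 𝓔 𝓔 (C.outerMap ρ r₁ r₂) ⟨A.flow (σ * T) q, A.D (σ * T) q v⟩ := by
  have hnear : ∀ᶠ q' in 𝓝 q, ∀ t ∈ Icc 0 T, A.flow (σ * t) q' ∈ C.outerDom r₁ r₂ := by
    rcases hσ with rfl | rfl
    · simp only [one_mul] at hq ⊢
      exact A.flow.eventually_forall_mem S.isOpen_outerDom hq
    · have := A.flow.eventually_forall_mem S.isOpen_outerDom (x := q) (a := -T) (b := 0)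
        fun t ht => by
          have := hq (-t) ⟨by linarith [ht.2], by linarith [ht.1]⟩
          simpa using this
      filter_upwards [this] with q' hq' t ht
      exact hq' _ ⟨by linarith [ht.2], by linarith [ht.1]⟩
  have h0 : ψ (σ * T) ∘ C.outerMap ρ r₁ r₂ =ᶠ[𝓝 q] C.outerMap ρ r₁ r₂ ∘ A.flow (σ * T) := by
    filter_upwards [hnear] with q' hq'
    show ψ (σ * T) (C.outerMap ρ r₁ r₂ q') = C.outerMap ρ r₁ r₂ (A.flow (σ * T) q')
    rcases hσ with rfl | rfl
    · have := S.outerMap_flow h hT (q := q') (by simpa using hq')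
      rw [A.flow.map_zero_apply, sub_zero] at this
      rw [one_mul, this]
    · have := S.outerMap_flow h (a := -T) (b := 0) (by linarith) (q := q') (fun t ht => by
        have := hq' (-t) ⟨by linarith [ht.2], by linarith [ht.1]⟩
        simpa using this)
      rw [A.flow.map_zero_apply, zero_sub, neg_neg] at this
      rw [neg_one_mul, this, ← ψ.map_add, neg_add_cancel, ψ.map_zero_apply]
  have hq0 : q ∈ C.outerDom r₁ r₂ := by
    have := hq 0 ⟨le_rfl, hT⟩
    rwa [mul_zero, A.flow.map_zero_apply] at this
  have h1 := tangentMap_comp_at (⟨q, v⟩ : TangentBundle 𝓔 M₀)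
    (f := C.outerMap ρ r₁ r₂) (g := ψ (σ * T))
    (mdifferentiable_flow_apply h.isSmoothFlowOf.smooth_flow _ _)
    ((S.isLocalDiffeomorphAt_outerMap h hq0).mdifferentiableAt (by simp))
  have h2 := tangentMap_comp_at (⟨q, v⟩ : TangentBundle 𝓔 M₀)
    (f := A.flow (σ * T)) (g := C.outerMap ρ r₁ r₂)
    ((S.isLocalDiffeomorphAt_outerMap h (hq T ⟨hT, le_rfl⟩)).mdifferentiableAt (by simp))
    (mdifferentiable_flow_apply A.isSmoothFlowOf.smooth_flow _ _)
  rw [← h1, h0.tangentMap_eq v, h2]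
  rfl

theorem tangentMap_flow_liftMap {u : ℝ³} {σ T : ℝ} (hσ : σ = 1 ∨ σ = -1) (hT : 0 ≤ T)
    (hq : ∀ t ∈ Icc 0 T, affineFlow lam n k (σ * t) u ∈ liftInt r₁ r₂) (v : ℝ³) :
    tangentMap 𝓔 𝓔 (ψ (σ * T))
      (tangentMap 𝓘(ℝ, ℝ³) 𝓔 (C.liftMap ρ r₁ r₂) ⟨u, v⟩) =
    tangentMap 𝓘(ℝ, ℝ³) 𝓔 (C.liftMap ρ r₁ r₂) ⟨affineFlow lam n k (σ * T) u,
      (Real.exp (Real.log lam * (σ * T)) * v.1, Real.exp (-Real.log lam * (σ * T)) * v.2.1, v.2.2)⟩ := by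
  obtain ⟨L, hL, hLv⟩ := affineFlow_fderiv lam n k (σ * T) u
  have hc : Continuous fun z : ℝ³ × ℝ => affineFlow lam n k (σ * z.2) z.1 := by
    unfold affineFlow; fun_prop
  have hnear : ∀ᶠ u' in 𝓝 u, ∀ t ∈ Icc 0 T, affineFlow lam n k (σ * t) u' ∈ liftInt r₁ r₂ :=
    isCompact_Icc.eventually_forall_of_forall_eventually
      (P := fun u' t => affineFlow lam n k (σ * t) u' ∈ liftInt r₁ r₂)
      fun t ht => hc.continuousAt.eventually ((isOpen_liftInt r₁ r₂).mem_nhds (hq t ht))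
  have h0 : ψ (σ * T) ∘ C.liftMap ρ r₁ r₂ =ᶠ[𝓝 u] C.liftMap ρ r₁ r₂ ∘ affineFlow lam n k (σ * T) := by
    filter_upwards [hnear] with q' hq'
    show ψ (σ * T) (C.liftMap ρ r₁ r₂ q') = C.liftMap ρ r₁ r₂ (affineFlow lam n k (σ * T) q')
    rcases hσ with rfl | rfl
    · have := S.liftMap_flow h hT (u := q') (by simpa using hq')
      rw [affineFlow_zero, sub_zero] at this
      rw [one_mul, this]
    · have := S.liftMap_flow h (a := -T) (b := 0) (by linarith) (u := q') (fun t ht => by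
        have := hq' (-t) ⟨by linarith [ht.2], by linarith [ht.1]⟩
        simpa using this)
      rw [affineFlow_zero, zero_sub, neg_neg] at this
      rw [neg_one_mul, this, ← ψ.map_add, neg_add_cancel, ψ.map_zero_apply]
  have hq0 : u ∈ liftInt r₁ r₂ := by
    have := hq 0 ⟨le_rfl, hT⟩
    rwa [mul_zero, affineFlow_zero] at this
  have h1 := tangentMap_comp_at (⟨u, v⟩ : TangentBundle 𝓘(ℝ, ℝ³) ℝ³)
    (f := C.liftMap ρ r₁ r₂) (g := ψ (σ * T))
    (mdifferentiable_flow_apply h.isSmoothFlowOf.smooth_flow _ _)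
    ((liftMap_spec h hq0).1.mdifferentiableAt (by simp))
  have hL' : HasMFDerivAt 𝓘(ℝ, ℝ³) 𝓘(ℝ, ℝ³) (affineFlow lam n k (σ * T)) u L :=
    hL.hasMFDerivAt
  have h2 := tangentMap_comp_at (⟨u, v⟩ : TangentBundle 𝓘(ℝ, ℝ³) ℝ³)
    (f := affineFlow lam n k (σ * T)) (g := C.liftMap ρ r₁ r₂)
    ((liftMap_spec h (hq T ⟨hT, le_rfl⟩)).1.mdifferentiableAt (by simp)) hL'.mdifferentiableAt
  rw [← h1, h0.tangentMap_eq v, h2]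
  congr 1
  show (⟨affineFlow lam n k (σ * T) u, mfderiv 𝓘(ℝ, ℝ³) 𝓘(ℝ, ℝ³)
    (affineFlow lam n k (σ * T)) u v⟩ : TangentBundle 𝓘(ℝ, ℝ³) ℝ³) = _
  rw [hL'.mfderiv, ← hLv v]
  rfl

/-- The inclusion of the cross is invariant by integral vertical translations. -/
theorem tangentMap_liftMap_add_int {u : ℝ³} (hu : u ∈ liftInt r₁ r₂) (j : ℤ) (v : ℝ³) :
    tangentMap 𝓘(ℝ, ℝ³) 𝓔 (C.liftMap ρ r₁ r₂) ⟨u + (0, 0, (j : ℝ)), v⟩ =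
      tangentMap 𝓘(ℝ, ℝ³) 𝓔 (C.liftMap ρ r₁ r₂) ⟨u, v⟩ := by
  have hL : HasMFDerivAt 𝓘(ℝ, ℝ³) 𝓘(ℝ, ℝ³) (fun u => u + (0, 0, (j : ℝ))) u
      (ContinuousLinearMap.id ℝ ℝ³) := ((hasFDerivAt_id u).add_const _).hasMFDerivAt
  have hu' : u + (0, 0, (j : ℝ)) ∈ liftInt r₁ r₂ := by
    show ((u + (0, 0, (j : ℝ))).1, (u + (0, 0, (j : ℝ))).2.1) ∈ crossInterior r₁ r₂
    simpa using (show (u.1, u.2.1) ∈ crossInterior r₁ r₂ from hu)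
  have h0 : C.liftMap ρ r₁ r₂ = C.liftMap ρ r₁ r₂ ∘ fun u => u + (0, 0, (j : ℝ)) := by
    funext u
    rw [Function.comp, liftMap, liftMap, liftProj_add_int]
  have h2 := tangentMap_comp_at (⟨u, v⟩ : TangentBundle 𝓘(ℝ, ℝ³) ℝ³)
    (f := fun u => u + (0, 0, (j : ℝ))) (g := C.liftMap ρ r₁ r₂)
    ((liftMap_spec h hu').1.mdifferentiableAt (by simp)) hL.mdifferentiableAt
  conv_rhs => rw [h0, h2]
  congr 1
  show _ = (⟨u + (0, 0, (j : ℝ)), mfderiv 𝓘(ℝ, ℝ³) 𝓘(ℝ, ℝ³)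
    (fun u => u + (0, 0, (j : ℝ))) u v⟩ : TangentBundle 𝓘(ℝ, ℝ³) ℝ³)
  rw [hL.mfderiv]
  rfl

end IsGlueingData

/-! ### Cone fields -/

variable (C ρ r₁ r₂) in
/-- A field of cones with sizes, expanded at the rate `κ` in the direction `σ = ±1` of time. `outer q v b`
means that `v` is in the cone at `q` in the complement of `γ` and has size `b`, and `affine u w b` has the
same meaning in the coordinates of the cross. An orbit enters the cross with `σ |x| > σ |y|` and leaves
it with `σ |x| < σ |y|`. -/
structure ConeField (σ κ : ℝ) where
  outer : ∀ q : M₀, TangentSpace 𝓔 q → ℝ → Prop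
  affine : ℝ³ → ℝ³ → ℝ → Prop
  outer_flow : ∀ q v b t, 0 ≤ t → outer q v b →
    ∃ b', Real.exp (κ * t) * b ≤ b' ∧ outer (A.flow (σ * t) q) (A.D (σ * t) q v) b'
  affine_flow : ∀ u w b t, 0 ≤ t → affine u w b →
    ∃ b', Real.exp (κ * t) * b ≤ b' ∧ affine (affineFlow lam n k (σ * t) u)
      (Real.exp (Real.log lam * (σ * t)) * w.1, Real.exp (-Real.log lam * (σ * t)) * w.2.1, w.2.2) b'
  affine_add_int : ∀ u w b (j : ℤ), affine u w b → affine (u + (0, 0, (j : ℝ))) w b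
  enter : ∀ q ∈ C.crossInt r₁ r₂, 0 < σ * (|C.xc q| - |C.yc q|) → ∀ g T,
    C.IsGlueLift ρ r₁ r₂ g T q → IsShear (r₁ * r₂) T → ((∀ s, T s = 0) ∨ |C.yc q| < C.xc q) →
    ∀ v b, outer q v b → ∃ b', b ≤ b' ∧ affine (g q) (vderiv g q v) b'
  exit : ∀ q ∈ C.crossInt r₁ r₂, σ * (|C.xc q| - |C.yc q|) < 0 → ∀ g T,
    C.IsGlueLift ρ r₁ r₂ g T q → IsShear (r₁ * r₂) T → ((∀ s, T s = 0) ∨ |C.yc q| < C.xc q) →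
    ∀ v b, affine (g q) (vderiv g q v) b → ∃ b', b ≤ b' ∧ outer q v b'

namespace IsGlueingData
variable [T2Space M] (S : C.IsGlueingData ρ r₁ r₂)
include S

/-- On either side in time, a short orbit arc starting at a point of `M_R(r₁, r₂)` lies in
`M_R(r₁, r₂)` or, apart from its origin, in the interior of the cross. -/
theorem exists_local_arc_dir {q : M₀} (hq : (q : M) ∈ C.outer r₁ r₂) {σ : ℝ}
    (hσ : σ = 1 ∨ σ = -1) :
    ∃ ε > 0, ((∀ t ∈ Ico 0 ε, (A.flow (σ * t) q : M) ∈ C.outer r₁ r₂) ∨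
      ∀ t ∈ Ioo 0 ε, A.flow (σ * t) q ∈ C.ringDom r₁ r₂ ∧ A.flow (σ * t) q ∈ C.crossInt r₁ r₂ ∧
        0 < σ * (|C.xc (A.flow (σ * t) q)| - |C.yc (A.flow (σ * t) q)|)) := by
  have hcf : Continuous (fun t => A.flow (σ * t) q) :=
    A.flow.continuous (continuous_const.mul continuous_id) continuous_const
  have h00 : A.flow (σ * 0) q = q := by rw [mul_zero, A.flow.map_zero_apply]
  have hℓ := A.log_lam_neg
  by_cases hc : q ∈ C.cross r₁ r₂
  swap
  · have h1 : ∀ᶠ t in 𝓝 (0 : ℝ), A.flow (σ * t) q ∉ C.cross r₁ r₂ :=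
      hcf.continuousAt.eventually_mem (S.isClosed_cross.isOpen_compl.mem_nhds (by rwa [h00]))
    obtain ⟨ε, hε, hb⟩ := Metric.eventually_nhds_iff_ball.1 h1
    refine ⟨ε, hε, Or.inl fun t ht => S.mem_outer_iff.2 fun h' =>
      hb t (by rw [Metric.mem_ball, Real.dist_eq, sub_zero, abs_lt]; constructor <;> linarith [ht.1, ht.2])
        ⟨h'.1, crossInterior_subset _ _ h'.2⟩⟩
  have hni := S.mem_outer_iff.1 hq
  have hD := S.mem_ringDom_of_boundary hc hni
  have hDe : ∀ᶠ t in 𝓝 (0 : ℝ), A.flow (σ * t) q ∈ C.ringDom r₁ r₂ :=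
    hcf.continuousAt.eventually_mem ((C.isOpen_ringDom r₁ r₂).mem_nhds (by rwa [h00]))
  have hsc : Filter.Tendsto (fun t : ℝ => σ * t) (𝓝 0) (𝓝 0) := by
    have : Continuous fun t : ℝ => σ * t := by fun_prop
    simpa using this.tendsto 0
  have hxy := hsc.eventually (C.eventually_xy_flow hD.1)
  obtain ⟨hcx, hcy, hcp⟩ := hc.2
  simp only at hcx hcy hcp
  have hprod : ∀ t, C.xc (A.flow (σ * t) q) = Real.exp (Real.log lam * (σ * t)) * C.xc q ∧
      C.yc (A.flow (σ * t) q) = Real.exp (-Real.log lam * (σ * t)) * C.yc q →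
      C.xc (A.flow (σ * t) q) * C.yc (A.flow (σ * t) q) = C.xc q * C.yc q := by
    rintro t ⟨h3, h4⟩
    rw [h3, h4, mul_mul_mul_comm, ← Real.exp_add]
    simp
  rcases hcp.eq_or_lt with h0 | h0
  · obtain ⟨ε, hε, hb⟩ := Metric.eventually_nhds_iff_ball.1 hxy
    refine ⟨ε, hε, Or.inl fun t ht => S.mem_outer_iff.2 fun h' => ?_⟩
    have h1 := hprod t (hb t (by
      rw [Metric.mem_ball, Real.dist_eq, sub_zero, abs_lt]; constructor <;> linarith [ht.1, ht.2]))
    have h2 := h'.2.2.2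
    simp only at h2
    rw [h1, h0] at h2
    exact lt_irrefl _ h2
  have hcont : ∀ c a : ℝ, Continuous fun t : ℝ => |Real.exp (c * (σ * t)) * a| := fun c a => by fun_prop
  have hle : ∀ s a : ℝ, s < 0 → 0 < |a| → |Real.exp s * a| < |a| := fun s a hs ha => by
    rw [abs_mul, Real.abs_exp]
    exact mul_lt_of_lt_one_left ha (by rw [← Real.exp_zero]; exact Real.exp_lt_exp.2 hs)
  have hge : ∀ s a : ℝ, 0 ≤ s → |a| ≤ |Real.exp s * a| := fun s a hs => by
    rw [abs_mul, Real.abs_exp]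
    exact le_mul_of_one_le_left (abs_nonneg _) (Real.one_le_exp hs)
  have hr1 := S.pos₁
  have hr2 := S.pos
  have hlt := S.lt
  -- the coordinates of a point of the faces of entrance and of exit
  have hother : ∀ a b : ℝ, |a| = r₁ → |a * b| < r₁ * r₂ → |b| < r₂ := by
    intro a b ha hab
    rw [abs_mul, ha] at hab
    exact lt_of_mul_lt_mul_left hab hr1.le
  have hface : |C.xc q| = r₁ ∨ |C.yc q| = r₁ := by
    by_contra hn
    push Not at hn
    exact hni ⟨hc.1, lt_of_le_of_ne hcx hn.1, lt_of_le_of_ne hcy hn.2, h0⟩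
  have hexp : ∀ t, 0 ≤ t → (σ = 1 → Real.log lam * (σ * t) ≤ 0 ∧ 0 ≤ -Real.log lam * (σ * t)) ∧
      (σ = -1 → 0 ≤ Real.log lam * (σ * t) ∧ -Real.log lam * (σ * t) ≤ 0) := by
    intro t ht
    constructor
    · rintro rfl
      constructor <;> nlinarith
    · rintro rfl
      constructor <;> nlinarith
  have hout_x : |C.xc q| = r₁ → σ = -1 → ∃ ε > 0, ∀ t ∈ Ico 0 ε, (A.flow (σ * t) q : M) ∈ C.outer r₁ r₂ := by
    intro hx hs
    obtain ⟨ε, hε, hb⟩ := Metric.eventually_nhds_iff_ball.1 hxy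
    refine ⟨ε, hε, fun t ht => S.mem_outer_iff.2 fun h' => ?_⟩
    have h1 := hb t (by
      rw [Metric.mem_ball, Real.dist_eq, sub_zero, abs_lt]; constructor <;> linarith [ht.1, ht.2])
    have h2 : |C.xc (A.flow (σ * t) q)| < r₁ := h'.2.1
    rw [h1.1] at h2
    linarith [hge _ (C.xc q) ((hexp t ht.1).2 hs).1]
  have hout_y : |C.yc q| = r₁ → σ = 1 → ∃ ε > 0, ∀ t ∈ Ico 0 ε, (A.flow (σ * t) q : M) ∈ C.outer r₁ r₂ := by
    intro hx hs
    obtain ⟨ε, hε, hb⟩ := Metric.eventually_nhds_iff_ball.1 hxy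
    refine ⟨ε, hε, fun t ht => S.mem_outer_iff.2 fun h' => ?_⟩
    have h1 := hb t (by
      rw [Metric.mem_ball, Real.dist_eq, sub_zero, abs_lt]; constructor <;> linarith [ht.1, ht.2])
    have h2 : |C.yc (A.flow (σ * t) q)| < r₁ := h'.2.2.1
    rw [h1.2] at h2
    linarith [hge _ (C.yc q) ((hexp t ht.1).1 hs).2]
  rcases hface with hx | hy
  · rcases hσ with hσ | hσ
    swap
    · obtain ⟨ε, hε, h1⟩ := hout_x hx hσ
      exact ⟨ε, hε, Or.inl h1⟩
    have hyr := hother _ _ hx h0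
    have e1 : ∀ᶠ t in 𝓝 (0 : ℝ), |Real.exp (-Real.log lam * (σ * t)) * C.yc q| <
        |Real.exp (Real.log lam * (σ * t)) * C.xc q| :=
      (hcont _ _).continuousAt.eventually_lt (hcont _ _).continuousAt (by simp; linarith)
    obtain ⟨ε, hε, hb⟩ := Metric.eventually_nhds_iff_ball.1 (hxy.and (hDe.and e1))
    refine ⟨ε, hε, Or.inr fun t ht => ?_⟩
    obtain ⟨h1, h2, h3⟩ := hb t (by
      rw [Metric.mem_ball, Real.dist_eq, sub_zero, abs_lt]; constructor <;> linarith [ht.1, ht.2])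
    have h4 : |C.xc (A.flow (σ * t) q)| < r₁ := by
      rw [h1.1, ← hx]; exact hle _ _ (by rw [hσ]; nlinarith [ht.1]) (by linarith)
    have h5 : |C.yc (A.flow (σ * t) q)| < |C.xc (A.flow (σ * t) q)| := by rw [h1.1, h1.2]; exact h3
    refine ⟨h2, ⟨h2.1, h4, h5.trans h4, ?_⟩, ?_⟩
    · simp only; rw [hprod t h1]; exact h0
    · rw [hσ] at h5 ⊢; linarith
  · rcases hσ with hσ | hσ
    · obtain ⟨ε, hε, h1⟩ := hout_y hy hσ
      exact ⟨ε, hε, Or.inl h1⟩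
    have hxr := hother _ _ hy (by rwa [mul_comm])
    have e1 : ∀ᶠ t in 𝓝 (0 : ℝ), |Real.exp (Real.log lam * (σ * t)) * C.xc q| <
        |Real.exp (-Real.log lam * (σ * t)) * C.yc q| :=
      (hcont _ _).continuousAt.eventually_lt (hcont _ _).continuousAt (by simp; linarith)
    obtain ⟨ε, hε, hb⟩ := Metric.eventually_nhds_iff_ball.1 (hxy.and (hDe.and e1))
    refine ⟨ε, hε, Or.inr fun t ht => ?_⟩
    obtain ⟨h1, h2, h3⟩ := hb t (by
      rw [Metric.mem_ball, Real.dist_eq, sub_zero, abs_lt]; constructor <;> linarith [ht.1, ht.2])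
    have h4 : |C.yc (A.flow (σ * t) q)| < r₁ := by
      rw [h1.2, ← hy]; exact hle _ _ (by rw [hσ]; nlinarith [ht.1]) (by linarith)
    have h5 : |C.xc (A.flow (σ * t) q)| < |C.yc (A.flow (σ * t) q)| := by rw [h1.1, h1.2]; exact h3
    refine ⟨h2, ⟨h2.1, h5.trans h4, h4, ?_⟩, ?_⟩
    · simp only; rw [hprod t h1]; exact h0
    · rw [hσ] at h5 ⊢; linarith

end IsGlueingData
end NormalCoordinates

theorem affineFlow_add (lam : ℝ) (n k : ℕ) (s t : ℝ) (u : ℝ³) :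
    affineFlow lam n k (s + t) u = affineFlow lam n k s (affineFlow lam n k t u) := by
  simp only [affineFlow, mul_add, Real.exp_add, add_mul]
  ext
  · simp; ring
  · simp; ring
  · simp; ring

namespace NormalCoordinates
variable [Nonempty (C.GluedSpace ρ r₁ r₂)]
  [ChartedSpace E3 (C.GluedSpace ρ r₁ r₂)] [IsManifold 𝓔 ∞ (C.GluedSpace ρ r₁ r₂)]

variable (C ρ r₁ r₂) in
/-- The differential of the inclusion of `M_R(r₁, r₂)`. -/
def outerTan (q : M₀) (v : TangentSpace 𝓔 q) :
    TangentBundle 𝓔 (C.GluedSpace ρ r₁ r₂) :=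
  tangentMap 𝓔 𝓔 (C.outerMap ρ r₁ r₂) ⟨q, v⟩

variable (C ρ r₁ r₂) in
/-- The differential of the inclusion of the cross, in lifted coordinates. -/
def liftTan (u w : ℝ³) : TangentBundle 𝓔 (C.GluedSpace ρ r₁ r₂) :=
  tangentMap 𝓘(ℝ, ℝ³) 𝓔 (C.liftMap ρ r₁ r₂) ⟨u, w⟩

/-- A tangent vector of the glued space lies in the cone field and has size `b`. The cones of the
complement of `γ` are only used over `M_R(r₁, r₂)`. -/
def ConeField.Mem {σ κ : ℝ} (K : C.ConeField ρ r₁ r₂ σ κ)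
    (V : TangentBundle 𝓔 (C.GluedSpace ρ r₁ r₂)) (b : ℝ) : Prop :=
  (∃ (q : M₀) (v : _), (q : M) ∈ C.outer r₁ r₂ ∧ V = C.outerTan ρ r₁ r₂ q v ∧ K.outer q v b) ∨
  ∃ u w, u ∈ liftInt r₁ r₂ ∧ V = C.liftTan ρ r₁ r₂ u w ∧ K.affine u w b

namespace IsGlueingData
variable [T2Space M] (S : C.IsGlueingData ρ r₁ r₂)
  {Y : ∀ x : C.GluedSpace ρ r₁ r₂, TangentSpace 𝓔 x}
  {ψ : Flow ℝ (C.GluedSpace ρ r₁ r₂)} (h : C.IsSmoothModel ρ r₁ r₂ Y ψ)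
  {σ κ : ℝ} (K : C.ConeField ρ r₁ r₂ σ κ)
include S

omit [ChartedSpace E3 (C.GluedSpace ρ r₁ r₂)] [IsManifold 𝓔 ∞ (C.GluedSpace ρ r₁ r₂)] in
theorem outerMap_ne_liftMap {q : M₀} (hq : (q : M) ∈ C.outer r₁ r₂) {u : ℝ³}
    (hu : u ∈ liftInt r₁ r₂) : C.outerMap ρ r₁ r₂ q ≠ C.liftMap ρ r₁ r₂ u := by
  intro h
  have hU := S.mem_outerDom_of_outer hq
  obtain ⟨h1, h2⟩ := (S.outerMap_eq_affineMap_iff hU (liftProj_mem hu)).1 h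
  have h3 := S.glueMap_fst (S.mem_ringDom_of_cross hU h1)
  rw [← h2] at h3
  refine S.mem_outer_iff.1 hq ⟨h1.1, ?_⟩
  rw [← h3.1, ← h3.2]
  exact hu

theorem mem_outer_of_mem {V : TangentBundle 𝓔 (C.GluedSpace ρ r₁ r₂)} {b : ℝ}
    {q : M₀} (hq : (q : M) ∈ C.outer r₁ r₂) (hV : V.1 = C.outerMap ρ r₁ r₂ q)
    (hb : K.Mem V b) : ∃ v, V = C.outerTan ρ r₁ r₂ q v ∧ K.outer q v b := by
  rcases hb with ⟨q', v, hq', rfl, hv⟩ | ⟨u, w, hu, rfl, hw⟩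
  · have := S.injOn_outerMap (S.mem_outerDom_of_outer hq') (S.mem_outerDom_of_outer hq) hV
    subst this
    exact ⟨v, rfl, hv⟩
  · exact absurd hV.symm (S.outerMap_ne_liftMap hq hu)

include h in
/-- Membership in the cones does not depend on the lift to the covering of the cross. -/
theorem mem_affine_of_mem {V : TangentBundle 𝓔 (C.GluedSpace ρ r₁ r₂)} {b : ℝ}
    {u : ℝ³} (hu : u ∈ liftInt r₁ r₂) (hV : V.1 = C.liftMap ρ r₁ r₂ u)
    (hb : K.Mem V b) : ∃ w, V = C.liftTan ρ r₁ r₂ u w ∧ K.affine u w b := by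
  rcases hb with ⟨q', v, hq', rfl, hv⟩ | ⟨u', w, hu', rfl, hw⟩
  · exact absurd hV (S.outerMap_ne_liftMap hq' hu)
  · obtain ⟨j, rfl⟩ := exists_int_of_liftProj_eq (S.injOn_affineMap (liftProj_mem hu) (liftProj_mem hu')
      hV.symm)
    exact ⟨w, (S.tangentMap_liftMap_add_int h hu' j w).symm, K.affine_add_int _ _ _ _ hw⟩

omit [ChartedSpace E3 (C.GluedSpace ρ r₁ r₂)] [IsManifold 𝓔 ∞ (C.GluedSpace ρ r₁ r₂)] in
theorem cover' (a : C.GluedSpace ρ r₁ r₂) :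
    (∃ q : M₀, (q : M) ∈ C.outer r₁ r₂ ∧ C.outerMap ρ r₁ r₂ q = a) ∨
    ∃ u ∈ liftInt r₁ r₂, C.liftMap ρ r₁ r₂ u = a := by
  rcases S.cover a with h | ⟨c, hc, rfl⟩
  · exact Or.inl h
  · obtain ⟨u, rfl, -⟩ := exists_liftProj_eq c
    exact Or.inr ⟨u, hc, rfl⟩

include h

omit K in
theorem outerTan_flow {q : M₀} {T : ℝ} (hσ : σ = 1 ∨ σ = -1) (hT : 0 ≤ T)
    (hq : ∀ t ∈ Icc 0 T, A.flow (σ * t) q ∈ C.outerDom r₁ r₂) (v : TangentSpace 𝓔 q) :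
    tangentMap 𝓔 𝓔 (ψ (σ * T)) (C.outerTan ρ r₁ r₂ q v) =
      C.outerTan ρ r₁ r₂ (A.flow (σ * T) q) (A.D (σ * T) q v) :=
  S.tangentMap_flow_outerMap h hσ hT hq v

omit K in
theorem outerMap_flow_dir {q : M₀} {T : ℝ} (hσ : σ = 1 ∨ σ = -1) (hT : 0 ≤ T)
    (hq : ∀ t ∈ Icc 0 T, A.flow (σ * t) q ∈ C.outerDom r₁ r₂) :
    ψ (σ * T) (C.outerMap ρ r₁ r₂ q) = C.outerMap ρ r₁ r₂ (A.flow (σ * T) q) :=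
  congrArg (fun V : TangentBundle 𝓔 (C.GluedSpace ρ r₁ r₂) => V.1)
    (S.tangentMap_flow_outerMap h hσ hT hq 0)

omit K in
theorem liftMap_flow_dir {u : ℝ³} {T : ℝ} (hσ : σ = 1 ∨ σ = -1) (hT : 0 ≤ T)
    (hq : ∀ t ∈ Icc 0 T, affineFlow lam n k (σ * t) u ∈ liftInt r₁ r₂) :
    ψ (σ * T) (C.liftMap ρ r₁ r₂ u) = C.liftMap ρ r₁ r₂ (affineFlow lam n k (σ * T) u) :=
  congrArg (fun V : TangentBundle 𝓔 (C.GluedSpace ρ r₁ r₂) => V.1)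
    (S.tangentMap_flow_liftMap h hσ hT hq 0)

/-- A vector of the cone field that is based at `p` stays in it for a short time. -/
theorem exists_mem_flow_right (hσ : σ = 1 ∨ σ = -1) (p : C.GluedSpace ρ r₁ r₂) :
    ∃ ε > 0, ∀ τ ∈ Ico 0 ε, ∀ V : TangentBundle 𝓔 (C.GluedSpace ρ r₁ r₂), V.1 = p →
      ∀ b, K.Mem V b → ∃ b', Real.exp (κ * τ) * b ≤ b' ∧
        K.Mem (tangentMap 𝓔 𝓔 (ψ (σ * τ)) V) b' := by
  rcases S.cover' p with ⟨q, hq, rfl⟩ | ⟨u, hu, rfl⟩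
  · obtain ⟨ε, hε, harc⟩ := S.exists_local_arc_dir hq hσ
    refine ⟨ε, hε, fun τ hτ V hV b hb => ?_⟩
    obtain ⟨v, rfl, hv⟩ := S.mem_outer_of_mem K hq hV hb
    obtain ⟨b', hb', hv'⟩ := K.outer_flow q v b τ hτ.1 hv
    rcases harc with harc | harc
    · refine ⟨b', hb', Or.inl ⟨_, _, harc τ hτ, S.outerTan_flow h hσ hτ.1 (fun t ht => ?_) v, hv'⟩⟩
      exact S.mem_outerDom_of_outer (harc t ⟨ht.1, ht.2.trans_lt hτ.2⟩)
    · rcases hτ.1.eq_or_lt with rfl | hτ0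
      · refine ⟨b, by simp, ?_⟩
        rw [mul_zero, tangentMap_flow_zero]
        exact hb
      obtain ⟨hD, hc, hs⟩ := harc τ ⟨hτ0, hτ.2⟩
      obtain ⟨g, T, hT, hT0, hg⟩ := S.exists_isGlueLift hD
      -- the alternative for the shear is that of the point itself
      obtain ⟨b'', hb'', hw⟩ := K.enter _ hc hs g T hg.self_of_nhds hT hT0 _ _ hv'
      refine ⟨b'', hb'.trans hb'', Or.inr ⟨_, _, mem_liftInt_of_isGlueLift hc hg.self_of_nhds, ?_, hw⟩⟩
      rw [S.outerTan_flow h hσ hτ.1 (fun t ht => ?_) v]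
      · exact S.tangentMap_outerMap_eq h hc hg _
      · rcases ht.1.eq_or_lt with rfl | ht0
        · rw [mul_zero, A.flow.map_zero_apply]; exact S.mem_outerDom_of_outer hq
        · exact S.ringDom_subset (harc t ⟨ht0, ht.2.trans_lt hτ.2⟩).1
  · have hc : Continuous fun t => affineFlow lam n k (σ * t) u :=
      (continuous_affineFlow lam n k u).comp (continuous_const.mul continuous_id)
    have h1 : ∀ᶠ t in 𝓝 (0 : ℝ), affineFlow lam n k (σ * t) u ∈ liftInt r₁ r₂ :=
      hc.continuousAt.eventually_mem ((isOpen_liftInt r₁ r₂).mem_nhds (by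
        rwa [mul_zero, affineFlow_zero]))
    obtain ⟨ε, hε, hb⟩ := Metric.eventually_nhds_iff_ball.1 h1
    have harc : ∀ t ∈ Ico 0 ε, affineFlow lam n k (σ * t) u ∈ liftInt r₁ r₂ := fun t ht => hb t (by
      rw [Metric.mem_ball, Real.dist_eq, sub_zero, abs_lt]; constructor <;> linarith [ht.1, ht.2])
    refine ⟨ε, hε, fun τ hτ V hV b hb => ?_⟩
    obtain ⟨w, rfl, hw⟩ := S.mem_affine_of_mem h K hu hV hb
    obtain ⟨b', hb', hw'⟩ := K.affine_flow u w b τ hτ.1 hw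
    exact ⟨b', hb', Or.inr ⟨_, _, harc τ hτ, S.tangentMap_flow_liftMap h hσ hτ.1
      (fun t ht => harc t ⟨ht.1, ht.2.trans_lt hτ.2⟩) w, hw'⟩⟩

/-- A vector of the cone field that is based slightly before `p` stays in it until it is based at
`p`. -/
theorem exists_mem_flow_left (hσ : σ = 1 ∨ σ = -1) (p : C.GluedSpace ρ r₁ r₂) :
    ∃ ε > 0, ∀ τ ∈ Ico 0 ε, ∀ V : TangentBundle 𝓔 (C.GluedSpace ρ r₁ r₂),
      V.1 = ψ (-σ * τ) p → ∀ b, K.Mem V b → ∃ b', Real.exp (κ * τ) * b ≤ b' ∧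
        K.Mem (tangentMap 𝓔 𝓔 (ψ (σ * τ)) V) b' := by
  have hσ' : -σ = 1 ∨ -σ = -1 := by rcases hσ with rfl | rfl <;> simp
  rcases S.cover' p with ⟨q, hq, rfl⟩ | ⟨u, hu, rfl⟩
  · obtain ⟨ε, hε, harc⟩ := S.exists_local_arc_dir hq hσ'
    refine ⟨ε, hε, fun τ hτ V hV b hb => ?_⟩
    have hshift : ∀ t, A.flow (σ * t) (A.flow (-σ * τ) q) = A.flow (-σ * (τ - t)) q := fun t => by
      rw [← A.flow.map_add]; congr 1; ring
    rcases harc with harc | harc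
    · rw [S.outerMap_flow_dir h hσ' hτ.1 fun t ht =>
        S.mem_outerDom_of_outer (harc t ⟨ht.1, ht.2.trans_lt hτ.2⟩)] at hV
      obtain ⟨v, rfl, hv⟩ := S.mem_outer_of_mem K (harc τ hτ) hV hb
      obtain ⟨b', hb', hv'⟩ := K.outer_flow _ v b τ hτ.1 hv
      have harc' : ∀ t ∈ Icc 0 τ, (A.flow (σ * t) (A.flow (-σ * τ) q) : M) ∈ C.outer r₁ r₂ := fun t ht => by
        rw [hshift]; exact harc _ ⟨by linarith [ht.2], by linarith [ht.1, hτ.2]⟩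
      exact ⟨b', hb', Or.inl ⟨_, _, harc' τ ⟨hτ.1, le_rfl⟩, S.outerTan_flow h hσ hτ.1
        (fun t ht => S.mem_outerDom_of_outer (harc' t ht)) v, hv'⟩⟩
    · rcases hτ.1.eq_or_lt with rfl | hτ0
      · refine ⟨b, by simp, ?_⟩
        rw [mul_zero, tangentMap_flow_zero]
        exact hb
      have harcU : ∀ t ∈ Icc 0 τ, A.flow (-σ * t) q ∈ C.outerDom r₁ r₂ := fun t ht => by
        rcases ht.1.eq_or_lt with rfl | ht0
        · rw [mul_zero, A.flow.map_zero_apply]; exact S.mem_outerDom_of_outer hq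
        · exact S.ringDom_subset (harc t ⟨ht0, ht.2.trans_lt hτ.2⟩).1
      obtain ⟨hD, hc, hs⟩ := harc τ ⟨hτ0, hτ.2⟩
      obtain ⟨g, T, hT, hT0, hg⟩ := S.exists_isGlueLift hD
      have hg0 := hg.self_of_nhds
      rw [S.outerMap_flow_dir h hσ' hτ.1 harcU,
        (S.outerMap_eventuallyEq_liftMap hc hg).self_of_nhds] at hV
      obtain ⟨w, rfl, hw⟩ := S.mem_affine_of_mem h K (mem_liftInt_of_isGlueLift hc hg0) hV hb
      obtain ⟨v, rfl⟩ : ∃ v, vderiv g (A.flow (-σ * τ) q) v = w :=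
        hg0.isLocalDiffeomorphAt.mfderiv_surjective w
      obtain ⟨b', hb', hv⟩ := K.exit _ hc (by linarith) g T hg0 hT hT0 v b hw
      obtain ⟨b'', hb'', hv'⟩ := K.outer_flow _ v b' τ hτ.1 hv
      refine ⟨b'', (mul_le_mul_of_nonneg_left hb' (Real.exp_pos _).le).trans hb'',
        Or.inl ⟨_, _, ?_, ?_, hv'⟩⟩
      · rw [hshift, sub_self, mul_zero, A.flow.map_zero_apply]; exact hq
      · have e : C.liftTan ρ r₁ r₂ (g (A.flow (-σ * τ) q)) (vderiv g (A.flow (-σ * τ) q) v) =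
            C.outerTan ρ r₁ r₂ (A.flow (-σ * τ) q) v := (S.tangentMap_outerMap_eq h hc hg v).symm
        rw [e]
        refine S.outerTan_flow h hσ hτ.1 (fun t ht => ?_) v
        rw [hshift]
        exact harcU _ ⟨by linarith [ht.2], by linarith [ht.1]⟩
  · have hc : Continuous fun t => affineFlow lam n k (-σ * t) u :=
      (continuous_affineFlow lam n k u).comp (continuous_const.mul continuous_id)
    have h1 : ∀ᶠ t in 𝓝 (0 : ℝ), affineFlow lam n k (-σ * t) u ∈ liftInt r₁ r₂ :=
      hc.continuousAt.eventually_mem ((isOpen_liftInt r₁ r₂).mem_nhds (by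
        rwa [mul_zero, affineFlow_zero]))
    obtain ⟨ε, hε, hb⟩ := Metric.eventually_nhds_iff_ball.1 h1
    have harc : ∀ t ∈ Ico 0 ε, affineFlow lam n k (-σ * t) u ∈ liftInt r₁ r₂ := fun t ht => hb t (by
      rw [Metric.mem_ball, Real.dist_eq, sub_zero, abs_lt]; constructor <;> linarith [ht.1, ht.2])
    refine ⟨ε, hε, fun τ hτ V hV b hb => ?_⟩
    rw [S.liftMap_flow_dir h hσ' hτ.1 fun t ht => harc t ⟨ht.1, ht.2.trans_lt hτ.2⟩] at hV
    have harc' : ∀ t ∈ Icc 0 τ, affineFlow lam n k (σ * t) (affineFlow lam n k (-σ * τ) u) ∈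
        liftInt r₁ r₂ := fun t ht => by
      rw [← affineFlow_add, show σ * t + -σ * τ = -σ * (τ - t) by ring]
      exact harc _ ⟨by linarith [ht.2], by linarith [ht.1, hτ.2]⟩
    obtain ⟨w, rfl, hw⟩ := S.mem_affine_of_mem h K (harc τ hτ) hV hb
    obtain ⟨b', hb', hw'⟩ := K.affine_flow _ w b τ hτ.1 hw
    exact ⟨b', hb', Or.inr ⟨_, _, harc' τ ⟨hτ.1, le_rfl⟩,
      S.tangentMap_flow_liftMap h hσ hτ.1 harc' w, hw'⟩⟩

/-- The cone field is invariant by the flow, which expands the sizes. -/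
theorem mem_flow (hσ : σ = 1 ∨ σ = -1) {T : ℝ} (hT : 0 ≤ T)
    {V : TangentBundle 𝓔 (C.GluedSpace ρ r₁ r₂)} {b : ℝ} (hb : K.Mem V b) :
    ∃ b', Real.exp (κ * T) * b ≤ b' ∧ K.Mem (tangentMap 𝓔 𝓔 (ψ (σ * T)) V) b' := by
  have hadd : ∀ s t, tangentMap 𝓔 𝓔 (ψ (σ * (t - s)))
      (tangentMap 𝓔 𝓔 (ψ (σ * s)) V) = tangentMap 𝓔 𝓔 (ψ (σ * t)) V := by
    intro s t
    rw [← tangentMap_flow_add h.isSmoothFlowOf.smooth_flow]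
    congr 2; ring
  have key : ∀ b, K.Mem (tangentMap 𝓔 𝓔 (ψ (σ * 0)) V) b →
      ∃ b', Real.exp (κ * (T - 0)) * b ≤ b' ∧ K.Mem (tangentMap 𝓔 𝓔 (ψ (σ * T)) V) b' := by
    refine rel_of_locally_rel (R := fun s t => ∀ b, K.Mem (tangentMap 𝓔 𝓔 (ψ (σ * s)) V) b →
      ∃ b', Real.exp (κ * (t - s)) * b ≤ b' ∧
        K.Mem (tangentMap 𝓔 𝓔 (ψ (σ * t)) V) b') hT ?_ ?_ ?_
    · intro s t u _ _ _ _ h1 h2 b hb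
      obtain ⟨b', hb', h3⟩ := h1 b hb
      obtain ⟨b'', hb'', h4⟩ := h2 b' h3
      refine ⟨b'', le_trans ?_ hb'', h4⟩
      refine le_trans (le_of_eq ?_) (mul_le_mul_of_nonneg_left hb' (Real.exp_pos _).le)
      rw [← mul_assoc, ← Real.exp_add]
      congr 2; ring
    · intro t ht
      obtain ⟨ε, hε, h1⟩ := S.exists_mem_flow_left h K hσ (ψ (σ * t) V.1)
      refine ⟨ε, hε, fun s hs hst hst' b hb => ?_⟩
      have := h1 (t - s) ⟨by linarith, by linarith⟩ _ (by
        show ψ (σ * s) V.1 = ψ (-σ * (t - s)) (ψ (σ * t) V.1)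
        rw [← ψ.map_add]; congr 1; ring) b hb
      rwa [hadd] at this
    · intro t ht
      obtain ⟨ε, hε, h1⟩ := S.exists_mem_flow_right h K hσ (ψ (σ * t) V.1)
      refine ⟨ε, hε, fun s hs hst hst' b hb => ?_⟩
      have := h1 (s - t) ⟨by linarith, by linarith⟩ _ rfl b hb
      rwa [hadd] at this
  rw [sub_zero] at key
  refine key b ?_
  rwa [mul_zero, tangentMap_flow_zero]

end IsGlueingData
end NormalCoordinates

/-! ### The unstable and the stable cone field -/

/-- A shear whose slope has the sign opposite to `x y` acts on the pair of products `P = y a`, `Q = x b`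
by `(P + κ (P + Q), Q - κ (P + Q))` with `κ ≤ 0`: the dominant product grows and stays dominant. -/
theorem abs_le_of_shear {P Q κ : ℝ} (hκ : κ ≤ 0) (h : |P| ≤ |Q|) :
    |P + κ * (P + Q)| ≤ |Q - κ * (P + Q)| ∧ |Q| ≤ |Q - κ * (P + Q)| := by
  have h1 : 0 ≤ Q * (P + Q) := by
    have := sq_le_sq.2 h
    nlinarith [abs_mul_abs_self P, abs_mul_abs_self Q, neg_abs_le (P * Q), abs_mul P Q, abs_nonneg Q]
  have h2 := sq_le_sq.2 h
  have h3 : 0 ≤ -κ * (P + Q) ^ 2 := mul_nonneg (by linarith) (sq_nonneg _)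
  have h4 : |P + κ * (P + Q)| ≤ |Q - κ * (P + Q)| := sq_le_sq.1 (by nlinarith)
  refine ⟨h4, sq_le_sq.1 ?_⟩
  nlinarith [mul_nonneg (neg_nonneg.2 hκ) h1, sq_nonneg (κ * (P + Q))]

namespace NormalCoordinates

/-- The coefficient of the shear in the planar directions, after the flow direction is projected out. -/
def shearCoeff (lam : ℝ) (n k : ℕ) (T : ℝ → ℝ) (s : ℝ) : ℝ := -(n * k * Real.log lam * deriv T s)

include A in
theorem shearCoeff_nonpos {T : ℝ → ℝ} (hT : IsShear (r₁ * r₂) T) (s : ℝ) :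
    shearCoeff lam n k T s * s ≤ 0 := by
  have h1 := hT.mul_deriv_nonpos s
  have h2 := A.log_lam_neg
  have h3 : (0 : ℝ) ≤ n * k := by positivity
  have : shearCoeff lam n k T s * s = (n * k) * (-Real.log lam) * (s * deriv T s) := by
    rw [shearCoeff]; ring
  rw [this]
  exact mul_nonpos_of_nonneg_of_nonpos (mul_nonneg h3 (by linarith)) h1

theorem metricNorm_flow_back (t : ℝ) (q : M₀) (v : TangentSpace 𝓔 q)
    (f : M₀ → ℝ) :
    f (A.flow t (A.flow (-t) q)) * metricNorm A.metric (A.flow t (A.flow (-t) q))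
      (A.D t (A.flow (-t) q) (A.D (-t) q v)) = f q * metricNorm A.metric q v := by
  have h2 := tangentMap_flow_add A.isSmoothFlowOf.smooth_flow t (-t) ⟨q, v⟩
  rw [add_neg_cancel, tangentMap_flow_zero] at h2
  exact (congrArg (fun V : TangentBundle 𝓔 M₀ =>
    f V.1 * metricNorm A.metric V.1 V.2) h2).symm

theorem D_sum (t : ℝ) {q : M₀} (e u : TangentSpace 𝓔 q) (τ : ℝ) :
    A.D t q (e + τ • A.X q + u) = A.D t q e + τ • A.X (A.flow t q) + A.D t q u := by
  simp only [AlmostAnosovStructure.D, map_add, map_smul, A.isSmoothFlowOf.mfderiv_field]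

namespace IsGlueLift
variable {g : M₀ → ℝ³} {T : ℝ → ℝ} {q : M₀}

theorem affineField_eq (hg : C.IsGlueLift ρ r₁ r₂ g T q) : affineField lam n k (g q) =
    (Real.log lam * C.xc q, -Real.log lam * C.yc q, 1 / ((n : ℝ) * k)) := by
  rw [affineField, hg.fst_eq, hg.snd_eq]

/-- The planar components, modulo the flow direction, of the differential of the glueing map. -/
theorem vderiv_sum (hg : C.IsGlueLift ρ r₁ r₂ g T q) (hn : 1 ≤ n) (hk : 1 ≤ k)
    {e u : TangentSpace 𝓔 q} (he : e ∈ A.Es q) (hu : u ∈ A.Eu q) (τ : ℝ) :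
    ∃ τ' : ℝ, vderiv g q (e + τ • A.X q + u) =
      (vderiv C.xc q e + shearCoeff lam n k T (C.xc q * C.yc q) *
          (C.yc q * vderiv C.xc q e + C.xc q * vderiv C.yc q u) * C.xc q,
        vderiv C.yc q u - shearCoeff lam n k T (C.xc q * C.yc q) *
          (C.yc q * vderiv C.xc q e + C.xc q * vderiv C.yc q u) * C.yc q, 0) +
      τ' • affineField lam n k (g q) := by
  have hnk : ((n : ℝ) * k) ≠ 0 := by positivity
  refine ⟨τ + n * k * (deriv T (C.xc q * C.yc q) *
    (C.yc q * vderiv C.xc q e + C.xc q * vderiv C.yc q u)), ?_⟩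
  rw [map_add, map_add, map_smul, hg.apply_Es e he, hg.apply_Eu u hu, hg.field, hg.affineField_eq,
    shearCoeff]
  ext
  · simp; ring
  · simp; ring
  · simp; field_simp; ring

/-- Every vector at a point of the ring decomposes, and the components of its image modulo the flow
direction are given by `IsGlueLift.vderiv_sum`. -/
theorem exists_sum (hg : C.IsGlueLift ρ r₁ r₂ g T q) (hn : 1 ≤ n) (hk : 1 ≤ k)
    {v : TangentSpace 𝓔 q} {a β τ' : ℝ}
    (hv : vderiv g q v = (a, β, 0) + τ' • affineField lam n k (g q)) :
    ∃ e ∈ A.Es q, ∃ u ∈ A.Eu q, ∃ τ : ℝ, v = e + τ • A.X q + u ∧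
      vderiv C.xc q e = a - shearCoeff lam n k T (C.xc q * C.yc q) *
        (C.yc q * a + C.xc q * β) * C.xc q ∧
      vderiv C.yc q u = β + shearCoeff lam n k T (C.xc q * C.yc q) *
        (C.yc q * a + C.xc q * β) * C.yc q := by
  have hnk : ((n : ℝ) * k) ≠ 0 := by positivity
  set c := shearCoeff lam n k T (C.xc q * C.yc q) with hc
  obtain ⟨e, he, hea⟩ := hg.exists_Es (a - c * (C.yc q * a + C.xc q * β) * C.xc q)
  obtain ⟨u, hu, hub⟩ := hg.exists_Eu (β + c * (C.yc q * a + C.xc q * β) * C.yc q)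
  obtain ⟨τ₁, h1⟩ := hg.vderiv_sum hn hk he hu 0
  refine ⟨e, he, u, hu, τ' - τ₁, ?_, hea, hub⟩
  apply hg.isLocalDiffeomorphAt.mfderiv_injective
  change vderiv g q v = vderiv g q _
  have h2 : e + (τ' - τ₁) • A.X q + u = (e + (0 : ℝ) • A.X q + u) + (τ' - τ₁) • A.X q := by
    rw [zero_smul]; abel
  rw [h2, map_add, map_smul, h1, hv, hg.field, hea, hub, ← hc, add_assoc, ← add_smul,
    add_sub_cancel]
  congr 1
  ext
  · simp; ring
  · simp; ring
  · rfl

end IsGlueLift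

namespace IsGlueingData
variable (S : C.IsGlueingData ρ r₁ r₂) {ε : ℝ} (H : C.AdaptedSizes ε) (hε : r₁ < ε)
include S H hε

theorem hs_eq_of_mem {q : M₀} (hq : q ∈ C.crossInt r₁ r₂) {e : TangentSpace 𝓔 q}
    (he : e ∈ A.Es q) : H.hs q * metricNorm A.metric q e = |vderiv C.xc q e| :=
  H.hs_eq q hq.1 (lt_trans hq.2.1 hε) (lt_trans hq.2.2.1 hε) e he

theorem hu_eq_of_mem {q : M₀} (hq : q ∈ C.crossInt r₁ r₂) {e : TangentSpace 𝓔 q}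
    (he : e ∈ A.Eu q) : H.hu q * metricNorm A.metric q e = |vderiv C.yc q e| :=
  H.hu_eq q hq.1 (lt_trans hq.2.1 hε) (lt_trans hq.2.2.1 hε) e he

/-- The unstable cone field. Its bound on `|a|` in the cross comes from `|y a| ≤ |x b|` together with
`r₁ r₂ ≤ 3 |x y|`, which holds where the shear is not trivial. -/
def unstableCone : C.ConeField ρ r₁ r₂ 1 (-(Real.log lam / 2)) where
  outer q v b := ∃ e ∈ A.Es q, ∃ u ∈ A.Eu q, ∃ τ : ℝ, v = e + τ • A.X q + u ∧
    H.hs q * metricNorm A.metric q e ≤ H.hu q * metricNorm A.metric q u ∧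
    b = H.hu q * metricNorm A.metric q u
  affine u w b := ∃ a β τ : ℝ, w = (a, β, 0) + τ • affineField lam n k u ∧
    |a * u.2.1| ≤ |u.1 * β| ∧ r₂ * |a| ≤ 3 * r₁ * |β| ∧ b = |β|
  outer_flow := by
    rintro q v b t ht ⟨e, he, u, hu, τ, rfl, hle, rfl⟩
    rw [one_mul]
    have h1 := H.hs_flow q t ht e he
    have h2 := H.hu_flow q t ht u hu
    have hℓ := A.log_lam_neg
    have h3 : Real.exp (Real.log lam / 2 * t) ≤ 1 := Real.exp_le_one_iff.2 (by nlinarith)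
    have h4 : 1 ≤ Real.exp (-(Real.log lam / 2 * t)) := Real.one_le_exp (by nlinarith)
    have hnn := metricNorm_nonneg A.metric
    have h5 : 0 ≤ H.hs q * metricNorm A.metric q e :=
      mul_nonneg ((inv_pos.2 H.bd_pos).le.trans (H.le_hs q)) (hnn q e)
    refine ⟨_, ?_, _, A.D_mem_Es t he, _, A.D_mem_Eu t hu, τ, D_sum t e u τ, ?_, rfl⟩
    · rwa [neg_mul]
    · nlinarith
  affine_flow := by
    rintro u w b t ht ⟨a, β, τ, rfl, h1, h2, rfl⟩
    have hℓ := A.log_lam_neg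
    have hr1 := S.pos₁
    have hr2 := S.pos
    have h3 : Real.exp (Real.log lam * (1 * t)) ≤ 1 := Real.exp_le_one_iff.2 (by nlinarith)
    have h4 : 1 ≤ Real.exp (-Real.log lam * (1 * t)) := Real.one_le_exp (by nlinarith)
    have h5 : Real.exp (Real.log lam * (1 * t)) * Real.exp (-Real.log lam * (1 * t)) = 1 := by
      rw [← Real.exp_add]; simp
    have h6 : Real.exp (-(Real.log lam / 2) * t) ≤ Real.exp (-Real.log lam * (1 * t)) :=
      Real.exp_le_exp.2 (by nlinarith)
    have h7 := Real.exp_pos (Real.log lam * (1 * t))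
    refine ⟨_, ?_, Real.exp (Real.log lam * (1 * t)) * a, Real.exp (-Real.log lam * (1 * t)) * β, τ, ?_, ?_, ?_, rfl⟩
    · rw [abs_mul, Real.abs_exp]
      exact mul_le_mul_of_nonneg_right h6 (abs_nonneg _)
    · ext
      · simp [affineField, affineFlow]; ring
      · simp [affineField, affineFlow]; ring
      · simp [affineField]
    · simp only [affineFlow]
      rw [mul_mul_mul_comm, h5, mul_mul_mul_comm, h5, one_mul, one_mul]
      exact h1
    · rw [abs_mul, abs_mul, Real.abs_exp, Real.abs_exp]
      calc r₂ * (Real.exp (Real.log lam * (1 * t)) * |a|) ≤ r₂ * |a| :=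
            mul_le_mul_of_nonneg_left (mul_le_of_le_one_left (abs_nonneg a) h3) hr2.le
        _ ≤ 3 * r₁ * |β| := h2
        _ ≤ _ := mul_le_mul_of_nonneg_left (le_mul_of_one_le_left (abs_nonneg β) h4) (by linarith)
  affine_add_int := by
    rintro u w b j ⟨a, β, τ, rfl, h1, h2, rfl⟩
    exact ⟨a, β, τ, by simp [affineField], by simpa using h1, h2, rfl⟩
  enter := by
    rintro q hq hs g T hg hT hT0 v b ⟨e, he, u, hu, τ, rfl, hle, rfl⟩
    obtain ⟨τ', hv⟩ := hg.vderiv_sum S.one_le_n S.one_le_k he hu τ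
    rw [S.hs_eq_of_mem H hε hq he, S.hu_eq_of_mem H hε hq hu] at hle
    rw [S.hu_eq_of_mem H hε hq hu]
    set a := vderiv C.xc q e
    set β := vderiv C.yc q u
    set x := C.xc q with hx
    set y := C.yc q with hy
    set c := shearCoeff lam n k T (x * y) with hc
    have hyx : |y| < |x| := by linarith
    have hx0 : 0 < |x| := (abs_nonneg y).trans_lt hyx
    have hr1 := S.pos₁
    have hxr : |x| < r₁ := hq.2.1
    have h1 : |y * a| ≤ |x * β| := by
      rw [abs_mul, abs_mul]; exact mul_le_mul hyx.le hle (abs_nonneg _) hx0.le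
    obtain ⟨h2, h3⟩ := abs_le_of_shear (shearCoeff_nonpos (A := A) (n := n) (k := k) hT (x * y)) h1
    rw [← hc] at h2 h3
    have e1 : y * a + c * (x * y) * (y * a + x * β) = y * (a + c * (y * a + x * β) * x) := by ring
    have e2 : x * β - c * (x * y) * (y * a + x * β) = x * (β - c * (y * a + x * β) * y) := by ring
    rw [e1, e2] at h2
    rw [e2, abs_mul, abs_mul] at h3
    refine ⟨_, le_of_mul_le_mul_left h3 hx0, _, _, τ', hv, ?_, ?_, rfl⟩
    · rw [hg.fst_eq, hg.snd_eq, mul_comm _ (C.yc q)]; exact h2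
    · by_cases hd : deriv T (x * y) = 0
      · have : c = 0 := by rw [hc, shearCoeff, hd]; ring
        rw [this]
        simp only [zero_mul, add_zero, sub_zero]
        nlinarith [S.lt, S.pos, abs_nonneg a, abs_nonneg β]
      · -- `r₁ r₂ |a'| ≤ 3 |x y a'| ≤ 3 x² |β'| ≤ 3 r₁² |β'|`
        have h4 := hT.le_abs _ hd
        rw [abs_mul] at h4 h2
        rw [abs_mul] at h2
        set a' := |a + c * (y * a + x * β) * x|
        set β' := |β - c * (y * a + x * β) * y|
        have h5 : r₁ * r₂ / 3 * a' ≤ |x| * |y| * a' := mul_le_mul_of_nonneg_right h4 (abs_nonneg _)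
        have h6 : |x| * (|y| * a') ≤ |x| * (|x| * β') := mul_le_mul_of_nonneg_left h2 hx0.le
        have h7 : |x| * |x| * β' ≤ r₁ * r₁ * β' :=
          mul_le_mul_of_nonneg_right (mul_le_mul hxr.le hxr.le hx0.le hr1.le) (abs_nonneg _)
        refine le_of_mul_le_mul_left ?_ hr1
        nlinarith
  exit := by
    rintro q hq hs g T hg hT hT0 v b ⟨a, β, τ', hv, h1, -, rfl⟩
    obtain ⟨e, he, u, hu, τ, rfl, hea, hub⟩ := hg.exists_sum S.one_le_n S.one_le_k hv
    -- the shear is trivial on this face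
    have hxy : |C.xc q| < |C.yc q| := by linarith
    have hT1 : T = fun _ => 0 := funext
      (hT0.resolve_right fun h' => absurd (h'.trans_le (le_abs_self _)) hxy.not_gt)
    have hc : shearCoeff lam n k T (C.xc q * C.yc q) = 0 := by
      rw [shearCoeff, hT1, deriv_const]; ring
    rw [hc] at hea hub
    simp only [zero_mul, add_zero, sub_zero] at hea hub
    rw [hg.fst_eq, hg.snd_eq, abs_mul, abs_mul] at h1
    refine ⟨_, le_of_eq ?_, e, he, u, hu, τ, rfl, ?_, rfl⟩
    · rw [S.hu_eq_of_mem H hε hq hu, hub]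
    · rw [S.hs_eq_of_mem H hε hq he, S.hu_eq_of_mem H hε hq hu, hea, hub]
      refine le_of_mul_le_mul_right ?_ ((abs_nonneg _).trans_lt hxy)
      nlinarith [abs_nonneg β]

/-- The stable cone field. In the reversed direction of time the orbits leave the cross with
`|y| < |x|`, so that the shear acts at the exit and not at the entrance. -/
def stableCone : C.ConeField ρ r₁ r₂ (-1) (-(Real.log lam / 2)) where
  outer q v b := ∃ e ∈ A.Es q, ∃ u ∈ A.Eu q, ∃ τ : ℝ, v = e + τ • A.X q + u ∧
    H.hu q * metricNorm A.metric q u ≤ H.hs q * metricNorm A.metric q e ∧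
    b = H.hs q * metricNorm A.metric q e
  affine u w b := ∃ a β τ : ℝ, w = (a, β, 0) + τ • affineField lam n k u ∧
    |u.1 * β| ≤ |a * u.2.1| ∧ |β| ≤ |a| ∧ b = |a|
  outer_flow := by
    rintro q v b t ht ⟨e, he, u, hu, τ, rfl, hle, rfl⟩
    rw [neg_one_mul]
    have h1 := H.hs_flow _ t ht _ (A.D_mem_Es (-t) he)
    have h2 := H.hu_flow _ t ht _ (A.D_mem_Eu (-t) hu)
    rw [metricNorm_flow_back] at h1 h2
    have hℓ := A.log_lam_neg
    have h3 : Real.exp (Real.log lam / 2 * t) ≤ 1 := Real.exp_le_one_iff.2 (by nlinarith)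
    have h4 : 1 ≤ Real.exp (-(Real.log lam / 2 * t)) := Real.one_le_exp (by nlinarith)
    have h5 : Real.exp (-(Real.log lam / 2) * t) * Real.exp (Real.log lam / 2 * t) = 1 := by
      rw [← Real.exp_add]; simp
    have h0 : ∀ f : M₀ → ℝ, (∀ q, H.bd⁻¹ ≤ f q) → ∀ q v, 0 ≤ f q * metricNorm A.metric q v :=
      fun f hf q v => mul_nonneg ((inv_pos.2 H.bd_pos).le.trans (hf q)) (metricNorm_nonneg _ _ _)
    have h6 := h0 H.hu H.le_hu (A.flow (-t) q) (A.D (-t) q u)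
    have h7 := h0 H.hs H.le_hs (A.flow (-t) q) (A.D (-t) q e)
    refine ⟨_, ?_, _, A.D_mem_Es (-t) he, _, A.D_mem_Eu (-t) hu, τ, D_sum (-t) e u τ, ?_, rfl⟩
    · refine (mul_le_mul_of_nonneg_left h1 (Real.exp_pos _).le).trans (le_of_eq ?_)
      rw [← mul_assoc, h5, one_mul]
    · nlinarith
  affine_flow := by
    rintro u w b t ht ⟨a, β, τ, rfl, h1, h2, rfl⟩
    have hℓ := A.log_lam_neg
    have h3 : Real.exp (-Real.log lam * (-1 * t)) ≤ 1 := Real.exp_le_one_iff.2 (by nlinarith)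
    have h4 : 1 ≤ Real.exp (Real.log lam * (-1 * t)) := Real.one_le_exp (by nlinarith)
    have h5 : Real.exp (Real.log lam * (-1 * t)) * Real.exp (-Real.log lam * (-1 * t)) = 1 := by
      rw [← Real.exp_add]; simp
    have h6 : Real.exp (-(Real.log lam / 2) * t) ≤ Real.exp (Real.log lam * (-1 * t)) :=
      Real.exp_le_exp.2 (by nlinarith)
    refine ⟨_, ?_, Real.exp (Real.log lam * (-1 * t)) * a, Real.exp (-Real.log lam * (-1 * t)) * β, τ, ?_, ?_, ?_, rfl⟩
    · rw [abs_mul, Real.abs_exp]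
      exact mul_le_mul_of_nonneg_right h6 (abs_nonneg _)
    · ext
      · simp [affineField, affineFlow]; ring
      · simp [affineField, affineFlow]; ring
      · simp [affineField]
    · simp only [affineFlow]
      rw [mul_mul_mul_comm, h5, mul_mul_mul_comm, h5, one_mul, one_mul]
      exact h1
    · rw [abs_mul, abs_mul, Real.abs_exp, Real.abs_exp]
      exact (mul_le_of_le_one_left (abs_nonneg β) h3).trans
        (h2.trans (le_mul_of_one_le_left (abs_nonneg a) h4))
  affine_add_int := by
    rintro u w b j ⟨a, β, τ, rfl, h1, h2, rfl⟩
    exact ⟨a, β, τ, by simp [affineField], by simpa using h1, h2, rfl⟩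
  enter := by
    rintro q hq hs g T hg hT hT0 v b ⟨e, he, u, hu, τ, rfl, hle, rfl⟩
    obtain ⟨τ', hv⟩ := hg.vderiv_sum S.one_le_n S.one_le_k he hu τ
    rw [S.hs_eq_of_mem H hε hq he, S.hu_eq_of_mem H hε hq hu] at hle
    rw [S.hs_eq_of_mem H hε hq he]
    -- the shear is trivial on this face
    have hxy : |C.xc q| < |C.yc q| := by linarith
    have hT1 : T = fun _ => 0 := funext
      (hT0.resolve_right fun h' => absurd (h'.trans_le (le_abs_self _)) hxy.not_gt)
    have hc : shearCoeff lam n k T (C.xc q * C.yc q) = 0 := by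
      rw [shearCoeff, hT1, deriv_const]; ring
    rw [hc] at hv
    simp only [zero_mul, add_zero, sub_zero] at hv
    refine ⟨_, le_rfl, _, _, τ', hv, ?_, hle, rfl⟩
    rw [hg.fst_eq, hg.snd_eq, mul_comm, abs_mul, abs_mul]
    exact mul_le_mul hle hxy.le (abs_nonneg _) (abs_nonneg _)
  exit := by
    rintro q hq hs g T hg hT hT0 v b ⟨a, β, τ', hv, h1, -, rfl⟩
    obtain ⟨e, he, u, hu, τ, rfl, hea, hub⟩ := hg.exists_sum S.one_le_n S.one_le_k hv
    have hyx : |C.yc q| < |C.xc q| := by linarith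
    rw [hg.fst_eq, hg.snd_eq, mul_comm a] at h1
    refine ⟨_, ?_, e, he, u, hu, τ, rfl, ?_, rfl⟩ <;>
      rw [S.hs_eq_of_mem H hε hq he, hea]
    all_goals
      try rw [S.hu_eq_of_mem H hε hq hu, hub]
      set x := C.xc q with hx
      set y := C.yc q with hy
      set c := shearCoeff lam n k T (x * y) with hc
      have hx0 : 0 < |x| := (abs_nonneg y).trans_lt hyx
      obtain ⟨h2, h3⟩ := abs_le_of_shear (shearCoeff_nonpos (A := A) (n := n) (k := k) hT (x * y)) h1
      rw [← hc] at h2 h3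
      have e1 : y * a - c * (x * y) * (x * β + y * a) = y * (a - c * (y * a + x * β) * x) := by ring
      have e2 : x * β + c * (x * y) * (x * β + y * a) = x * (β + c * (y * a + x * β) * y) := by ring
      rw [e1, e2, abs_mul, abs_mul] at h2
      rw [e1, abs_mul, abs_mul] at h3
    · -- the growth of `y a` is that of `a`, except for `y = 0`, where the shear is trivial
      rcases eq_or_ne y 0 with h0 | h0
      · have hd : deriv T (x * y) = 0 := by
          by_contra hd
          have h4 := hT.le_abs _ hd
          rw [h0, mul_zero, abs_zero] at h4
          linarith [S.mul_pos]
        have : c = 0 := by rw [hc, shearCoeff, hd]; ring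
        rw [this]; simp
      · exact le_of_mul_le_mul_left h3 (abs_pos.2 h0)
    · exact le_of_mul_le_mul_left (h2.trans (mul_le_mul_of_nonneg_right hyx.le (abs_nonneg _))) hx0

end IsGlueingData
end NormalCoordinates

/-! ### Comparison of norms -/

section
variable {E H : Type*} [NormedAddCommGroup E] [NormedSpace ℝ E] [TopologicalSpace H]
  {I : ModelWithCorners ℝ E H} {X : Type*} [TopologicalSpace X] [ChartedSpace H X] [IsManifold I ∞ X]

/-- A continuous homogeneous function that is positive on the plane spanned by two continuous vector
fields at a point is comparable nearby with the norm of the coefficients. -/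
theorem eventually_comparable {F : TangentBundle I X → ℝ} {O : Set X} (hO : IsOpen O) {x₀ : X}
    (hx₀ : x₀ ∈ O) {v₁ v₂ : ∀ x : X, TangentSpace I x}
    (h1 : ContinuousOn (fun x => (⟨x, v₁ x⟩ : TangentBundle I X)) O)
    (h2 : ContinuousOn (fun x => (⟨x, v₂ x⟩ : TangentBundle I X)) O)
    (hF : ContinuousOn F {V | V.1 ∈ O})
    (hhom : ∀ x (c : ℝ) (v : TangentSpace I x), F ⟨x, c • v⟩ = |c| * F ⟨x, v⟩)
    (hpos : ∀ z : ℝ × ℝ, z ≠ 0 → 0 < F ⟨x₀, z.1 • v₁ x₀ + z.2 • v₂ x₀⟩) :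
    ∃ K > 0, ∀ᶠ x in 𝓝 x₀, ∀ z : ℝ × ℝ, F ⟨x, z.1 • v₁ x + z.2 • v₂ x⟩ ≤ K * ‖z‖ ∧
      ‖z‖ ≤ K * F ⟨x, z.1 • v₁ x + z.2 • v₂ x⟩ := by
  let e := trivializationAt E (TangentSpace I : X → Type _) x₀
  have hb₀ : x₀ ∈ e.baseSet := FiberBundle.mem_baseSet_trivializationAt' x₀
  have hw : ∀ v : ∀ x : X, TangentSpace I x, ∀ y ∈ e.baseSet, e.symm y ((e ⟨y, v y⟩).2) = v y :=
    fun v y hy => e.symm_apply_apply_mk hy (v y)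
  have hwc : ∀ v : ∀ x : X, TangentSpace I x, ContinuousOn (fun x => (⟨x, v x⟩ : TangentBundle I X)) O →
      ContinuousAt (fun x => (e ⟨x, v x⟩).2) x₀ := by
    intro v hv
    have h3 := hv.continuousAt (hO.mem_nhds hx₀)
    have h4 : ContinuousAt e ⟨x₀, v x₀⟩ := e.continuousAt (e.mem_source.2 hb₀)
    exact continuous_snd.continuousAt.comp (ContinuousAt.comp (f := fun x => (⟨x, v x⟩ : TangentBundle I X)) h4 h3)
  have hlin : ∀ y ∈ e.baseSet, ∀ z : ℝ × ℝ, e.symm y (z.1 • (e ⟨y, v₁ y⟩).2 + z.2 • (e ⟨y, v₂ y⟩).2) =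
      z.1 • v₁ y + z.2 • v₂ y := by
    intro y hy z
    rw [← e.symmL_apply (R := ℝ) hy, map_add, map_smul, map_smul, e.symmL_apply (R := ℝ) hy,
      e.symmL_apply (R := ℝ) hy, hw v₁ y hy, hw v₂ y hy]
  have hcont : ∀ z : ℝ × ℝ, ContinuousAt
      (fun p : X × (ℝ × ℝ) => F ⟨p.1, p.2.1 • v₁ p.1 + p.2.2 • v₂ p.1⟩) (x₀, z) := by
    intro z
    have h3 : ContinuousAt (fun p : X × E => (⟨p.1, e.symm p.1 p.2⟩ : TangentBundle I X))
        (x₀, z.1 • (e ⟨x₀, v₁ x₀⟩).2 + z.2 • (e ⟨x₀, v₂ x₀⟩).2) :=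
      e.continuousOn_symm.continuousAt ((e.open_baseSet.prod isOpen_univ).mem_nhds ⟨hb₀, trivial⟩)
    have h4 : ∀ v : ∀ x : X, TangentSpace I x, ContinuousOn (fun x => (⟨x, v x⟩ : TangentBundle I X)) O →
        ContinuousAt (fun p : X × (ℝ × ℝ) => (e ⟨p.1, v p.1⟩).2) (x₀, z) := fun v hv =>
      ContinuousAt.comp (f := Prod.fst) (g := fun x => (e ⟨x, v x⟩).2) (hwc v hv) continuousAt_fst
    have h5 : ContinuousAt (fun p : X × (ℝ × ℝ) => (p.1, p.2.1 • (e ⟨p.1, v₁ p.1⟩).2 +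
        p.2.2 • (e ⟨p.1, v₂ p.1⟩).2)) (x₀, z) := by
      refine continuousAt_fst.prodMk (ContinuousAt.add ?_ ?_)
      · exact (continuous_fst.comp continuous_snd).continuousAt.smul (h4 v₁ h1)
      · exact (continuous_snd.comp continuous_snd).continuousAt.smul (h4 v₂ h2)
    have h6 := ContinuousAt.comp (f := fun p : X × (ℝ × ℝ) => (p.1, p.2.1 • (e ⟨p.1, v₁ p.1⟩).2 +
        p.2.2 • (e ⟨p.1, v₂ p.1⟩).2)) (x := (x₀, z)) h3 h5
    have h7 : ContinuousAt F ⟨x₀, e.symm x₀ (z.1 • (e ⟨x₀, v₁ x₀⟩).2 + z.2 • (e ⟨x₀, v₂ x₀⟩).2)⟩ :=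
      hF.continuousAt ((hO.preimage (FiberBundle.continuous_proj E _)).mem_nhds hx₀)
    have h8 := ContinuousAt.comp (x := (x₀, z)) h7 h6
    refine h8.congr ?_
    filter_upwards [continuous_fst.continuousAt.eventually (e.open_baseSet.mem_nhds hb₀)] with p hp
    show F ⟨p.1, e.symm p.1 _⟩ = _
    rw [hlin p.1 hp]
  let f₀ : ℝ × ℝ → ℝ := fun z => F ⟨x₀, z.1 • v₁ x₀ + z.2 • v₂ x₀⟩
  have hf₀ : Continuous f₀ := continuous_iff_continuousAt.2 fun z =>
    ContinuousAt.comp (f := fun z : ℝ × ℝ => (x₀, z)) (hcont z) (by fun_prop)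
  have hS : IsCompact (Metric.sphere (0 : ℝ × ℝ) 1) := isCompact_sphere _ _
  obtain ⟨a, ha, hmin⟩ := hS.exists_isMinOn ⟨(1, 0), by simp [Prod.norm_def]⟩ hf₀.continuousOn
  obtain ⟨b, hb, hmax⟩ := hS.exists_isMaxOn ⟨(1, 0), by simp [Prod.norm_def]⟩ hf₀.continuousOn
  have hne : ∀ z ∈ Metric.sphere (0 : ℝ × ℝ) 1, z ≠ 0 := by
    rintro z hz rfl; simp at hz
  have hm : 0 < f₀ a := hpos a (hne a ha)
  have hM : 0 < f₀ b := hpos b (hne b hb)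
  have key : ∀ᶠ x in 𝓝 x₀, ∀ z ∈ Metric.sphere (0 : ℝ × ℝ) 1,
      f₀ a / 2 < F ⟨x, z.1 • v₁ x + z.2 • v₂ x⟩ ∧ F ⟨x, z.1 • v₁ x + z.2 • v₂ x⟩ < 2 * f₀ b := by
    refine hS.eventually_forall_of_forall_eventually
      (P := fun x z => f₀ a / 2 < F ⟨x, z.1 • v₁ x + z.2 • v₂ x⟩ ∧
        F ⟨x, z.1 • v₁ x + z.2 • v₂ x⟩ < 2 * f₀ b) fun z hz => ?_
    have h3 : f₀ a ≤ f₀ z := hmin hz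
    have h4 : f₀ z ≤ f₀ b := hmax hz
    exact ((hcont z).eventually (lt_mem_nhds (show f₀ a / 2 < f₀ z by linarith))).and
      ((hcont z).eventually (gt_mem_nhds (show f₀ z < 2 * f₀ b by linarith)))
  refine ⟨max (2 * f₀ b) (2 / f₀ a), lt_max_of_lt_left (by linarith), key.mono fun x hx z => ?_⟩
  rcases eq_or_ne z 0 with rfl | hz
  · have h3 := hhom x 0 0
    rw [zero_smul, abs_zero, zero_mul] at h3
    simp [h3]
  have hzn : 0 < ‖z‖ := norm_pos_iff.2 hz
  obtain ⟨h3, h4⟩ := hx (‖z‖⁻¹ • z) (by simp [norm_smul, hzn.ne'])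
  have h5 : (‖z‖⁻¹ • z).1 • v₁ x + (‖z‖⁻¹ • z).2 • v₂ x = ‖z‖⁻¹ • (z.1 • v₁ x + z.2 • v₂ x) := by
    rw [smul_add, smul_smul, smul_smul]; rfl
  rw [h5, hhom, abs_of_pos (inv_pos.2 hzn), inv_mul_eq_div] at h3 h4
  rw [div_lt_iff₀ hzn] at h4
  rw [lt_div_iff₀ hzn] at h3
  have h6 : 0 < F ⟨x, z.1 • v₁ x + z.2 • v₂ x⟩ := lt_trans (by positivity) h3
  constructor
  · exact h4.le.trans (mul_le_mul_of_nonneg_right (le_max_left _ _) hzn.le)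
  · refine le_trans ?_ (mul_le_mul_of_nonneg_right (le_max_right _ _) h6.le)
    rw [div_mul_eq_mul_div, le_div_iff₀ hm]
    linarith
end

theorem eq_smul_of_transverseNorm_eq_zero {N : Type*} [TopologicalSpace N] [ChartedSpace E3 N]
    [IsManifold 𝓔 ∞ N] (g : SmoothMetric N) (Y : ∀ x : N, TangentSpace 𝓔 x) {p : N}
    {v : TangentSpace 𝓔 p} (h : transverseNorm g Y p v = 0) : v = fieldCoeff g Y p v • Y p := by
  by_contra hv
  exact (metricNorm_pos g p (sub_ne_zero.2 hv)).ne' h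

/-- In an invariant splitting, a sum of vectors of `Es` and `Eu` along the flow vanishes. -/
theorem IsInvariantSplitting.eq_zero_of_add {N : Type*} [TopologicalSpace N] [ChartedSpace E3 N]
    [IsManifold 𝓔 ∞ N] {X : ∀ x : N, TangentSpace 𝓔 x} {ψ : Flow ℝ N}
    {Es Eu : ∀ x : N, Submodule ℝ (TangentSpace 𝓔 x)} (h : IsInvariantSplitting X ψ Es Eu) {p : N}
    {e u : TangentSpace 𝓔 p} (he : e ∈ Es p) (hu : u ∈ Eu p) {c : ℝ} (hs : e + u = c • X p) :
    e = 0 ∧ u = 0 := by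
  have h1 := (iSupIndep_iff_finsetSum_eq_zero_imp_eq_zero _).1 (h.direct p).submodule_iSupIndep
    Finset.univ ![e, -(c • X p), u] (by
      intro i _
      fin_cases i
      · exact he
      · exact Submodule.neg_mem _ (Submodule.smul_mem _ _ (Submodule.mem_span_singleton_self _))
      · exact hu) (by
      rw [Fin.sum_univ_three]
      show e + -(c • X p) + u = 0
      rw [← hs]; abel)
  exact ⟨h1 0 (Finset.mem_univ _), h1 2 (Finset.mem_univ _)⟩

namespace NormalCoordinates
variable [Nonempty (C.GluedSpace ρ r₁ r₂)]
  [ChartedSpace E3 (C.GluedSpace ρ r₁ r₂)] [IsManifold 𝓔 ∞ (C.GluedSpace ρ r₁ r₂)]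

namespace IsGlueingData
variable [T2Space M] (S : C.IsGlueingData ρ r₁ r₂)
  {Y : ∀ x : C.GluedSpace ρ r₁ r₂, TangentSpace 𝓔 x}
  {ψ : Flow ℝ (C.GluedSpace ρ r₁ r₂)} (h : C.IsSmoothModel ρ r₁ r₂ Y ψ)
  (g : SmoothMetric (C.GluedSpace ρ r₁ r₂)) (hY0 : ∀ x, Y x ≠ 0)
include S h hY0

theorem transverseNorm_outerTan_add_field {q : M₀} (hq : q ∈ C.outerDom r₁ r₂)
    (v : TangentSpace 𝓔 q) (c : ℝ) :
    transverseNorm g Y _ (C.outerTan ρ r₁ r₂ q (v + c • A.X q)).2 =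
      transverseNorm g Y _ (C.outerTan ρ r₁ r₂ q v).2 := by
  have h1 : mfderiv 𝓔 𝓔 (C.outerMap ρ r₁ r₂) q (v + c • A.X q) =
      mfderiv 𝓔 𝓔 (C.outerMap ρ r₁ r₂) q v + c • Y (C.outerMap ρ r₁ r₂ q) := by
    rw [map_add, map_smul, S.mfderiv_outerMap_field h hq]
  exact (congrArg (transverseNorm g Y (C.outerMap ρ r₁ r₂ q)) h1).trans
    (transverseNorm_add_field g Y (hY0 _) _ _)

omit S in
theorem transverseNorm_liftTan_add_field {u : ℝ³} (hu : u ∈ liftInt r₁ r₂)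
    (w : ℝ³) (c : ℝ) :
    transverseNorm g Y _ (C.liftTan ρ r₁ r₂ u (w + c • affineField lam n k u)).2 =
      transverseNorm g Y _ (C.liftTan ρ r₁ r₂ u w).2 := by
  have h1 : mfderiv 𝓘(ℝ, ℝ³) 𝓔 (C.liftMap ρ r₁ r₂) u (w + c • affineField lam n k u) =
      mfderiv 𝓘(ℝ, ℝ³) 𝓔 (C.liftMap ρ r₁ r₂) u w + c • Y (C.liftMap ρ r₁ r₂ u) := by
    rw [← (liftMap_spec h hu).2]
    exact (map_add (mfderiv 𝓘(ℝ, ℝ³) 𝓔 (C.liftMap ρ r₁ r₂) u) w _).trans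
      (congrArg (_ + ·) (map_smul (mfderiv 𝓘(ℝ, ℝ³) 𝓔 (C.liftMap ρ r₁ r₂) u) c _))
  exact (congrArg (transverseNorm g Y (C.liftMap ρ r₁ r₂ u)) h1).trans
    (transverseNorm_add_field g Y (hY0 _) _ _)

/-- Over `M_R(r₁, r₂)`, the transverse norm is comparable with the adapted norms of the components. -/
theorem exists_outer_comparable [CompactSpace M] {ε : ℝ} (H : C.AdaptedSizes ε) :
    ∃ K > 0, ∀ q : M₀, (q : M) ∈ C.outer r₁ r₂ → ∀ e ∈ A.Es q, ∀ u ∈ A.Eu q,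
      transverseNorm g Y _ (C.outerTan ρ r₁ r₂ q (e + u)).2 ≤
        K * max (H.hs q * metricNorm A.metric q e) (H.hu q * metricNorm A.metric q u) ∧
      max (H.hs q * metricNorm A.metric q e) (H.hu q * metricNorm A.metric q u) ≤
        K * transverseNorm g Y _ (C.outerTan ρ r₁ r₂ q (e + u)).2 := by
  have hcpt : IsCompact {q : M₀ | (q : M) ∈ C.outer r₁ r₂} := by
    rw [Subtype.isCompact_iff]
    have : ((↑) : M₀ → M) '' {q | (q : M) ∈ C.outer r₁ r₂} = C.outer r₁ r₂ := by
      ext x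
      exact ⟨by rintro ⟨q, hq, rfl⟩; exact hq, fun hx => ⟨⟨x, h.outer_subset hx⟩, hx, rfl⟩⟩
    rw [this]
    exact isOpen_interior.isClosed_compl.isCompact
  have hTN := continuous_transverseNorm g h.isSmoothFlowOf.smooth_field.continuous hY0
  have h0 : ∀ q v, 0 ≤ transverseNorm g Y _ (C.outerTan ρ r₁ r₂ q v).2 := fun q v => transverseNorm_nonneg _ _ _ _
  have hbd := H.bd_pos
  have hnn := metricNorm_nonneg A.metric
  refine hcpt.induction_on (p := fun s => ∃ K > 0, ∀ q ∈ s, ∀ e ∈ A.Es q, ∀ u ∈ A.Eu q,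
      transverseNorm g Y _ (C.outerTan ρ r₁ r₂ q (e + u)).2 ≤
        K * max (H.hs q * metricNorm A.metric q e) (H.hu q * metricNorm A.metric q u) ∧
      max (H.hs q * metricNorm A.metric q e) (H.hu q * metricNorm A.metric q u) ≤
        K * transverseNorm g Y _ (C.outerTan ρ r₁ r₂ q (e + u)).2) ⟨1, one_pos, by simp⟩ ?_ ?_ ?_
  · rintro s t hst ⟨K, hK, ht⟩
    exact ⟨K, hK, fun q hq => ht q (hst hq)⟩
  · rintro s t ⟨K, hK, hs⟩ ⟨K', hK', ht⟩
    have hmx : ∀ q e u, 0 ≤ max (H.hs q * metricNorm A.metric q e) (H.hu q * metricNorm A.metric q u) :=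
      fun q e u => le_max_of_le_left (mul_nonneg ((inv_pos.2 hbd).le.trans (H.le_hs q)) (hnn q e))
    refine ⟨max K K', lt_max_of_lt_left hK, fun q hq e he u hu => ?_⟩
    rcases hq with hq | hq
    · exact ⟨(hs q hq e he u hu).1.trans (mul_le_mul_of_nonneg_right (le_max_left _ _) (hmx _ _ _)),
        (hs q hq e he u hu).2.trans (mul_le_mul_of_nonneg_right (le_max_left _ _) (h0 _ _))⟩
    · exact ⟨(ht q hq e he u hu).1.trans (mul_le_mul_of_nonneg_right (le_max_right _ _) (hmx _ _ _)),
        (ht q hq e he u hu).2.trans (mul_le_mul_of_nonneg_right (le_max_right _ _) (h0 _ _))⟩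
  intro q₀ hq₀
  have hD := S.mem_outerDom_of_outer hq₀
  obtain ⟨U₁, hU₁, v₁, hv₁, hs₁⟩ := A.splitting.lineField_s q₀
  obtain ⟨U₂, hU₂, v₂, hv₂, hs₂⟩ := A.splitting.lineField_u q₀
  let O := interior (U₁ ∩ U₂) ∩ C.outerDom r₁ r₂
  have hO : IsOpen O := isOpen_interior.inter S.isOpen_outerDom
  have hqO : q₀ ∈ O := ⟨mem_interior_iff_mem_nhds.2 (Filter.inter_mem hU₁ hU₂), hD⟩
  have hO₁ : O ⊆ U₁ := fun q hq => (interior_subset hq.1).1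
  have hO₂ : O ⊆ U₂ := fun q hq => (interior_subset hq.1).2
  have hF : ContinuousOn (fun V : TangentBundle 𝓔 M₀ =>
      transverseNorm g Y _ (C.outerTan ρ r₁ r₂ V.1 V.2).2) {V | V.1 ∈ O} :=
    hTN.comp_continuousOn (continuousOn_tangentMap_of_contMDiffAt hO fun q hq =>
      (S.isLocalDiffeomorphAt_outerMap h hq.2).contMDiffAt)
  obtain ⟨K, hK, hcomp⟩ := eventually_comparable hO hqO (hv₁.mono hO₁) (hv₂.mono hO₂) hF (by
      intro x c v
      have h1 : (C.outerTan ρ r₁ r₂ x (c • v)).2 = c • (C.outerTan ρ r₁ r₂ x v).2 :=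
        map_smul (mfderiv 𝓔 𝓔 (C.outerMap ρ r₁ r₂) x) c v
      show transverseNorm g Y _ (C.outerTan ρ r₁ r₂ x (c • v)).2 = _
      rw [h1]
      exact transverseNorm_smul g Y _ c _) (by
      intro z hz
      refine (transverseNorm_nonneg _ _ _ _).lt_of_ne' fun hzero => hz ?_
      have h1 := eq_smul_of_transverseNorm_eq_zero g Y hzero
      have h2 : z.1 • v₁ q₀ + z.2 • v₂ q₀ =
          fieldCoeff g Y _ (C.outerTan ρ r₁ r₂ q₀ (z.1 • v₁ q₀ + z.2 • v₂ q₀)).2 • A.X q₀ := by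
        apply (S.isLocalDiffeomorphAt_outerMap h hD).mfderiv_injective
        rw [map_smul, S.mfderiv_outerMap_field h hD]
        exact h1
      have hm1 := (hs₁ q₀ (hO₁ hqO)).2
      have hm2 := (hs₂ q₀ (hO₂ hqO)).2
      obtain ⟨h3, h4⟩ := A.splitting.eq_zero_of_add
        (by rw [hm1]; exact Submodule.smul_mem _ _ (Submodule.mem_span_singleton_self _))
        (by rw [hm2]; exact Submodule.smul_mem _ _ (Submodule.mem_span_singleton_self _)) h2
      exact Prod.ext ((smul_eq_zero.1 h3).resolve_right (hs₁ q₀ (hO₁ hqO)).1)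
        ((smul_eq_zero.1 h4).resolve_right (hs₂ q₀ (hO₂ hqO)).1))
  -- the norms of the two fields are bounded from above and from below
  have hloc : ∀ v : ∀ q : M₀, TangentSpace 𝓔 q, v q₀ ≠ 0 →
      ContinuousOn (fun q => (⟨q, v q⟩ : TangentBundle 𝓔 M₀)) O →
      ∃ L > 0, ∀ᶠ q in 𝓝 q₀, metricNorm A.metric q (v q) ≤ L ∧ 1 ≤ L * metricNorm A.metric q (v q) := by
    intro v hv hvc
    have h1 : ContinuousAt (fun q => metricNorm A.metric q (v q)) q₀ :=
      ((continuous_metricNorm A.metric).comp_continuousOn hvc).continuousAt (hO.mem_nhds hqO)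
    set b := metricNorm A.metric q₀ (v q₀) with hb
    have hb0 : 0 < b := metricNorm_pos A.metric q₀ hv
    refine ⟨max (2 * b) (2 / b), lt_max_of_lt_left (by linarith), ?_⟩
    filter_upwards [h1.eventually (lt_mem_nhds (show b / 2 < b by linarith)),
      h1.eventually (gt_mem_nhds (show b < 2 * b by linarith))] with q h2 h3
    refine ⟨h3.le.trans (le_max_left _ _), ?_⟩
    refine le_trans ?_ (mul_le_mul_of_nonneg_right (le_max_right _ _) (hnn _ _))
    rw [div_mul_eq_mul_div, le_div_iff₀ hb0]
    linarith
  obtain ⟨L₁, hL₁, hb₁⟩ := hloc v₁ (hs₁ q₀ (hO₁ hqO)).1 (hv₁.mono hO₁)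
  obtain ⟨L₂, hL₂, hb₂⟩ := hloc v₂ (hs₂ q₀ (hO₂ hqO)).1 (hv₂.mono hO₂)
  obtain ⟨L, hL, hLL₁, hLL₂⟩ : ∃ L > 0, L₁ ≤ L ∧ L₂ ≤ L :=
    ⟨max L₁ L₂, lt_max_of_lt_left hL₁, le_max_left _ _, le_max_right _ _⟩
  have hscal : ∀ η b L' z : ℝ, η ≤ H.bd → H.bd⁻¹ ≤ η → L' ≤ L → 0 ≤ b → b ≤ L' → 1 ≤ L' * b →
      η * (|z| * b) ≤ (H.bd * L) * |z| ∧ |z| ≤ (H.bd * L) * (η * (|z| * b)) := by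
    intro η b L' z h1 h2 h3 h4 h5 h6
    have hz := abs_nonneg z
    have hη : 0 < η := (inv_pos.2 hbd).trans_le h2
    constructor
    · calc η * (|z| * b) ≤ H.bd * (|z| * L) :=
          mul_le_mul h1 (mul_le_mul_of_nonneg_left (h5.trans h3) hz) (mul_nonneg hz h4) hbd.le
        _ = _ := by ring
    · have h7 : 1 ≤ H.bd * η := by
        rw [← inv_mul_cancel₀ hbd.ne', mul_comm]; exact mul_le_mul_of_nonneg_left h2 hbd.le
      have h8 : 1 ≤ L * b := h6.trans (mul_le_mul_of_nonneg_right h3 h4)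
      calc |z| = 1 * 1 * |z| := by ring
        _ ≤ (H.bd * η) * (L * b) * |z| :=
          mul_le_mul_of_nonneg_right (mul_le_mul h7 h8 zero_le_one (by positivity)) hz
        _ = _ := by ring
  refine ⟨_, mem_nhdsWithin_of_mem_nhds (hcomp.and (hb₁.and (hb₂.and (hO.mem_nhds hqO)))),
    K * (H.bd * L), by positivity, ?_⟩
  rintro q ⟨hq, ⟨hq₁, hq₁'⟩, ⟨hq₂, hq₂'⟩, hqq⟩ e he u hu
  rw [(hs₁ q (hO₁ hqq)).2] at he
  rw [(hs₂ q (hO₂ hqq)).2] at hu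
  obtain ⟨a, rfl⟩ := Submodule.mem_span_singleton.1 he
  obtain ⟨c, rfl⟩ := Submodule.mem_span_singleton.1 hu
  obtain ⟨h3, h4⟩ := hq (a, c)
  obtain ⟨h5, h6⟩ := hscal _ _ _ a (H.hs_le q) (H.le_hs q) hLL₁ (hnn _ _) hq₁ hq₁'
  obtain ⟨h7, h8⟩ := hscal _ _ _ c (H.hu_le q) (H.le_hu q) hLL₂ (hnn _ _) hq₂ hq₂'
  rw [metricNorm_smul, metricNorm_smul]
  have hac : ‖(a, c)‖ = max |a| |c| := rfl
  rw [hac] at h3 h4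
  have hBL : 0 < H.bd * L := by positivity
  constructor
  · rw [mul_assoc]
    refine h3.trans (mul_le_mul_of_nonneg_left (max_le ?_ ?_) hK.le)
    · exact h6.trans (mul_le_mul_of_nonneg_left (le_max_left _ _) hBL.le)
    · exact h8.trans (mul_le_mul_of_nonneg_left (le_max_right _ _) hBL.le)
  · rw [mul_comm K, mul_assoc]
    refine le_trans (max_le ?_ ?_) (mul_le_mul_of_nonneg_left h4 hBL.le)
    · exact h5.trans (mul_le_mul_of_nonneg_left (le_max_left _ _) hBL.le)
    · exact h7.trans (mul_le_mul_of_nonneg_left (le_max_right _ _) hBL.le)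

/-- Over the interior of the cross, the transverse norm is comparable with the planar components. -/
theorem exists_affine_comparable :
    ∃ K > 0, ∀ u ∈ liftInt r₁ r₂, u.2.2 ∈ Icc (0 : ℝ) 1 → ∀ z : ℝ × ℝ,
      transverseNorm g Y _ (C.liftTan ρ r₁ r₂ u (z.1, z.2, 0)).2 ≤ K * ‖z‖ ∧
      ‖z‖ ≤ K * transverseNorm g Y _ (C.liftTan ρ r₁ r₂ u (z.1, z.2, 0)).2 := by
  have hcpt : IsCompact {u : ℝ³ | liftProj u ∈ affineCross r₁ r₂ ∧ u.2.2 ∈ Icc (0 : ℝ) 1} := by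
    refine ((isCompact_Icc (a := -r₁) (b := r₁)).prod ((isCompact_Icc (a := -r₁) (b := r₁)).prod
      (isCompact_Icc (a := (0 : ℝ)) (b := 1)))).of_isClosed_subset ?_ ?_
    · have h1 : IsClosed {u : ℝ³ | (u.1, u.2.1) ∈ crossRegion r₁ r₂} :=
        (isClosed_crossRegion r₁ r₂).preimage (by fun_prop)
      have h2 : IsClosed {u : ℝ³ | u.2.2 ∈ Icc (0 : ℝ) 1} := isClosed_Icc.preimage (by fun_prop)
      exact h1.inter h2
    · rintro u ⟨hu, hz⟩
      exact ⟨abs_le.1 hu.1, abs_le.1 hu.2.1, hz⟩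
  have hTN := continuous_transverseNorm g h.isSmoothFlowOf.smooth_field.continuous hY0
  have key : ∃ K > 0, ∀ u ∈ {u : ℝ³ | liftProj u ∈ affineCross r₁ r₂ ∧ u.2.2 ∈ Icc (0 : ℝ) 1},
      u ∈ liftInt r₁ r₂ → ∀ z : ℝ × ℝ,
      transverseNorm g Y _ (C.liftTan ρ r₁ r₂ u (z.1, z.2, 0)).2 ≤ K * ‖z‖ ∧
      ‖z‖ ≤ K * transverseNorm g Y _ (C.liftTan ρ r₁ r₂ u (z.1, z.2, 0)).2 := by
    refine hcpt.induction_on (p := fun s => ∃ K > 0, ∀ u ∈ s, u ∈ liftInt r₁ r₂ → ∀ z : ℝ × ℝ,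
      transverseNorm g Y _ (C.liftTan ρ r₁ r₂ u (z.1, z.2, 0)).2 ≤ K * ‖z‖ ∧
      ‖z‖ ≤ K * transverseNorm g Y _ (C.liftTan ρ r₁ r₂ u (z.1, z.2, 0)).2) ⟨1, one_pos, by simp⟩ ?_ ?_ ?_
    · rintro s t hst ⟨K, hK, ht⟩
      exact ⟨K, hK, fun q hq => ht q (hst hq)⟩
    · rintro s t ⟨K, hK, hs⟩ ⟨K', hK', ht⟩
      have h0 : ∀ q v, 0 ≤ transverseNorm g Y _ (C.liftTan ρ r₁ r₂ q v).2 := fun q v => transverseNorm_nonneg _ _ _ _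
      refine ⟨max K K', lt_max_of_lt_left hK, fun q hq hi z => ?_⟩
      rcases hq with hq | hq
      · exact ⟨(hs q hq hi z).1.trans (mul_le_mul_of_nonneg_right (le_max_left _ _) (norm_nonneg _)),
          (hs q hq hi z).2.trans (mul_le_mul_of_nonneg_right (le_max_left _ _) (h0 _ _))⟩
      · exact ⟨(ht q hq hi z).1.trans (mul_le_mul_of_nonneg_right (le_max_right _ _) (norm_nonneg _)),
          (ht q hq hi z).2.trans (mul_le_mul_of_nonneg_right (le_max_right _ _) (h0 _ _))⟩
    rintro u₀ ⟨hu₀, -⟩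
    obtain ⟨f, hf, hfe, hfY⟩ := h.smooth_affine u₀ hu₀
    obtain ⟨O, hOs, hO, huO⟩ := mem_nhds_iff.1 (hf.eventually.and hfe.eventually_nhds)
    have hconst : ∀ w : ℝ³, ContinuousOn
        (fun u : ℝ³ => (⟨u, w⟩ : TangentBundle 𝓘(ℝ, ℝ³) ℝ³)) O := fun w =>
      ((tangentBundleModelSpaceHomeomorph 𝓘(ℝ, ℝ³)).symm.continuous.comp
        (continuous_id.prodMk continuous_const)).continuousOn
    have hF : ContinuousOn (fun V : TangentBundle 𝓘(ℝ, ℝ³) ℝ³ =>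
        transverseNorm g Y _ (tangentMap 𝓘(ℝ, ℝ³) 𝓔 f V).2) {V | V.1 ∈ O} :=
      hTN.comp_continuousOn (continuousOn_tangentMap_of_contMDiffAt hO fun q hq =>
        (hOs hq).1.contMDiffAt)
    have hw : ∀ z : ℝ × ℝ, z.1 • ((1, 0, 0) : ℝ³) + z.2 • ((0, 1, 0) : ℝ³) = (z.1, z.2, 0) :=
      fun z => by ext <;> simp
    obtain ⟨K, hK, hcomp⟩ := eventually_comparable hO huO (hconst (1, 0, 0)) (hconst (0, 1, 0)) hF (by
        intro x c v
        have h1 : (tangentMap 𝓘(ℝ, ℝ³) 𝓔 f ⟨x, c • v⟩).2 =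
            c • (tangentMap 𝓘(ℝ, ℝ³) 𝓔 f ⟨x, v⟩).2 :=
          map_smul (mfderiv 𝓘(ℝ, ℝ³) 𝓔 f x) c v
        show transverseNorm g Y _ (tangentMap 𝓘(ℝ, ℝ³) 𝓔 f ⟨x, c • v⟩).2 = _
        rw [h1]
        exact transverseNorm_smul g Y _ c _) (by
        intro z hz
        refine (transverseNorm_nonneg _ _ _ _).lt_of_ne' fun hzero => hz ?_
        have h1 := eq_smul_of_transverseNorm_eq_zero g Y hzero
        obtain ⟨c, h2⟩ : ∃ c : ℝ, z.1 • ((1, 0, 0) : ℝ³) + z.2 • ((0, 1, 0) : ℝ³) =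
            c • affineField lam n k u₀ := by
          refine ⟨fieldCoeff g Y (f u₀) (mfderiv 𝓘(ℝ, ℝ³) 𝓔 f u₀
            (z.1 • ((1, 0, 0) : ℝ³) + z.2 • ((0, 1, 0) : ℝ³))),
            hf.mfderiv_injective (h1.trans ?_)⟩
          exact ((map_smul (mfderiv 𝓘(ℝ, ℝ³) 𝓔 f u₀) _ _).trans
            (congrArg _ hfY)).symm
        rw [hw] at h2
        have hnk : (0 : ℝ) < n * k := by
          have h3 := S.one_le_n
          have h4 := S.one_le_k
          positivity
        have h3 : c = 0 := by
          have h4 := congrArg (fun w : ℝ³ => w.2.2) h2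
          have h5 : (0 : ℝ) = c * (1 / (n * k)) := h4
          exact (mul_eq_zero.1 h5.symm).resolve_right (one_div_pos.2 hnk).ne'
        rw [h3, zero_smul] at h2
        exact Prod.ext (congrArg (fun w : ℝ³ => w.1) h2) (congrArg (fun w : ℝ³ => w.2.1) h2))
    refine ⟨_, mem_nhdsWithin_of_mem_nhds (hcomp.and (hO.mem_nhds huO)), K, hK, ?_⟩
    rintro u ⟨hu, huO⟩ hui z
    have h1 : C.liftMap ρ r₁ r₂ =ᶠ[𝓝 u] f := by
      filter_upwards [(hOs huO).2, (isOpen_liftInt r₁ r₂).mem_nhds hui] with u' h2 h3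
      rw [h2 (liftProj_mem h3)]
      exact affineMap_of_mem (liftProj_mem h3)
    have h2 : C.liftTan ρ r₁ r₂ u (z.1, z.2, 0) = tangentMap 𝓘(ℝ, ℝ³) 𝓔 f ⟨u, (z.1, z.2, 0)⟩ :=
      h1.tangentMap_eq (I := 𝓘(ℝ, ℝ³)) (J := 𝓔) _
    rw [h2]
    have e1 : (⟨u, z.1 • ((1, 0, 0) : ℝ³) + z.2 • ((0, 1, 0) : ℝ³)⟩ :
        TangentBundle 𝓘(ℝ, ℝ³) ℝ³) = ⟨u, (z.1, z.2, 0)⟩ := by rw [hw z]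
    rw [← e1]
    exact hu z
  obtain ⟨K, hK, hb⟩ := key
  exact ⟨K, hK, fun u hu hz z => hb u ⟨liftProj_mem hu, hz⟩ hu z⟩

end IsGlueingData
end NormalCoordinates

theorem IsLineField.exists_ne_zero {N : Type*} [TopologicalSpace N] [ChartedSpace E3 N]
    [IsManifold 𝓔 ∞ N] {E : ∀ x : N, Submodule ℝ (TangentSpace 𝓔 x)} (h : IsLineField E)
    (p : N) : ∃ v ∈ E p, v ≠ 0 := by
  obtain ⟨U, hU, v, -, hv⟩ := h p
  obtain ⟨h1, h2⟩ := hv p (mem_of_mem_nhds hU)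
  exact ⟨v p, by rw [h2]; exact Submodule.mem_span_singleton_self _, h1⟩

/-! ### Expanded vectors and the Anosov property -/

namespace NormalCoordinates
variable [Nonempty (C.GluedSpace ρ r₁ r₂)]
  [ChartedSpace E3 (C.GluedSpace ρ r₁ r₂)] [IsManifold 𝓔 ∞ (C.GluedSpace ρ r₁ r₂)]

/-- The size of the vectors of the cones is comparable with the norm of their components, and every
fibre contains a vector of positive size. -/
structure ConeField.IsSized {σ κ : ℝ} (K : C.ConeField ρ r₁ r₂ σ κ) {ε : ℝ} (H : C.AdaptedSizes ε)
    (B : ℝ) : Prop where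
  outer : ∀ q v b, K.outer q v b → ∃ e ∈ A.Es q, ∃ u ∈ A.Eu q, ∃ τ : ℝ, v = e + u + τ • A.X q ∧
    b ≤ max (H.hs q * metricNorm A.metric q e) (H.hu q * metricNorm A.metric q u) ∧
    max (H.hs q * metricNorm A.metric q e) (H.hu q * metricNorm A.metric q u) ≤ B * b
  affine : ∀ u w b, K.affine u w b → ∃ (z : ℝ × ℝ) (τ : ℝ),
    w = (z.1, z.2, 0) + τ • affineField lam n k u ∧ b ≤ ‖z‖ ∧ ‖z‖ ≤ B * b
  exists_outer : ∀ q, ∃ v, ∃ b > 0, K.outer q v b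
  exists_affine : ∀ u, ∃ w, ∃ b > 0, K.affine u w b

namespace IsGlueingData
variable [T2Space M] (S : C.IsGlueingData ρ r₁ r₂)
  {Y : ∀ x : C.GluedSpace ρ r₁ r₂, TangentSpace 𝓔 x}
  {ψ : Flow ℝ (C.GluedSpace ρ r₁ r₂)} (h : C.IsSmoothModel ρ r₁ r₂ Y ψ)
  (g : SmoothMetric (C.GluedSpace ρ r₁ r₂)) (hY0 : ∀ x, Y x ≠ 0)
  {ε : ℝ} (H : C.AdaptedSizes ε) (hε : r₁ < ε)
include S

omit [Nonempty (C.GluedSpace ρ r₁ r₂)] [ChartedSpace E3 (C.GluedSpace ρ r₁ r₂)]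
  [IsManifold 𝓔 ∞ (C.GluedSpace ρ r₁ r₂)] in
/-- The ratio `3 r₁ / r₂` is the width of the unstable cones inside the cross. -/
theorem isSized_unstableCone : (S.unstableCone H hε).IsSized H (3 * r₁ / r₂) := by
  have hr2 := S.pos
  have hB : 1 ≤ 3 * r₁ / r₂ := by rw [one_le_div hr2]; linarith [S.lt]
  have hpos : ∀ q, 0 < H.hu q := fun q => (inv_pos.2 H.bd_pos).trans_le (H.le_hu q)
  refine ⟨?_, ?_, ?_, ?_⟩
  · rintro q v b ⟨e, he, u, hu, τ, rfl, hle, rfl⟩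
    refine ⟨e, he, u, hu, τ, by abel, le_max_right _ _, ?_⟩
    rw [max_eq_right hle]
    exact le_mul_of_one_le_left (mul_nonneg (hpos q).le (metricNorm_nonneg _ _ _)) hB
  · rintro u w b ⟨a, β, τ, rfl, -, h2, rfl⟩
    refine ⟨(a, β), τ, rfl, le_max_right _ _, max_le ?_ ?_⟩
    · rw [div_mul_eq_mul_div, le_div_iff₀ hr2]
      show |a| * r₂ ≤ _
      linarith
    · exact le_mul_of_one_le_left (abs_nonneg _) hB
  · intro q
    obtain ⟨u, hu, hu0⟩ := A.splitting.lineField_u.exists_ne_zero q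
    refine ⟨_, _, _root_.mul_pos (hpos q) (metricNorm_pos A.metric q hu0), 0, Submodule.zero_mem _, u, hu, 0, rfl, ?_, rfl⟩
    rw [show metricNorm A.metric q 0 = 0 by simp [metricNorm], mul_zero]
    exact mul_nonneg (hpos q).le (metricNorm_nonneg _ _ _)
  · exact fun u => ⟨_, _, one_pos, 0, 1, 0, rfl, by simp, by simp [S.pos₁.le], by simp⟩

omit [Nonempty (C.GluedSpace ρ r₁ r₂)] [ChartedSpace E3 (C.GluedSpace ρ r₁ r₂)]
  [IsManifold 𝓔 ∞ (C.GluedSpace ρ r₁ r₂)] in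
theorem isSized_stableCone : (S.stableCone H hε).IsSized H 1 := by
  have hpos : ∀ q, 0 < H.hs q := fun q => (inv_pos.2 H.bd_pos).trans_le (H.le_hs q)
  refine ⟨?_, ?_, ?_, ?_⟩
  · rintro q v b ⟨e, he, u, hu, τ, rfl, hle, rfl⟩
    exact ⟨e, he, u, hu, τ, by abel, le_max_left _ _, by rw [max_eq_left hle, one_mul]⟩
  · rintro u w b ⟨a, β, τ, rfl, -, h2, rfl⟩
    exact ⟨(a, β), τ, rfl, le_max_left _ _, by rw [one_mul]; exact max_le le_rfl h2⟩
  · intro q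
    obtain ⟨e, he, he0⟩ := A.splitting.lineField_s.exists_ne_zero q
    refine ⟨_, _, _root_.mul_pos (hpos q) (metricNorm_pos A.metric q he0), e, he, 0, Submodule.zero_mem _, 0, rfl, ?_, rfl⟩
    rw [show metricNorm A.metric q 0 = 0 by simp [metricNorm], mul_zero]
    exact mul_nonneg (hpos q).le (metricNorm_nonneg _ _ _)
  · exact fun u => ⟨_, _, one_pos, 1, 0, 0, rfl, by simp, by simp, by simp⟩

include h

theorem field_ne_zero (p : C.GluedSpace ρ r₁ r₂) : Y p ≠ 0 := by
  rcases S.cover' p with ⟨q, hq, rfl⟩ | ⟨u, hu, rfl⟩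
  · have hD := S.mem_outerDom_of_outer hq
    rw [← S.mfderiv_outerMap_field h hD]
    intro h0
    exact A.splitting.nonsingular q ((S.isLocalDiffeomorphAt_outerMap h hD).mfderiv_injective
      (h0.trans (map_zero _).symm))
  · rw [← (liftMap_spec h hu).2]
    intro h0
    have h1 : affineField lam n k u = 0 := (liftMap_spec h hu).1.mfderiv_injective
      (h0.trans (map_zero (mfderiv 𝓘(ℝ, ℝ³) 𝓔 (C.liftMap ρ r₁ r₂) u)).symm)
    have h2 : 1 / ((n : ℝ) * k) = 0 := congrArg (fun w : ℝ³ => w.2.2) h1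
    have h3 := S.one_le_n
    have h4 := S.one_le_k
    exact (one_div_pos.2 (show (0 : ℝ) < n * k by positivity)).ne' h2

include hY0

/-- The transverse norm of the vectors of a sized cone field is comparable with their size. -/
theorem exists_mem_bound [CompactSpace M] {σ κ B : ℝ} {K : C.ConeField ρ r₁ r₂ σ κ} (hK : K.IsSized H B)
    (hB : 0 < B) : ∃ L > 0, ∀ V b, K.Mem V b →
      transverseNorm g Y V.1 V.2 ≤ L * b ∧ b ≤ L * transverseNorm g Y V.1 V.2 := by
  obtain ⟨L₁, hL₁, h1⟩ := S.exists_outer_comparable h g hY0 H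
  obtain ⟨L₂, hL₂, h2⟩ := S.exists_affine_comparable h g hY0
  -- both comparisons have the same shape
  have key : ∀ L' N z b : ℝ, 0 < L' → L' ≤ L₁ + L₂ → 0 ≤ N → N ≤ L' * z → z ≤ L' * N → b ≤ z → z ≤ B * b →
      N ≤ (L₁ + L₂) * (B + 1) * b ∧ b ≤ (L₁ + L₂) * (B + 1) * N := by
    intro L' N z b hL' hle hN h3 h4 h5 h6
    have hb : 0 ≤ b := by
      by_contra hb
      have : 0 ≤ z := le_of_mul_le_mul_left (by linarith) hL'
      nlinarith
    have h7 : L' * z ≤ (L₁ + L₂) * (B * b) := mul_le_mul hle h6 (hb.trans h5) (by linarith)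
    have h8 : L' * N ≤ (L₁ + L₂) * N := mul_le_mul_of_nonneg_right hle hN
    have h9 : 0 ≤ (L₁ + L₂) * b := by positivity
    have h10 : 0 ≤ (L₁ + L₂) * B * N := by positivity
    constructor <;> nlinarith
  refine ⟨(L₁ + L₂) * (B + 1), by positivity, ?_⟩
  rintro V b (⟨q, v, hq, rfl, hv⟩ | ⟨u, w, hu, rfl, hw⟩)
  · obtain ⟨e, he, u, hu, τ, rfl, h3, h4⟩ := hK.outer q v b hv
    obtain ⟨h5, h6⟩ := h1 q hq e he u hu
    rw [S.transverseNorm_outerTan_add_field h g hY0 (S.mem_outerDom_of_outer hq)]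
    exact key L₁ _ _ b hL₁ (by linarith) (transverseNorm_nonneg _ _ _ _) h5 h6 h3 h4
  · -- by periodicity, the last coordinate can be taken in `[0, 1]`
    obtain ⟨u', hu', hz⟩ := exists_liftProj_eq (liftProj u)
    obtain ⟨j, rfl⟩ := exists_int_of_liftProj_eq hu'
    have hui : u + (0, 0, (j : ℝ)) ∈ liftInt r₁ r₂ := by
      have h3 : (liftProj (u + (0, 0, (j : ℝ)))).1 = (liftProj u).1 := by rw [hu']
      simpa [liftInt] using hu
    have e1 : C.liftTan ρ r₁ r₂ u w = C.liftTan ρ r₁ r₂ (u + (0, 0, (j : ℝ))) w :=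
      (S.tangentMap_liftMap_add_int h hu j w).symm
    obtain ⟨z, τ, rfl, h3, h4⟩ := hK.affine _ w b (K.affine_add_int u w b j hw)
    obtain ⟨h5, h6⟩ := h2 _ hui hz z
    rw [e1, transverseNorm_liftTan_add_field h g hY0 hui]
    exact key L₂ _ _ b hL₂ (by linarith) (transverseNorm_nonneg _ _ _ _) h5 h6 h3 h4

/-- In every tangent space there is a vector that is expanded, modulo the flow direction, in the
direction of time given by the cone field. -/
theorem exists_expanded [CompactSpace M] {σ κ B : ℝ} {K : C.ConeField ρ r₁ r₂ σ κ} (hK : K.IsSized H B)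
    (hB : 0 < B) (hσ : σ = 1 ∨ σ = -1) : ∃ L, ∀ p : C.GluedSpace ρ r₁ r₂, ∃ w : TangentSpace 𝓔 p,
      transverseNorm g Y p w ≠ 0 ∧ ∀ s t : ℝ, s ≤ t → t ≤ 0 →
        transverseNorm g Y _ (tangentMap 𝓔 𝓔 (ψ (σ * -t)) ⟨p, w⟩).2 ≤
          L * Real.exp (-κ * (t - s)) *
            transverseNorm g Y _ (tangentMap 𝓔 𝓔 (ψ (σ * -s)) ⟨p, w⟩).2 := by
  obtain ⟨L, hL, hb⟩ := S.exists_mem_bound h g hY0 H hK hB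
  have hstart : ∀ p : C.GluedSpace ρ r₁ r₂, ∃ (w : TangentSpace 𝓔 p) (b : ℝ), 0 < b ∧ K.Mem ⟨p, w⟩ b := by
    intro p
    rcases S.cover' p with ⟨q, hq, rfl⟩ | ⟨u, hu, rfl⟩
    · obtain ⟨v, b, hb0, hv⟩ := hK.exists_outer q
      exact ⟨(C.outerTan ρ r₁ r₂ q v).2, b, hb0, Or.inl ⟨q, v, hq, rfl, hv⟩⟩
    · obtain ⟨w, b, hb0, hw⟩ := hK.exists_affine u
      exact ⟨(C.liftTan ρ r₁ r₂ u w).2, b, hb0, Or.inr ⟨u, w, hu, rfl, hw⟩⟩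
  refine ⟨L * L, fun p => ?_⟩
  -- the factor `L` is lost at both ends of the time interval, when norms are compared with sizes
  obtain ⟨w, b, hb0, hw⟩ := hstart p
  refine ⟨w, fun h0 => ?_, fun s t hst ht => ?_⟩
  · have := (hb _ _ hw).2
    rw [h0, mul_zero] at this
    linarith
  · obtain ⟨b₁, -, hb₁⟩ := S.mem_flow h K hσ (show 0 ≤ -t by linarith) hw
    obtain ⟨b₂, hb₂, hb₂'⟩ := S.mem_flow h K hσ (show 0 ≤ t - s by linarith) hb₁
    rw [← tangentMap_flow_add h.isSmoothFlowOf.smooth_flow, ← mul_add,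
      show t - s + -t = -s by ring] at hb₂'
    have h1 := (hb _ _ hb₁).1
    have h2 := (hb _ _ hb₂').2
    set N₁ := transverseNorm g Y _ (tangentMap 𝓔 𝓔 (ψ (σ * -t)) ⟨p, w⟩).2
    set N₂ := transverseNorm g Y _ (tangentMap 𝓔 𝓔 (ψ (σ * -s)) ⟨p, w⟩).2
    have h3 : Real.exp (-κ * (t - s)) * Real.exp (κ * (t - s)) = 1 := by rw [← Real.exp_add]; simp
    have h4 : b₁ ≤ Real.exp (-κ * (t - s)) * b₂ := by
      have := mul_le_mul_of_nonneg_left hb₂ (Real.exp_pos (-κ * (t - s))).le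
      rwa [← mul_assoc, h3, one_mul] at this
    calc N₁ ≤ L * (Real.exp (-κ * (t - s)) * (L * N₂)) := h1.trans (mul_le_mul_of_nonneg_left
          (h4.trans (mul_le_mul_of_nonneg_left h2 (Real.exp_pos _).le)) hL.le)
      _ = _ := by ring

omit hY0
include H hε

/-- Every smooth model of the glued flow is Anosov. -/
theorem isAnosovFlow [CompactSpace M] : IsAnosovFlow Y ψ := by
  have hc : CompactSpace (C.GluedSpace ρ r₁ r₂) := compactSpace_gluedSpace
  have ht : T2Space (C.GluedSpace ρ r₁ r₂) := S.t2Space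
  have hY0 := S.field_ne_zero h
  obtain ⟨g⟩ := exists_smoothMetric (C.GluedSpace ρ r₁ r₂)
  have hr1 := S.pos₁
  have hr2 := S.pos
  obtain ⟨L₁, h1⟩ := S.exists_expanded h g hY0 H (S.isSized_unstableCone H hε) (by positivity) (Or.inl rfl)
  obtain ⟨L₂, h2⟩ := S.exists_expanded h g hY0 H (S.isSized_stableCone H hε) one_pos (Or.inr rfl)
  have hℓ := A.log_lam_neg
  have hμ : ∀ x : ℝ, Real.exp (Real.log lam / 2) ^ x = Real.exp (- -(Real.log lam / 2) * x) := fun x => by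
    rw [← Real.exp_mul, neg_neg]
  have hmax : ∀ {L N N' a : ℝ}, N ≤ L * Real.exp a * N' → 0 ≤ N' → L ≤ max L₁ L₂ →
      N ≤ max L₁ L₂ * Real.exp a * N' := fun h3 h4 h5 => h3.trans
    (mul_le_mul_of_nonneg_right (mul_le_mul_of_nonneg_right h5 (Real.exp_pos _).le) h4)
  refine isAnosovFlow_of_transverse g h.isSmoothFlowOf hY0 (C := max L₁ L₂)
    (μ := Real.exp (Real.log lam / 2)) (Real.exp_pos _)
    (by rw [← Real.exp_zero]; exact Real.exp_lt_exp.2 (by linarith)) ?_ ?_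
  · intro p
    obtain ⟨w, hw, hb⟩ := h2 p
    refine ⟨w, hw, fun s t hst ht => ?_⟩
    have h3 := hb s t hst ht
    rw [neg_mul_neg, neg_mul_neg, one_mul, one_mul] at h3
    rw [hμ]
    exact hmax h3 (transverseNorm_nonneg _ _ _ _) (le_max_right _ _)
  · intro p
    obtain ⟨w, hw, hb⟩ := h1 p
    refine ⟨w, hw, fun s t hst ht => ?_⟩
    have h3 := hb s t hst ht
    rw [one_mul, one_mul] at h3
    rw [hμ]
    exact hmax h3 (transverseNorm_nonneg _ _ _ _) (le_max_left _ _)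

end IsGlueingData
end NormalCoordinates

/-! ### Smooth flows from local flows -/

section
variable {N : Type*} [TopologicalSpace N]

/-- A covering family of charts with smooth transition maps is contained in a smooth atlas. -/
theorem exists_isManifold_of_charts (𝒜 : Set (OpenPartialHomeomorph N E3))
    (hcov : ∀ a, ∃ e ∈ 𝒜, a ∈ e.source)
    (hcomp : ∀ e ∈ 𝒜, ∀ e' ∈ 𝒜, ∀ w ∈ (e.symm ≫ₕ e').source, ContDiffAt ℝ ∞ (e' ∘ e.symm) w) :
    ∃ (_ : ChartedSpace E3 N) (_ : IsManifold 𝓔 ∞ N), ∀ e ∈ 𝒜, e ∈ atlas E3 N := by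
  choose e he hea using hcov
  let cs : ChartedSpace E3 N :=
    { atlas := 𝒜, chartAt := e, mem_chart_source := hea, chart_mem_atlas := he }
  refine ⟨cs, isManifold_of_contDiffOn 𝓔 ∞ N fun e e' he he' w hw => ?_, fun _ h => h⟩
  exact (hcomp e he e' he' w (by simpa using hw)).contDiffWithinAt

variable [ChartedSpace E3 N] [IsManifold 𝓔 ∞ N]

section
variable {E H : Type*} [NormedAddCommGroup E] [NormedSpace ℝ E] [TopologicalSpace H]
  {I : ModelWithCorners ℝ E H} {X : Type*} [TopologicalSpace X] [ChartedSpace H X] [IsManifold I ∞ X]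

/-- A vector field is smooth where it is the image of a smooth one by a local diffeomorphism. -/
theorem IsLocalDiffeomorphAt.contMDiffAt_field {p : X → N} {x₀ : X}
    (hp : IsLocalDiffeomorphAt I 𝓔 ∞ p x₀) {Z : ∀ x : X, TangentSpace I x}
    (hZ : ContMDiff I I.tangent ∞ (fun x => (⟨x, Z x⟩ : TangentBundle I X)))
    {Y : ∀ a : N, TangentSpace 𝓔 a}
    (hY : ∀ᶠ x in 𝓝 x₀, mfderiv I 𝓔 p x (Z x) = Y (p x)) :
    ContMDiffAt 𝓔 (𝓔).tangent ∞ (fun a => (⟨a, Y a⟩ : TangentBundle 𝓔 N)) (p x₀) := by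
  obtain ⟨p', hp', hp0, hpr, -⟩ := hp.exists_inverse
  obtain ⟨O, hO, hOo, hxO⟩ := mem_nhds_iff.1 hp.eventually
  have h1 : ContMDiffOn I 𝓔 ∞ p O := fun x hx => (hO hx).contMDiffAt.contMDiffWithinAt
  have h2 := h1.contMDiffOn_tangentMapWithin (m := ∞) (by simp) hOo.uniqueMDiffOn
  have hOp : IsOpen (Bundle.TotalSpace.proj ⁻¹' O : Set (TangentBundle I X)) :=
    hOo.preimage (FiberBundle.continuous_proj E (TangentSpace I : X → Type _))
  have h3 : ContMDiffAt I.tangent (𝓔).tangent ∞ (tangentMap I 𝓔 p) ⟨x₀, Z x₀⟩ := by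
    have hOn : (Bundle.TotalSpace.proj ⁻¹' O : Set (TangentBundle I X)) ∈ 𝓝 (⟨x₀, Z x₀⟩ : TangentBundle I X) :=
      hOp.mem_nhds hxO
    refine ContMDiffAt.congr_of_eventuallyEq (h2.contMDiffAt hOn) ?_
    filter_upwards [hOn] with V hV
    exact (tangentMapWithin_eq_tangentMap (hOo.uniqueMDiffOn _ hV)
      ((hO hV).mdifferentiableAt (by simp))).symm
  have h4 : ContMDiffAt 𝓔 (𝓔).tangent ∞
      (fun a => tangentMap I 𝓔 p ⟨p' a, Z (p' a)⟩) (p x₀) := by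
    refine ContMDiffAt.comp (I' := I.tangent) (g := tangentMap I 𝓔 p)
      (f := fun a => (⟨p' a, Z (p' a)⟩ : TangentBundle I X)) (p x₀) ?_
      ((hZ.contMDiffAt (x := p' (p x₀))).comp (p x₀) hp'.contMDiffAt)
    rw [hp0]; exact h3
  have hp'c : ∀ᶠ a in 𝓝 (p x₀), mfderiv I 𝓔 p (p' a) (Z (p' a)) = Y (p (p' a)) :=
    hp'.contMDiffAt.continuousAt.eventually (by rw [hp0]; exact hY)
  refine h4.congr_of_eventuallyEq ?_
  filter_upwards [hpr, hp'c] with a h5 h6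
  show (⟨a, Y a⟩ : TangentBundle 𝓔 N) = ⟨p (p' a), mfderiv I 𝓔 p (p' a) (Z (p' a))⟩
  rw [h6, h5]

/-- `Φ` is near `a` a smooth local flow of the vector field `Y`. -/
def IsLocalFlow (Y : ∀ a : N, TangentSpace 𝓔 a) (Φ : ℝ × N → N) (a : N) : Prop :=
  ∀ᶠ z in 𝓝 ((0 : ℝ), a), ContMDiffAt (𝓘(ℝ, ℝ).prod 𝓔) 𝓔 ∞ Φ z ∧
    HasVelocity 𝓔 (fun t => Φ (t, z.2)) (Y (Φ z)) z.1 ∧ Φ (0, z.2) = z.2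

/-- The image of a smooth flow by a local diffeomorphism is a local flow. -/
theorem IsLocalDiffeomorphAt.exists_isLocalFlow {p : X → N} {x₀ : X}
    (hp : IsLocalDiffeomorphAt I 𝓔 ∞ p x₀) {Θ : ℝ × X → X}
    (hΘ : ContMDiff (𝓘(ℝ, ℝ).prod I) I ∞ Θ) (h0 : ∀ x, Θ (0, x) = x)
    {Y : ∀ a : N, TangentSpace 𝓔 a}
    (hv : ∀ᶠ z in 𝓝 ((0 : ℝ), x₀), HasVelocity 𝓔 (fun t => p (Θ (t, z.2))) (Y (p (Θ z))) z.1) :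
    ∃ Φ, IsLocalFlow Y Φ (p x₀) := by
  obtain ⟨p', hp', hp0, hpr, -⟩ := hp.exists_inverse
  refine ⟨fun z => p (Θ (z.1, p' z.2)), ?_⟩
  have hc : ContinuousAt (fun z : ℝ × N => (z.1, p' z.2)) (0, p x₀) :=
    continuousAt_fst.prodMk (ContinuousAt.comp (f := Prod.snd) hp'.contMDiffAt.continuousAt continuousAt_snd)
  have h1 : ∀ᶠ z : ℝ × N in 𝓝 (0, p x₀), IsLocalDiffeomorphAt I 𝓔 ∞ p (Θ (z.1, p' z.2)) :=
    (ContinuousAt.comp (f := fun z : ℝ × N => (z.1, p' z.2)) hΘ.continuous.continuousAt hc).eventually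
      (by simpa only [Function.comp_apply, hp0, h0] using hp.eventually)
  have h2 : ∀ᶠ z : ℝ × N in 𝓝 (0, p x₀), HasVelocity 𝓔 (fun t => p (Θ (t, p' z.2)))
      (Y (p (Θ (z.1, p' z.2)))) z.1 := hc.eventually (by simpa only [hp0] using hv)
  have h3 : ∀ᶠ z : ℝ × N in 𝓝 (0, p x₀), p (p' z.2) = z.2 :=
    (continuousAt_snd : ContinuousAt Prod.snd ((0 : ℝ), p x₀)).eventually hpr
  have h4 : ∀ᶠ z : ℝ × N in 𝓝 (0, p x₀), IsLocalDiffeomorphAt 𝓔 I ∞ p' z.2 :=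
    continuousAt_snd.eventually hp'.eventually
  filter_upwards [h1, h2, h3, h4] with z h5 h6 h7 h8
  refine ⟨?_, h6, by simp only [h0, h7]⟩
  have h9 : ContMDiffAt (𝓘(ℝ, ℝ).prod 𝓔) (𝓘(ℝ, ℝ).prod I) ∞ (fun z : ℝ × N => (z.1, p' z.2)) z :=
    contMDiffAt_fst.prodMk (h8.contMDiffAt.comp z contMDiffAt_snd)
  exact ContMDiffAt.comp (f := fun z : ℝ × N => Θ (z.1, p' z.2)) z h5.contMDiffAt
    (hΘ.contMDiffAt.comp z h9)
end

/-- On a closed manifold, a smooth vector field with smooth local flows generates a smooth flow. -/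
theorem exists_isSmoothFlowOf [CompactSpace N] [T2Space N] {Y : ∀ a : N, TangentSpace 𝓔 a}
    (hY : ContMDiff 𝓔 (𝓔).tangent ∞ (fun a => (⟨a, Y a⟩ : TangentBundle 𝓔 N)))
    (hloc : ∀ a : N, ∃ Φ, IsLocalFlow Y Φ a) : ∃ ψ : Flow ℝ N, IsSmoothFlowOf Y ψ := by
  have hY1 := hY.of_le (m := 1) (by norm_cast)
  obtain ⟨ε, hε, hloc'⟩ : ∃ ε > 0, ∀ a ∈ (univ : Set N), ∃ Φ : ℝ × N → N, ∀ t ∈ Ioo (-ε) ε, ∀ᶠ b in 𝓝 a,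
      ContMDiffAt (𝓘(ℝ, ℝ).prod 𝓔) 𝓔 ∞ Φ (t, a) ∧ ∀ s ∈ Ioo (-ε) ε,
        HasVelocity 𝓔 (fun t => Φ (t, b)) (Y (Φ (s, b))) s ∧ Φ (0, b) = b := by
    refine isCompact_univ.induction_on (p := fun S => ∃ ε > 0, ∀ a ∈ S, ∃ Φ : ℝ × N → N, ∀ t ∈ Ioo (-ε) ε,
      ∀ᶠ b in 𝓝 a, ContMDiffAt (𝓘(ℝ, ℝ).prod 𝓔) 𝓔 ∞ Φ (t, a) ∧ ∀ s ∈ Ioo (-ε) ε,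
        HasVelocity 𝓔 (fun t => Φ (t, b)) (Y (Φ (s, b))) s ∧ Φ (0, b) = b) ⟨1, one_pos, by simp⟩ ?_ ?_ ?_
    · rintro S T hST ⟨ε, hε, h⟩
      exact ⟨ε, hε, fun a ha => h a (hST ha)⟩
    · rintro S T ⟨ε, hε, h⟩ ⟨ε', hε', h'⟩
      refine ⟨min ε ε', lt_min hε hε', fun a ha => ?_⟩
      have hs : Ioo (-min ε ε') (min ε ε') ⊆ Ioo (-ε) ε :=
        Ioo_subset_Ioo (neg_le_neg (min_le_left _ _)) (min_le_left _ _)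
      have hs' : Ioo (-min ε ε') (min ε ε') ⊆ Ioo (-ε') ε' :=
        Ioo_subset_Ioo (neg_le_neg (min_le_right _ _)) (min_le_right _ _)
      rcases ha with ha | ha
      · obtain ⟨Φ, hΦ⟩ := h a ha
        exact ⟨Φ, fun t ht => (hΦ t (hs ht)).mono fun b hb => ⟨hb.1, fun s hs1 => hb.2 s (hs hs1)⟩⟩
      · obtain ⟨Φ, hΦ⟩ := h' a ha
        exact ⟨Φ, fun t ht => (hΦ t (hs' ht)).mono fun b hb => ⟨hb.1, fun s hs1 => hb.2 s (hs' hs1)⟩⟩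
    · intro a _
      obtain ⟨Φ, hΦ⟩ := hloc a
      obtain ⟨S, hS, U, hU, hSU⟩ := mem_nhds_prod_iff.1 hΦ
      obtain ⟨ε, hε, hεS⟩ := Metric.mem_nhds_iff.1 hS
      rw [Real.ball_eq_Ioo, zero_sub, zero_add] at hεS
      refine ⟨interior U, mem_nhdsWithin_of_mem_nhds (interior_mem_nhds.2 hU), ε, hε, fun a' ha' =>
        ⟨Φ, fun t ht => ?_⟩⟩
      filter_upwards [isOpen_interior.mem_nhds ha'] with b hb
      exact ⟨(hSU ⟨hεS ht, interior_subset ha'⟩).1, fun s hs =>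
        (hSU (show ((s, b) : ℝ × N) ∈ S ×ˢ U from ⟨hεS hs, interior_subset hb⟩)).2⟩
  have h00 : (0 : ℝ) ∈ Ioo (-ε) ε := ⟨by linarith, hε⟩
  -- the global integral curves
  have hglob : ∀ x : N, ∃ c : ℝ → N, c 0 = x ∧ IsMIntegralCurve (I := 𝓔) c Y := by
    refine exists_isMIntegralCurve_of_isMIntegralCurveOn hY1 hε fun x => ?_
    obtain ⟨Φ, hΦ⟩ := hloc' x trivial
    have h1 := (hΦ 0 h00).self_of_nhds.2
    exact ⟨fun t => Φ (t, x), (h1 0 h00).2, fun t ht => (h1 t ht).1.hasMFDerivWithinAt⟩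
  choose c hc0 hc using hglob
  have hadd : ∀ s t x, c x (s + t) = c (c x t) s := by
    intro s t x
    have h1 : IsMIntegralCurve (I := 𝓔) (c x ∘ (· + t)) Y := (hc x).comp_add t
    exact congrFun (isMIntegralCurve_Ioo_eq_of_contMDiff_boundaryless (t₀ := 0) hY1 h1 (hc (c x t))
      (by simp [hc0])) s
  have hsm : ∀ t ∈ Ioo (-ε) ε, ∀ x, ContMDiffAt (𝓘(ℝ, ℝ).prod 𝓔) 𝓔 ∞
      (fun z : ℝ × N => c z.2 z.1) (t, x) := by
    intro t ht x
    obtain ⟨Φ, hΦ⟩ := hloc' x trivial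
    refine (hΦ t ht).self_of_nhds.1.congr_of_eventuallyEq ?_
    have h1 : ∀ᶠ z : ℝ × N in 𝓝 (t, x), z.1 ∈ Ioo (-ε) ε := continuousAt_fst.eventually (Ioo_mem_nhds ht.1 ht.2)
    have h2 := (continuousAt_snd (p := (t, x))).eventually (hΦ t ht)
    filter_upwards [h1, h2] with z h3 h4
    exact isMIntegralCurveOn_Ioo_eqOn_of_contMDiff_boundaryless h00 hY1 ((hc z.2).isMIntegralCurveOn _)
      (γ' := fun t => Φ (t, z.2)) (fun s hs => (h4.2 s hs).1.hasMFDerivWithinAt)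
      (by rw [hc0, (h4.2 0 h00).2]) h3
  have hsmt : ∀ t, ContMDiff 𝓔 𝓔 ∞ (fun x => c x t) := by
    have h1 : ∀ t ∈ Ioo (-ε) ε, ContMDiff 𝓔 𝓔 ∞ (fun x => c x t) := fun t ht x =>
      ContMDiffAt.comp (f := fun x => (t, x)) x (hsm t ht x) (contMDiffAt_const.prodMk contMDiffAt_id)
    have h2 : ∀ (s : ℝ), s ∈ Ioo (-ε) ε → ∀ j : ℕ, ContMDiff 𝓔 𝓔 ∞ (fun x => c x (j * s)) := by
      intro s hs j
      induction j with
      | zero =>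
        have : (fun x => c x ((0 : ℕ) * s)) = id := by funext x; simp [hc0]
        rw [this]; exact contMDiff_id
      | succ j ih =>
        have : (fun x => c x ((j + 1 : ℕ) * s)) = fun x => c (c x (j * s)) s := by
          funext x; rw [← hadd]; congr 1; push_cast; ring
        rw [this]
        exact (h1 s hs).comp ih
    intro t
    obtain ⟨j, hj⟩ := exists_nat_gt (|t| / ε)
    have hj0 : (0 : ℝ) < j := (by positivity : 0 ≤ |t| / ε).trans_lt hj
    have := h2 (t / j) (by
      rw [mem_Ioo, ← abs_lt, abs_div, abs_of_pos hj0, div_lt_iff₀ hj0]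
      rw [div_lt_iff₀ hε] at hj; linarith) j
    rwa [mul_div_cancel₀ _ hj0.ne'] at this
  have hall : ContMDiff (𝓘(ℝ, ℝ).prod 𝓔) 𝓔 ∞ (fun z : ℝ × N => c z.2 z.1) := by
    rintro ⟨t, x⟩
    have h1 : (fun z : ℝ × N => c z.2 z.1) = fun z => c (c z.2 (z.1 - t)) t := by
      funext z; rw [← hadd, add_sub_cancel]
    have h2 : ContMDiffAt (𝓘(ℝ, ℝ).prod 𝓔) 𝓔 ∞ (fun z : ℝ × N => c z.2 (z.1 - t)) (t, x) := by
      refine ContMDiffAt.comp (I' := 𝓘(ℝ, ℝ).prod 𝓔) (f := fun z : ℝ × N => (z.1 - t, z.2))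
        (g := fun z : ℝ × N => c z.2 z.1)
        (t, x) ?_ ?_
      · rw [sub_self]; exact hsm 0 h00 x
      · exact ((contDiff_id.sub contDiff_const).contDiffAt.contMDiffAt.comp (t, x) contMDiffAt_fst).prodMk
          contMDiffAt_snd
    rw [h1]
    exact (hsmt t).contMDiffAt.comp (t, x) h2
  exact ⟨⟨fun t x => c x t, hall.continuous, fun s t x => hadd s t x, hc0⟩, hY, hall, hc⟩
end

/-! ### The smooth atlas of the glued space -/

/-- A continuous injective map of an open set that is open on it is an open partial homeomorphism. -/
theorem exists_openPartialHomeomorph {X N : Type*} [TopologicalSpace X] [TopologicalSpace N] [Nonempty X]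
    {f : X → N} {s : Set X} (hs : IsOpen s) (hc : ContinuousOn f s) (hi : InjOn f s)
    (ho : ∀ Z ⊆ s, IsOpen Z → IsOpen (f '' Z)) :
    ∃ Φ : OpenPartialHomeomorph X N, Φ.source = s ∧ ⇑Φ = f := by
  refine ⟨.ofContinuousOpenRestrict (hi.toPartialEquiv f s) hc (fun Z hZ => ?_) hs, rfl, rfl⟩
  have : s.domRestrict f '' Z = f '' (Subtype.val '' Z) := by rw [image_image]; rfl
  show IsOpen (s.domRestrict f '' Z)
  rw [this]
  exact ho _ (by rintro _ ⟨x, -, rfl⟩; exact x.2) (hs.isOpenMap_subtype_val Z hZ)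

section
variable {N : Type*} [TopologicalSpace N]
variable {E H : Type*} [NormedAddCommGroup E] [NormedSpace ℝ E] [TopologicalSpace H]
  {I : ModelWithCorners ℝ E H} {X : Type*} [TopologicalSpace X] [ChartedSpace H X]
variable {E' H' : Type*} [NormedAddCommGroup E'] [NormedSpace ℝ E'] [TopologicalSpace H']
  {I' : ModelWithCorners ℝ E' H'} {X' : Type*} [TopologicalSpace X'] [ChartedSpace H' X']

/-- The expression of the parametrization `r` in the chart induced by the parametrization `φ` is a
local diffeomorphism if the transition `g` is one. -/
theorem isLocalDiffeomorphAt_chart_comp {φ : OpenPartialHomeomorph X N} {c : OpenPartialHomeomorph X E3}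
    {r : X' → N} {g : X' → X} {y : X'} (hg : IsLocalDiffeomorphAt I' I ∞ g y)
    (hc : IsLocalDiffeomorphAt I 𝓔 ∞ c (g y)) (hy : g y ∈ φ.source) (h : r =ᶠ[𝓝 y] φ ∘ g) :
    IsLocalDiffeomorphAt I' 𝓔 ∞ ((φ.symm ≫ₕ c) ∘ r) y := by
  refine (hg.trans hc).congr ?_
  filter_upwards [h, hg.contMDiffAt.continuousAt.eventually (φ.open_source.mem_nhds hy)] with y' h1 h2
  simp [h1, φ.left_inv h2]

/-- A transition map of two charts is smooth at a point near which both express a parametrization by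
local diffeomorphisms. -/
theorem contDiffAt_transition {e e' : OpenPartialHomeomorph N E3} {p : X → N} {x : X}
    (hp : ContinuousAt p x) (hx : p x ∈ e.source)
    (h : IsLocalDiffeomorphAt I 𝓔 ∞ (e ∘ p) x) (h' : IsLocalDiffeomorphAt I 𝓔 ∞ (e' ∘ p) x) :
    ContDiffAt ℝ ∞ (e' ∘ e.symm) (e (p x)) := by
  obtain ⟨i, hi, hi0, hir, -⟩ := h.exists_inverse
  rw [← contMDiffAt_iff_contDiffAt]
  have h1 : ContMDiffAt 𝓔 𝓔 ∞ ((e' ∘ p) ∘ i) ((e ∘ p) x) :=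
    ContMDiffAt.comp _ (by rw [hi0]; exact h'.contMDiffAt) hi.contMDiffAt
  refine h1.congr_of_eventuallyEq ?_
  have h2 : ∀ᶠ w in 𝓝 ((e ∘ p) x), p (i w) ∈ e.source := by
    have h3 : ContinuousAt (p ∘ i) ((e ∘ p) x) :=
      ContinuousAt.comp (by rw [hi0]; exact hp) hi.contMDiffAt.continuousAt
    have h4 : (p ∘ i) ((e ∘ p) x) = p x := congrArg p hi0
    exact h3.eventually (by rw [h4]; exact e.open_source.mem_nhds hx)
  filter_upwards [hir, h2] with w h4 h5
  simp only [Function.comp_apply] at h4 ⊢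
  rw [← h4, e.left_inv h5, h4]

variable [ChartedSpace E3 N] [IsManifold 𝓔 ∞ N]

/-- A parametrization is a local diffeomorphism if its expression in a chart is one. -/
theorem IsLocalDiffeomorphAt.of_chart {e : OpenPartialHomeomorph N E3} (he : e ∈ atlas E3 N) {p : X → N}
    {x : X} (hp : ContinuousAt p x) (hx : p x ∈ e.source)
    (h : IsLocalDiffeomorphAt I 𝓔 ∞ (e ∘ p) x) : IsLocalDiffeomorphAt I 𝓔 ∞ p x := by
  have hm := IsManifold.subset_maximalAtlas (I := 𝓔) (n := ∞) he
  have h2 : IsLocalDiffeomorphAt 𝓔 𝓔 ∞ e.symm ((e ∘ p) x) :=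
    ⟨⟨e.symm.toPartialEquiv, e.open_target, e.open_source,
      contMDiffOn_symm_of_mem_maximalAtlas hm, contMDiffOn_of_mem_maximalAtlas hm⟩, e.map_source hx,
      fun _ _ => rfl⟩
  refine (h.trans h2).congr ?_
  filter_upwards [hp.eventually (e.open_source.mem_nhds hx)] with x' hx'
  simp [e.left_inv hx']
end

theorem isLocalDiffeomorphAt_add_const (c u : ℝ³) :
    IsLocalDiffeomorphAt 𝓘(ℝ, ℝ³) 𝓘(ℝ, ℝ³) ∞ (fun u => u + c) u := by
  let e := (Homeomorph.addRight c).toOpenPartialHomeomorph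
  have h1 : ∀ c : ℝ³, ContMDiff 𝓘(ℝ, ℝ³) 𝓘(ℝ, ℝ³) ∞ (fun u => u + c) := fun c =>
    (contDiff_id.add contDiff_const).contMDiff
  refine ⟨⟨e.toPartialEquiv, e.open_source, e.open_target, (h1 c).contMDiffOn, (h1 (-c)).contMDiffOn.congr
    fun u _ => ?_⟩, trivial, fun _ _ => rfl⟩
  show u - c = u + -c
  rw [sub_eq_add_neg]

namespace NormalCoordinates

/-- A local lift of the glueing map can be translated by an integer. -/
theorem IsGlueLift.add_int {g : M₀ → ℝ³} {T : ℝ → ℝ} {q : M₀}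
    (h : C.IsGlueLift ρ r₁ r₂ g T q) (j : ℤ) :
    C.IsGlueLift ρ r₁ r₂ (fun q => g q + (0, 0, (j : ℝ))) T q := by
  have h1 : vderiv (fun q => g q + (0, 0, (j : ℝ))) q = vderiv g q := by
    have h2 := (h.isLocalDiffeomorphAt.mdifferentiableAt (by simp)).hasMFDerivAt.add
      (hasMFDerivAt_const ((0, 0, (j : ℝ)) : ℝ³) q)
    exact h2.mfderiv.trans (add_zero (mfderiv 𝓔 𝓘(ℝ, ℝ³) g q))
  refine ⟨h.isLocalDiffeomorphAt.trans (isLocalDiffeomorphAt_add_const _ _), h.mem,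
    by rw [liftProj_add_int, h.liftProj_eq], by simp [h.fst_eq], by simp [h.snd_eq], ?_, ?_, ?_,
    h.exists_Es, h.exists_Eu⟩
  · rw [h1, h.field]; simp [affineField]
  · rw [h1]; exact h.apply_Es
  · rw [h1]; exact h.apply_Eu

theorem affineField_add_int (u : ℝ³) (j : ℤ) :
    affineField lam n k (u + (0, 0, (j : ℝ))) = affineField lam n k u := by
  simp [affineField]

namespace IsGlueingData
variable [T2Space M] (S : C.IsGlueingData ρ r₁ r₂) [Nonempty (C.GluedSpace ρ r₁ r₂)]
include S

omit [T2Space M] [Nonempty (C.GluedSpace ρ r₁ r₂)] in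
theorem exists_isGlueLift_eq {q : M₀} (hq : q ∈ C.ringDom r₁ r₂) {u : ℝ³}
    (hu : liftProj u = C.glueMap ρ r₁ r₂ q) :
    ∃ g T, g q = u ∧ ∀ᶠ q' in 𝓝 q, C.IsGlueLift ρ r₁ r₂ g T q' := by
  obtain ⟨g, T, -, -, hg⟩ := S.exists_isGlueLift hq
  obtain ⟨j, hj⟩ := exists_int_of_liftProj_eq (hu.trans hg.self_of_nhds.liftProj_eq.symm)
  exact ⟨fun q => g q + (0, 0, (j : ℝ)), T, hj.symm, hg.mono fun q' h => h.add_int j⟩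

/-- Where the images of `outerMap` and `liftMap` overlap, the transition is a lift of the glueing
map. -/
theorem exists_transition {q : M₀} (hq : q ∈ C.outerDom r₁ r₂) {u : ℝ³}
    (hu : u ∈ liftInt r₁ r₂) (h : C.outerMap ρ r₁ r₂ q = C.liftMap ρ r₁ r₂ u) :
    ∃ g T, g q = u ∧ C.outerMap ρ r₁ r₂ =ᶠ[𝓝 q] C.liftMap ρ r₁ r₂ ∘ g ∧ C.IsGlueLift ρ r₁ r₂ g T q := by
  obtain ⟨hc, hqu⟩ := (S.outerMap_eq_affineMap_iff hq (liftProj_mem hu)).1 h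
  have hD := S.mem_ringDom_of_cross hq hc
  obtain ⟨g, T, hgq, hg⟩ := S.exists_isGlueLift_eq hD hqu
  have hi : q ∈ C.crossInt r₁ r₂ := by
    by_contra hi
    exact S.outerMap_ne_liftMap (S.mem_outer_iff.2 hi) hu h
  exact ⟨g, T, hgq, S.outerMap_eventuallyEq_liftMap hi hg, hg.self_of_nhds⟩

/-- The transition in the other direction. -/
theorem exists_transition_symm {q : M₀} (hq : q ∈ C.outerDom r₁ r₂) {u : ℝ³}
    (hu : u ∈ liftInt r₁ r₂) (h : C.outerMap ρ r₁ r₂ q = C.liftMap ρ r₁ r₂ u) :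
    ∃ g, IsLocalDiffeomorphAt 𝓘(ℝ, ℝ³) 𝓔 ∞ g u ∧ g u = q ∧
      C.liftMap ρ r₁ r₂ =ᶠ[𝓝 u] C.outerMap ρ r₁ r₂ ∘ g := by
  obtain ⟨g, T, rfl, he, hg⟩ := S.exists_transition hq hu h
  obtain ⟨g', hg', hq', hr, -⟩ := hg.isLocalDiffeomorphAt.exists_inverse
  refine ⟨g', hg', hq', ?_⟩
  have h1 := hg'.contMDiffAt.continuousAt.eventually (by rw [hq']; exact he)
  filter_upwards [hr, h1] with u' h2 h3
  simp only [Function.comp_apply] at h3 ⊢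
  rw [h3, h2]

theorem exists_outerMap_homeo : ∃ Φ : OpenPartialHomeomorph M₀ (C.GluedSpace ρ r₁ r₂),
    Φ.source = C.outerDom r₁ r₂ ∧ ⇑Φ = C.outerMap ρ r₁ r₂ := by
  have := C.nonempty_compl
  exact exists_openPartialHomeomorph S.isOpen_outerDom S.continuousOn_outerMap S.injOn_outerMap
    fun Z hZ hZo => S.isOpen_image_outerMap hZo hZ

/-- The covering is injective on open slabs of height `1`. -/
theorem exists_liftMap_homeo {u : ℝ³} (hu : u ∈ liftInt r₁ r₂) :
    ∃ Φ : OpenPartialHomeomorph ℝ³ (C.GluedSpace ρ r₁ r₂), u ∈ Φ.source ∧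
      Φ.source ⊆ liftInt r₁ r₂ ∧ ⇑Φ = C.liftMap ρ r₁ r₂ := by
  have hs : IsOpen (liftInt r₁ r₂ ∩ {u' : ℝ³ | |u'.2.2 - u.2.2| < 1 / 2}) :=
    (isOpen_liftInt r₁ r₂).inter (isOpen_lt (by fun_prop) continuous_const)
  suffices h : ∃ Φ : OpenPartialHomeomorph ℝ³ (C.GluedSpace ρ r₁ r₂),
      Φ.source = liftInt r₁ r₂ ∩ {u' : ℝ³ | |u'.2.2 - u.2.2| < 1 / 2} ∧ ⇑Φ = C.liftMap ρ r₁ r₂ from by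
    obtain ⟨Φ, h1, h2⟩ := h
    exact ⟨Φ, by rw [h1]; exact ⟨hu, by simp⟩, by rw [h1]; exact inter_subset_left, h2⟩
  refine exists_openPartialHomeomorph hs
    (continuousOn_affineMap.comp continuous_liftProj.continuousOn fun u' h => liftProj_mem h.1) ?_ ?_
  · rintro a ⟨ha, ha'⟩ b ⟨hb, hb'⟩ hab
    obtain ⟨j, rfl⟩ := exists_int_of_liftProj_eq (S.injOn_affineMap (liftProj_mem ha) (liftProj_mem hb) hab)
    rw [mem_ofPred_eq, abs_lt] at ha' hb'
    simp only [Prod.snd_add] at ha'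
    have h1 : (-1 : ℝ) < j ∧ (j : ℝ) < 1 := ⟨by linarith [ha'.1, hb'.2], by linarith [ha'.2, hb'.1]⟩
    have h2 : j = 0 := by
      have : -1 < j ∧ j < 1 := by exact_mod_cast h1
      lia
    simp [h2]
  · intro Z hZ hZo
    have : C.liftMap ρ r₁ r₂ '' Z = C.affineMap ρ r₁ r₂ '' (liftProj '' Z) := by rw [image_image]; rfl
    rw [this]
    refine S.isOpen_image_affineMap (isOpenMap_liftProj Z hZo) ?_
    rintro _ ⟨u', hu', rfl⟩
    exact (hZ hu').1

theorem continuousAt_outerMap {q : M₀} (hq : q ∈ C.outerDom r₁ r₂) :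
    ContinuousAt (C.outerMap ρ r₁ r₂) q :=
  S.continuousOn_outerMap.continuousAt (S.isOpen_outerDom.mem_nhds hq)

omit S in
theorem continuousAt_liftMap {u : ℝ³} (hu : u ∈ liftInt r₁ r₂) :
    ContinuousAt (C.liftMap ρ r₁ r₂) u :=
  (continuousOn_affineMap.comp continuous_liftProj.continuousOn
    fun _ h => liftProj_mem h : ContinuousOn (C.affineMap ρ r₁ r₂ ∘ liftProj) (liftInt r₁ r₂)).continuousAt
      ((isOpen_liftInt r₁ r₂).mem_nhds hu)

/-- The transition between two sheets of the covering over the cross is an integer translation. -/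
theorem exists_int_of_liftMap_eq {u u' : ℝ³} (hu : u ∈ liftInt r₁ r₂) (hu' : u' ∈ liftInt r₁ r₂)
    (h : C.liftMap ρ r₁ r₂ u = C.liftMap ρ r₁ r₂ u') : ∃ j : ℤ, u' = u + (0, 0, (j : ℝ)) :=
  exists_int_of_liftProj_eq (S.injOn_affineMap (liftProj_mem hu') (liftProj_mem hu) h.symm)

omit S [T2Space M] in
theorem liftMap_add_int (u : ℝ³) (j : ℤ) :
    C.liftMap ρ r₁ r₂ (u + (0, 0, (j : ℝ))) = C.liftMap ρ r₁ r₂ u :=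
  congrArg (C.affineMap ρ r₁ r₂) (liftProj_add_int u j)

/-- The glued space has a smooth atlas for which the two parametrizations are local diffeomorphisms. -/
theorem exists_smooth_atlas : ∃ (_ : ChartedSpace E3 (C.GluedSpace ρ r₁ r₂))
    (_ : IsManifold 𝓔 ∞ (C.GluedSpace ρ r₁ r₂)),
    (∀ q ∈ C.outerDom r₁ r₂, IsLocalDiffeomorphAt 𝓔 𝓔 ∞ (C.outerMap ρ r₁ r₂) q) ∧
    ∀ u ∈ liftInt r₁ r₂, IsLocalDiffeomorphAt 𝓘(ℝ, ℝ³) 𝓔 ∞ (C.liftMap ρ r₁ r₂) u := by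
  let 𝒜 : Set (OpenPartialHomeomorph (C.GluedSpace ρ r₁ r₂) E3) := {e |
    (∀ q ∈ C.outerDom r₁ r₂, C.outerMap ρ r₁ r₂ q ∈ e.source →
      IsLocalDiffeomorphAt 𝓔 𝓔 ∞ (e ∘ C.outerMap ρ r₁ r₂) q) ∧
    ∀ u ∈ liftInt r₁ r₂, C.liftMap ρ r₁ r₂ u ∈ e.source →
      IsLocalDiffeomorphAt 𝓘(ℝ, ℝ³) 𝓔 ∞ (e ∘ C.liftMap ρ r₁ r₂) u}
  have hP : ∀ q ∈ C.outerDom r₁ r₂, ∃ e ∈ 𝒜, C.outerMap ρ r₁ r₂ q ∈ e.source := by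
    intro q hq
    obtain ⟨Φ, hΦs, hΦ⟩ := S.exists_outerMap_homeo
    let c := chartAt E3 q
    have hc : ∀ x ∈ c.source, IsLocalDiffeomorphAt 𝓔 𝓔 ∞ c x := fun x hx =>
      ⟨⟨c.toPartialEquiv, c.open_source, c.open_target, contMDiffOn_chart, contMDiffOn_chart_symm⟩, hx,
        fun _ _ => rfl⟩
    have key : ∀ a ∈ (Φ.symm ≫ₕ c).source, ∃ q' ∈ C.outerDom r₁ r₂, q' ∈ c.source ∧
        C.outerMap ρ r₁ r₂ q' = a := by
      rintro a ⟨h1, h2⟩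
      exact ⟨Φ.symm a, by rw [← hΦs]; exact Φ.map_target h1, h2, by rw [← hΦ]; exact Φ.right_inv h1⟩
    refine ⟨Φ.symm ≫ₕ c, ⟨fun q' hq' h' => ?_, fun u hu h' => ?_⟩, ?_⟩
    · obtain ⟨q'', h1, h2, h3⟩ := key _ h'
      obtain rfl := S.injOn_outerMap h1 hq' h3
      exact isLocalDiffeomorphAt_chart_comp (g := id) ((Diffeomorph.refl 𝓔 _ ∞).isLocalDiffeomorph q'')
        (hc q'' h2)
        (by rw [hΦs]; exact h1) (by rw [hΦ]; rfl)
    · obtain ⟨q', h1, h2, h3⟩ := key _ h'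
      obtain ⟨g, hg, rfl, he⟩ := S.exists_transition_symm h1 hu h3
      exact isLocalDiffeomorphAt_chart_comp hg (hc _ h2) (by rw [hΦs]; exact h1) (by rw [hΦ]; exact he)
    · have h1 : q ∈ Φ.source := by rw [hΦs]; exact hq
      rw [← hΦ]
      exact ⟨Φ.map_source h1, by
        show Φ.symm (Φ q) ∈ c.source
        rw [Φ.left_inv h1]; exact mem_chart_source E3 q⟩
  have hL : ∀ u ∈ liftInt r₁ r₂, ∃ e ∈ 𝒜, C.liftMap ρ r₁ r₂ u ∈ e.source := by
    intro u₀ hu₀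
    obtain ⟨Φ, huΦ, hΦs, hΦ⟩ := S.exists_liftMap_homeo hu₀
    let Λ : ℝ³ ≃L[ℝ] E3 := ContinuousLinearEquiv.ofFinrankEq (by simp)
    let c := Λ.toHomeomorph.toOpenPartialHomeomorph
    have hc : ∀ x, IsLocalDiffeomorphAt 𝓘(ℝ, ℝ³) 𝓔 ∞ c x := fun x =>
      ⟨⟨c.toPartialEquiv, c.open_source, c.open_target, Λ.contDiff.contMDiff.contMDiffOn,
        Λ.symm.contDiff.contMDiff.contMDiffOn⟩, trivial, fun _ _ => rfl⟩
    have key : ∀ a ∈ (Φ.symm ≫ₕ c).source, ∃ u ∈ Φ.source, C.liftMap ρ r₁ r₂ u = a := by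
      rintro a ⟨h1, -⟩
      exact ⟨Φ.symm a, Φ.map_target h1, by rw [← hΦ]; exact Φ.right_inv h1⟩
    refine ⟨Φ.symm ≫ₕ c, ⟨fun q hq h' => ?_, fun u hu h' => ?_⟩, ?_⟩
    · obtain ⟨u, h1, h2⟩ := key _ h'
      obtain ⟨g, T, rfl, he, hg⟩ := S.exists_transition hq (hΦs h1) h2.symm
      exact isLocalDiffeomorphAt_chart_comp hg.isLocalDiffeomorphAt (hc _) h1 (by rw [hΦ]; exact he)
    · obtain ⟨u', h1, h2⟩ := key _ h'
      obtain ⟨j, rfl⟩ := S.exists_int_of_liftMap_eq hu (hΦs h1) h2.symm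
      exact isLocalDiffeomorphAt_chart_comp (g := fun u => u + (0, 0, (j : ℝ)))
        (isLocalDiffeomorphAt_add_const _ _) (hc _) h1
        (Filter.Eventually.of_forall fun u' => by rw [hΦ]; exact (liftMap_add_int u' j).symm)
    · rw [← hΦ]
      exact ⟨Φ.map_source huΦ, trivial⟩
  obtain ⟨cs, ism, hat⟩ := exists_isManifold_of_charts 𝒜 (fun a => by
    rcases S.cover' a with ⟨q, hq, rfl⟩ | ⟨u, hu, rfl⟩
    · exact hP q (S.mem_outerDom_of_outer hq)
    · exact hL u hu) (fun e he e' he' w hw => by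
    obtain ⟨h1, h2⟩ := hw
    have h3 := e.right_inv h1
    have h4 := e.map_target h1
    change e.symm w ∈ e'.source at h2
    rw [← h3]
    generalize e.symm w = a at h2 h4 ⊢
    rcases S.cover' a with ⟨q, hq, rfl⟩ | ⟨u, hu, rfl⟩
    · have hq := S.mem_outerDom_of_outer hq
      exact contDiffAt_transition (S.continuousAt_outerMap hq) h4 (he.1 q hq h4) (he'.1 q hq h2)
    · exact contDiffAt_transition (continuousAt_liftMap hu) h4 (he.2 u hu h4) (he'.2 u hu h2))
  refine ⟨cs, ism, fun q hq => ?_, fun u hu => ?_⟩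
  · obtain ⟨e, he, h⟩ := hP q hq
    exact .of_chart (hat e he) (S.continuousAt_outerMap hq) h (he.1 q hq h)
  · obtain ⟨e, he, h⟩ := hL u hu
    exact .of_chart (hat e he) (continuousAt_liftMap hu) h (he.2 u hu h)
end IsGlueingData
end NormalCoordinates

/-! ### The vector field and the flow of the glued space -/

theorem contDiff_affineField (lam : ℝ) (n k : ℕ) : ContDiff ℝ ∞ (affineField lam n k) := by
  unfold affineField; fun_prop

theorem contDiff_affineFlow (lam : ℝ) (n k : ℕ) :
    ContDiff ℝ ∞ (fun z : ℝ × ℝ³ => affineFlow lam n k z.1 z.2) := by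
  unfold affineFlow; fun_prop

namespace NormalCoordinates

namespace IsGlueingData
variable [T2Space M] (S : C.IsGlueingData ρ r₁ r₂) [Nonempty (C.GluedSpace ρ r₁ r₂)]
  [ChartedSpace E3 (C.GluedSpace ρ r₁ r₂)]
  (hP : ∀ q ∈ C.outerDom r₁ r₂, IsLocalDiffeomorphAt 𝓔 𝓔 ∞ (C.outerMap ρ r₁ r₂) q)
  (hL : ∀ u ∈ liftInt r₁ r₂, IsLocalDiffeomorphAt 𝓘(ℝ, ℝ³) 𝓔 ∞ (C.liftMap ρ r₁ r₂) u)
include S hP hL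

/-- The vector fields on both pieces are the expressions of one vector field on the glued space. -/
theorem exists_field : ∃ Y : ∀ a : C.GluedSpace ρ r₁ r₂, TangentSpace 𝓔 a,
    (∀ q ∈ C.outerDom r₁ r₂, mfderiv 𝓔 𝓔 (C.outerMap ρ r₁ r₂) q (A.X q) =
      Y (C.outerMap ρ r₁ r₂ q)) ∧
    ∀ u ∈ liftInt r₁ r₂, mfderiv 𝓘(ℝ, ℝ³) 𝓔 (C.liftMap ρ r₁ r₂) u (affineField lam n k u) =
      Y (C.liftMap ρ r₁ r₂ u) := by
  have key : ∀ a : C.GluedSpace ρ r₁ r₂, ∃ y : E3,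
      (∀ q ∈ C.outerDom r₁ r₂, C.outerMap ρ r₁ r₂ q = a →
        (mfderiv 𝓔 𝓔 (C.outerMap ρ r₁ r₂) q (A.X q) : E3) = y) ∧
      ∀ u ∈ liftInt r₁ r₂, C.liftMap ρ r₁ r₂ u = a →
        (mfderiv 𝓘(ℝ, ℝ³) 𝓔 (C.liftMap ρ r₁ r₂) u (affineField lam n k u) : E3) = y := by
    intro a
    have hPL : ∀ q ∈ C.outerDom r₁ r₂, ∀ u ∈ liftInt r₁ r₂, C.outerMap ρ r₁ r₂ q = C.liftMap ρ r₁ r₂ u →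
        (mfderiv 𝓔 𝓔 (C.outerMap ρ r₁ r₂) q (A.X q) : E3) =
        (mfderiv 𝓘(ℝ, ℝ³) 𝓔 (C.liftMap ρ r₁ r₂) u (affineField lam n k u) : E3) := by
      intro q hq u hu h
      obtain ⟨g, T, rfl, he, hg⟩ := S.exists_transition hq hu h
      have h1 := mfderiv_comp_apply q ((hL _ hu).mdifferentiableAt (by simp))
        (hg.isLocalDiffeomorphAt.mdifferentiableAt (by simp)) (A.X q)
      rw [← hg.field]
      exact (congrArg (fun D : E3 →L[ℝ] E3 => D (A.X q)) he.mfderiv_eq).trans h1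
    by_cases ha : ∃ q ∈ C.outerDom r₁ r₂, C.outerMap ρ r₁ r₂ q = a
    · obtain ⟨q, hq, rfl⟩ := ha
      refine ⟨mfderiv 𝓔 𝓔 (C.outerMap ρ r₁ r₂) q (A.X q), fun q' hq' h => ?_, fun u hu h => ?_⟩
      · obtain rfl := S.injOn_outerMap hq' hq h
        rfl
      · exact (hPL q hq u hu h.symm).symm
    · rcases S.cover' a with ⟨q, hq, h⟩ | ⟨u, hu, rfl⟩
      · exact absurd ⟨q, S.mem_outerDom_of_outer hq, h⟩ ha
      refine ⟨mfderiv 𝓘(ℝ, ℝ³) 𝓔 (C.liftMap ρ r₁ r₂) u (affineField lam n k u),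
        fun q' hq' h => absurd ⟨q', hq', h⟩ ha, fun u' hu' h => ?_⟩
      obtain ⟨j, rfl⟩ := S.exists_int_of_liftMap_eq hu' hu h
      have h0 : C.liftMap ρ r₁ r₂ = C.liftMap ρ r₁ r₂ ∘ fun u => u + (0, 0, (j : ℝ)) :=
        funext fun u => (liftMap_add_int u j).symm
      have h2 : HasMFDerivAt 𝓘(ℝ, ℝ³) 𝓘(ℝ, ℝ³) (fun u : ℝ³ => u + (0, 0, (j : ℝ))) u'
          (ContinuousLinearMap.id ℝ ℝ³) := ((hasFDerivAt_id u').add_const _).hasMFDerivAt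
      have h1 := (((hL _ hu).mdifferentiableAt (by simp)).hasMFDerivAt.comp u' h2).mfderiv
      rw [← h0] at h1
      rw [affineField_add_int]
      exact congrArg (fun D : ℝ³ →L[ℝ] E3 => D (affineField lam n k u')) h1
  choose Y hY1 hY2 using key
  exact ⟨Y, fun q hq => hY1 _ q hq rfl, fun u hu => hY2 _ u hu rfl⟩

variable [IsManifold 𝓔 ∞ (C.GluedSpace ρ r₁ r₂)]

/-- The field of the glued space is smooth and generates a smooth flow. -/
theorem exists_isSmoothFlowOf [CompactSpace M] {Y : ∀ a : C.GluedSpace ρ r₁ r₂, TangentSpace 𝓔 a}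
    (hYP : ∀ q ∈ C.outerDom r₁ r₂, mfderiv 𝓔 𝓔 (C.outerMap ρ r₁ r₂) q (A.X q) =
      Y (C.outerMap ρ r₁ r₂ q))
    (hYL : ∀ u ∈ liftInt r₁ r₂, mfderiv 𝓘(ℝ, ℝ³) 𝓔 (C.liftMap ρ r₁ r₂) u
      (affineField lam n k u) = Y (C.liftMap ρ r₁ r₂ u)) : ∃ ψ, IsSmoothFlowOf Y ψ := by
  have := C.compactSpace_gluedSpace (ρ := ρ) (r₁ := r₁) (r₂ := r₂)
  have := S.t2Space
  refine _root_.exists_isSmoothFlowOf (fun a => ?_) fun a => ?_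
  · rcases S.cover' a with ⟨q, hq, rfl⟩ | ⟨u, hu, rfl⟩
    · have hq := S.mem_outerDom_of_outer hq
      exact (hP q hq).contMDiffAt_field A.isSmoothFlowOf.smooth_field
        (Filter.eventually_of_mem (S.isOpen_outerDom.mem_nhds hq) hYP)
    · refine (hL u hu).contMDiffAt_field (Z := fun u => affineField lam n k u) ?_
        (Filter.eventually_of_mem ((isOpen_liftInt r₁ r₂).mem_nhds hu) hYL)
      exact contMDiff_vectorSpace_iff_contDiff.2 (contDiff_affineField lam n k)
  · rcases S.cover' a with ⟨q, hq, rfl⟩ | ⟨u, hu, rfl⟩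
    · have hq := S.mem_outerDom_of_outer hq
      refine (hP q hq).exists_isLocalFlow A.isSmoothFlowOf.smooth_flow A.flow.map_zero_apply ?_
      have h1 : ∀ᶠ z : ℝ × M₀ in 𝓝 (0, q), A.flow z.1 z.2 ∈ C.outerDom r₁ r₂ :=
        A.isSmoothFlowOf.smooth_flow.continuous.continuousAt.eventually
          (by simp only [A.flow.map_zero_apply]; exact S.isOpen_outerDom.mem_nhds hq)
      filter_upwards [h1] with z hz
      exact ((A.hasVelocity_flow z.2 z.1).comp ((hP _ hz).mdifferentiableAt (by simp))).congr
        Filter.EventuallyEq.rfl (hYP _ hz).symm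
    · have hsm : ContMDiff (𝓘(ℝ, ℝ).prod 𝓘(ℝ, ℝ³)) 𝓘(ℝ, ℝ³) ∞
          (fun z : ℝ × ℝ³ => affineFlow lam n k z.1 z.2) := by
        have := (contDiff_affineFlow lam n k).contMDiff
        rwa [show 𝓘(ℝ, ℝ × ℝ³) = 𝓘(ℝ, ℝ).prod 𝓘(ℝ, ℝ³) from modelWithCornersSelf_prod,
          ← chartedSpaceSelf_prod] at this
      refine (hL u hu).exists_isLocalFlow hsm (affineFlow_zero lam n k) ?_
      have h1 : ∀ᶠ z : ℝ × ℝ³ in 𝓝 (0, u), affineFlow lam n k z.1 z.2 ∈ liftInt r₁ r₂ :=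
        hsm.continuous.continuousAt.eventually
          (by simp only [affineFlow_zero]; exact (isOpen_liftInt r₁ r₂).mem_nhds hu)
      filter_upwards [h1] with z hz
      have h2 : HasVelocity 𝓘(ℝ, ℝ³) (fun t => affineFlow lam n k t z.2)
          (affineField lam n k (affineFlow lam n k z.1 z.2)) z.1 :=
        (hasDerivAt_affineFlow lam n k z.1 z.2).hasFDerivAt.hasMFDerivAt
      exact (h2.comp ((hL _ hz).mdifferentiableAt (by simp))).congr
        Filter.EventuallyEq.rfl (hYL _ hz).symm

omit hP hL [ChartedSpace E3 (C.GluedSpace ρ r₁ r₂)] [IsManifold 𝓔 ∞ (C.GluedSpace ρ r₁ r₂)] in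
/-- The glued space carries a smooth model. -/
theorem exists_isSmoothModel [CompactSpace M] : ∃ (_ : ChartedSpace E3 (C.GluedSpace ρ r₁ r₂))
    (_ : IsManifold 𝓔 ∞ (C.GluedSpace ρ r₁ r₂))
    (Y : ∀ x : C.GluedSpace ρ r₁ r₂, TangentSpace 𝓔 x)
    (ψ : Flow ℝ (C.GluedSpace ρ r₁ r₂)), C.IsSmoothModel ρ r₁ r₂ Y ψ := by
  obtain ⟨cs, ism, hP, hL⟩ := S.exists_smooth_atlas
  obtain ⟨Y, hYP, hYL⟩ := S.exists_field hP hL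
  obtain ⟨ψ, hψ⟩ := S.exists_isSmoothFlowOf hP hL hYP hYL
  have := S.t2Space
  refine ⟨cs, ism, Y, ψ, hψ, ?_, ?_, C.outer_subset_compl S.isPeriodicOrbit S.pos S.lt S.lt_rad,
    fun q hq => ?_, fun u hu => ?_⟩
  · have : CompactSpace (C.outer r₁ r₂) :=
      isCompact_iff_compactSpace.1 (isOpen_interior.isClosed_compl).isCompact
    exact (continuous_inclOuter.isClosedEmbedding S.injective_inclOuter).isEmbedding
  · have : CompactSpace (affineCross r₁ r₂) := isCompact_iff_compactSpace.1 (isCompact_affineCross r₁ r₂)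
    exact (continuous_inclAffine.isClosedEmbedding S.injective_inclAffine).isEmbedding
  · have hq' := S.mem_outerDom_of_outer hq
    exact ⟨C.outerMap ρ r₁ r₂, hP q hq', Filter.Eventually.of_forall fun q' h => outerMap_of_mem h, hYP q hq'⟩
  · by_cases hi : u ∈ liftInt r₁ r₂
    · exact ⟨C.liftMap ρ r₁ r₂, hL u hi, Filter.Eventually.of_forall fun u' h => affineMap_of_mem h, hYL u hi⟩
    -- at a boundary point, the inclusion is extended by means of the outer parametrization
    obtain ⟨q, hq, hqu⟩ := S.exists_glueMap_eq (S.mem_ringPlane_of_boundary hu hi)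
    obtain ⟨g, T, rfl, hg⟩ := S.exists_isGlueLift_eq hq hqu.symm
    have hg0 := hg.self_of_nhds
    obtain ⟨g', hg', hq', hr, hl⟩ := hg0.isLocalDiffeomorphAt.exists_inverse
    have hU := S.ringDom_subset hq
    have hloc := hg'.trans (g := C.outerMap ρ r₁ r₂) (by rw [hq']; exact hP q hU)
    refine ⟨C.outerMap ρ r₁ r₂ ∘ g', hloc, ?_, ?_⟩
    · have h1 := hg'.contMDiffAt.continuousAt.eventually (by rw [hq']; exact hg)
      filter_upwards [hr, h1] with u' h2 h3 h
      have h4 : g' u' ∈ C.cross r₁ r₂ := ⟨h3.mem.1, by rw [← h3.fst_eq, ← h3.snd_eq, h2]; exact h⟩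
      rw [Function.comp_apply, S.outerMap_eq_affineMap h3.mem h4, ← h3.liftProj_eq, h2, affineMap_of_mem h]
    · have h1 : C.outerMap ρ r₁ r₂ =ᶠ[𝓝 q] (C.outerMap ρ r₁ r₂ ∘ g') ∘ g := by
        filter_upwards [hl] with q' h
        rw [Function.comp_apply, Function.comp_apply, h]
      have h2 := mfderiv_comp_apply q (hloc.mdifferentiableAt (by simp))
        (hg0.isLocalDiffeomorphAt.mdifferentiableAt (by simp)) (A.X q)
      have h3 := congrArg (fun D : E3 →L[ℝ] E3 => D (A.X q)) (h1.mfderiv_eq (I := 𝓔) (I' := 𝓔))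
      have h4 : mfderiv 𝓔 𝓘(ℝ, ℝ³) g q (A.X q) = affineField lam n k (g q) := hg0.field
      rw [Function.comp_apply, hq', ← hYP q hU, ← h4]
      exact (h3.trans h2).symm
end IsGlueingData
end NormalCoordinates

end

theorem mainTheorem4 {M : Type*} [TopologicalSpace M] [ChartedSpace E3 M] [T2Space M]
    [CompactSpace M] (φ : Flow ℝ M) (hφ : ∀ x : M, ∃ t : ℝ, φ t x ≠ x)
    (γ : Set M) (hγ : IsPeriodicOrbit φ γ)
    [ChartedSpace E3 {x : M // x ∉ γ}] [IsManifold 𝓘(ℝ, E3) ∞ {x : M // x ∉ γ}]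
    (lam : ℝ) (A : AlmostAnosovStructure φ γ lam)
    (n k : ℕ) (m : ℤ) (hn : 1 ≤ n) (hk : 1 ≤ k) (hm : m ≠ 0)
    (C : NormalCoordinates A n k m) (ρ : ℝ → ℝ) (hρ : IsTwistProfile ρ) :
    ∃ ε : ℝ, 0 < ε ∧ ∀ r₁ r₂ : ℝ, 0 < r₂ → r₂ < r₁ → r₁ < ε →
      (∃ (_ : ChartedSpace E3 (C.GluedSpace ρ r₁ r₂))
        (_ : IsManifold 𝓘(ℝ, E3) ∞ (C.GluedSpace ρ r₁ r₂))
        (Y : ∀ x : C.GluedSpace ρ r₁ r₂, TangentSpace 𝓘(ℝ, E3) x)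
        (ψ : Flow ℝ (C.GluedSpace ρ r₁ r₂)), C.IsSmoothModel ρ r₁ r₂ Y ψ) ∧
      (∀ [ChartedSpace E3 (C.GluedSpace ρ r₁ r₂)]
        [IsManifold 𝓘(ℝ, E3) ∞ (C.GluedSpace ρ r₁ r₂)]
        (Y : ∀ x : C.GluedSpace ρ r₁ r₂, TangentSpace 𝓘(ℝ, E3) x)
        (ψ : Flow ℝ (C.GluedSpace ρ r₁ r₂)),
        C.IsSmoothModel ρ r₁ r₂ Y ψ → IsAnosovFlow Y ψ) := by
  obtain ⟨ε, hε, hεr, ⟨H⟩⟩ := C.exists_adaptedSizes hγ.isCompact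
  refine ⟨ε, hε, fun r₁ r₂ h2 h12 h1 => ?_⟩
  have S : C.IsGlueingData ρ r₁ r₂ := ⟨hγ, hρ, hn, hk, h2, h12, h1.trans_le hεr⟩
  have := S.nonempty
  exact ⟨S.exists_isSmoothModel, fun Y ψ h => S.isAnosovFlow h H h1⟩
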